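/- Conventions. A graph is a finite 1-dimensional CW complex; $T_vG$ denotes the set of directions at a vertex $v$ (the oriented edges with initial vertex $v$), and $d\overline{E}$ denotes the terminal direction of an oriented edge $E$. A marked graph of rank $n$ is a connected graph $G$ without vertices of valence $1$ together with a homotopy equivalence $R_n\to G$ from the rose with $\pi_1(R_n)=F_n$; it carries its natural cell structure if every vertex has valence $\neq 2$ (if $G$ is a circle, any cell structure is allowed). A circuit is a locally injective map $S^1\to G$ up to orientation preserving reparametrization, i.e. a nontrivial cyclically reduced closed edge path up to cyclic permutation; a circuit family is a finite family $\gamma=(\gamma_1,\dots,\gamma_K)$ of pairwise inequivalent circuits, and equivalence of families means componentwise equivalence. The Whitehead graph $W_v\gamma$ has as vertices the directions at $v$ crossed by $\gamma$ (in either orientation) and as edges the turns $\{d,d'\}\subset T_vG$, $d\ne d'$, taken by $\gamma$; the augmented Whitehead graph is $\widehat W_v\gamma=W_v\gamma\cup T_vG$. A cut of $\widehat W_v\gamma$ along $d\in W_v\gamma$ is a pair of subgraphs with $\widehat W_v\gamma=\widehat W_1\cup\widehat W_2$, $\widehat W_1\cap\widehat W_2=\{d\}$, each containing an edge incident to $d$.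 Put $T_i=\widehat W_i\cap T_vG$ and let $E$ be the oriented edge with terminal direction $d\overline{E}=d$. The splitting $H$ of $G$ along $d$ is obtained by replacing $v$ by two vertices $v_1,v_2$, attaching the directions of $T_i\setminus\{d\}$ to $v_i$, and replacing $E$ by two edges $E_1,E_2$ with terminal vertices $v_1,v_2$ and with common initial vertex the initial vertex of $E$ (if $E$ is a loop: the $v_i$ with $dE\in T_i$); $f\colon H\to G$ is the map identifying $E_1$ with $E_2$ and $v_1$ with $v_2$. For a circuit family $\gamma$ let $w_k(\gamma)$ be the number of natural edges crossed exactly $k$ times by $\gamma$; the natural weight sequences $w=(w_0,w_1,\dots)$ are ordered by $w<w'$ iff there is $k$ with $w_i=w_i'$ for $i>k$ and $w_k<w_k'$. (1) The split operation. Let $G$ be a marked graph of rank $n$ with its natural cell structure, $\gamma$ a circuit family in $G$, and $\{\widehat W_1,\widehat W_2\}$ a cut of $\widehat W_v\gamma$ along $d\in W_v\gamma$. Then $H$ is a connected graph without vertices of valence 1, $f$ is a (non-bigon) fold map folding $E_1$ with $E_2$, and there is, up to homotopy, a unique marking of $H$ by $F_n$ such that $f$ preserves markings. There is a unique circuit family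 $\delta$ in $H$ such that $\delta$ does not take the illegal turn of $f$ and $f\circ\delta$ is equivalent to $\gamma$. Moreover $w(\delta)<w(\gamma)$. The marked graph $H$, the map $f$ and the family $\delta$ are computable from $G$, $\gamma$ and the cut. (2) Whitehead's algorithm. Input: a marked graph $G$ with natural cell structure and a circuit family $\gamma$. Step 1: if $\gamma$ is not jointly primitive (some $\gamma_i$ is a proper power, or $\gamma_i$ equals $\gamma_j$ or $\overline{\gamma_j}$ for some $i\ne j$), stop with answer "no". Step 2: if for every $v$ each component of $W_v\gamma$ is a single edge, stop with answer "yes"; otherwise, if no component of any $W_v\gamma$ has a cut vertex, stop with answer "no"; otherwise choose any cut, replace $(G,\gamma)$ by $(H,\delta)$ as in (1), with $H$ given its natural cell structure, and repeat Step 2. Whenever some component of some $W_v\gamma$ has a cut vertex, such a replacement exists; each replacement strictly decreases the natural weight sequence, and there is no infinite sequence of replacements. For all choices made, the algorithm stops, and its answer is "yes" if and only if $\gamma$ represents a partial free basis of $F_n$, i.e. the conjugacy classes represented by $\gamma_1,\dots,\gamma_K$ have pairwise distinct representatives that belong to a common free basis of $F_n$. The algorithm is effective: some computable function assigns to each (coded)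 input an answer of the algorithm. Consequently there is a single computable function which, given $n$ and a finite list of words in the generators of $F_n$ and their inverses, decides whether the conjugacy classes of these words have pairwise distinct representatives that belong to a common free basis of $F_n$. -/

import Mathlib

namespace Whitehead

/-- A graph (a 1-dimensional CW complex, in combinatorial form) with vertex set `V` and edge set
`E`; loops and multiple edges are allowed. Each edge carries a reference orientation: `(e, true)` is
the edge `e` with that orientation, `(e, false)` is `e` with the opposite one. The only datum is the
initial vertex of each oriented edge. An oriented edge with initial vertex `v` is the same thing as a
direction at `v`. -/
structure Multigraph (V E : Type*) where
  init : E × Bool → V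

/-- Orientation reversal of oriented edges. -/
def rev {E : Type*} (a : E × Bool) : E × Bool := (a.1, !a.2)

namespace Multigraph

variable {V E V' E' : Type*}

/-- Terminal vertex of an oriented edge. -/
def term (G : Multigraph V E) (a : E × Bool) : V := G.init (rev a)

/-- The set `T_v G` of directions at `v`. -/
def directions (G : Multigraph V E) (v : V) : Set (E × Bool) := {a | G.init a = v}

noncomputable def valence (G : Multigraph V E) (v : V) : ℕ := (G.directions v).ncard

/-- `G.IsPath u l w`: the list `l` of oriented edges is an edge path (not necessarily tight, possibly
trivial) from `u` to `w`. -/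
def IsPath (G : Multigraph V E) : V → List (E × Bool) → V → Prop
  | u, [], w => u = w
  | u, a :: l, w => G.init a = u ∧ G.IsPath (G.term a) l w

theorem IsPath.append {G : Multigraph V E} {l l' : List (E × Bool)} :
    ∀ {u v w : V}, G.IsPath u l v → G.IsPath v l' w → G.IsPath u (l ++ l') w := by
  induction l with
  | nil => intro u v w h h'; cases h; exact h'
  | cons a l ih => intro u v w h h'; exact ⟨h.1, ih h.2 h'⟩

theorem IsPath.reverse {G : Multigraph V E} {l : List (E × Bool)} :
    ∀ {u w : V}, G.IsPath u l w → G.IsPath w (FreeGroup.invRev l) u := by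
  induction l with
  | nil => intro u w h; cases h; rfl
  | cons a l ih =>
    intro u w h
    have h2 : G.IsPath (G.term a) [rev a] u := by
      refine ⟨rfl, ?_⟩
      have : G.term (rev a) = G.init a := by simp [term, rev]
      rw [this]; exact h.1
    have h3 := (ih h.2).append h2
    simpa [FreeGroup.invRev, rev] using h3

/-- Any two vertices are joined by an edge path, and there is a vertex. -/
def IsConnected (G : Multigraph V E) : Prop :=
  Nonempty V ∧ ∀ u w, ∃ l, G.IsPath u l w

/-- A connected core graph (used for finite graphs): no vertex has valence one. -/
def IsCore (G : Multigraph V E) : Prop :=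
  G.IsConnected ∧ ∀ v, G.valence v ≠ 1

/-- The cell structure of `G` is the natural one: every vertex is a natural vertex, that is, has
valence different from two. A circle has no natural vertex at all; for it any cell structure is
admitted. -/
def IsNatural (G : Multigraph V E) : Prop :=
  (∀ v, G.valence v ≠ 2) ∨ (∀ v, G.valence v = 2)

/-- The fundamental group `π₁(G, v)`. Two edge paths with the same endpoints are path homotopic
exactly if they have the same reduction, that is, if they define the same element of the free group
on the edges; so `π₁(G, v)` is the group of those elements that are defined by closed edge paths
based at `v`. -/
def pi1 (G : Multigraph V E) (v : V) : Subgroup (FreeGroup E) where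
  carrier := {g | ∃ l, G.IsPath v l v ∧ FreeGroup.mk l = g}
  one_mem' := ⟨[], rfl, rfl⟩
  mul_mem' := by
    rintro _ _ ⟨l, hl, rfl⟩ ⟨l', hl', rfl⟩
    exact ⟨l ++ l', hl.append hl', rfl⟩
  inv_mem' := by
    rintro _ ⟨l, hl, rfl⟩
    exact ⟨FreeGroup.invRev l, hl.reverse, rfl⟩

/-- A marking of `G` by the free group `F_n` (for connected `G`): a homotopy equivalence from the
rose `R_n` to `G`, given by the image of the vertex of the rose and by the induced isomorphism
from `F_n = π₁(R_n)`. -/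
structure Marking (G : Multigraph V E) (n : ℕ) where
  base : V
  iso : FreeGroup (Fin n) ≃* G.pi1 base

/-- Homotopy of markings. -/
def Marking.Homotopic {G : Multigraph V E} {n : ℕ} (m m' : G.Marking n) : Prop :=
  ∃ q, G.IsPath m.base q m'.base ∧
    ∀ g, (m.iso g : FreeGroup E) = FreeGroup.mk q * (m'.iso g : FreeGroup E) * (FreeGroup.mk q)⁻¹

end Multigraph

section Maps

variable {V E V' E' : Type*}

/-- A map of graphs that takes vertices to vertices and edges to edge paths. -/
structure GraphMap (G : Multigraph V E) (G' : Multigraph V' E') where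
  onV : V → V'
  onE : E → List (E' × Bool)
  isPath : ∀ e, G'.IsPath (onV (G.init (e, true))) (onE e) (onV (G.init (e, false)))

namespace GraphMap

variable {G : Multigraph V E} {G' : Multigraph V' E'}

/-- The image of an oriented edge. -/
def onDir (f : GraphMap G G') (a : E × Bool) : List (E' × Bool) :=
  if a.2 then f.onE a.1 else FreeGroup.invRev (f.onE a.1)

/-- The image of an edge path, without any tightening. -/
def onPath (f : GraphMap G G') (l : List (E × Bool)) : List (E' × Bool) :=
  l.flatMap f.onDir

/-- The image `f ∘ c` of a closed path up to change of base point, without any tightening. -/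
def onCycle (f : GraphMap G G') (c : Cycle (E × Bool)) : Cycle (E' × Bool) :=
  Quotient.map' f.onPath (by
    rintro l l' ⟨k, rfl⟩
    have key : ∀ l₁ l₂ : List (E × Bool), f.onPath (l₁ ++ l₂) ~r f.onPath (l₂ ++ l₁) := by
      intro l₁ l₂
      simp only [onPath, List.flatMap_append]
      exact List.isRotated_append
    have h := key (l.take (k % l.length)) (l.drop (k % l.length))
    rw [List.take_append_drop] at h
    rwa [List.rotate_eq_drop_append_take_mod]) c

/-- The homomorphism induced on homotopy classes of edge paths. -/
def hom (f : GraphMap G G') : FreeGroup E →* FreeGroup E' :=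
  FreeGroup.lift fun e => FreeGroup.mk (f.onE e)

/-- `f` preserves marking: the marking `m` followed by `f` is homotopic to the marking `m'`. -/
def PreservesMarking {n : ℕ} (f : GraphMap G G') (m : G.Marking n) (m' : G'.Marking n) : Prop :=
  ∃ q, G'.IsPath (f.onV m.base) q m'.base ∧
    ∀ g, f.hom (m.iso g) =
      FreeGroup.mk q * (m'.iso g : FreeGroup E') * (FreeGroup.mk q)⁻¹

/-- The turn `{x, y}` is illegal: `x ≠ y` are directions at the same vertex, and `f` takes them to
the same direction (the derivative of `f` takes `x` to the first oriented edge of the image of `x`). -/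
def IsIllegalTurn (f : GraphMap G G') (x y : E × Bool) : Prop :=
  x ≠ y ∧ G.init x = G.init y ∧ (f.onDir x).head? = (f.onDir y).head?

/-- `f` is a fold map that takes edges to edges, is not a bigon fold, and folds the whole oriented
edge `a` with the whole oriented edge `b`: it is surjective with at least two gates at each vertex,
and it identifies `a` with `b` and the terminal vertex of `a` with that of `b`, but nothing else. -/
structure IsFold (f : GraphMap G G') (a b : E × Bool) : Prop where
  ne : a.1 ≠ b.1
  init_eq : G.init a = G.init b
  nonbigon : G.term a ≠ G.term b
  onDir_eq : ∀ x, ∃ y, f.onDir x = [y]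
  surj_dir : ∀ y, ∃ x, f.onDir x = [y]
  surj_vert : Function.Surjective f.onV
  gates : ∀ v, ∃ x y, G.init x = v ∧ G.init y = v ∧ (f.onDir x).head? ≠ (f.onDir y).head?
  fiber_vert : ∀ u w, f.onV u = f.onV w ↔
    u = w ∨ (u = G.term a ∧ w = G.term b) ∨ (u = G.term b ∧ w = G.term a)
  fiber_dir : ∀ x y, f.onDir x = f.onDir y ↔
    x = y ∨ (x = a ∧ y = b) ∨ (x = b ∧ y = a) ∨ (x = rev a ∧ y = rev b) ∨ (x = rev b ∧ y = rev a)

/-- `h : G → G'` exhibits `G` as the natural cell structure of `G'`: `h` matches the vertices of `G`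
with the natural vertices of `G'`, and each edge of `G` with a chain of edges of `G'` through
vertices of valence two, such that each edge of `G'` is covered exactly once. -/
structure IsNaturalStructure (h : GraphMap G G') : Prop where
  inj : Function.Injective h.onV
  range : Set.range h.onV = {w | G'.valence w ≠ 2}
  nonempty : ∀ e, h.onE e ≠ []
  interior : ∀ e, (h.onE e).IsChain fun a _ => G'.valence (G'.term a) = 2
  cover : ∀ x : E', ∃! p : (e : E) × Fin (h.onE e).length, ((h.onE p.1).get p.2).1 = x

end GraphMap

end Maps

section Circuits

variable {V E : Type*} {K : ℕ}

/-- A circuit, up to orientation preserving change of parameter: a nontrivial cyclically reduced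
closed edge path up to cyclic permutation. -/
def IsCircuit (G : Multigraph V E) (c : Cycle (E × Bool)) : Prop :=
  c ≠ Cycle.nil ∧ c.Chain fun a b => G.term a = G.init b ∧ b ≠ rev a

/-- A circuit family with `K` components: circuits that are pairwise inequivalent. -/
def IsCircuitFamily (G : Multigraph V E) (γ : Fin K → Cycle (E × Bool)) : Prop :=
  (∀ i, IsCircuit G (γ i)) ∧ Function.Injective γ

/-- The circuit with reversed orientation. -/
def revCycle (c : Cycle (E × Bool)) : Cycle (E × Bool) := (c.map rev).reverse

/-- A circuit is primitive (root-free) if it is not a proper power of a circuit. -/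
def IsPrimitiveCircuit (G : Multigraph V E) (c : Cycle (E × Bool)) : Prop :=
  ¬ ∃ (l : List (E × Bool)) (k : ℕ), IsCircuit G (l : Cycle (E × Bool)) ∧ 2 ≤ k ∧
    c = ((List.replicate k l).flatten : List (E × Bool))

/-- Joint primitivity of a circuit family. -/
def JointlyPrimitive (G : Multigraph V E) (γ : Fin K → Cycle (E × Bool)) : Prop :=
  (∀ i, IsPrimitiveCircuit G (γ i)) ∧ ∀ i j, i ≠ j → γ i ≠ γ j ∧ γ i ≠ revCycle (γ j)

/-- The closed path `c` takes the turn `{x, y}`: somewhere in `c` an oriented edge `a` is followed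
(cyclically) by an oriented edge `b` such that `{rev a, b} = {x, y}`. -/
def TakesTurn (c : Cycle (E × Bool)) (x y : E × Bool) : Prop :=
  ¬ c.Chain fun a b => ¬ ((rev a = x ∧ b = y) ∨ (rev a = y ∧ b = x))

theorem TakesTurn.symm {c : Cycle (E × Bool)} {x y : E × Bool} (h : TakesTurn c x y) :
    TakesTurn c y x := by
  unfold TakesTurn at *
  simpa only [or_comm] using h

theorem TakesTurn.crosses {c : Cycle (E × Bool)} {x y : E × Bool} (h : TakesTurn c x y) :
    x ∈ c ∨ rev x ∈ c := by
  by_contra hx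
  rw [not_or] at hx
  refine h (Cycle.chain_of_pairwise ?_)
  rintro a ha b hb (⟨h1, -⟩ | ⟨-, h2⟩)
  · refine hx.2 ?_
    have : rev x = a := by rw [← h1]; simp [rev]
    rwa [this]
  · exact hx.1 (h2 ▸ hb)

/-- The Whitehead graph `W_v γ`, a subgraph of the graph of turns (the complete graph on the
directions at `v`): its vertices are the directions at `v` that `γ` crosses in one orientation or the
other, its edges the turns at `v` that are taken by `γ`. -/
def whiteheadGraph (G : Multigraph V E) (γ : Fin K → Cycle (E × Bool)) (v : V) :
    (⊤ : SimpleGraph (E × Bool)).Subgraph where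
  verts := {a | G.init a = v ∧ ∃ i, a ∈ γ i ∨ rev a ∈ γ i}
  Adj a b := a ≠ b ∧ G.init a = v ∧ G.init b = v ∧ ∃ i, TakesTurn (γ i) a b
  adj_sub h := h.1
  edge_vert := by
    rintro a b ⟨-, ha, -, i, hi⟩
    exact ⟨ha, i, hi.crosses⟩
  symm := ⟨by
    rintro a b ⟨hne, ha, hb, i, hi⟩
    exact ⟨hne.symm, hb, ha, i, hi.symm⟩⟩

/-- The augmented Whitehead graph: all directions at `v` are thrown in as vertices. -/
def augmentedWhiteheadGraph (G : Multigraph V E) (γ : Fin K → Cycle (E × Bool)) (v : V) :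
    (⊤ : SimpleGraph (E × Bool)).Subgraph where
  verts := G.directions v
  Adj := (whiteheadGraph G γ v).Adj
  adj_sub h := h.1
  edge_vert h := h.2.1
  symm := (whiteheadGraph G γ v).symm

/-- `{W₁, W₂}` is a cut of the augmented Whitehead graph at `v` along the direction `d`. -/
structure IsCut (G : Multigraph V E) (γ : Fin K → Cycle (E × Bool)) (v : V) (d : E × Bool)
    (W₁ W₂ : (⊤ : SimpleGraph (E × Bool)).Subgraph) : Prop where
  union : W₁ ⊔ W₂ = augmentedWhiteheadGraph G γ v
  inter : W₁ ⊓ W₂ = SimpleGraph.singletonSubgraph ⊤ d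
  mem : d ∈ (whiteheadGraph G γ v).verts
  edge₁ : ∃ x, W₁.Adj d x
  edge₂ : ∃ x, W₂.Adj d x

/-- Near visibility condition: at each vertex, each component of the Whitehead graph is a single
edge (each of its vertices has exactly one neighbour). -/
def NearVisible (G : Multigraph V E) (γ : Fin K → Cycle (E × Bool)) : Prop :=
  ∀ v, (whiteheadGraph G γ v).IsMatching

/-- Cut vertex condition: at some vertex `v`, some component of the Whitehead graph has a cut vertex
`w`, i.e. there are vertices `x`, `y` other than `w` which are joined by a path in the Whitehead
graph, and every such path contains `w`. -/
def CutVertexCondition (G : Multigraph V E) (γ : Fin K → Cycle (E × Bool)) : Prop :=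
  ∃ v w x y, w ∈ (whiteheadGraph G γ v).verts ∧ x ≠ w ∧ y ≠ w ∧
    (whiteheadGraph G γ v).spanningCoe.Reachable x y ∧
    ∀ p : (whiteheadGraph G γ v).spanningCoe.Walk x y, w ∈ p.support

open Classical in
/-- The number of times that `γ` crosses the edge `e` (in either orientation). -/
noncomputable def crossings (γ : Fin K → Cycle (E × Bool)) (e : E) : ℕ :=
  ∑ i, ((γ i).toMultiset.map Prod.fst).count e

/-- Edges belong to the same natural edge if they are linked through vertices of valence two. -/
def naturalSetoid (G : Multigraph V E) : Setoid E :=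
  Relation.EqvGen.setoid fun e e' =>
    ∃ β β' : Bool, G.init (e, β) = G.init (e', β') ∧ G.valence (G.init (e, β)) = 2

/-- The natural weight sequence: `naturalWeight G γ k` is the number of natural edges of `G` that are
crossed exactly `k` times by `γ`. (A circuit family crosses all edges of a natural edge equally
often.) -/
noncomputable def naturalWeight (G : Multigraph V E) (γ : Fin K → Cycle (E × Bool)) (k : ℕ) : ℕ :=
  {N : Quotient (naturalSetoid G) | ∃ e, Quotient.mk (naturalSetoid G) e = N ∧
    crossings γ e = k}.ncard

/-- The dictionary order on finitely supported sequences of natural numbers, in which the last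
difference decides. -/
def WeightLT (w w' : ℕ → ℕ) : Prop := ∃ k, (∀ i, k < i → w i = w' i) ∧ w k < w' k

/-- The circuit `c` represents the conjugacy class `C` of `F_n` in the marked graph `G`. -/
def Represents {G : Multigraph V E} {n : ℕ} (m : G.Marking n) (c : Cycle (E × Bool))
    (C : ConjClasses (FreeGroup (Fin n))) : Prop :=
  ∃ (g : FreeGroup (Fin n)) (l q : List (E × Bool)) (v : V), ConjClasses.mk g = C ∧
    (l : Cycle (E × Bool)) = c ∧ G.IsPath v l v ∧ G.IsPath m.base q v ∧
    (m.iso g : FreeGroup E) = FreeGroup.mk q * FreeGroup.mk l * (FreeGroup.mk q)⁻¹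

/-- The list `C` of conjugacy classes of `F_n` is represented by a partial free basis: there are
pairwise distinct representatives that are members of a free basis. -/
def RepresentedByPartialFreeBasis {n : ℕ} (C : Fin K → ConjClasses (FreeGroup (Fin n))) : Prop :=
  ∃ g : Fin K → FreeGroup (Fin n), Function.Injective g ∧ (∀ i, ConjClasses.mk (g i) = C i) ∧
    ∃ (κ : Type) (b : FreeGroupBasis κ (FreeGroup (Fin n))), Set.range g ⊆ Set.range b

/-- The circuit family `γ` represents a partial free basis. -/
def FamilyRepresentsPartialFreeBasis {G : Multigraph V E} {n : ℕ} (m : G.Marking n)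
    (γ : Fin K → Cycle (E × Bool)) : Prop :=
  ∃ C : Fin K → ConjClasses (FreeGroup (Fin n)),
    (∀ i, Represents m (γ i) (C i)) ∧ RepresentedByPartialFreeBasis C

end Circuits

section Split

variable {V E : Type*}

open Classical in
/-- The vertex of the split graph to which the direction `a` of `G` is attached when `G` is split
along `d`. The terminal vertex `v` of the split edge (the vertex at which `d` is based) is replaced by
`v₁ = some v` and `v₂ = none`; the directions in `T₂ - {d}` are attached to `v₂`, the other
directions at `v` to `v₁`, and all other directions stay where they are. -/
noncomputable def attach (G : Multigraph V E) (d : E × Bool) (T₂ : Set (E × Bool))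
    (a : E × Bool) : Option V :=
  if a ∈ T₂ ∧ a ≠ d ∧ G.init a = G.init d then none else some (G.init a)

/-- The graph `H` obtained by splitting `G` along the direction `d`, using the direction cut
`{T₁, T₂}` of the set of directions at `v = init d` (with `T₁` and `T₂` meeting in `d` only, `T₂`
determines `T₁`). Let `E` be the oriented edge with terminal direction `d`, i.e. `E = rev d`. In `H`
it is replaced by two edges, `E₁ = some d.1` and `E₂ = none`, oriented like `E`, with terminal
vertices `v₁` and `v₂`; their common initial vertex is the vertex to which the initial direction of
`E` is attached (this is the initial vertex of `E`, or one of `v₁`, `v₂` if `E` is a loop). -/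
noncomputable def split (G : Multigraph V E) (d : E × Bool) (T₂ : Set (E × Bool)) :
    Multigraph (Option V) (Option E) where
  init
    | (some x, β) => attach G d T₂ (x, β)
    | (none, β) => if β = d.2 then none else attach G d T₂ (d.1, β)

theorem attach_getD (G : Multigraph V E) (d : E × Bool) (T₂ : Set (E × Bool)) (a : E × Bool) :
    (attach G d T₂ a).getD (G.init d) = G.init a := by
  unfold attach
  split_ifs with h
  · exact h.2.2.symm
  · rfl

theorem split_init_getD (G : Multigraph V E) (d : E × Bool) (T₂ : Set (E × Bool))
    (x : Option E) (β : Bool) :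
    ((split G d T₂).init (x, β)).getD (G.init d) = G.init (x.getD d.1, β) := by
  cases x with
  | some x => exact attach_getD G d T₂ (x, β)
  | none =>
    by_cases h : β = d.2
    · subst h; simp [split]
    · simpa [split, h] using attach_getD G d T₂ (d.1, β)

/-- The fold map `f : H → G`, with `f(v₁) = f(v₂) = v` and `f(E₁) = f(E₂) = E`. -/
noncomputable def splitFold (G : Multigraph V E) (d : E × Bool) (T₂ : Set (E × Bool)) :
    GraphMap (split G d T₂) G where
  onV x := x.getD (G.init d)
  onE x := [(x.getD d.1, true)]
  isPath x := by
    refine ⟨(split_init_getD G d T₂ x true).symm, ?_⟩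
    exact (split_init_getD G d T₂ x false).symm

/-- The oriented edges `E₁`, `E₂` of the split graph, which are folded together by `splitFold`. -/
def splitEdge₁ (d : E × Bool) : Option E × Bool := (some d.1, !d.2)

/-- The second of the two folded edges; see `splitEdge₁`. -/
def splitEdge₂ (d : E × Bool) : Option E × Bool := (none, !d.2)

/-- `δ` is a circuit family in the split graph that does not take an illegal turn of the fold `f`
and such that `f ∘ δ` is equivalent to `γ`. -/
def IsSplitFamily {K : ℕ} (G : Multigraph V E) (d : E × Bool) (T₂ : Set (E × Bool))
    (γ : Fin K → Cycle (E × Bool)) (δ : Fin K → Cycle (Option E × Bool)) : Prop :=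
  IsCircuitFamily (split G d T₂) δ ∧
  (∀ i x y, (splitFold G d T₂).IsIllegalTurn x y → ¬ TakesTurn (δ i) x y) ∧
  ∀ i, (splitFold G d T₂).onCycle (δ i) = γ i

end Split

section Algorithm

/-- The data on which the algorithm works: a marked graph of rank `n` with its natural cell structure
and a circuit family with `K` components in it. -/
structure State (n K : ℕ) where
  numV : ℕ
  numE : ℕ
  graph : Multigraph (Fin numV) (Fin numE)
  core : graph.IsCore
  natural : graph.IsNatural
  marking : graph.Marking n
  family : Fin K → Cycle (Fin numE × Bool)
  isFamily : IsCircuitFamily graph family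

variable {n K : ℕ}

/-- One split (step 2d): choose a cut of the augmented Whitehead graph at some vertex of `s`, split
along it to get the marked graph `H`, the marking preserving fold `H → G` and the circuit family `δ`
in `H`; then `t` is `H` with its natural cell structure and with the circuit family `δ`. -/
def SplitStep (s t : State n K) : Prop :=
  ∃ (v : Fin s.numV) (d : Fin s.numE × Bool)
    (W₁ W₂ : (⊤ : SimpleGraph (Fin s.numE × Bool)).Subgraph),
    IsCut s.graph s.family v d W₁ W₂ ∧
    ∃ (mH : (split s.graph d W₂.verts).Marking n) (δ : Fin K → Cycle (Option (Fin s.numE) × Bool))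
      (h : GraphMap t.graph (split s.graph d W₂.verts)),
      (splitFold s.graph d W₂.verts).PreservesMarking mH s.marking ∧
      IsSplitFamily s.graph d W₂.verts s.family δ ∧
      h.IsNaturalStructure ∧ h.PreservesMarking t.marking mH ∧ ∀ i, h.onCycle (t.family i) = δ i

/-- The loop (step 2) with its answers, for all possible choices of cuts: stop with the answer "yes"
if the near visibility condition holds, otherwise stop with the answer "no" if the cut vertex
condition fails, otherwise split and repeat. -/
inductive LoopOutput : State n K → Bool → Prop
  | visible (s : State n K) : NearVisible s.graph s.family → LoopOutput s true
  | noCut (s : State n K) : ¬ NearVisible s.graph s.family →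
      ¬ CutVertexCondition s.graph s.family → LoopOutput s false
  | split (s t : State n K) (b : Bool) : ¬ NearVisible s.graph s.family →
      CutVertexCondition s.graph s.family → SplitStep s t → LoopOutput t b → LoopOutput s b

/-- Whitehead's algorithm may stop with the answer `b` on the input `s`: if the circuit family is not
jointly primitive then the answer is "no" (step 1), otherwise the loop is run. -/
def AlgorithmOutput (s : State n K) (b : Bool) : Prop :=
  (¬ JointlyPrimitive s.graph s.family ∧ b = false) ∨
  (JointlyPrimitive s.graph s.family ∧ LoopOutput s b)

end Algorithm

/-! Codes: finite data written down with natural numbers, for the computability statements. -/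
section Codes

/-- The number of vertices, and the list of the endpoint pairs of the edges. -/
abbrev GraphCode := ℕ × List (ℕ × ℕ)

/-- An edge path written as a word in numbered oriented edges. -/
abbrev WordCode := List (ℕ × Bool)

/-- A marked graph with a circuit family: the graph, the base vertex and the images of the
generators of `F_n` under the marking, and the circuits. -/
abbrev FamilyCode := GraphCode × (ℕ × List WordCode) × List WordCode

/-- The direction along which the cut is made, and the lists of the vertices of the two sides. -/
abbrev CutCode := (ℕ × Bool) × List (ℕ × Bool) × List (ℕ × Bool)

/-- A map of graphs: the images of the vertices and of the edges. -/
abbrev MapCode := List ℕ × List WordCode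

variable {V E V' E' : Type*} {p q p' q' n K : ℕ}

def graphCode (iV : V ≃ Fin p) (iE : E ≃ Fin q) (G : Multigraph V E) : GraphCode :=
  (p, List.ofFn fun j : Fin q =>
    ((iV (G.init (iE.symm j, true)) : ℕ), (iV (G.init (iE.symm j, false)) : ℕ)))

def wordCode (iE : E ≃ Fin q) (l : List (E × Bool)) : WordCode :=
  l.map fun a => ((iE a.1 : ℕ), a.2)

/-- `c` describes the marked graph `G` with marking `m` and circuit family `γ`, relative to numberings
of the vertices and edges (markings and circuits can be described by different words). -/
def IsFamilyCode (iV : V ≃ Fin p) (iE : E ≃ Fin q) (G : Multigraph V E) (m : G.Marking n)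
    (γ : Fin K → Cycle (E × Bool)) (c : FamilyCode) : Prop :=
  ∃ (x : Fin n → List (E × Bool)) (y : Fin K → List (E × Bool)),
    (∀ i, G.IsPath m.base (x i) m.base ∧
      FreeGroup.mk (x i) = (m.iso (FreeGroup.of i) : FreeGroup E)) ∧
    (∀ i, (y i : Cycle (E × Bool)) = γ i) ∧
    c = (graphCode iV iE G, ((iV m.base : ℕ), List.ofFn fun i => wordCode iE (x i)),
      List.ofFn fun i => wordCode iE (y i))

/-- `c` describes the direction `d` and the sets of directions `T₁`, `T₂`. -/
def IsCutCode (iE : E ≃ Fin q) (d : E × Bool) (T₁ T₂ : Set (E × Bool)) (c : CutCode) : Prop :=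
  ∃ l₁ l₂ : List (E × Bool), (∀ a, a ∈ l₁ ↔ a ∈ T₁) ∧ (∀ a, a ∈ l₂ ↔ a ∈ T₂) ∧
    c = (((iE d.1 : ℕ), d.2), wordCode iE l₁, wordCode iE l₂)

def mapCode (iV : V ≃ Fin p) (iE : E ≃ Fin q) (iV' : V' ≃ Fin p') (iE' : E' ≃ Fin q')
    {G : Multigraph V E} {G' : Multigraph V' E'} (f : GraphMap G G') : MapCode :=
  (List.ofFn fun j : Fin p => (iV' (f.onV (iV.symm j)) : ℕ),
   List.ofFn fun j : Fin q => wordCode iE' (f.onE (iE.symm j)))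

/-- `c` describes the state `s`. -/
def State.IsCode (s : State n K) (c : FamilyCode) : Prop :=
  IsFamilyCode (Equiv.refl _) (Equiv.refl _) s.graph s.marking s.family c

end Codes

end Whitehead

namespace Whitehead

open Multigraph

/-! ### Orientation reversal, edge paths, and their images under graph maps. -/

section Basics

variable {V E V' E' V'' E'' : Type*}

/-! All conditions on a circuit family are expressed through the turns that it takes (`TurnOf`).
Near visibility becomes `UniqueTurns` (each direction has at most one neighbour, `nearVisible_iff`),
and the existence of a cut vertex becomes `HasCut` (`cutVertexCondition_iff`).

Split. The fold `H → G` has the homotopy inverse `splitSection`, hence it is an isomorphism on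
fundamental groups and markings pull back along it, uniquely up to homotopy. A circuit lifts to `H`
in exactly one way: whether a crossing of `E` lifts to `E₁` or to `E₂` is dictated by the side on
which the neighbouring direction at `v` lies, and the two directions of a turn that avoids `d` lie
on one side (`isCircuit_liftList`, `eq_liftList`). Both `E₁` and `E₂` are crossed, and their
crossing numbers add up to that of `E`. So `E` disappears from its level of the weight sequence,
while every natural edge created or merged lies at a lower level (`weightLT_split`).

Answer "yes". If turns are unique, a circuit is an orbit of the successor map, and joint primitivity
implies that each edge is crossed at most once (`crossings_le_one_of_uniqueTurns`). One edge of each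
circuit can then be removed without disconnecting the graph, and the circuits together with a basis
of what remains form a free basis (`exists_freeGroupBasis_of_edges`).

Answer "no". Joint primitivity is necessary, as exponent sums of basis elements show. The main point
is the cut vertex lemma `uniqueTurns_of_familyRepresents`, proved by Stallings folds. A free basis
that contains the given classes defines a wedge of lollipops with a map to `G`. This map is an
isomorphism on fundamental groups, and the circuits are the images of disjoint embedded loops, whose
turns are unique. The map is a composition of folds followed by an injective map. A fold of two
edges that are both crossed creates a cut vertex (`hasCut_of_crossed`). If the family in `G` has no
cut, then by induction no fold identifies two crossed edges, so that the uniqueness of turns is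
passed down to `G` (`IsResolution.hasCut_or_uniqueTurns`).

Termination. After a split, vertices of valence two are removed one by one (`exists_subdivision`),
which does not change the natural weight. The order on finitely supported sequences in which the
last difference decides is well-founded.

Effectivity. The turns can be read off from the circuit words, so cuts are searched and lifts
computed on words alone, without restoring natural cell structures. Each split lowers the sum of
`crossings - 1`, so the total length of the words bounds the number of splits. All runs of the
algorithm give the same, correct answer, which is therefore the computed one. For words in `F_n`
this is applied to their cyclic reductions, as circuits in the rose. -/

@[simp] theorem rev_rev (a : E × Bool) : rev (rev a) = a := by simp [rev]

theorem rev_inj {a b : E × Bool} : rev a = rev b ↔ a = b :=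
  ⟨fun h => by rw [← rev_rev a, h, rev_rev], fun h => h ▸ rfl⟩

theorem rev_eq_iff {a b : E × Bool} : rev a = b ↔ a = rev b := by
  rw [← rev_inj, rev_rev]

theorem rev_ne (a : E × Bool) : rev a ≠ a := by
  intro h
  have := congrArg Prod.snd h
  simp [rev] at this

@[simp] theorem rev_fst (a : E × Bool) : (rev a).1 = a.1 := rfl

theorem eq_or_eq_rev_of_fst_eq {a b : E × Bool} (h : a.1 = b.1) : a = b ∨ a = rev b := by
  obtain ⟨x, β⟩ := a
  obtain ⟨y, β'⟩ := b
  obtain rfl : x = y := h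
  cases β <;> cases β' <;> simp [rev]

theorem invRev_eq_map_rev (l : List (E × Bool)) : FreeGroup.invRev l = (l.map rev).reverse := rfl

theorem invRev_append (l l' : List (E × Bool)) :
    FreeGroup.invRev (l ++ l') = FreeGroup.invRev l' ++ FreeGroup.invRev l := by
  simp [FreeGroup.invRev]

theorem mk_invRev (l : List (E × Bool)) : FreeGroup.mk (FreeGroup.invRev l) = (FreeGroup.mk l)⁻¹ :=
  FreeGroup.inv_mk.symm

theorem mk_append (l l' : List (E × Bool)) :
    FreeGroup.mk (l ++ l') = FreeGroup.mk l * FreeGroup.mk l' := FreeGroup.mul_mk.symm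

theorem mk_nil : FreeGroup.mk ([] : List (E × Bool)) = 1 := rfl

theorem mk_cons (a : E × Bool) (l : List (E × Bool)) :
    FreeGroup.mk (a :: l) = FreeGroup.mk [a] * FreeGroup.mk l := mk_append [a] l

theorem mk_rev (a : E × Bool) : FreeGroup.mk [rev a] = (FreeGroup.mk [a])⁻¹ := by
  rw [← mk_invRev]; rfl

theorem mk_singleton_injective : Function.Injective fun a : E × Bool => FreeGroup.mk [a] := by
  classical
  intro a b h
  simpa [FreeGroup.reduce_singleton] using FreeGroup.reduce.sound h

namespace Multigraph

variable {G : Multigraph V E}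

@[simp] theorem init_rev (a : E × Bool) : G.init (rev a) = G.term a := rfl

@[simp] theorem term_rev (a : E × Bool) : G.term (rev a) = G.init a := by simp [term]

@[simp] theorem isPath_nil {u w : V} : G.IsPath u [] w ↔ u = w := Iff.rfl

theorem isPath_cons {u w : V} {a : E × Bool} {l : List (E × Bool)} :
    G.IsPath u (a :: l) w ↔ G.init a = u ∧ G.IsPath (G.term a) l w := Iff.rfl

theorem isPath_singleton (a : E × Bool) : G.IsPath (G.init a) [a] (G.term a) := ⟨rfl, rfl⟩

theorem IsPath.right_unique {l : List (E × Bool)} {u w w' : V} (h : G.IsPath u l w)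
    (h' : G.IsPath u l w') : w = w' := by
  induction l generalizing u with
  | nil => exact h.symm.trans h'
  | cons a l ih => exact ih h.2 h'.2

theorem isPath_append_iff {l l' : List (E × Bool)} {u w : V} :
    G.IsPath u (l ++ l') w ↔ ∃ v, G.IsPath u l v ∧ G.IsPath v l' w := by
  induction l generalizing u with
  | nil => simp
  | cons a l ih => simp [isPath_cons, ih, and_assoc]

theorem IsPath.mem_pi1 {l : List (E × Bool)} {v : V} (h : G.IsPath v l v) :
    FreeGroup.mk l ∈ G.pi1 v := ⟨l, h, rfl⟩

theorem IsPath.invRev {l : List (E × Bool)} {u w : V} (h : G.IsPath u l w) :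
    G.IsPath w (FreeGroup.invRev l) u := h.reverse

/-- The two cancelled letters run along an edge and back, so removing them keeps both endpoints. -/
theorem IsPath.reduces {l : List (E × Bool)} {l' : List (E × Bool)} (hr : FreeGroup.Red.Step l l')
    {u w : V} (h : G.IsPath u l w) : G.IsPath u l' w := by
  obtain ⟨l₁, l₂, x, b⟩ := FreeGroup.Red.Step.rec (motive := fun l l' _ => ∃ l₁ l₂ x b,
    l = l₁ ++ (x, b) :: (x, !b) :: l₂ ∧ l' = l₁ ++ l₂) (fun {L₁ L₂ x b} => ⟨L₁, L₂, x, b, rfl, rfl⟩) hr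
  obtain ⟨b, rfl, rfl⟩ := b
  rw [isPath_append_iff] at h ⊢
  obtain ⟨v, h₁, h₂⟩ := h
  refine ⟨v, h₁, ?_⟩
  obtain ⟨h3, h4, h5⟩ := h₂
  have : G.term (rev (x, b)) = v := by rw [term_rev, h3]
  exact this ▸ h5

theorem IsPath.red {l l' : List (E × Bool)} (hr : FreeGroup.Red l l') {u w : V}
    (h : G.IsPath u l w) : G.IsPath u l' w := by
  induction hr with
  | refl => exact h
  | tail _ hs ih => exact ih.reduces hs

theorem IsConnected.exists_isPath (h : G.IsConnected) (u w : V) : ∃ l, G.IsPath u l w := h.2 u w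

theorem exists_isPath_mk_of_mem_pi1 {v : V} (g : G.pi1 v) :
    ∃ l, G.IsPath v l v ∧ FreeGroup.mk l = (g : FreeGroup E) := g.2

end Multigraph

namespace GraphMap

variable {G : Multigraph V E} {G' : Multigraph V' E'} {G'' : Multigraph V'' E''}

@[simp] theorem onDir_true (f : GraphMap G G') (e : E) : f.onDir (e, true) = f.onE e := by
  simp [onDir]

@[simp] theorem onDir_false (f : GraphMap G G') (e : E) :
    f.onDir (e, false) = FreeGroup.invRev (f.onE e) := by
  simp [onDir]

theorem onDir_rev (f : GraphMap G G') (a : E × Bool) :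
    f.onDir (rev a) = FreeGroup.invRev (f.onDir a) := by
  obtain ⟨e, b⟩ := a
  cases b <;> simp [rev, FreeGroup.invRev_invRev]

@[simp] theorem onPath_nil (f : GraphMap G G') : f.onPath [] = [] := rfl

@[simp] theorem onPath_cons (f : GraphMap G G') (a : E × Bool) (l : List (E × Bool)) :
    f.onPath (a :: l) = f.onDir a ++ f.onPath l := rfl

@[simp] theorem onPath_append (f : GraphMap G G') (l l' : List (E × Bool)) :
    f.onPath (l ++ l') = f.onPath l ++ f.onPath l' := by simp [onPath]

theorem onPath_invRev (f : GraphMap G G') (l : List (E × Bool)) :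
    f.onPath (FreeGroup.invRev l) = FreeGroup.invRev (f.onPath l) := by
  induction l with
  | nil => rfl
  | cons a l ih =>
    have : FreeGroup.invRev (a :: l) = FreeGroup.invRev l ++ [rev a] := by
      simp [FreeGroup.invRev, rev]
    rw [this, onPath_append, ih, onPath_cons, onPath_cons, invRev_append, onDir_rev]
    simp

theorem isPath_onDir (f : GraphMap G G') (a : E × Bool) :
    G'.IsPath (f.onV (G.init a)) (f.onDir a) (f.onV (G.term a)) := by
  obtain ⟨e, b⟩ := a
  cases b
  · rw [onDir_false]; exact (f.isPath e).reverse
  · rw [onDir_true]; exact f.isPath e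

theorem isPath_onPath (f : GraphMap G G') {l : List (E × Bool)} {u w : V} (h : G.IsPath u l w) :
    G'.IsPath (f.onV u) (f.onPath l) (f.onV w) := by
  induction l generalizing u with
  | nil => cases h; rfl
  | cons a l ih =>
    obtain ⟨rfl, h⟩ := h
    exact (f.isPath_onDir a).append (ih h)

theorem hom_mk (f : GraphMap G G') (l : List (E × Bool)) :
    f.hom (FreeGroup.mk l) = FreeGroup.mk (f.onPath l) := by
  induction l with
  | nil => exact map_one _
  | cons a l ih =>
    rw [mk_cons, map_mul, ih, onPath_cons, mk_append]
    congr 1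
    obtain ⟨e, b⟩ := a
    have h : f.hom (FreeGroup.mk [(e, true)]) = FreeGroup.mk (f.onE e) :=
      FreeGroup.lift_apply_of
    cases b
    · have : FreeGroup.mk [(e, false)] = (FreeGroup.mk [(e, true)])⁻¹ := mk_rev (e, true)
      rw [this, map_inv, h, onDir_false, mk_invRev]
    · rw [h, onDir_true]

@[simp] theorem onCycle_coe (f : GraphMap G G') (l : List (E × Bool)) :
    f.onCycle (l : Cycle (E × Bool)) = (f.onPath l : List (E' × Bool)) := rfl

/-- Composition of maps of graphs. -/
def comp (f : GraphMap G' G'') (h : GraphMap G G') : GraphMap G G'' where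
  onV v := f.onV (h.onV v)
  onE e := f.onPath (h.onE e)
  isPath e := f.isPath_onPath (h.isPath e)

theorem comp_onDir (f : GraphMap G' G'') (h : GraphMap G G') (a : E × Bool) :
    (f.comp h).onDir a = f.onPath (h.onDir a) := by
  obtain ⟨e, b⟩ := a
  cases b
  · rw [onDir_false, onDir_false, onPath_invRev]; rfl
  · rw [onDir_true, onDir_true]; rfl

theorem comp_onPath (f : GraphMap G' G'') (h : GraphMap G G') (l : List (E × Bool)) :
    (f.comp h).onPath l = f.onPath (h.onPath l) := by
  induction l with
  | nil => rfl
  | cons a l ih => rw [onPath_cons, ih, onPath_cons, onPath_append, comp_onDir]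

theorem comp_onCycle (f : GraphMap G' G'') (h : GraphMap G G') (c : Cycle (E × Bool)) :
    (f.comp h).onCycle c = f.onCycle (h.onCycle c) := by
  induction c using Quotient.inductionOn' with
  | h l => exact congrArg _ (comp_onPath f h l)

theorem comp_hom (f : GraphMap G' G'') (h : GraphMap G G') (x : FreeGroup E) :
    (f.comp h).hom x = f.hom (h.hom x) := by
  induction x using Quot.inductionOn with
  | h l =>
    have h1 := (f.comp h).hom_mk l
    have h2 := h.hom_mk l
    simp only [FreeGroup.quot_mk_eq_mk]
    rw [h1, h2, hom_mk, comp_onPath]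

variable {n : ℕ}

theorem PreservesMarking.comp {f : GraphMap G' G''} {h : GraphMap G G'} {m : G.Marking n}
    {m' : G'.Marking n} {m'' : G''.Marking n} (hf : f.PreservesMarking m' m'')
    (hh : h.PreservesMarking m m') : (f.comp h).PreservesMarking m m'' := by
  obtain ⟨q, hq, hq'⟩ := hh
  obtain ⟨r, hr, hr'⟩ := hf
  refine ⟨f.onPath q ++ r, (f.isPath_onPath hq).append hr, fun g => ?_⟩
  rw [comp_hom, hq', map_mul, map_mul, map_inv, hr', hom_mk, mk_append]
  group

end GraphMap

/-! ### Conjugacy classes represented by closed paths. -/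

section Represents

variable {G : Multigraph V E} {G' : Multigraph V' E'} {n K : ℕ}

/-- Under the marking a conjugating element is a loop at the base point; put in front of the
connecting path, it absorbs the conjugation. -/
theorem Represents.exists_of_mk {m : G.Marking n} {c : Cycle (E × Bool)} {g : FreeGroup (Fin n)}
    (h : Represents m c (ConjClasses.mk g)) :
    ∃ (l q : List (E × Bool)) (v : V), (l : Cycle (E × Bool)) = c ∧ G.IsPath v l v ∧
      G.IsPath m.base q v ∧
      (m.iso g : FreeGroup E) = FreeGroup.mk q * FreeGroup.mk l * (FreeGroup.mk q)⁻¹ := by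
  obtain ⟨g', l, q, v, hg, hl, hv, hq, e⟩ := h
  obtain ⟨x, rfl⟩ := isConj_iff.1 (ConjClasses.mk_eq_mk_iff_isConj.1 hg)
  obtain ⟨r, hr, hr'⟩ := exists_isPath_mk_of_mem_pi1 (m.iso x)
  refine ⟨l, r ++ q, v, hl, hv, hr.append hq, ?_⟩
  rw [map_mul, map_mul, map_inv, mk_append, hr']
  push_cast
  rw [e]
  group

theorem Represents.map {m : G.Marking n} {m' : G'.Marking n} {f : GraphMap G G'}
    (hf : f.PreservesMarking m m') {c : Cycle (E × Bool)} {C : ConjClasses (FreeGroup (Fin n))}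
    (h : Represents m c C) : Represents m' (f.onCycle c) C := by
  obtain ⟨g, l, q, v, hg, rfl, hv, hq, e⟩ := h
  obtain ⟨r, hr, hr'⟩ := hf
  refine ⟨g, f.onPath l, FreeGroup.invRev r ++ f.onPath q, f.onV v, hg, rfl, f.isPath_onPath hv,
    hr.invRev.append (f.isPath_onPath hq), ?_⟩
  have h1 := hr' g
  rw [e, map_mul, map_mul, map_inv, GraphMap.hom_mk, GraphMap.hom_mk] at h1
  rw [mk_append, mk_invRev]
  have : (m'.iso g : FreeGroup E') = (FreeGroup.mk r)⁻¹ *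
      (FreeGroup.mk r * (m'.iso g : FreeGroup E') * (FreeGroup.mk r)⁻¹) * FreeGroup.mk r := by group
  rw [this, ← h1]; group

/-- Two words for a cycle differ by a rotation, and moving the starting point along `l₁` conjugates
the loop. The empty cycle is treated apart: it does not determine a vertex, but both elements are
trivial. -/
theorem Represents.unique {m : G.Marking n} {c : Cycle (E × Bool)}
    {C C' : ConjClasses (FreeGroup (Fin n))} (h : Represents m c C) (h' : Represents m c C') :
    C = C' := by
  obtain ⟨g, l, q, v, rfl, hl, hv, hq, e⟩ := h
  obtain ⟨g', l', q', v', rfl, hl', hv', hq', e'⟩ := h'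
  by_cases hne : l = []
  · subst hne
    obtain rfl : l' = [] := by
      rw [← Cycle.coe_eq_nil, hl', ← hl, Cycle.coe_nil]
    have h1 : (m.iso g : FreeGroup E) = 1 := by rw [e, mk_nil]; group
    have h2 : (m.iso g' : FreeGroup E) = 1 := by rw [e', mk_nil]; group
    have : g = g' := m.iso.injective (Subtype.ext (h1.trans h2.symm))
    rw [this]
  obtain ⟨k, rfl⟩ := Cycle.coe_eq_coe.1 (hl'.trans hl.symm)
  have hk : l'.rotate k = l'.drop (k % l'.length) ++ l'.take (k % l'.length) :=
    List.rotate_eq_drop_append_take_mod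
  set l₁ := l'.take (k % l'.length)
  set l₂ := l'.drop (k % l'.length)
  have h12 : l₁ ++ l₂ = l' := List.take_append_drop _ _
  rw [hk] at hv e hne
  rw [← h12] at hv' e'
  obtain ⟨w, hw1, hw2⟩ := isPath_append_iff.1 hv'
  obtain ⟨w', hw1', hw2'⟩ := isPath_append_iff.1 hv
  have hvw : v = w := by
    by_cases h2 : l₂ = []
    · have h1 : l₁ ≠ [] := by rintro h1; simp [h1, h2] at hne
      rw [h2] at hw2 hw1'
      obtain ⟨a, t, ht⟩ := List.exists_cons_of_ne_nil h1
      rw [ht] at hw1 hw2'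
      cases hw2; cases hw1'
      exact hw2'.1.symm.trans hw1.1
    · obtain ⟨a, t, ht⟩ := List.exists_cons_of_ne_nil h2
      rw [ht] at hw2 hw1'
      exact hw1'.1.symm.trans hw2.1
  subst hvw
  have hz : G.IsPath m.base (q' ++ l₁ ++ FreeGroup.invRev q) m.base :=
    (hq'.append hw1).append hq.invRev
  obtain ⟨z, hz'⟩ := m.iso.surjective ⟨_, hz.mem_pi1⟩
  rw [ConjClasses.mk_eq_mk_iff_isConj, isConj_iff]
  refine ⟨z, m.iso.injective (Subtype.ext ?_)⟩
  have hz2 := congrArg Subtype.val hz'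
  rw [map_mul, map_mul, map_inv]
  push_cast
  rw [e', e, hz2]
  simp only [mk_append, mk_invRev]
  group

theorem exists_represents (hG : G.IsConnected) (m : G.Marking n) {l : List (E × Bool)} {v : V}
    (hl : G.IsPath v l v) : ∃ C, Represents m (l : Cycle (E × Bool)) C := by
  obtain ⟨q, hq⟩ := hG.exists_isPath m.base v
  obtain ⟨g, hg⟩ := m.iso.surjective ⟨_, ((hq.append hl).append hq.invRev).mem_pi1⟩
  refine ⟨_, g, l, q, v, rfl, rfl, hl, hq, ?_⟩
  rw [hg]
  simp only [mk_append, mk_invRev]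

theorem familyRepresents_congr {m : G.Marking n} {m' : G'.Marking n}
    {γ : Fin K → Cycle (E × Bool)} {γ' : Fin K → Cycle (E' × Bool)}
    {C : Fin K → ConjClasses (FreeGroup (Fin n))} (h : ∀ i, Represents m (γ i) (C i))
    (h' : ∀ i, Represents m' (γ' i) (C i)) :
    FamilyRepresentsPartialFreeBasis m γ ↔ FamilyRepresentsPartialFreeBasis m' γ' := by
  constructor
  · rintro ⟨C', hC', hb⟩
    obtain rfl : C' = C := funext fun i => (hC' i).unique (h i)
    exact ⟨C', h', hb⟩
  · rintro ⟨C', hC', hb⟩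
    obtain rfl : C' = C := funext fun i => (hC' i).unique (h' i)
    exact ⟨C', h, hb⟩

end Represents

/-! ### Maps inducing isomorphisms of fundamental groups, and pulling back markings. -/

section HomotopyEquivalence

variable {G : Multigraph V E} {H : Multigraph V' E'} {n : ℕ}

/-- The map induces isomorphisms of fundamental groups. -/
structure GraphMap.IsPi1Equiv (f : GraphMap H G) : Prop where
  inj : ∀ u l, H.IsPath u l u → f.hom (FreeGroup.mk l) = 1 → FreeGroup.mk l = 1
  surj : ∀ u l', G.IsPath (f.onV u) l' (f.onV u) →
    ∃ l, H.IsPath u l u ∧ f.hom (FreeGroup.mk l) = FreeGroup.mk l'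

/-- Two homomorphisms that agree on edges up to a gauge transformation agree on paths up to the same
gauge transformation. -/
theorem hom_mk_of_gauge {Γ : Type*} [Group Γ] {Ψ Θ : FreeGroup E' →* Γ} {c : V' → Γ}
    (hs : ∀ e, Ψ (FreeGroup.of e) = c (H.init (e, true)) * Θ (FreeGroup.of e) *
      (c (H.init (e, false)))⁻¹) {l : List (E' × Bool)} {u w : V'} (h : H.IsPath u l w) :
    Ψ (FreeGroup.mk l) = c u * Θ (FreeGroup.mk l) * (c w)⁻¹ := by
  induction l generalizing u with
  | nil => cases h; rw [mk_nil, map_one, map_one, mul_one, mul_inv_cancel]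
  | cons a l ih =>
    obtain ⟨rfl, h⟩ := h
    rw [mk_cons, map_mul, map_mul, ih h]
    have : Ψ (FreeGroup.mk [a]) = c (H.init a) * Θ (FreeGroup.mk [a]) * (c (H.term a))⁻¹ := by
      obtain ⟨e, b⟩ := a
      cases b
      · have h1 : FreeGroup.mk [(e, false)] = (FreeGroup.of e)⁻¹ := mk_rev (e, true)
        rw [h1, map_inv, map_inv, hs]
        simp only [term, rev, Bool.not_false]
        group
      · exact hs e
    rw [this]; group

theorem GraphMap.hom_track {f : GraphMap H G} {s : GraphMap G H} {c : V' → List (E' × Bool)}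
    (hs : ∀ e, s.hom (f.hom (FreeGroup.of e)) = FreeGroup.mk (c (H.init (e, true))) *
      FreeGroup.of e * (FreeGroup.mk (c (H.init (e, false))))⁻¹)
    {l : List (E' × Bool)} {u w : V'} (h : H.IsPath u l w) :
    s.hom (f.hom (FreeGroup.mk l)) = FreeGroup.mk (c u) * FreeGroup.mk l * (FreeGroup.mk (c w))⁻¹ :=
  hom_mk_of_gauge (Ψ := s.hom.comp f.hom) (Θ := MonoidHom.id _) (c := fun v => FreeGroup.mk (c v))
    hs h

/-- `c` and `k` are the tracks of homotopies from `s ∘ f` and `f ∘ s` to the identities. So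
`s(f(l))` is conjugate to `l`, which gives injectivity, and `f(s(l'))` is conjugate to `l'`, which
gives surjectivity after a correction at the base point. -/
theorem GraphMap.isPi1Equiv_of_inverse {f : GraphMap H G} {s : GraphMap G H}
    {c : V' → List (E' × Bool)} {k : V → List (E × Bool)}
    (hc : ∀ u, H.IsPath (s.onV (f.onV u)) (c u) u)
    (hk : ∀ u, G.IsPath (f.onV (s.onV u)) (k u) u)
    (hs : ∀ e, s.hom (f.hom (FreeGroup.of e)) = FreeGroup.mk (c (H.init (e, true))) *
      FreeGroup.of e * (FreeGroup.mk (c (H.init (e, false))))⁻¹)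
    (hf : ∀ e, f.hom (s.hom (FreeGroup.of e)) = FreeGroup.mk (k (G.init (e, true))) *
      FreeGroup.of e * (FreeGroup.mk (k (G.init (e, false))))⁻¹) : f.IsPi1Equiv where
  inj u l hl h := by
    have := GraphMap.hom_track hs hl
    rw [h, map_one] at this
    have h2 : FreeGroup.mk l = (FreeGroup.mk (c u))⁻¹ *
      (FreeGroup.mk (c u) * FreeGroup.mk l * (FreeGroup.mk (c u))⁻¹) * FreeGroup.mk (c u) := by group
    rw [h2, ← this]; group
  surj u l' hl' := by
    -- Since `k z` is homotopic to `f(c)`, conjugating `l'` by `z` cancels the base point changes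
    -- caused by `k` and `c`.
    set z := FreeGroup.invRev (k (f.onV u)) ++ f.onPath (c u) with hz
    have hzp : G.IsPath (f.onV u) z (f.onV u) := (hk _).invRev.append (f.isPath_onPath (hc u))
    have hl2 : G.IsPath (f.onV u) (z ++ l' ++ FreeGroup.invRev z) (f.onV u) :=
      (hzp.append hl').append hzp.invRev
    refine ⟨FreeGroup.invRev (c u) ++ s.onPath (z ++ l' ++ FreeGroup.invRev z) ++ c u,
      ((hc u).invRev.append (s.isPath_onPath hl2)).append (hc u), ?_⟩
    rw [mk_append, mk_append, map_mul, map_mul, ← GraphMap.hom_mk, GraphMap.hom_track hf hl2,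
      mk_invRev, map_inv]
    simp only [mk_append, mk_invRev, hz, GraphMap.hom_mk]
    group

/-- The new marking is the inverse of `Φ`, which takes a loop `x` at `u` to the element whose marked
loop, conjugated by `q`, is `f(x)`. -/
theorem GraphMap.IsPi1Equiv.exists_marking {f : GraphMap H G} (hf : f.IsPi1Equiv)
    (m : G.Marking n) {u : V'} {q : List (E × Bool)} (hq : G.IsPath (f.onV u) q m.base) :
    ∃ mH : H.Marking n, mH.base = u ∧ f.PreservesMarking mH m ∧ ∀ g, f.hom (mH.iso g) =
      FreeGroup.mk q * (m.iso g : FreeGroup E) * (FreeGroup.mk q)⁻¹ := by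
  have key : ∀ x : H.pi1 u, ∃ g, f.hom (x : FreeGroup E') =
      FreeGroup.mk q * (m.iso g : FreeGroup E) * (FreeGroup.mk q)⁻¹ := by
    rintro ⟨_, l, hl, rfl⟩
    obtain ⟨g, hg⟩ := m.iso.surjective
      ⟨_, ((hq.invRev.append (f.isPath_onPath hl)).append hq).mem_pi1⟩
    refine ⟨g, ?_⟩
    rw [hg, GraphMap.hom_mk]
    simp only [mk_append, mk_invRev]
    group
  choose φ hφ using key
  have inj : ∀ g g' : FreeGroup (Fin n), FreeGroup.mk q * (m.iso g : FreeGroup E) *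
      (FreeGroup.mk q)⁻¹ = FreeGroup.mk q * (m.iso g' : FreeGroup E) * (FreeGroup.mk q)⁻¹ →
      g = g' := by
    intro g g' h
    exact m.iso.injective (Subtype.ext (by simpa using h))
  let Φ : H.pi1 u →* FreeGroup (Fin n) := MonoidHom.mk' φ (by
    intro x y
    apply inj
    rw [← hφ, map_mul]
    push_cast
    rw [map_mul, hφ, hφ]
    group)
  have hΦ : Function.Bijective Φ := by
    constructor
    · rw [injective_iff_map_eq_one]
      rintro ⟨_, l, hl, rfl⟩ h
      refine Subtype.ext (hf.inj u l hl ?_)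
      have h1 := hφ ⟨_, l, hl, rfl⟩
      rw [show φ _ = 1 from h] at h1
      rw [show f.hom (FreeGroup.mk l) = _ from h1, map_one, OneMemClass.coe_one, mul_one,
        mul_inv_cancel]
    · intro g
      obtain ⟨l', hl', e'⟩ := exists_isPath_mk_of_mem_pi1 (m.iso g)
      obtain ⟨l, hl, e⟩ := hf.surj u _ ((hq.append hl').append hq.invRev)
      refine ⟨⟨_, l, hl, rfl⟩, inj _ _ ?_⟩
      rw [← e', show Φ ⟨_, l, hl, rfl⟩ = φ ⟨_, l, hl, rfl⟩ from rfl, ← hφ]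
      simp only [mk_append, mk_invRev] at e
      exact e
  suffices h : ∀ g, f.hom ((MulEquiv.ofBijective Φ hΦ).symm g : FreeGroup E') =
      FreeGroup.mk q * (m.iso g : FreeGroup E) * (FreeGroup.mk q)⁻¹ from
    ⟨⟨u, (MulEquiv.ofBijective Φ hΦ).symm⟩, rfl, ⟨q, hq, h⟩, h⟩
  intro g
  obtain ⟨x, rfl⟩ := hΦ.2 g
  have : (MulEquiv.ofBijective Φ hΦ).symm (Φ x) = x :=
    (MulEquiv.ofBijective Φ hΦ).symm_apply_apply x
  simp only [this]
  exact hφ x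

theorem GraphMap.IsPi1Equiv.marking_unique {f : GraphMap H G} (hf : f.IsPi1Equiv)
    (hH : H.IsConnected) {m : G.Marking n} {m₁ m₂ : H.Marking n} (h₁ : f.PreservesMarking m₁ m)
    (h₂ : f.PreservesMarking m₂ m) : m₁.Homotopic m₂ := by
  obtain ⟨q₁, hq₁, e₁⟩ := h₁
  obtain ⟨q₂, hq₂, e₂⟩ := h₂
  obtain ⟨r₀, hr₀⟩ := hH.exists_isPath m₁.base m₂.base
  -- The path `r₀` is arbitrary, and the loop `z` corrects it: `z⁻¹ r₀` is mapped to `q₁ q₂⁻¹` up to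
  -- homotopy, which compares the images of the two markings.
  obtain ⟨z, hz, ez⟩ := hf.surj m₁.base _
    (((f.isPath_onPath hr₀).append hq₂).append hq₁.invRev)
  simp only [mk_append, mk_invRev] at ez
  refine ⟨FreeGroup.invRev z ++ r₀, hz.invRev.append hr₀, fun g => ?_⟩
  obtain ⟨l₁, hl₁, x₁⟩ := exists_isPath_mk_of_mem_pi1 (m₁.iso g)
  obtain ⟨l₂, hl₂, x₂⟩ := exists_isPath_mk_of_mem_pi1 (m₂.iso g)
  have hr := hz.invRev.append hr₀
  have hp := hl₁.append ((hr.append hl₂.invRev).append hr.invRev)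
  have h1 := e₁ g
  have h2 := e₂ g
  have := hf.inj _ _ hp (by
    simp only [mk_append, mk_invRev, map_mul, map_inv, ez, x₁, x₂, h1, h2, GraphMap.hom_mk]
    group)
  rw [← x₁, ← x₂]
  simp only [mk_append, mk_invRev] at this ⊢
  rw [mul_eq_one_iff_eq_inv] at this
  rw [this]
  group

end HomotopyEquivalence

/-! ### Cyclic words: successors and turns. -/

section Cycles

variable {α β : Type*} {K : ℕ}

/-- The entry `a` of the cycle is somewhere followed by `b`. -/
def Follows (c : Cycle α) (a b : α) : Prop := ¬ c.Chain fun x y => ¬ (x = a ∧ y = b)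

/-- Indices modulo the length put the closing pair, last letter and first letter, on the same
footing as the other pairs. -/
theorem chain_coe_iff {r : α → α → Prop} {l : List α} :
    (l : Cycle α).Chain r ↔ ∀ (i : ℕ) (h : i < l.length),
      r l[i] (l[(i + 1) % l.length]'(Nat.mod_lt _ (by omega))) := by
  cases l with
  | nil => simp
  | cons a t =>
    rw [Cycle.chain_coe_cons, List.isChain_iff_getElem]
    have key : ∀ (i : ℕ) (h : i < (a :: t).length),
        (a :: (t ++ [a]))[i + 1]'(by simp at h ⊢; omega) =
          (a :: t)[(i + 1) % (a :: t).length]'(Nat.mod_lt _ (by simp)) := by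
      intro i h
      simp only [List.length_cons] at h ⊢
      by_cases hi : i = t.length
      · subst hi; simp
      · have : (i + 1) % (t.length + 1) = i + 1 := Nat.mod_eq_of_lt (by omega)
        simp only [this, List.getElem_cons_succ]
        rw [List.getElem_append_left (by omega)]
    have key2 : ∀ (i : ℕ) (h : i < (a :: t).length),
        (a :: (t ++ [a]))[i]'(by simp at h ⊢; omega) = (a :: t)[i] := by
      intro i h
      have : a :: (t ++ [a]) = (a :: t) ++ [a] := rfl
      simp only [this]
      rw [List.getElem_append_left]
    constructor
    · intro H i h
      have := H i (by simp at h ⊢; omega)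
      rwa [key i h, key2 i h] at this
    · intro H i h
      have h' : i < (a :: t).length := by simp at h ⊢; omega
      rw [key i h', key2 i h']
      exact H i h'

theorem follows_coe_iff {l : List α} {a b : α} :
    Follows (l : Cycle α) a b ↔ ∃ (i : ℕ) (h : i < l.length),
      l[i] = a ∧ l[(i + 1) % l.length]'(Nat.mod_lt _ (by omega)) = b := by
  unfold Follows
  rw [chain_coe_iff]
  push Not
  rfl

/-- Reduces chains for arbitrary relations to the single relation `Follows`, in which circuits are
studied from here on. -/
theorem chain_iff_follows {r : α → α → Prop} {c : Cycle α} :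
    c.Chain r ↔ ∀ a b, Follows c a b → r a b := by
  induction c using Quotient.inductionOn' with
  | h l =>
    change Cycle.Chain r (l : Cycle α) ↔ ∀ a b, Follows (l : Cycle α) a b → r a b
    simp only [chain_coe_iff, follows_coe_iff]
    constructor
    · rintro h a b ⟨i, hi, rfl, rfl⟩
      exact h i hi
    · exact fun h i hi => h _ _ ⟨i, hi, rfl, rfl⟩

theorem follows_map {f : α → β} {c : Cycle α} {p q : β} :
    Follows (c.map f) p q ↔ ∃ a b, Follows c a b ∧ f a = p ∧ f b = q := by
  conv_lhs => rw [Follows, Cycle.chain_map, chain_iff_follows]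
  push Not
  rfl

theorem Follows.mem_right {c : Cycle α} {a b : α} (h : Follows c a b) : b ∈ c := by
  induction c using Quotient.inductionOn' with
  | h l =>
    obtain ⟨i, hi, -, rfl⟩ := follows_coe_iff.1 h
    exact List.getElem_mem _

theorem exists_follows_right {c : Cycle α} {a : α} (h : a ∈ c) : ∃ b, Follows c a b := by
  induction c using Quotient.inductionOn' with
  | h l =>
    obtain ⟨i, hi, rfl⟩ := List.getElem_of_mem (show a ∈ l from h)
    exact ⟨_, follows_coe_iff.2 ⟨i, hi, rfl, rfl⟩⟩

theorem exists_follows_left {c : Cycle α} {b : α} (h : b ∈ c) : ∃ a, Follows c a b := by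
  induction c using Quotient.inductionOn' with
  | h l =>
    obtain ⟨i, hi, rfl⟩ := List.getElem_of_mem (show b ∈ l from h)
    have hl : 0 < l.length := by omega
    -- The predecessor of `i` is written `i + (length - 1)`, because `i - 1` would be truncated at
    -- `i = 0`.
    refine ⟨_, follows_coe_iff.2 ⟨(i + (l.length - 1)) % l.length, Nat.mod_lt _ hl, rfl, ?_⟩⟩
    congr 1
    rw [Nat.mod_add_mod, show i + (l.length - 1) + 1 = i + l.length by omega, Nat.add_mod_right,
      Nat.mod_eq_of_lt hi]

theorem takesTurn_iff {c : Cycle (α × Bool)} {x y : α × Bool} :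
    TakesTurn c x y ↔ Follows c (rev x) y ∨ Follows c (rev y) x := by
  unfold TakesTurn
  rw [chain_iff_follows]
  push Not
  constructor
  · rintro ⟨a, b, h, ⟨rfl, rfl⟩ | ⟨rfl, rfl⟩⟩
    · left; rwa [rev_rev]
    · right; rwa [rev_rev]
  · rintro (h | h)
    · exact ⟨_, _, h, Or.inl ⟨rev_rev x, rfl⟩⟩
    · exact ⟨_, _, h, Or.inr ⟨rev_rev y, rfl⟩⟩

/-- The turn `{x, y}` is taken by one of the circuits. -/
def TurnOf (γ : Fin K → Cycle (α × Bool)) (x y : α × Bool) : Prop := ∃ i, TakesTurn (γ i) x y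

/-- The oriented edge `x` is crossed in one of the two orientations. -/
def CrossedBy (γ : Fin K → Cycle (α × Bool)) (x : α × Bool) : Prop := ∃ i, x ∈ γ i ∨ rev x ∈ γ i

theorem TurnOf.symm {γ : Fin K → Cycle (α × Bool)} {x y : α × Bool} (h : TurnOf γ x y) :
    TurnOf γ y x := h.imp fun _ h => TakesTurn.symm h

theorem TurnOf.crossed {γ : Fin K → Cycle (α × Bool)} {x y : α × Bool} (h : TurnOf γ x y) :
    CrossedBy γ x := h.imp fun _ h => h.crosses

theorem CrossedBy.rev {γ : Fin K → Cycle (α × Bool)} {x : α × Bool} (h : CrossedBy γ x) :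
    CrossedBy γ (rev x) := h.imp fun _ h => by rw [rev_rev]; exact h.symm

theorem CrossedBy.exists_turn {γ : Fin K → Cycle (α × Bool)} {x : α × Bool} (h : CrossedBy γ x) :
    ∃ y, TurnOf γ x y := by
  obtain ⟨i, h | h⟩ := h
  · obtain ⟨a, ha⟩ := exists_follows_left h
    exact ⟨Whitehead.rev a, i, takesTurn_iff.2 (Or.inr (by rwa [rev_rev]))⟩
  · obtain ⟨b, hb⟩ := exists_follows_right h
    exact ⟨b, i, takesTurn_iff.2 (Or.inl hb)⟩

end Cycles

end Basics

/-! ### Cut sets and unique turns. -/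

section WhiteheadGraphShape

variable {α β : Type*} {K : ℕ}

/-- Deleting `w` from the total Whitehead graph separates two of the neighbours of `w`: the set `S`
is a union of components of the complement of `w`, and `w` has neighbours inside and outside `S`. -/
structure IsCutSet (γ : Fin K → Cycle (α × Bool)) (w : α × Bool) (S : Set (α × Bool)) : Prop where
  notMem : w ∉ S
  inside : ∃ x ∈ S, TurnOf γ w x
  outside : ∃ y, y ∉ S ∧ y ≠ w ∧ TurnOf γ w y
  closed : ∀ p q, TurnOf γ p q → q ≠ w → p ∈ S → q ∈ S

def HasCut (γ : Fin K → Cycle (α × Bool)) : Prop := ∃ w S, IsCutSet γ w S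

/-- Every oriented edge has at most one neighbour in the total Whitehead graph. -/
def UniqueTurns (γ : Fin K → Cycle (α × Bool)) : Prop :=
  ∀ x y z, TurnOf γ x y → TurnOf γ x z → y = z

/-- The cycles have no backtracking. -/
def Tight (γ : Fin K → Cycle (α × Bool)) : Prop := ∀ i a b, Follows (γ i) a b → b ≠ rev a

theorem Tight.turn_ne {γ : Fin K → Cycle (α × Bool)} (h : Tight γ) {x y : α × Bool}
    (hxy : TurnOf γ x y) : y ≠ x := by
  obtain ⟨i, hi⟩ := hxy
  rcases takesTurn_iff.1 hi with hi | hi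
  · simpa using h i _ _ hi
  · have := h i _ _ hi
    rw [rev_rev] at this
    exact this.symm

theorem turnOf_map {D : α × Bool → β × Bool} (hD : ∀ a, D (rev a) = rev (D a))
    {δ : Fin K → Cycle (α × Bool)} {p q : β × Bool} :
    TurnOf (fun i => (δ i).map D) p q ↔ ∃ p' q', TurnOf δ p' q' ∧ D p' = p ∧ D q' = q := by
  unfold TurnOf
  simp only [takesTurn_iff, follows_map]
  constructor
  · rintro ⟨i, ⟨a, b, h, ha, rfl⟩ | ⟨a, b, h, ha, rfl⟩⟩
    · exact ⟨rev a, b, ⟨i, Or.inl (by rwa [rev_rev])⟩, by rw [hD, ha, rev_rev], rfl⟩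
    · exact ⟨b, rev a, ⟨i, Or.inr (by rwa [rev_rev])⟩, rfl, by rw [hD, ha, rev_rev]⟩
  · rintro ⟨p', q', ⟨i, h | h⟩, rfl, rfl⟩
    · exact ⟨i, Or.inl ⟨_, _, h, hD _, rfl⟩⟩
    · exact ⟨i, Or.inr ⟨_, _, h, hD _, rfl⟩⟩

theorem tight_of_map {D : α × Bool → β × Bool} (hD : ∀ a, D (rev a) = rev (D a))
    {δ : Fin K → Cycle (α × Bool)} (h : Tight fun i => (δ i).map D) : Tight δ := by
  rintro i a b hab rfl
  exact h i _ _ (follows_map.2 ⟨_, _, hab, rfl, rfl⟩) (hD a)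

/-- A relabelling that is injective on crossed directions is an isomorphism of total Whitehead
graphs. Only the crossed members of `S` are pushed forward, as `D` may identify the others. -/
theorem HasCut.map {D : α × Bool → β × Bool} (hD : ∀ a, D (rev a) = rev (D a))
    {δ : Fin K → Cycle (α × Bool)}
    (inj : ∀ a b, CrossedBy δ a → CrossedBy δ b → D a = D b → a = b) (h : HasCut δ) :
    HasCut fun i => (δ i).map D := by
  obtain ⟨w, S, h⟩ := h
  obtain ⟨x, hx, hwx⟩ := h.inside
  obtain ⟨y, hy, hyw, hwy⟩ := h.outside
  refine ⟨D w, {p | ∃ p' ∈ S, CrossedBy δ p' ∧ D p' = p}, ?_,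
    ⟨_, ⟨x, hx, hwx.symm.crossed, rfl⟩, (turnOf_map hD).2 ⟨_, _, hwx, rfl, rfl⟩⟩,
    ⟨D y, ?_, ?_, (turnOf_map hD).2 ⟨_, _, hwy, rfl, rfl⟩⟩, ?_⟩
  · rintro ⟨p, hp, hpc, e⟩
    exact h.notMem (inj _ _ hpc hwx.crossed e ▸ hp)
  · rintro ⟨p, hp, hpc, e⟩
    exact hy (inj _ _ hpc hwy.symm.crossed e ▸ hp)
  · exact fun e => hyw (inj _ _ hwy.symm.crossed hwx.crossed e)
  · rintro p q hpq hq ⟨p', hp', hpc, rfl⟩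
    obtain ⟨p₀, q₀, h₀, e, rfl⟩ := (turnOf_map hD).1 hpq
    obtain rfl := inj _ _ h₀.crossed hpc e
    exact ⟨q₀, h.closed _ _ h₀ (fun e => hq (e ▸ rfl)) hp', h₀.symm.crossed, rfl⟩

theorem UniqueTurns.map {D : α × Bool → β × Bool} (hD : ∀ a, D (rev a) = rev (D a))
    {δ : Fin K → Cycle (α × Bool)}
    (inj : ∀ a b, CrossedBy δ a → CrossedBy δ b → D a = D b → a = b) (h : UniqueTurns δ) :
    UniqueTurns fun i => (δ i).map D := by
  intro x y z hxy hxz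
  obtain ⟨x₁, y₁, h₁, rfl, rfl⟩ := (turnOf_map hD).1 hxy
  obtain ⟨x₂, z₂, h₂, e, rfl⟩ := (turnOf_map hD).1 hxz
  obtain rfl := inj _ _ h₂.crossed h₁.crossed e
  rw [h _ _ _ h₁ h₂]

end WhiteheadGraphShape

/-! ### Locally injective maps and resolutions. -/

section Immersions

variable {V E V' E' : Type*}

theorem isReduced_iff_isChain {l : List (E × Bool)} :
    FreeGroup.IsReduced l ↔ l.IsChain fun a b => b ≠ rev a := by
  unfold FreeGroup.IsReduced
  refine ⟨fun h => h.imp ?_, fun h => h.imp ?_⟩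
  · rintro ⟨a, i⟩ ⟨b, j⟩ h e
    simp only [rev, Prod.mk.injEq] at e
    have := h e.1.symm
    simp [e.2] at this
  · rintro ⟨a, i⟩ ⟨b, j⟩ h e
    simp only [rev, ne_eq, Prod.mk.injEq, not_and] at h e ⊢
    have := h e.symm
    cases i <;> cases j <;> simp_all

/-- The homomorphism of free groups induced by a map of oriented edges. -/
def dirHom (D : E' × Bool → E × Bool) : FreeGroup E' →* FreeGroup E :=
  FreeGroup.lift fun e => FreeGroup.mk [D (e, true)]

theorem dirHom_mk {D : E' × Bool → E × Bool} (hD : ∀ a, D (rev a) = rev (D a))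
    (l : List (E' × Bool)) : dirHom D (FreeGroup.mk l) = FreeGroup.mk (l.map D) := by
  induction l with
  | nil => exact map_one _
  | cons a l ih =>
    rw [mk_cons, map_mul, ih, List.map_cons, mk_cons (D a)]
    congr 1
    obtain ⟨e, b⟩ := a
    have h : dirHom D (FreeGroup.mk [(e, true)]) = FreeGroup.mk [D (e, true)] :=
      FreeGroup.lift_apply_of
    cases b
    · have : FreeGroup.mk [(e, false)] = (FreeGroup.mk [(e, true)])⁻¹ := mk_rev (e, true)
      rw [this, map_inv, h, ← mk_rev, ← hD]; rfl
    · exact h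

theorem map_invRev {D : E' × Bool → E × Bool} (hD : ∀ a, D (rev a) = rev (D a))
    (l : List (E' × Bool)) : (FreeGroup.invRev l).map D = FreeGroup.invRev (l.map D) := by
  rw [invRev_eq_map_rev, invRev_eq_map_rev, List.map_reverse, List.map_map, List.map_map]
  congr 2
  funext a
  exact hD a

theorem IsPath.map_of_init {H : Multigraph V' E'} {G : Multigraph V E} {D : E' × Bool → E × Bool}
    {fV : V' → V} (hD : ∀ a, D (rev a) = rev (D a)) (hf : ∀ a, G.init (D a) = fV (H.init a))
    {l : List (E' × Bool)} {u w : V'} (h : H.IsPath u l w) :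
    G.IsPath (fV u) (l.map D) (fV w) := by
  induction l generalizing u with
  | nil => cases h; rfl
  | cons a l ih =>
    refine ⟨by rw [hf, h.1], ?_⟩
    have : G.term (D a) = fV (H.term a) := by rw [term, ← hD, hf]; rfl
    rw [this]
    exact ih h.2

/-- A cancellation in the image would come from `rev a` and `b`, two directions at a common vertex
with the same image. -/
theorem isReduced_map_of_locallyInjective {H : Multigraph V' E'} {D : E' × Bool → E × Bool}
    (hD : ∀ a, D (rev a) = rev (D a)) (hinj : ∀ a b, H.init a = H.init b → D a = D b → a = b)
    {l : List (E' × Bool)} {u w : V'} (h : H.IsPath u l w) (hl : FreeGroup.IsReduced l) :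
    FreeGroup.IsReduced (l.map D) := by
  rw [isReduced_iff_isChain] at hl ⊢
  induction l generalizing u with
  | nil => simp
  | cons a l ih =>
    cases l with
    | nil => simp
    | cons b l =>
      rw [List.isChain_cons_cons] at hl
      rw [List.map_cons, List.map_cons, List.isChain_cons_cons]
      refine ⟨fun e => hl.1 ?_, ih h.2 hl.2⟩
      rw [← hD] at e
      exact hinj _ _ (by rw [h.2.1, init_rev]) e

theorem eq_of_map_eq_of_locallyInjective {H : Multigraph V' E'} {D : E' × Bool → E × Bool}
    (hinj : ∀ a b, H.init a = H.init b → D a = D b → a = b)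
    {l l' : List (E' × Bool)} {u w w' : V'} (h : H.IsPath u l w) (h' : H.IsPath u l' w')
    (e : l.map D = l'.map D) : l = l' := by
  induction l generalizing u l' with
  | nil => symm; simpa using e.symm
  | cons a l ih =>
    cases l' with
    | nil => simp at e
    | cons b l' =>
      simp only [List.map_cons, List.cons.injEq] at e
      obtain rfl := hinj a b (h.1.trans h'.1.symm) e.1
      rw [ih h.2 h'.2 e.2]

/-- A map of graphs from `H` to `G`, given by its effect `D` on oriented edges, which takes the
based graph `(H, base)` to `(G, v₀)`, induces an isomorphism of fundamental groups, and takes the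
family `δ` to the family `γ`. -/
structure IsResolution {K : ℕ} (G : Multigraph V E) (v₀ : V) (γ : Fin K → Cycle (E × Bool))
    (H : Multigraph V' E') (base : V') (D : E' × Bool → E × Bool)
    (δ : Fin K → Cycle (E' × Bool)) : Prop where
  map_rev : ∀ a, D (rev a) = rev (D a)
  vert : ∃ fV : V' → V, fV base = v₀ ∧ ∀ a, G.init (D a) = fV (H.init a)
  reach : ∀ a, ∃ l, H.IsPath base l (H.init a)
  inj : ∀ l, H.IsPath base l base → FreeGroup.mk (l.map D) = 1 → FreeGroup.mk l = 1
  surj : ∀ l', G.IsPath v₀ l' v₀ →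
    ∃ l, H.IsPath base l base ∧ FreeGroup.mk (l.map D) = FreeGroup.mk l'
  closed : ∀ i a b, Follows (δ i) a b → H.term a = H.init b
  map_eq : (fun i => (δ i).map D) = γ

/-- Let `p` and `p'` lead to edges `a` and `b` with the same image. The image of `p` followed by the
reversed image of `p'` is a loop, hence lifts to a loop `r` up to homotopy. The reductions of `r p'`
and of `p` have equal images, as reducedness is preserved, so they agree by unique lifting. Thus `a`
and `b` start at the same vertex, and local injectivity applies. -/
theorem IsResolution.injective {K : ℕ} {G : Multigraph V E} {v₀ : V} {γ : Fin K → Cycle (E × Bool)}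
    {H : Multigraph V' E'} {base : V'} {D : E' × Bool → E × Bool} {δ : Fin K → Cycle (E' × Bool)}
    (R : IsResolution G v₀ γ H base D δ)
    (hinj : ∀ a b, H.init a = H.init b → D a = D b → a = b) : Function.Injective D := by
  classical
  intro a b hab
  obtain ⟨fV, hf₀, hf⟩ := R.vert
  obtain ⟨p, hp⟩ := R.reach a
  obtain ⟨p', hp'⟩ := R.reach b
  have hG := IsPath.map_of_init R.map_rev hf hp
  have hG' := IsPath.map_of_init R.map_rev hf hp'
  rw [← hf, hf₀] at hG hG'
  rw [← hab] at hG'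
  obtain ⟨r, hr, er⟩ := R.surj _ (hG.append hG'.invRev)
  have e : FreeGroup.mk ((r ++ p').map D) = FreeGroup.mk (p.map D) := by
    rw [List.map_append, mk_append, er, mk_append, mk_invRev]; group
  have h1 := (hr.append hp').red FreeGroup.reduce.red
  have h2 := hp.red FreeGroup.reduce.red
  have r1 : FreeGroup.IsReduced (FreeGroup.reduce (r ++ p')) :=
    FreeGroup.isReduced_iff_reduce_eq.2 FreeGroup.reduce.idem
  have r2 : FreeGroup.IsReduced (FreeGroup.reduce p) :=
    FreeGroup.isReduced_iff_reduce_eq.2 FreeGroup.reduce.idem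
  have e2 : (FreeGroup.reduce (r ++ p')).map D = (FreeGroup.reduce p).map D := by
    rw [← (isReduced_map_of_locallyInjective R.map_rev hinj h1 r1).reduce_eq,
      ← (isReduced_map_of_locallyInjective R.map_rev hinj h2 r2).reduce_eq]
    apply FreeGroup.reduce.sound
    rw [← dirHom_mk R.map_rev, ← dirHom_mk R.map_rev, FreeGroup.reduce.self, FreeGroup.reduce.self,
      dirHom_mk R.map_rev, dirHom_mk R.map_rev, e]
  have e3 := eq_of_map_eq_of_locallyInjective hinj h1 h2 e2
  rw [e3] at h1
  exact hinj _ _ (h2.right_unique h1) hab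

end Immersions

/-! ### Folding two edges. -/

section Fold

variable {V E : Type*} {K : ℕ}

/-- The edge set after identifying the edge of `b` with another edge. -/
abbrev FoldEdge (b : E × Bool) : Type _ := {e : E // e ≠ b.1}

open Classical in
/-- The vertex map of the fold which identifies the terminal vertex of `b` with that of `a`. -/
noncomputable def foldVert (H : Multigraph V E) (a b : E × Bool) (v : V) : V :=
  if v = H.term b then H.term a else v

/-- The graph obtained by folding `b` with `a` (the old terminal vertex of `b` is kept as an isolated
vertex). -/
noncomputable def foldGraph (H : Multigraph V E) (a b : E × Bool) : Multigraph V (FoldEdge b) where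
  init x := foldVert H a b (H.init (x.1.1, x.2))

open Classical in
/-- The fold on oriented edges. -/
noncomputable def foldDir {a b : E × Bool} (hab : a.1 ≠ b.1) (x : E × Bool) : FoldEdge b × Bool :=
  if h : x.1 = b.1 then (if x = b then (⟨a.1, hab⟩, a.2) else rev (⟨a.1, hab⟩, a.2))
  else (⟨x.1, h⟩, x.2)

variable {H : Multigraph V E} {a b : E × Bool} (hab : a.1 ≠ b.1)

theorem foldDir_right : foldDir hab b = (⟨a.1, hab⟩, a.2) := by simp [foldDir]

theorem foldDir_rev_right : foldDir hab (rev b) = rev (⟨a.1, hab⟩, a.2) := by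
  simp [foldDir, rev_ne]

theorem foldDir_of_ne {x : E × Bool} (h : x.1 ≠ b.1) : foldDir hab x = (⟨x.1, h⟩, x.2) := by
  simp [foldDir, h]

theorem foldDir_left : foldDir hab a = (⟨a.1, hab⟩, a.2) := foldDir_of_ne hab hab

theorem foldDir_rev (x : E × Bool) : foldDir hab (rev x) = rev (foldDir hab x) := by
  by_cases h : x.1 = b.1
  · rcases eq_or_eq_rev_of_fst_eq h with rfl | rfl
    · rw [foldDir_right, foldDir_rev_right]
    · rw [rev_rev, foldDir_right, foldDir_rev_right, rev_rev]
  · rw [foldDir_of_ne hab h, foldDir_of_ne hab (x := rev x) h]; rfl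

theorem foldDir_eq_iff {x y : E × Bool} (h : foldDir hab x = foldDir hab y) :
    x = y ∨ (x = a ∧ y = b) ∨ (x = b ∧ y = a) ∨ (x = rev a ∧ y = rev b) ∨
      (x = rev b ∧ y = rev a) := by
  have key : ∀ x y : E × Bool, x.1 = b.1 → y.1 ≠ b.1 → foldDir hab x = foldDir hab y →
      (x = b ∧ y = a) ∨ (x = rev b ∧ y = rev a) := by
    intro x y hx hy h
    rw [foldDir_of_ne hab hy] at h
    rcases eq_or_eq_rev_of_fst_eq hx with rfl | rfl
    · rw [foldDir_right] at h
      simp only [Prod.mk.injEq, Subtype.mk.injEq] at h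
      exact Or.inl ⟨rfl, Prod.ext h.1.symm h.2.symm⟩
    · rw [foldDir_rev_right] at h
      simp only [rev, Prod.mk.injEq, Subtype.mk.injEq] at h
      exact Or.inr ⟨rfl, Prod.ext h.1.symm h.2.symm⟩
  by_cases hx : x.1 = b.1 <;> by_cases hy : y.1 = b.1
  · left
    rcases eq_or_eq_rev_of_fst_eq (hx.trans hy.symm) with rfl | rfl
    · rfl
    · rw [foldDir_rev] at h
      exact absurd h (rev_ne _)
  · rcases key x y hx hy h with h | h
    · exact Or.inr (Or.inr (Or.inl h))
    · exact Or.inr (Or.inr (Or.inr (Or.inr h)))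
  · rcases key y x hy hx h.symm with h | h
    · exact Or.inr (Or.inl h.symm)
    · exact Or.inr (Or.inr (Or.inr (Or.inl h.symm)))
  · left
    rw [foldDir_of_ne hab hx, foldDir_of_ne hab hy] at h
    simp only [Prod.mk.injEq, Subtype.mk.injEq] at h
    exact Prod.ext h.1 h.2

theorem foldVert_term_left (ht : H.term a ≠ H.term b) : foldVert H a b (H.term a) = H.term a := by
  simp [foldVert, ht]

theorem foldVert_term_right : foldVert H a b (H.term b) = H.term a := by
  simp [foldVert]

theorem init_foldDir (hi : H.init a = H.init b) (ht : H.term a ≠ H.term b) (x : E × Bool) :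
    (foldGraph H a b).init (foldDir hab x) = foldVert H a b (H.init x) := by
  by_cases h : x.1 = b.1
  · rcases eq_or_eq_rev_of_fst_eq h with rfl | rfl
    · rw [foldDir_right]
      change foldVert H a x (H.init a) = _
      rw [hi]
    · rw [foldDir_rev_right]
      change foldVert H a b (H.init (rev a)) = foldVert H a b (H.init (rev b))
      rw [init_rev, init_rev, foldVert_term_left ht, foldVert_term_right]
  · rw [foldDir_of_ne hab h]; rfl

/-- The two identified vertices are joined by the path `rev a, b`, whose image cancels. -/
theorem exists_isPath_of_foldVert_eq (hi : H.init a = H.init b) {u w : V}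
    (h : foldVert H a b u = foldVert H a b w) :
    ∃ l, H.IsPath u l w ∧ FreeGroup.mk (l.map (foldDir hab)) = 1 := by
  have jump : H.IsPath (H.term a) [rev a, b] (H.term b) :=
    ⟨rfl, by rw [term_rev, hi], rfl⟩
  have e : FreeGroup.mk ([rev a, b].map (foldDir hab)) = 1 := by
    rw [List.map_cons, mk_cons, foldDir_rev, mk_rev, List.map_singleton, foldDir_left,
      foldDir_right, inv_mul_cancel]
  by_cases huw : u = w
  · exact ⟨[], huw, rfl⟩
  unfold foldVert at h
  split_ifs at h with h1 h2 h2
  · exact absurd (h1.trans h2.symm) huw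
  · subst h1 h
    refine ⟨_, jump.invRev, ?_⟩
    rw [map_invRev (foldDir_rev hab), mk_invRev, e, inv_one]
  · subst h2 h
    exact ⟨_, jump, e⟩
  · exact absurd h huw

/-- Letters lift one by one; the gaps between consecutive lifts are bridged by paths with trivial
image. -/
theorem exists_lift_foldGraph (hi : H.init a = H.init b) {l' : List (FoldEdge b × Bool)}
    {u' w' : V} (h : (foldGraph H a b).IsPath u' l' w') {u w : V} (hu : foldVert H a b u = u')
    (hw : foldVert H a b w = w') :
    ∃ l, H.IsPath u l w ∧ FreeGroup.mk (l.map (foldDir hab)) = FreeGroup.mk l' := by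
  induction l' generalizing u' u with
  | nil =>
    cases h
    exact exists_isPath_of_foldVert_eq hab hi (hu.trans hw.symm)
  | cons x l' ih =>
    obtain ⟨l₁, h₁, e₁⟩ := exists_isPath_of_foldVert_eq hab hi (u := u)
      (w := H.init (x.1.1, x.2)) (hu.trans h.1.symm)
    obtain ⟨l₂, h₂, e₂⟩ := ih h.2 (u := H.term (x.1.1, x.2)) rfl
    refine ⟨l₁ ++ (x.1.1, x.2) :: l₂, h₁.append ⟨rfl, h₂⟩, ?_⟩
    rw [List.map_append, mk_append, e₁, List.map_cons, mk_cons, e₂, mk_cons x, one_mul]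
    congr 3
    exact foldDir_of_ne hab x.1.2

/-- If both edges that are folded are crossed, then a cut vertex arises. -/
theorem hasCut_of_crossed {δ : Fin K → Cycle (E × Bool)}
    (hclosed : ∀ i a b, Follows (δ i) a b → H.term a = H.init b)
    (htight : Tight δ) (hi : H.init a = H.init b) (ht : H.term a ≠ H.term b)
    (ha : CrossedBy δ a) (hb : CrossedBy δ b) :
    HasCut fun i => (δ i).map (foldDir hab) := by
  have hinit : ∀ p q, TurnOf δ p q → H.init p = H.init q := by
    rintro p q ⟨i, hpq⟩
    rcases takesTurn_iff.1 hpq with h | h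
    · have := hclosed i _ _ h
      rwa [term_rev] at this
    · have := hclosed i _ _ h
      rw [term_rev] at this
      exact this.symm
  obtain ⟨x, hx⟩ := ha.rev.exists_turn
  obtain ⟨y, hy⟩ := hb.rev.exists_turn
  have hx1 := htight.turn_ne hx
  have hy1 := htight.turn_ne hy
  have hx2 := hinit _ _ hx
  have hy2 := hinit _ _ hy
  rw [init_rev] at hx2 hy2
  have hD := foldDir_rev hab
  have hw : foldDir hab (rev b) = foldDir hab (rev a) := by
    rw [hD, hD, foldDir_left, foldDir_right]
  -- Apart from the future cut vertex, only `a` and `b` are identified, and these start at the same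
  -- vertex. So the vertex from which a direction stems is determined by its image.
  have key : ∀ p q, foldDir hab p = foldDir hab q → foldDir hab p ≠ foldDir hab (rev a) →
      H.init p = H.init q := by
    intro p q h hne
    rcases foldDir_eq_iff hab h with rfl | ⟨rfl, rfl⟩ | ⟨rfl, rfl⟩ | ⟨rfl, rfl⟩ | ⟨rfl, rfl⟩
    · rfl
    · exact hi
    · exact hi.symm
    · exact absurd rfl hne
    · exact absurd hw hne
  have hne : ∀ p, H.init p = H.term a → p ≠ rev a → foldDir hab p ≠ foldDir hab (rev a) := by
    intro p hp hpa h
    rcases foldDir_eq_iff hab h with h | ⟨-, h⟩ | ⟨-, h⟩ | ⟨h, -⟩ | ⟨h, -⟩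
    · exact hpa h
    · exact hab (by rw [← h]; rfl)
    · exact rev_ne _ h
    · exact hpa h
    · rw [h] at hp
      exact ht hp.symm
  have hyw : foldDir hab y ≠ foldDir hab (rev a) := by
    intro h
    rcases foldDir_eq_iff hab h with h | ⟨-, h⟩ | ⟨-, h⟩ | ⟨h, -⟩ | ⟨h, -⟩
    · rw [h] at hy2
      exact ht hy2.symm
    · exact hab (by rw [← h]; rfl)
    · exact rev_ne _ h
    · rw [h] at hy2
      exact ht hy2.symm
    · exact hy1 h
  -- The cut vertex is the common image of `rev a` and `rev b`. One side stems from the other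
  -- directions at `term a`; the witness on the other side stems from `term b`.
  refine ⟨foldDir hab (rev a), {p | ∃ p', H.init p' = H.term a ∧ p' ≠ rev a ∧ foldDir hab p' = p},
    ?_, ⟨_, ⟨x, hx2.symm, hx1, rfl⟩, (turnOf_map hD).2 ⟨_, _, hx, rfl, rfl⟩⟩,
    ⟨foldDir hab y, ?_, hyw, (turnOf_map hD).2 ⟨_, _, hy, hw, rfl⟩⟩, ?_⟩
  · rintro ⟨p, hp, hpa, e⟩
    exact hne p hp hpa e
  · rintro ⟨p, hp, hpa, e⟩
    have := key p y e (hne p hp hpa)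
    exact ht (hp.symm.trans (this.trans hy2.symm))
  · rintro p q hpq hq ⟨p', hp', hpa, rfl⟩
    obtain ⟨p₀, q₀, h₀, e, rfl⟩ := (turnOf_map hD).1 hpq
    have h1 := key p' p₀ e.symm (hne p' hp' hpa)
    exact ⟨q₀, by rw [← hinit _ _ h₀, ← h1, hp'], fun h => hq (h ▸ rfl), rfl⟩

end Fold

/-! ### Factoring a resolution into folds. -/

section FoldInduction

variable {V E : Type*} {V' E' : Type*} {K : ℕ}

theorem IsResolution.fst_ne {G : Multigraph V E} {v₀ : V} {γ : Fin K → Cycle (E × Bool)}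
    {H : Multigraph V' E'} {base : V'} {D : E' × Bool → E × Bool} {δ : Fin K → Cycle (E' × Bool)}
    (R : IsResolution G v₀ γ H base D δ) {a b : E' × Bool} (hne : a ≠ b) (h : D a = D b) :
    a.1 ≠ b.1 := by
  intro h1
  rcases eq_or_eq_rev_of_fst_eq h1 with rfl | rfl
  · exact hne rfl
  · rw [R.map_rev] at h
    exact rev_ne _ h

/-- Otherwise `a` followed by `rev b` is a nontrivial loop with trivial image. -/
theorem IsResolution.term_ne {G : Multigraph V E} {v₀ : V} {γ : Fin K → Cycle (E × Bool)}
    {H : Multigraph V' E'} {base : V'} {D : E' × Bool → E × Bool} {δ : Fin K → Cycle (E' × Bool)}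
    (R : IsResolution G v₀ γ H base D δ) {a b : E' × Bool} (hne : a ≠ b)
    (hi : H.init a = H.init b) (h : D a = D b) : H.term a ≠ H.term b := by
  intro ht
  obtain ⟨q, hq⟩ := R.reach a
  have hab : H.IsPath (H.init a) [a, rev b] (H.init a) := ⟨rfl, by
    rw [ht]; rfl, by rw [isPath_nil, term_rev, hi]⟩
  have := R.inj _ ((hq.append hab).append hq.invRev) (by
    rw [List.map_append, List.map_append, mk_append, mk_append, map_invRev R.map_rev, mk_invRev,
      List.map_cons, List.map_singleton, mk_cons, R.map_rev, mk_rev, h]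
    group)
  rw [mk_append, mk_append, mk_invRev, mk_cons, mk_rev] at this
  apply hne
  apply mk_singleton_injective
  change FreeGroup.mk [a] = FreeGroup.mk [b]
  rwa [mul_inv_eq_one, mul_eq_left, mul_inv_eq_one] at this

/-- Injectivity on fundamental groups passes to the folded graph because loops there lift up to
homotopy (`exists_lift_foldGraph`); surjectivity is inherited by composing with the fold. -/
theorem IsResolution.fold {G : Multigraph V E} {v₀ : V} {γ : Fin K → Cycle (E × Bool)}
    {H : Multigraph V' E'} {base : V'} {D : E' × Bool → E × Bool} {δ : Fin K → Cycle (E' × Bool)}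
    (R : IsResolution G v₀ γ H base D δ) {a b : E' × Bool} (hab : a.1 ≠ b.1)
    (hi : H.init a = H.init b) (ht : H.term a ≠ H.term b) (h : D a = D b) :
    IsResolution G v₀ γ (foldGraph H a b) (foldVert H a b base)
      (fun x : FoldEdge b × Bool => D (x.1.1, x.2)) (fun i => (δ i).map (foldDir hab)) := by
  have hD : ∀ x, D ((foldDir hab x).1.1, (foldDir hab x).2) = D x := by
    intro x
    by_cases hx : x.1 = b.1
    · rcases eq_or_eq_rev_of_fst_eq hx with rfl | rfl
      · rw [foldDir_right]; exact h
      · rw [foldDir_rev_right, R.map_rev, ← h, ← R.map_rev]; rfl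
    · rw [foldDir_of_ne hab hx]
  have hD' : ∀ l : List (E' × Bool),
      (l.map (foldDir hab)).map (fun x : FoldEdge b × Bool => D (x.1.1, x.2)) = l.map D := by
    intro l
    rw [List.map_map]
    exact List.map_congr_left fun x _ => hD x
  have hmap : ∀ {l : List (E' × Bool)} {u w}, H.IsPath u l w → (foldGraph H a b).IsPath
      (foldVert H a b u) (l.map (foldDir hab)) (foldVert H a b w) := fun hl =>
    IsPath.map_of_init (foldDir_rev hab) (init_foldDir hab hi ht) hl
  have hrev : ∀ x : FoldEdge b × Bool, D ((rev x).1.1, (rev x).2) = rev (D (x.1.1, x.2)) :=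
    fun x => R.map_rev (x.1.1, x.2)
  refine ⟨hrev, ?_, ?_, ?_, ?_, ?_, ?_⟩
  · obtain ⟨fV, hf₀, hf⟩ := R.vert
    have hfv : ∀ v, fV (foldVert H a b v) = fV v := by
      intro v
      unfold foldVert
      split_ifs with hv
      · rw [hv, ← init_rev, ← hf, ← init_rev, ← hf, R.map_rev, R.map_rev, h]
      · rfl
    refine ⟨fV, by rw [hfv, hf₀], fun x => ?_⟩
    exact (hf _).trans (hfv _).symm
  · intro x
    obtain ⟨l, hl⟩ := R.reach (x.1.1, x.2)
    exact ⟨_, hmap hl⟩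
  · intro l' hl' e
    obtain ⟨l, hl, hll'⟩ := exists_lift_foldGraph hab hi hl' (u := base) (w := base) rfl rfl
    have h1 : FreeGroup.mk l = 1 := by
      apply R.inj l hl
      rw [← hD', ← dirHom_mk hrev, hll', dirHom_mk hrev, e]
    rw [← hll', ← dirHom_mk (foldDir_rev hab), h1, map_one]
  · intro l' hl'
    obtain ⟨l, hl, e⟩ := R.surj l' hl'
    exact ⟨_, hmap hl, by rw [hD', e]⟩
  · intro i x y hxy
    obtain ⟨p, q, hpq, rfl, rfl⟩ := follows_map.1 hxy
    rw [term, ← foldDir_rev, init_foldDir hab hi ht, init_foldDir hab hi ht, init_rev,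
      R.closed i _ _ hpq]
  · rw [← R.map_eq]
    funext i
    induction δ i using Quotient.inductionOn' with
    | h l => exact congrArg Cycle.ofList (hD' l)

/-- Induction on the number of edges. If `D` is locally injective, it is injective and both families
have the same total Whitehead graph. Otherwise two edges can be folded, and by induction the folded
family has no cut. By `hasCut_of_crossed` the two edges are not both crossed, so the fold does not
identify crossed directions, and both assertions are carried back through it. -/
theorem IsResolution.hasCut_or_uniqueTurns {G : Multigraph V E} {v₀ : V}
    {γ : Fin K → Cycle (E × Bool)} (hγ : Tight γ) (hcut : ¬ HasCut γ) :
    ∀ (N : ℕ) {E' : Type*} [Finite E'] {H : Multigraph V' E'} {base : V'}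
      {D : E' × Bool → E × Bool} {δ : Fin K → Cycle (E' × Bool)}, Nat.card E' = N →
      IsResolution G v₀ γ H base D δ → ¬ HasCut δ ∧ (UniqueTurns δ → UniqueTurns γ) := by
  intro N
  induction N using Nat.strong_induction_on with
  | _ N ih =>
  intro E' _ H base D δ hN R
  by_cases hinj : ∀ a b, H.init a = H.init b → D a = D b → a = b
  · have hD := R.injective hinj
    have hD' : ∀ a b, CrossedBy δ a → CrossedBy δ b → D a = D b → a = b := fun a b _ _ h => hD h
    rw [← R.map_eq] at hcut ⊢
    exact ⟨fun h => hcut (h.map R.map_rev hD'), fun h => h.map R.map_rev hD'⟩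
  push Not at hinj
  obtain ⟨a, b, hi, hDab, hne⟩ := hinj
  have hab := R.fst_ne hne hDab
  have ht := R.term_ne hne hi hDab
  have R' := R.fold hab hi ht hDab
  have hcard : Nat.card (FoldEdge b) < N := by
    rw [← hN]
    exact Finite.card_subtype_lt (x := b.1) (by simp)
  obtain ⟨h1, h2⟩ := ih _ hcard rfl R'
  have htight : Tight δ := tight_of_map R.map_rev (by rw [R.map_eq]; exact hγ)
  by_cases ha : CrossedBy δ a
  · by_cases hb : CrossedBy δ b
    · exact absurd (hasCut_of_crossed hab R.closed htight hi ht ha hb) h1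
    · have hinj : ∀ x y, CrossedBy δ x → CrossedBy δ y → foldDir hab x = foldDir hab y → x = y := by
        intro x y hx hy h
        have hb' : ¬ CrossedBy δ (rev b) := fun h => hb (by simpa using h.rev)
        rcases foldDir_eq_iff hab h with h | ⟨rfl, rfl⟩ | ⟨rfl, rfl⟩ | ⟨rfl, rfl⟩ | ⟨rfl, rfl⟩
        exacts [h, absurd hy hb, absurd hx hb, absurd hy hb', absurd hx hb']
      exact ⟨fun h => h1 (h.map (foldDir_rev hab) hinj),
        fun h => h2 (h.map (foldDir_rev hab) hinj)⟩
  · have hinj : ∀ x y, CrossedBy δ x → CrossedBy δ y → foldDir hab x = foldDir hab y → x = y := by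
      intro x y hx hy h
      have ha' : ¬ CrossedBy δ (rev a) := fun h => ha (by simpa using h.rev)
      rcases foldDir_eq_iff hab h with h | ⟨rfl, rfl⟩ | ⟨rfl, rfl⟩ | ⟨rfl, rfl⟩ | ⟨rfl, rfl⟩
      exacts [h, absurd hx ha, absurd hy ha, absurd hx ha', absurd hy ha']
    exact ⟨fun h => h1 (h.map (foldDir_rev hab) hinj),
      fun h => h2 (h.map (foldDir_rev hab) hinj)⟩

end FoldInduction

/-! ### Positions on edge paths; circuits as closed paths without backtracking. -/

section Walks

variable {V E : Type*} {G : Multigraph V E} {K : ℕ}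

/-- The vertex reached after `j` edges of an edge path that starts at `u`. -/
def Multigraph.walk (G : Multigraph V E) : V → List (E × Bool) → ℕ → V
  | u, _, 0 => u
  | u, [], _ + 1 => u
  | _, a :: l, j + 1 => G.walk (G.term a) l j

@[simp] theorem walk_zero (u : V) (l : List (E × Bool)) : G.walk u l 0 = u := by
  cases l <;> rfl

theorem isPath_take_drop {l : List (E × Bool)} {u w : V} (h : G.IsPath u l w) {j : ℕ}
    (hj : j ≤ l.length) :
    G.IsPath u (l.take j) (G.walk u l j) ∧ G.IsPath (G.walk u l j) (l.drop j) w := by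
  induction l generalizing u j with
  | nil =>
    obtain rfl : j = 0 := by simpa using hj
    exact ⟨rfl, h⟩
  | cons a l ih =>
    cases j with
    | zero => exact ⟨rfl, h⟩
    | succ j =>
      obtain ⟨h1, h2⟩ := ih h.2 (j := j) (by simpa using hj)
      exact ⟨⟨h.1, h1⟩, h2⟩

theorem walk_length {l : List (E × Bool)} {u w : V} (h : G.IsPath u l w) :
    G.walk u l l.length = w := by
  have := (isPath_take_drop h le_rfl).2
  rwa [List.drop_length] at this

theorem init_getElem {l : List (E × Bool)} {u w : V} (h : G.IsPath u l w) {j : ℕ}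
    (hj : j < l.length) : G.init l[j] = G.walk u l j := by
  have := (isPath_take_drop h hj.le).2
  rw [List.drop_eq_getElem_cons hj] at this
  exact this.1

theorem term_getElem {l : List (E × Bool)} {u w : V} (h : G.IsPath u l w) {j : ℕ}
    (hj : j < l.length) : G.term l[j] = G.walk u l (j + 1) := by
  have h1 := (isPath_take_drop h hj.le).2
  have h2 := (isPath_take_drop h hj).2
  have h3 := (isPath_take_drop h hj).1
  rw [List.take_succ_eq_append_getElem hj] at h3
  obtain ⟨v, -, h4⟩ := isPath_append_iff.1 h3
  exact h4.2

theorem IsPath.term_eq_of_follows {l : List (E × Bool)} {v : V} (h : G.IsPath v l v)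
    {a b : E × Bool} (hab : Follows (l : Cycle (E × Bool)) a b) : G.term a = G.init b := by
  obtain ⟨i, hi, rfl, rfl⟩ := follows_coe_iff.1 hab
  rw [init_getElem h, term_getElem h]
  by_cases h' : i + 1 = l.length
  · rw [h', Nat.mod_self, walk_length h, walk_zero]
  · rw [Nat.mod_eq_of_lt (by omega)]

theorem isPath_of_isChain {l : List (E × Bool)} {a : E × Bool}
    (h : (a :: l).IsChain fun a b => G.term a = G.init b) {w : V}
    (hw : G.term ((a :: l).getLast (by simp)) = w) : G.IsPath (G.init a) (a :: l) w := by
  induction l generalizing a with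
  | nil => exact ⟨rfl, hw⟩
  | cons b l ih =>
    rw [List.isChain_cons_cons] at h
    refine ⟨rfl, ?_⟩
    rw [h.1]
    exact ih h.2 (by simpa using hw)

theorem IsCircuit.isPath {a : E × Bool} {l : List (E × Bool)}
    (h : IsCircuit G ((a :: l : List (E × Bool)) : Cycle (E × Bool))) :
    G.IsPath (G.init a) (a :: l) (G.init a) := by
  have h2 := h.2
  rw [Cycle.chain_coe_cons] at h2
  have h3 : (a :: (l ++ [a])).IsChain fun a b => G.term a = G.init b := h2.imp fun _ _ h => h.1
  have h4 : a :: (l ++ [a]) = (a :: l) ++ [a] := rfl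
  rw [h4, List.isChain_append] at h3
  exact isPath_of_isChain h3.1 (h3.2.2 _ (List.getLast?_eq_some_getLast (by simp)) _ rfl)

theorem IsCircuit.exists_isPath {l : List (E × Bool)} (h : IsCircuit G (l : Cycle (E × Bool))) :
    l ≠ [] ∧ ∃ v, G.IsPath v l v := by
  have hl : l ≠ [] := fun e => h.1 (by rw [e]; rfl)
  obtain ⟨a, t, rfl⟩ := List.exists_cons_of_ne_nil hl
  exact ⟨hl, _, h.isPath⟩

theorem isCircuit_iff {l : List (E × Bool)} {v : V} (hv : G.IsPath v l v) :
    IsCircuit G (l : Cycle (E × Bool)) ↔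
      l ≠ [] ∧ ∀ a b, Follows (l : Cycle (E × Bool)) a b → b ≠ rev a := by
  unfold IsCircuit
  rw [chain_iff_follows, ne_eq, Cycle.coe_eq_nil]
  refine and_congr_right fun _ => ⟨fun h a b hab => (h a b hab).2, fun h a b hab =>
    ⟨IsPath.term_eq_of_follows hv hab, h a b hab⟩⟩

theorem IsCircuit.tight {c : Cycle (E × Bool)} (h : IsCircuit G c) {a b : E × Bool}
    (hab : Follows c a b) : b ≠ rev a := (chain_iff_follows.1 h.2 _ _ hab).2

theorem IsCircuit.term_eq {c : Cycle (E × Bool)} (h : IsCircuit G c) {a b : E × Bool}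
    (hab : Follows c a b) : G.term a = G.init b := (chain_iff_follows.1 h.2 _ _ hab).1

theorem tight_of_isCircuit {γ : Fin K → Cycle (E × Bool)} (h : ∀ i, IsCircuit G (γ i)) :
    Tight γ := fun i _ _ => (h i).tight

end Walks

/-! ### The wedge of lollipops that belongs to a free basis. -/

section Lollipops

variable {κ V E : Type*} (q l : κ → List (E × Bool))

/-- The edges of the wedge of lollipops with sticks `q k` and loops `l k`. -/
abbrev LollipopEdge : Type _ := (k : κ) × Fin (q k ++ l k).length

/-- The vertex after `j` edges of the lollipop `k`; the base vertex is `none`. -/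
def lollipopVert (k : κ) : ℕ → Option (κ × ℕ)
  | 0 => none
  | j + 1 => some (k, j)

/-- The wedge of lollipops with sticks of lengths `|q k|` and loops of lengths `|l k|`. -/
def lollipopGraph : Multigraph (Option (κ × ℕ)) (LollipopEdge q l) where
  init
    | (⟨k, j⟩, true) => lollipopVert k j
    | (⟨k, j⟩, false) =>
      if (j : ℕ) + 1 = (q k ++ l k).length then lollipopVert k (q k).length
      else lollipopVert k (j + 1)

/-- The labelling of the wedge of lollipops. -/
def lollipopDir (x : LollipopEdge q l × Bool) : E × Bool :=
  if x.2 then (q x.1.1 ++ l x.1.1)[x.1.2] else rev (q x.1.1 ++ l x.1.1)[x.1.2]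

/-- The path through the stick and around the loop of the lollipop `k`. -/
def lollipopWord (k : κ) : List (LollipopEdge q l × Bool) :=
  List.ofFn fun j : Fin (q k ++ l k).length => (⟨k, j⟩, true)

@[simp] theorem length_lollipopWord (k : κ) :
    (lollipopWord q l k).length = (q k ++ l k).length := by simp [lollipopWord]

theorem getElem_lollipopWord (k : κ) (j : ℕ) (hj : j < (lollipopWord q l k).length) :
    (lollipopWord q l k)[j] = (⟨k, j, by simpa using hj⟩, true) := by
  simp [lollipopWord]

theorem lollipopDir_rev (x : LollipopEdge q l × Bool) :
    lollipopDir q l (rev x) = rev (lollipopDir q l x) := by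
  obtain ⟨e, b⟩ := x
  cases b <;> simp [lollipopDir, rev]

theorem map_lollipopWord (k : κ) : (lollipopWord q l k).map (lollipopDir q l) = q k ++ l k := by
  apply List.ext_getElem
  · simp
  · intro i h1 h2
    rw [List.getElem_map, getElem_lollipopWord]
    rfl

variable {q l}

theorem isPath_take_lollipopWord (hl : ∀ k, l k ≠ []) (k : κ) {j : ℕ}
    (hj : j ≤ (q k ++ l k).length) : (lollipopGraph q l).IsPath none ((lollipopWord q l k).take j)
      (if j = (q k ++ l k).length then lollipopVert k (q k).length else lollipopVert k j) := by
  induction j with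
  | zero =>
    have : (0 : ℕ) ≠ (q k ++ l k).length := by
      have := List.length_pos_iff.2 (hl k)
      rw [List.length_append]; omega
    rw [if_neg this]; rfl
  | succ j ih =>
    have hj' : j < (lollipopWord q l k).length := by rw [length_lollipopWord]; omega
    rw [List.take_succ_eq_append_getElem hj', getElem_lollipopWord]
    have h1 := ih (by omega)
    rw [if_neg (by omega)] at h1
    refine h1.append ⟨rfl, ?_⟩
    rfl

theorem isPath_lollipopStick (hl : ∀ k, l k ≠ []) (k : κ) :
    (lollipopGraph q l).IsPath none ((lollipopWord q l k).take (q k).length)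
      (lollipopVert k (q k).length) := by
  have h := isPath_take_lollipopWord (q := q) hl k (j := (q k).length) (by simp)
  rwa [ite_self] at h

theorem isPath_lollipopWord (hl : ∀ k, l k ≠ []) (k : κ) :
    (lollipopGraph q l).IsPath none (lollipopWord q l k) (lollipopVert k (q k).length) := by
  have h := isPath_take_lollipopWord (q := q) hl k (j := (q k ++ l k).length) le_rfl
  rwa [if_pos rfl, List.take_of_length_le (by simp)] at h

theorem isPath_lollipopLoop (hl : ∀ k, l k ≠ []) (k : κ) :
    (lollipopGraph q l).IsPath (lollipopVert k (q k).length)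
      ((lollipopWord q l k).drop (q k).length) (lollipopVert k (q k).length) := by
  have h := isPath_lollipopWord (q := q) hl k
  rw [← List.take_append_drop (q k).length (lollipopWord q l k), isPath_append_iff] at h
  obtain ⟨v, h1, h2⟩ := h
  rw [h1.right_unique (isPath_lollipopStick hl k)] at h2
  exact h2

/-- The loop that goes through the stick, around the loop, and back. -/
def lollipopLasso (q l : κ → List (E × Bool)) (k : κ) : List (LollipopEdge q l × Bool) :=
  lollipopWord q l k ++ FreeGroup.invRev ((lollipopWord q l k).take (q k).length)

theorem isPath_lollipopLasso (hl : ∀ k, l k ≠ []) (k : κ) :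
    (lollipopGraph q l).IsPath none (lollipopLasso q l k) none :=
  (isPath_lollipopWord hl k).append (isPath_lollipopStick hl k).invRev

theorem map_lollipopLasso (k : κ) : FreeGroup.mk ((lollipopLasso q l k).map (lollipopDir q l)) =
    FreeGroup.mk (q k) * FreeGroup.mk (l k) * (FreeGroup.mk (q k))⁻¹ := by
  rw [lollipopLasso, List.map_append, map_invRev (lollipopDir_rev q l), List.map_take,
    map_lollipopWord, List.take_left, mk_append, mk_append, mk_invRev]

/-- The tree path from the base vertex. -/
def lollipopTree (q l : κ → List (E × Bool)) :
    Option (κ × ℕ) → FreeGroup (LollipopEdge q l)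
  | none => 1
  | some (k, j) => FreeGroup.mk ((lollipopWord q l k).take (j + 1))

theorem lollipopTree_vert (k : κ) (j : ℕ) : lollipopTree q l (lollipopVert k j) =
    FreeGroup.mk ((lollipopWord q l k).take j) := by
  cases j <;> rfl

open Classical in
/-- The collapse of the wedge of lollipops onto a rose. -/
noncomputable def lollipopCollapse (q l : κ → List (E × Bool)) :
    FreeGroup (LollipopEdge q l) →* FreeGroup κ :=
  FreeGroup.lift fun e => if (e.2 : ℕ) + 1 = (q e.1 ++ l e.1).length then FreeGroup.of e.1 else 1

/-- All edges except the last one of each lollipop form a tree at the base vertex, which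
`lollipopCollapse` kills; the gauge transformation is given by the tree paths. In particular, the
lassos generate the fundamental group. -/
theorem lollipop_mk_eq {p : List (LollipopEdge q l × Bool)}
    (hp : (lollipopGraph q l).IsPath none p none) :
    FreeGroup.lift (fun k => FreeGroup.mk (lollipopLasso q l k))
      (lollipopCollapse q l (FreeGroup.mk p)) = FreeGroup.mk p := by
  have := hom_mk_of_gauge (Ψ := (FreeGroup.lift fun k =>
      FreeGroup.mk (lollipopLasso q l k)).comp (lollipopCollapse q l))
    (Θ := MonoidHom.id _) (c := lollipopTree q l) (H := lollipopGraph q l) (by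
      rintro ⟨k, j⟩
      have hj : (j : ℕ) < (lollipopWord q l k).length := by rw [length_lollipopWord]; exact j.2
      have hstep : FreeGroup.mk ((lollipopWord q l k).take j) * FreeGroup.of ⟨k, j⟩ =
          FreeGroup.mk ((lollipopWord q l k).take (j + 1)) := by
        rw [List.take_succ_eq_append_getElem hj, mk_append, getElem_lollipopWord]
        rfl
      simp only [MonoidHom.comp_apply, lollipopCollapse, FreeGroup.lift_apply_of, lollipopGraph,
        MonoidHom.id_apply]
      rw [lollipopTree_vert, hstep]
      -- The last edge returns to the end of the stick and becomes a generator; any other edge is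
      -- one step of a tree path.
      split_ifs with h
      · rw [FreeGroup.lift_apply_of, lollipopTree_vert, lollipopLasso, mk_append, mk_invRev, h,
          List.take_of_length_le (length_lollipopWord q l k).le]
      · rw [map_one, lollipopTree_vert, mul_inv_cancel]) hp
  simpa [lollipopTree] using this

/-- The lasso through lollipop `k` is labelled by `q l q⁻¹`. So on fundamental groups the labelling
is the homomorphism defined by these elements, which is assumed to be injective and onto. -/
theorem isResolution_lollipop {K : ℕ} {G : Multigraph V E} {v₀ : V} {v : κ → V}
    (hq : ∀ k, G.IsPath v₀ (q k) (v k)) (hlp : ∀ k, G.IsPath (v k) (l k) (v k))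
    (hl : ∀ k, l k ≠ [])
    (hinj : Function.Injective (FreeGroup.lift fun k =>
      FreeGroup.mk (q k) * FreeGroup.mk (l k) * (FreeGroup.mk (q k))⁻¹))
    (hsurj : ∀ g ∈ G.pi1 v₀, g ∈ (FreeGroup.lift fun k =>
      FreeGroup.mk (q k) * FreeGroup.mk (l k) * (FreeGroup.mk (q k))⁻¹).range)
    (k : Fin K → κ) :
    IsResolution G v₀ (fun i => (l (k i) : Cycle (E × Bool))) (lollipopGraph q l) none
      (lollipopDir q l)
      (fun i => ((lollipopWord q l (k i)).drop (q (k i)).length : List _)) := by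
  have hD := lollipopDir_rev q l
  have hcomp : ∀ x, dirHom (lollipopDir q l)
      (FreeGroup.lift (fun k => FreeGroup.mk (lollipopLasso q l k)) x) =
      FreeGroup.lift (fun k => FreeGroup.mk (q k) * FreeGroup.mk (l k) * (FreeGroup.mk (q k))⁻¹) x := by
    intro x
    rw [← MonoidHom.comp_apply]
    congr 1
    ext k
    simp only [MonoidHom.comp_apply, FreeGroup.lift_apply_of, dirHom_mk hD, map_lollipopLasso]
  refine ⟨hD, ?_, ?_, ?_, ?_, ?_, ?_⟩
  · have hwalk : ∀ k j, j ≤ (q k ++ l k).length → G.IsPath v₀ (q k ++ l k) (v k) := fun k _ _ =>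
      (hq k).append (hlp k)
    let fV : Option (κ × ℕ) → V := fun
      | none => v₀
      | some (k, j) => G.walk v₀ (q k ++ l k) (j + 1)
    have hfV : ∀ k j, fV (lollipopVert k j) = G.walk v₀ (q k ++ l k) j := by
      intro k j
      cases j with
      | zero => simp [fV, lollipopVert]
      | succ j => rfl
    refine ⟨fV, rfl, ?_⟩
    rintro ⟨⟨k, j⟩, b⟩
    have hw : G.IsPath v₀ (q k ++ l k) (v k) := (hq k).append (hlp k)
    cases b
    · have : lollipopDir q l (⟨k, j⟩, false) = rev (q k ++ l k)[j] := rfl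
      rw [this, init_rev]
      refine (term_getElem hw j.2).trans ?_
      simp only [lollipopGraph]
      split_ifs with h
      · rw [hfV, h, walk_length hw]
        have h1 := (isPath_take_drop hw (j := (q k).length) (by simp)).1
        rw [List.take_left] at h1
        exact (hq k).right_unique h1
      · rw [hfV]
    · exact (init_getElem hw j.2).trans (hfV _ _).symm
  · rintro ⟨⟨k, j⟩, b⟩
    have hj : (j : ℕ) < (lollipopWord q l k).length := by rw [length_lollipopWord]; exact j.2
    have h := isPath_lollipopWord (q := q) hl k
    cases b
    · have h1 := (isPath_take_drop h hj).1
      rw [← term_getElem h hj, getElem_lollipopWord] at h1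
      exact ⟨_, h1⟩
    · have h1 := (isPath_take_drop h hj.le).1
      rw [← init_getElem h hj, getElem_lollipopWord] at h1
      exact ⟨_, h1⟩
  · intro p hp h
    have h1 := lollipop_mk_eq hp
    have h2 := hcomp (lollipopCollapse q l (FreeGroup.mk p))
    rw [h1, dirHom_mk hD, h] at h2
    rw [← h1, hinj (h2.symm.trans (map_one _).symm), map_one]
  · intro p hp
    obtain ⟨x, hx⟩ := hsurj _ hp.mem_pi1
    have hmem : FreeGroup.lift (fun k => FreeGroup.mk (lollipopLasso q l k)) x ∈
        (lollipopGraph q l).pi1 none := by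
      refine FreeGroup.range_lift_le ?_ ⟨x, rfl⟩
      rintro _ ⟨k, rfl⟩
      exact (isPath_lollipopLasso hl k).mem_pi1
    obtain ⟨p', hp', e⟩ := hmem
    refine ⟨p', hp', ?_⟩
    rw [← dirHom_mk hD, e, hcomp, hx]
  · intro i a b hab
    exact IsPath.term_eq_of_follows (isPath_lollipopLoop hl (k i)) hab
  · funext i
    rw [Cycle.map_coe, List.map_drop, map_lollipopWord, List.drop_left]

/-- Each edge of a loop is crossed once, in the positive direction, and different circuits use
different lollipops. So successors and predecessors are unique, and the orientation of a direction
tells which of the two is asked for. -/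
theorem uniqueTurns_lollipop {K : ℕ} {k : Fin K → κ} (hk : Function.Injective k) :
    UniqueTurns fun i => (((lollipopWord q l (k i)).drop (q (k i)).length :
      List (LollipopEdge q l × Bool)) : Cycle (LollipopEdge q l × Bool)) := by
  have key : ∀ i a b, Follows (((lollipopWord q l (k i)).drop (q (k i)).length :
      List (LollipopEdge q l × Bool)) : Cycle (LollipopEdge q l × Bool)) a b →
      ∃ (s : ℕ) (hs : s < (l (k i)).length)
        (ha : (q (k i)).length + s < (q (k i) ++ l (k i)).length)
        (hb : (q (k i)).length + (s + 1) % (l (k i)).length < (q (k i) ++ l (k i)).length),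
        a = (⟨k i, ⟨_, ha⟩⟩, true) ∧ b = (⟨k i, ⟨_, hb⟩⟩, true) := by
    intro i a b h
    obtain ⟨s, hs, rfl, rfl⟩ := follows_coe_iff.1 h
    have hs' : s < (l (k i)).length := by simp at hs; omega
    have h2 : (s + 1) % (l (k i)).length < (l (k i)).length := Nat.mod_lt _ (by omega)
    refine ⟨s, hs', by simp; omega, by simp; omega, ?_, ?_⟩
    · rw [List.getElem_drop, getElem_lollipopWord]
    · rw [List.getElem_drop, getElem_lollipopWord]
      simp
  have hmod : ∀ s s' L : ℕ, s < L → s' < L → (s + 1) % L = (s' + 1) % L → s = s' := by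
    intro s s' L h h' e
    have := Nat.ModEq.add_right_cancel' 1 (show s + 1 ≡ s' + 1 [MOD L] from e)
    rwa [Nat.ModEq, Nat.mod_eq_of_lt h, Nat.mod_eq_of_lt h'] at this
  have fwd : ∀ i j a b c, Follows (((lollipopWord q l (k i)).drop (q (k i)).length :
      List (LollipopEdge q l × Bool)) : Cycle (LollipopEdge q l × Bool)) a b →
      Follows (((lollipopWord q l (k j)).drop (q (k j)).length :
      List (LollipopEdge q l × Bool)) : Cycle (LollipopEdge q l × Bool)) a c → b = c := by
    intro i j a b c h h'
    obtain ⟨s, hs, ha, hb, rfl, rfl⟩ := key _ _ _ h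
    obtain ⟨s', hs', ha', hb', e, rfl⟩ := key _ _ _ h'
    have hij : i = j := hk (congrArg (fun x => x.1.1) e)
    subst hij
    have : s = s' := by simpa using e
    subst this
    rfl
  have bwd : ∀ i j a b c, Follows (((lollipopWord q l (k i)).drop (q (k i)).length :
      List (LollipopEdge q l × Bool)) : Cycle (LollipopEdge q l × Bool)) b a →
      Follows (((lollipopWord q l (k j)).drop (q (k j)).length :
      List (LollipopEdge q l × Bool)) : Cycle (LollipopEdge q l × Bool)) c a → b = c := by
    intro i j a b c h h'
    obtain ⟨s, hs, ha, hb, rfl, rfl⟩ := key _ _ _ h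
    obtain ⟨s', hs', ha', hb', rfl, e⟩ := key _ _ _ h'
    have hij : i = j := hk (congrArg (fun x => x.1.1) e)
    subst hij
    have : (s + 1) % (l (k i)).length = (s' + 1) % (l (k i)).length := by simpa using e
    have := hmod _ _ _ hs hs' this
    subst this
    rfl
  have hpos : ∀ i a b, Follows (((lollipopWord q l (k i)).drop (q (k i)).length :
      List (LollipopEdge q l × Bool)) : Cycle (LollipopEdge q l × Bool)) a b →
      a.2 = true ∧ b.2 = true := by
    intro i a b h
    obtain ⟨s, hs, ha, hb, rfl, rfl⟩ := key _ _ _ h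
    exact ⟨rfl, rfl⟩
  rintro x y z ⟨i, h⟩ ⟨j, h'⟩
  rcases takesTurn_iff.1 h with h | h <;> rcases takesTurn_iff.1 h' with h' | h'
  · exact fwd _ _ _ _ _ h h'
  · have h1 := (hpos _ _ _ h).1
    have h2 := (hpos _ _ _ h').2
    simp [rev, h2] at h1
  · have h1 := (hpos _ _ _ h').1
    have h2 := (hpos _ _ _ h).2
    simp [rev, h2] at h1
  · exact rev_inj.1 (bwd _ _ _ _ _ h h')

end Lollipops

/-! ### Whitehead's cut vertex lemma. -/

section CutVertexLemma

variable {V E : Type*} {n K : ℕ}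

/-- There are finitely many homomorphisms to `ℤ/2`, and each basis element yields its own indicator
function. Finiteness is needed because the folding argument is an induction on the number of edges.
-/
theorem finite_of_freeGroupBasis {κ : Type*} (b : FreeGroupBasis κ (FreeGroup (Fin n))) :
    Finite κ := by
  classical
  have e : (κ → Multiplicative (ZMod 2)) ≃ (Fin n → Multiplicative (ZMod 2)) :=
    b.lift.trans FreeGroup.lift.symm
  have : Finite (κ → Multiplicative (ZMod 2)) := Finite.of_equiv _ e.symm
  refine Finite.of_injective (fun (k : κ) => (fun j => if j = k then Multiplicative.ofAdd 1
    else 1 : κ → Multiplicative (ZMod 2))) ?_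
  intro k k' h
  have := congrFun h k
  by_contra hne
  simp only [if_pos, if_neg hne] at this
  exact absurd this (by decide)

/-- **Whitehead's cut vertex lemma**: if a circuit family represents a partial free basis, then its
Whitehead graph has a cut vertex or all its components are single edges. -/
theorem uniqueTurns_of_familyRepresents {G : Multigraph V E} {m : G.Marking n}
    {γ : Fin K → Cycle (E × Bool)} (hγ : ∀ i, IsCircuit G (γ i))
    (hrep : FamilyRepresentsPartialFreeBasis m γ) (hcut : ¬ HasCut γ) : UniqueTurns γ := by
  obtain ⟨C, hC, g, hg, hgC, κ, b, hb⟩ := hrep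
  have hfin := finite_of_freeGroupBasis b
  -- A basis element from the family gets a lollipop whose loop spells the circuit itself. Any other
  -- one gets a trivial stick and a loop that represents it, nonempty because basis elements are
  -- nontrivial.
  have key : ∀ k, ∃ (q l : List (E × Bool)) (v : V), G.IsPath m.base q v ∧ G.IsPath v l v ∧ l ≠ [] ∧
      (m.iso (b k) : FreeGroup E) = FreeGroup.mk q * FreeGroup.mk l * (FreeGroup.mk q)⁻¹ ∧
      ∀ i, g i = b k → (l : Cycle (E × Bool)) = γ i := by
    intro k
    by_cases h : ∃ i, g i = b k
    · obtain ⟨i, hi⟩ := h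
      have h1 := hC i
      rw [← hgC i] at h1
      obtain ⟨l, q, v, hl, hv, hq, e⟩ := h1.exists_of_mk
      refine ⟨q, l, v, hq, hv, ?_, by rw [← hi, e], ?_⟩
      · rintro rfl
        exact (hγ i).1 hl.symm
      · intro j hj
        rw [hg (hj.trans hi.symm), hl]
    · obtain ⟨r, hr, e⟩ := exists_isPath_mk_of_mem_pi1 (m.iso (b k))
      refine ⟨[], r, m.base, rfl, hr, ?_, by rw [← e, mk_nil]; group, fun i hi => absurd ⟨i, hi⟩ h⟩
      rintro rfl
      have h1 : m.iso (b k) = 1 := Subtype.ext e.symm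
      have h2 : b k = 1 := by simpa using h1
      have h3 := b.repr_apply_coe k
      rw [h2, map_one] at h3
      exact FreeGroup.one_ne_of k h3
  choose q l v hq hv hl e hlγ using key
  have hk : ∀ i, ∃ k, b k = g i := fun i => hb ⟨i, rfl⟩
  choose k hk using hk
  have hkinj : Function.Injective k := fun i j h => hg (by rw [← hk, ← hk, h])
  have hlift : FreeGroup.lift (fun k => FreeGroup.mk (q k) * FreeGroup.mk (l k) *
      (FreeGroup.mk (q k))⁻¹) =
      ((G.pi1 m.base).subtype.comp m.iso.toMonoidHom).comp b.repr.symm.toMonoidHom := by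
    ext x
    rw [FreeGroup.lift_apply_of, ← e]
    rfl
  have R := isResolution_lollipop (K := K) hq hv hl (by
    rw [hlift]
    exact (Subtype.val_injective.comp m.iso.injective).comp b.repr.symm.injective) (by
    intro x hx
    rw [hlift]
    obtain ⟨y, hy⟩ := m.iso.surjective ⟨x, hx⟩
    refine ⟨b.repr y, ?_⟩
    simp [hy]) k
  have hγ' : (fun i => (l (k i) : Cycle (E × Bool))) = γ := funext fun i => hlγ _ i (hk i).symm
  rw [hγ'] at R
  exact (R.hasCut_or_uniqueTurns (tight_of_isCircuit hγ) hcut _ rfl).2 (uniqueTurns_lollipop hkinj)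

end CutVertexLemma

/-! ### The fundamental group as a retract. -/

section Retraction

variable {V E : Type*} {G : Multigraph V E}

/-- The fundamental group of a connected graph is a retract of the free group on the edges. -/
theorem exists_retraction (hG : G.IsConnected) (v₀ : V) :
    ∃ ρ : FreeGroup E →* G.pi1 v₀, ∀ g : G.pi1 v₀, ρ g = g := by
  choose t ht using fun v => hG.exists_isPath v₀ v
  -- The paths are normalised so that the one to `v₀` is homotopically trivial; then the gauge
  -- transformation does not affect loops at `v₀`.
  have hc : ∀ v, G.IsPath v₀ (FreeGroup.invRev (t v₀) ++ t v) v := fun v =>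
    (ht v₀).invRev.append (ht v)
  set c := fun v => FreeGroup.invRev (t v₀) ++ t v with hcdef
  refine ⟨FreeGroup.lift fun e => ⟨_, (((hc (G.init (e, true))).append
    (isPath_singleton (e, true))).append (hc (G.term (e, true))).invRev).mem_pi1⟩, ?_⟩
  rintro ⟨_, p, hp, rfl⟩
  apply Subtype.ext
  have := hom_mk_of_gauge (Ψ := (G.pi1 v₀).subtype.comp (FreeGroup.lift fun e => (⟨_,
    (((hc (G.init (e, true))).append (isPath_singleton (e, true))).append
      (hc (G.term (e, true))).invRev).mem_pi1⟩ : G.pi1 v₀)))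
    (Θ := MonoidHom.id _) (c := fun v => FreeGroup.mk (c v)) (H := G) (by
      intro e
      simp only [MonoidHom.comp_apply, FreeGroup.lift_apply_of, MonoidHom.id_apply,
        Subgroup.subtype_apply, mk_append, mk_invRev]
      rfl) hp
  refine Eq.trans this ?_
  have h1 : FreeGroup.mk (c v₀) = 1 := by
    rw [hcdef]
    simp only [mk_append, mk_invRev]
    group
  simp [h1]

end Retraction

/-! ### Circuits that cross each edge at most once. -/

section EdgeSimple

/-- The graph with a set of edges removed. -/
def removeEdges {V E : Type*} (G : Multigraph V E) (A : Set E) : Multigraph V {e // e ∉ A} where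
  init x := G.init (x.1.1, x.2)

/-- Inclusion of oriented edges. -/
def inclDir {E : Type*} (A : Set E) (x : {e // e ∉ A} × Bool) : E × Bool := (x.1.1, x.2)

theorem inclDir_rev {E : Type*} {A : Set E} (x : {e // e ∉ A} × Bool) :
    inclDir A (rev x) = rev (inclDir A x) := rfl

variable {V E : Type*} {G : Multigraph V E} {A : Set E}

theorem isPath_map_inclDir {l : List ({e // e ∉ A} × Bool)} {u w : V} :
    G.IsPath u (l.map (inclDir A)) w ↔ (removeEdges G A).IsPath u l w := by
  induction l generalizing u with
  | nil => rfl
  | cons a l ih => exact and_congr Iff.rfl ih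

theorem exists_map_inclDir {l : List (E × Bool)} (h : ∀ x ∈ l, x.1 ∉ A) :
    ∃ l' : List ({e // e ∉ A} × Bool), l'.map (inclDir A) = l := by
  induction l with
  | nil => exact ⟨[], rfl⟩
  | cons a l ih =>
    obtain ⟨l', rfl⟩ := ih fun x hx => h x (List.mem_cons_of_mem _ hx)
    exact ⟨(⟨a.1, h a (List.mem_cons_self ..)⟩, a.2) :: l', rfl⟩

/-- If closed edge paths `a i :: r i` are such that none of them crosses any `a j` except for the
initial crossing of `a i` by the path `a i :: r i`, then they extend to a free basis of the
fundamental group. -/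
theorem exists_freeGroupBasis_of_edges {V E : Type} {G : Multigraph V E} (hG : G.IsConnected)
    (v₀ : V) {K : ℕ} {a : Fin K → E × Bool} {r : Fin K → List (E × Bool)}
    (hp : ∀ i, G.IsPath (G.init (a i)) (a i :: r i) (G.init (a i)))
    (hinj : Function.Injective fun i => (a i).1) (hr : ∀ i j, ∀ x ∈ r i, x.1 ≠ (a j).1) :
    ∃ (κ : Type) (b : FreeGroupBasis κ (G.pi1 v₀)) (k : Fin K → κ) (q : Fin K → List (E × Bool)),
      Function.Injective k ∧ ∀ i, G.IsPath v₀ (q i) (G.init (a i)) ∧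
        (b (k i) : FreeGroup E) =
          FreeGroup.mk (q i) * FreeGroup.mk (a i :: r i) * (FreeGroup.mk (q i))⁻¹ := by
  classical
  set A : Set E := Set.range fun i => (a i).1 with hA
  set G' := removeEdges G A with hG'
  have hD := inclDir_rev (A := A)
  have hr' : ∀ i, ∃ r' : List ({e // e ∉ A} × Bool), r'.map (inclDir A) = r i := fun i => exists_map_inclDir (by
    rintro x hx ⟨j, hj⟩
    exact hr i j x hx hj.symm)
  choose r' hr' using hr'
  have hpr : ∀ i, G'.IsPath (G.term (a i)) (r' i) (G.init (a i)) := by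
    intro i
    rw [hG', ← isPath_map_inclDir, hr']
    exact (hp i).2
  -- The removed edge `a i` is bypassed by running backwards along the rest `r i` of its circuit.
  have hconn : G'.IsConnected := by
    refine ⟨hG.1, fun u w => ?_⟩
    obtain ⟨p, hpath⟩ := hG.2 u w
    induction p generalizing u with
    | nil => exact ⟨[], hpath⟩
    | cons x p ih =>
      obtain ⟨p', hp'⟩ := ih _ hpath.2
      by_cases hx : x.1 ∈ A
      · obtain ⟨i, hi⟩ := hx
        rcases eq_or_eq_rev_of_fst_eq hi with h | h
        · refine ⟨FreeGroup.invRev (r' i) ++ p', IsPath.append ?_ hp'⟩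
          have := (hpr i).invRev
          rw [h] at this
          rwa [← hpath.1]
        · refine ⟨r' i ++ p', IsPath.append ?_ hp'⟩
          have := hpr i
          rw [h, term_rev, init_rev] at this
          rwa [← hpath.1]
      · exact ⟨(⟨x.1, hx⟩, x.2) :: p', hpath.1, hp'⟩
  choose t₀ ht₀ using fun v => hconn.exists_isPath v₀ v
  set t := fun v => FreeGroup.invRev (t₀ v₀) ++ t₀ v with htdef
  have ht : ∀ v, G'.IsPath v₀ (t v) v := fun v => (ht₀ v₀).invRev.append (ht₀ v)
  have ht1 : FreeGroup.mk (t v₀) = 1 := by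
    rw [htdef]
    simp only [mk_append, mk_invRev]
    group
  have htG : ∀ v, G.IsPath v₀ ((t v).map (inclDir A)) v := fun v => isPath_map_inclDir.2 (ht v)
  -- A basis of the fundamental group of the remaining graph, which is free by Nielsen–Schreier. The
  -- loops `g i`, each crossing its `a i` once, are added to it.
  let B := IsFreeGroup.basis (G'.pi1 v₀)
  have hmem : ∀ x : G'.pi1 v₀, dirHom (inclDir A) (x : FreeGroup _) ∈ G.pi1 v₀ := by
    rintro ⟨_, p, hp, rfl⟩
    rw [dirHom_mk hD]
    exact (isPath_map_inclDir.2 hp).mem_pi1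
  let incl : G'.pi1 v₀ →* G.pi1 v₀ :=
    ((dirHom (inclDir A)).comp (G'.pi1 v₀).subtype).codRestrict _ hmem
  let g : Fin K → G.pi1 v₀ := fun i => ⟨_, (((htG (G.init (a i))).append (hp i)).append
    (htG (G.init (a i))).invRev).mem_pi1⟩
  have hg : ∀ i, (g i : FreeGroup E) = FreeGroup.mk ((t (G.init (a i))).map (inclDir A)) *
      FreeGroup.mk (a i :: r i) * (FreeGroup.mk ((t (G.init (a i))).map (inclDir A)))⁻¹ := by
    intro i
    simp only [g, mk_append, mk_invRev]
  let of : IsFreeGroup.Generators (G'.pi1 v₀) ⊕ Fin K → G.pi1 v₀ :=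
    Sum.elim (fun k => incl (B k)) g
  obtain ⟨ρ, hρ⟩ := exists_retraction hconn v₀
  have hbasis : ∀ {Γ : Type} [Group Γ] (f : IsFreeGroup.Generators (G'.pi1 v₀) ⊕ Fin K → Γ),
      ∃! F : G.pi1 v₀ →* Γ, ∀ x, F (of x) = f x := by
    intro Γ _ f
    -- Through the retraction the values prescribed on `B` extend to all edges of `G'`.
    let ψ : FreeGroup {e // e ∉ A} →* Γ := (B.lift (f ∘ Sum.inl)).comp ρ
    -- The value on `a i` that is forced by sending `g i` to `f (Sum.inr i)`.
    let z : Fin K → Γ := fun i => (ψ (FreeGroup.mk (t (G.init (a i)))))⁻¹ * f (Sum.inr i) *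
      ψ (FreeGroup.mk (t (G.init (a i)))) * (ψ (FreeGroup.mk (r' i)))⁻¹
    let Ψ : FreeGroup E →* Γ := FreeGroup.lift fun e =>
      if h : e ∈ A then (if (a h.choose).2 then z h.choose else (z h.choose)⁻¹)
      else ψ (FreeGroup.of ⟨e, h⟩)
    have hΨ : ∀ x, Ψ (dirHom (inclDir A) x) = ψ x := by
      intro x
      rw [← MonoidHom.comp_apply]
      congr 1
      ext ⟨e, he⟩
      have : dirHom (inclDir A) (FreeGroup.of ⟨e, he⟩) = FreeGroup.of e := FreeGroup.lift_apply_of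
      rw [MonoidHom.comp_apply, this]
      simp only [Ψ, FreeGroup.lift_apply_of, dif_neg he]
    have hΨa : ∀ i, Ψ (FreeGroup.mk [a i]) = z i := by
      intro i
      have hi : (a i).1 ∈ A := ⟨i, rfl⟩
      have hch : hi.choose = i := hinj hi.choose_spec
      have h1 : Ψ (FreeGroup.of (a i).1) = if (a i).2 then z i else (z i)⁻¹ := by
        simp only [Ψ, FreeGroup.lift_apply_of, dif_pos hi, hch]
      cases hb : (a i).2
      · have : a i = rev ((a i).1, true) := Prod.ext rfl hb
        rw [this, mk_rev, map_inv]
        rw [hb] at h1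
        exact (congrArg _ h1).trans (by simp)
      · have : a i = ((a i).1, true) := Prod.ext rfl hb
        rw [this]
        rw [hb] at h1
        exact h1.trans (if_pos rfl)
    set F := Ψ.comp (G.pi1 v₀).subtype
    have hF : ∀ x, F (of x) = f x := by
      rintro (k | i)
      · change Ψ (dirHom (inclDir A) (B k : FreeGroup _)) = _
        rw [hΨ]
        simp only [ψ, MonoidHom.comp_apply, hρ]
        exact congrFun (B.lift.symm_apply_apply (f ∘ Sum.inl)) k
      · change Ψ (g i : FreeGroup E) = _
        rw [hg, mk_cons, ← hr', ← dirHom_mk hD, ← dirHom_mk hD, map_mul, map_mul, map_mul, map_inv,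
          hΨ, hΨ, hΨa]
        simp only [z]
        group
    refine ⟨F, hF, ?_⟩
    · intro F' hF'
      have hincl : F'.comp incl = F.comp incl := by
        apply B.ext_hom
        intro k
        exact (hF' (Sum.inl k)).trans (hF (Sum.inl k)).symm
      -- Uniqueness: `T` consists of the elements on which both extensions agree. Every path, closed
      -- up by the paths `t`, turns out to lie in `T`.
      let T : Subgroup (FreeGroup E) := (F'.eqLocus F).map (G.pi1 v₀).subtype
      have hT1 : ∀ p, G'.IsPath v₀ p v₀ → FreeGroup.mk (p.map (inclDir A)) ∈ T := by
        intro p hp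
        refine ⟨incl ⟨_, hp.mem_pi1⟩, ?_, ?_⟩
        · exact DFunLike.congr_fun hincl _
        · exact dirHom_mk hD p
      have hT2 : ∀ i, (g i : FreeGroup E) ∈ T := fun i =>
        ⟨g i, (hF' (Sum.inr i)).trans (hF (Sum.inr i)).symm, rfl⟩
      -- Multiplying `g i` by the loop back along `r i`, which lies in `G'`, leaves the crossing of
      -- `a i` alone.
      have hTe : ∀ i, FreeGroup.mk ((t (G.init (a i))).map (inclDir A)) * FreeGroup.mk [a i] *
          (FreeGroup.mk ((t (G.term (a i))).map (inclDir A)))⁻¹ ∈ T := by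
        intro i
        have h1 := hT1 _ (((ht (G.init (a i))).append (hpr i).invRev).append
          (ht (G.term (a i))).invRev)
        have h2 := mul_mem (hT2 i) h1
        rw [hg, mk_cons, ← hr'] at h2
        simp only [List.map_append, map_invRev hD, mk_append, mk_invRev] at h2
        convert h2 using 1
        group
      have hT : ∀ p u w, G.IsPath u p w → FreeGroup.mk ((t u).map (inclDir A)) * FreeGroup.mk p *
          (FreeGroup.mk ((t w).map (inclDir A)))⁻¹ ∈ T := by
        intro p
        induction p with
        | nil =>
          rintro u w h
          cases h
          rw [mk_nil, mul_one, mul_inv_cancel]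
          exact one_mem _
        | cons x p ih =>
          rintro u w ⟨rfl, h⟩
          have hx : FreeGroup.mk ((t (G.init x)).map (inclDir A)) * FreeGroup.mk [x] *
              (FreeGroup.mk ((t (G.term x)).map (inclDir A)))⁻¹ ∈ T := by
            by_cases hxA : x.1 ∈ A
            · obtain ⟨i, hi⟩ := hxA
              rcases eq_or_eq_rev_of_fst_eq hi with h | h
              · rw [← h]; exact hTe i
              · have h' : x = rev (a i) := by rw [h, rev_rev]
                have := inv_mem (hTe i)
                rw [h', mk_rev, init_rev, term_rev]
                convert this using 1
                group
            · have h1 := hT1 (t (G.init x) ++ [(⟨x.1, hxA⟩, x.2)] ++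
                FreeGroup.invRev (t (G.term x))) (((ht (G.init x)).append
                  (show G'.IsPath (G.init x) [(⟨x.1, hxA⟩, x.2)] (G.term x) from ⟨rfl, rfl⟩)).append
                  (ht (G.term x)).invRev)
              simp only [List.map_append, map_invRev hD, mk_append, mk_invRev] at h1
              exact h1
          have h2 := mul_mem hx (ih _ _ h)
          rw [mk_cons]
          convert h2 using 1
          group
      have ht2 : FreeGroup.mk ((t v₀).map (inclDir A)) = 1 := by
        rw [← dirHom_mk hD, ht1, map_one]
      ext ⟨_, p, hp, rfl⟩
      obtain ⟨y, hy, e⟩ := hT p _ _ hp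
      rw [ht2] at e
      have : y = ⟨_, hp.mem_pi1⟩ := Subtype.ext (e.trans (by simp))
      rw [← this]
      exact hy
  refine ⟨_, FreeGroupBasis.ofUniqueLift _ of hbasis, Sum.inr, fun i => (t (G.init (a i))).map
    (inclDir A), Sum.inr_injective, fun i => ⟨htG _, ?_⟩⟩
  have : FreeGroupBasis.ofUniqueLift _ of hbasis (Sum.inr i) = g i := by
    change FreeGroup.lift of (FreeGroup.of (Sum.inr i)) = _
    rw [FreeGroup.lift_apply_of]; rfl
  rw [this, hg]

open Classical in
theorem crossings_pos_of_mem {K : ℕ} {γ : Fin K → Cycle (E × Bool)} {i : Fin K} {x : E × Bool}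
    (h : x ∈ γ i) : 0 < crossings γ x.1 := by
  refine lt_of_lt_of_le ?_ (Finset.single_le_sum (f := fun i =>
    ((γ i).toMultiset.map Prod.fst).count x.1) (fun _ _ => Nat.zero_le _) (Finset.mem_univ i))
  rw [Multiset.count_pos, Multiset.mem_map]
  refine ⟨x, ?_, rfl⟩
  induction h' : γ i using Quotient.inductionOn' with
  | h l => rw [h'] at h; exact h

/-- A circuit family which crosses each edge at most once represents a partial free basis. -/
theorem familyRepresents_of_crossings_le_one {V E : Type} {G : Multigraph V E}
    (hG : G.IsConnected) {n K : ℕ} (m : G.Marking n) {γ : Fin K → Cycle (E × Bool)}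
    (hγ : ∀ i, IsCircuit G (γ i)) (h : ∀ e, crossings γ e ≤ 1) :
    FamilyRepresentsPartialFreeBasis m γ := by
  classical
  have hex : ∀ i, ∃ (a : E × Bool) (r : List (E × Bool)), ((a :: r : List _) : Cycle _) = γ i := by
    intro i
    induction h' : γ i using Quotient.inductionOn' with
    | h l =>
      have h0 := hγ i
      rw [h'] at h0
      obtain ⟨a, r, rfl⟩ := List.exists_cons_of_ne_nil (IsCircuit.exists_isPath h0).1
      exact ⟨a, r, rfl⟩
  choose a r hl using hex
  have hp : ∀ i, G.IsPath (G.init (a i)) (a i :: r i) (G.init (a i)) := fun i =>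
    IsCircuit.isPath (by rw [hl]; exact hγ i)
  have hcount : ∀ i, ((γ i).toMultiset.map Prod.fst) = ((a i :: r i).map Prod.fst : List E) := by
    intro i; rw [← hl i]; rfl
  have hsum : ∀ i j e, i ≠ j → ((a i :: r i).map Prod.fst).count e +
      ((a j :: r j).map Prod.fst).count e ≤ 1 := by
    intro i j e hij
    refine le_trans ?_ (h e)
    have := Finset.sum_le_sum_of_subset (f := fun i => ((γ i).toMultiset.map Prod.fst).count e)
      (Finset.subset_univ {i, j})
    rw [Finset.sum_pair hij, hcount, hcount] at this
    simp only [Multiset.coe_count] at this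
    refine this.trans (le_of_eq ?_)
    unfold crossings
    refine Finset.sum_congr rfl fun j _ => ?_
    rw [hcount, Multiset.coe_count]
  have hone : ∀ i e, ((a i :: r i).map Prod.fst).count e ≤ 1 := by
    intro i e
    refine le_trans ?_ (h e)
    have := Finset.single_le_sum (f := fun i => ((γ i).toMultiset.map Prod.fst).count e)
      (fun _ _ => Nat.zero_le _) (Finset.mem_univ i)
    simp only [hcount, Multiset.coe_count] at this
    refine this.trans (le_of_eq ?_)
    unfold crossings
    refine Finset.sum_congr rfl fun j _ => ?_
    rw [hcount, Multiset.coe_count]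
  have hinj : Function.Injective fun i => (a i).1 := by
    intro i j hij
    by_contra hne
    have := hsum i j (a i).1 hne
    simp only at hij
    simp [← hij] at this
    omega
  have hr : ∀ i j, ∀ x ∈ r i, x.1 ≠ (a j).1 := by
    intro i j x hx e
    have hpos : 0 < ((r i).map Prod.fst).count (a j).1 := by
      rw [List.count_pos_iff, List.mem_map]
      exact ⟨x, hx, e⟩
    by_cases hij : i = j
    · subst hij
      have := hone i (a i).1
      simp only [List.map_cons, List.count_cons, beq_self_eq_true, if_true] at this
      omega
    · have := hsum i j (a j).1 hij
      simp only [List.map_cons, List.count_cons, beq_self_eq_true, if_true] at this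
      omega
  obtain ⟨κ, b, k, q, hk, hb⟩ := exists_freeGroupBasis_of_edges hG m.base hp hinj hr
  refine ⟨fun i => ConjClasses.mk (m.iso.symm (b (k i))), fun i => ⟨_, a i :: r i, q i, _, rfl,
    hl i, hp i, (hb i).1, ?_⟩, fun i => m.iso.symm (b (k i)), ?_, fun _ => rfl, κ,
    b.map m.iso.symm, ?_⟩
  · rw [m.iso.apply_symm_apply, (hb i).2]
  · exact fun i j hij => hk (b.injective (m.iso.symm.injective hij))
  · rintro _ ⟨i, rfl⟩
    exact ⟨k i, b.map_apply _ _⟩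

end EdgeSimple

/-! ### Cyclic words as powers of periodic orbits; reversal of cycles. -/

section PeriodicCycles

variable {α : Type*}

theorem exists_cons_eq_of_mem {c : Cycle α} {x : α} (h : x ∈ c) : ∃ t : List α, (x :: t : List α) = c := by
  induction c using Quotient.inductionOn' with
  | h l =>
    obtain ⟨s, t, rfl⟩ := List.append_of_mem (show x ∈ l from h)
    exact ⟨t ++ s, Quotient.sound' (List.isRotated_append (l := x :: t) (l' := s))⟩

theorem map_range_mul {f : ℕ → α} {p : ℕ} (hf : ∀ i, f (i + p) = f i) (k : ℕ) :
    (List.range (p * k)).map f = (List.replicate k ((List.range p).map f)).flatten := by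
  have hf' : ∀ k i, f (p * k + i) = f i := by
    intro k i
    induction k with
    | zero => simp
    | succ k ih => rw [← ih, ← hf (p * k + i)]; congr 1; ring
  induction k with
  | zero => simp
  | succ k ih =>
    rw [Nat.mul_succ, List.range_add, List.map_append, ih, List.replicate_succ']
    simp [hf', Function.comp_def]

/-- A cycle in which each entry determines the next one is a power of a periodic orbit. -/
theorem eq_flatten_of_follows {f : α → α} {c : Cycle α} (hf : ∀ a b, Follows c a b → b = f a) {x : α}
    (hx : x ∈ c) : x ∈ Function.periodicPts f ∧ ∃ k, 1 ≤ k ∧ c = ((List.replicate k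
      ((List.range (Function.minimalPeriod f x)).map fun n => f^[n] x)).flatten : List α) := by
  obtain ⟨t, rfl⟩ := exists_cons_eq_of_mem hx
  set l := x :: t with hl
  have key : ∀ j (h : j < l.length), l[j] = f^[j] x := by
    intro j
    induction j with
    | zero => intro h; rfl
    | succ j ih =>
      intro h
      have := hf l[j] l[j + 1] (follows_coe_iff.2 ⟨j, by omega, rfl, by
        simp only [Nat.mod_eq_of_lt h]⟩)
      rw [this, ih, Function.iterate_succ_apply']
  have hlen : 0 < l.length := by simp [hl]
  have hper : f^[l.length] x = x := by
    have := hf l[l.length - 1] l[0] (follows_coe_iff.2 ⟨l.length - 1, by omega, rfl, by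
      simp only [Nat.sub_add_cancel hlen, Nat.mod_self]⟩)
    rw [key, key, ← Function.iterate_succ_apply' f, Nat.succ_eq_add_one, Nat.sub_add_cancel hlen]
      at this
    exact this.symm
  have hpt : Function.IsPeriodicPt f l.length x := hper
  have hmem : x ∈ Function.periodicPts f := Function.mk_mem_periodicPts hlen hpt
  refine ⟨hmem, ?_⟩
  obtain ⟨k, hk⟩ := hpt.minimalPeriod_dvd
  refine ⟨k, ?_, ?_⟩
  · rcases Nat.eq_zero_or_pos k with rfl | h
    · omega
    · exact h
  · rw [← map_range_mul fun i => Function.iterate_add_minimalPeriod_eq]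
    congr 1
    refine List.ext_getElem (by simp [← hk]) fun i h₁ h₂ => ?_
    simp [key]

theorem follows_reverse {c : Cycle α} {a b : α} (h : Follows c a b) : Follows c.reverse b a := by
  induction c using Quotient.inductionOn' with
  | h l =>
    change Follows (l.reverse : Cycle α) b a
    obtain ⟨i, hi, rfl, rfl⟩ := follows_coe_iff.1 h
    -- Reversal moves the pair at `i, i + 1` to `length - 2 - i, length - 1 - i`, whereas the
    -- closing pair stays at the last index.
    by_cases hn : i + 1 < l.length
    · refine follows_coe_iff.2 ⟨l.length - 2 - i, by rw [List.length_reverse]; omega, ?_, ?_⟩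
      · rw [List.getElem_reverse]
        congr 1
        rw [Nat.mod_eq_of_lt hn]
        omega
      · rw [List.getElem_reverse]
        congr 1
        rw [List.length_reverse, Nat.mod_eq_of_lt (by omega)]
        omega
    · obtain hn : i + 1 = l.length := by omega
      refine follows_coe_iff.2 ⟨l.length - 1, by rw [List.length_reverse]; omega, ?_, ?_⟩
      · rw [List.getElem_reverse]
        congr 1
        rw [hn, Nat.mod_self]
        omega
      · rw [List.getElem_reverse]
        congr 1
        rw [List.length_reverse, Nat.sub_add_cancel (by omega), Nat.mod_self]
        omega

theorem Follows.reverse {c : Cycle (α × Bool)} {a b : α × Bool} (h : Follows c a b) :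
    Follows (revCycle c) (rev b) (rev a) := by
  exact follows_reverse (follows_map.2 ⟨a, b, h, rfl, rfl⟩)

theorem revCycle_revCycle (c : Cycle (α × Bool)) : revCycle (revCycle c) = c := by
  unfold revCycle
  induction c using Quotient.inductionOn' with
  | h l =>
    change ((((l.map rev).reverse.map rev).reverse : List (α × Bool)) : Cycle (α × Bool)) = (l : Cycle _)
    simp [Function.comp_def, rev_rev]

theorem follows_revCycle_iff {c : Cycle (α × Bool)} {a b : α × Bool} :
    Follows (revCycle c) a b ↔ Follows c (rev b) (rev a) := by
  constructor
  · intro h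
    simpa [revCycle_revCycle] using h.reverse
  · intro h
    simpa [rev_rev] using h.reverse

theorem mem_revCycle {c : Cycle (α × Bool)} {a : α × Bool} : a ∈ revCycle c ↔ rev a ∈ c := by
  constructor
  · intro h
    obtain ⟨b, hb⟩ := exists_follows_right h
    exact (follows_revCycle_iff.1 hb).mem_right
  · intro h
    obtain ⟨b, hb⟩ := exists_follows_right h
    have := hb.reverse.mem_right
    rwa [rev_rev] at this

theorem nodup_revCycle {c : Cycle (α × Bool)} (h : c.Nodup) : (revCycle c).Nodup := by
  unfold revCycle
  rw [Cycle.nodup_reverse_iff]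
  induction c using Quotient.inductionOn' with
  | h l => exact List.Nodup.map (fun a b h => rev_inj.1 h) h

end PeriodicCycles

/-! ### Primitive circuits with unique turns. -/

section Primitive

variable {V E : Type*} {G : Multigraph V E} {K : ℕ} {γ : Fin K → Cycle (E × Bool)}

open Classical in
/-- The oriented edge that follows `a` in a family all of whose turns are unique. -/
noncomputable def nextEdge (γ : Fin K → Cycle (E × Bool)) (a : E × Bool) : E × Bool :=
  if h : ∃ b, TurnOf γ (rev a) b then h.choose else a

theorem UniqueTurns.nextEdge_eq (hu : UniqueTurns γ) {a b : E × Bool} (h : TurnOf γ (rev a) b) :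
    nextEdge γ a = b := by
  have h' : ∃ b, TurnOf γ (rev a) b := ⟨b, h⟩
  rw [nextEdge, dif_pos h']
  exact hu _ _ _ h'.choose_spec h

theorem UniqueTurns.follows (hu : UniqueTurns γ) {i : Fin K} {a b : E × Bool}
    (h : Follows (γ i) a b) : b = nextEdge γ a :=
  (hu.nextEdge_eq ⟨i, takesTurn_iff.2 (Or.inl (by rwa [rev_rev]))⟩).symm

theorem UniqueTurns.iterate_mem (hu : UniqueTurns γ) {i : Fin K} {x : E × Bool} (hx : x ∈ γ i)
    (n : ℕ) : Follows (γ i) ((nextEdge γ)^[n] x) ((nextEdge γ)^[n + 1] x) := by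
  have step : ∀ y ∈ γ i, Follows (γ i) y (nextEdge γ y) := by
    intro y hy
    obtain ⟨b, hb⟩ := exists_follows_right hy
    rwa [← hu.follows hb]
  have mem : ∀ n, (nextEdge γ)^[n] x ∈ γ i := by
    intro n
    induction n with
    | zero => exact hx
    | succ n ih => rw [Function.iterate_succ_apply']; exact (step _ ih).mem_right
  rw [Function.iterate_succ_apply']
  exact step _ (mem n)

/-- Turns determine successors, so the circuit is a power of a periodic orbit; primitivity makes the
exponent one. -/
theorem UniqueTurns.eq_periodicOrbit (hu : UniqueTurns γ) (hγ : ∀ i, IsCircuit G (γ i)) {i : Fin K}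
    (hp : IsPrimitiveCircuit G (γ i)) {x : E × Bool} (hx : x ∈ γ i) :
    γ i = Function.periodicOrbit (nextEdge γ) x := by
  obtain ⟨hpt, k, hk, e⟩ := eq_flatten_of_follows (f := nextEdge γ) (fun a b h => hu.follows h) hx
  by_cases h2 : 2 ≤ k
  · refine absurd ⟨_, k, ?_, h2, e⟩ hp
    change IsCircuit G (Function.periodicOrbit (nextEdge γ) x)
    refine ⟨fun h => ?_, ?_⟩
    · exact Function.periodicOrbit_eq_nil_iff_not_periodic_pt.1 h hpt
    · rw [Function.periodicOrbit_chain' _ hpt]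
      intro n
      have := hu.iterate_mem hx n
      exact ⟨(hγ i).term_eq this, (hγ i).tight this⟩
  · obtain rfl : k = 1 := by omega
    rw [e]
    simp [Function.periodicOrbit]

/-- With exponent at least two the entry `x` would recur. This serves for reversed circuits, where
absence of repetitions is at hand instead of primitivity. -/
theorem eq_periodicOrbit_of_nodup {α : Type*} {f : α → α} {c : Cycle α} (hc : c.Nodup)
    (hf : ∀ a b, Follows c a b → b = f a) {x : α} (hx : x ∈ c) :
    c = Function.periodicOrbit f x := by
  obtain ⟨hpt, k, hk, e⟩ := eq_flatten_of_follows (f := f) hf hx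
  have h0 := Function.minimalPeriod_pos_of_mem_periodicPts hpt
  rcases k with - | - | k
  · omega
  · rw [e]
    simp [Function.periodicOrbit]
  · rw [e, Cycle.nodup_coe_iff, List.replicate_succ, List.replicate_succ, List.flatten_cons,
      List.flatten_cons, List.nodup_append] at hc
    have hm : x ∈ (List.range (Function.minimalPeriod f x)).map
        fun n => f^[n] x := List.mem_map.2 ⟨0, by simpa using h0, rfl⟩
    exact absurd rfl (hc.2.2 x hm x (List.mem_append_left _ hm))

/-- A circuit of a family all of whose turns are unique does not cross an edge in both directions. -/
theorem UniqueTurns.rev_notMem (hu : UniqueTurns γ) (hγ : ∀ i, IsCircuit G (γ i)) {i : Fin K}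
    (hp : IsPrimitiveCircuit G (γ i)) {x : E × Bool} (hx : x ∈ γ i) : rev x ∉ γ i := by
  intro hx'
  -- If the circuit runs from `y` to `rev y` in `k` steps, then by uniqueness of turns it runs from
  -- the successor `z` of `y` to `rev z` in `k - 2` steps. The descent ends with `rev y = y` or with
  -- a backtracking.
  have key : ∀ k y, y ∈ γ i → rev y ≠ (nextEdge γ)^[k] y := by
    intro k
    induction k using Nat.strong_induction_on with
    | _ k ih =>
      intro y hy e
      have h01 := hu.iterate_mem hy 0
      rcases k with - | - | k
      · exact rev_ne y e
      · exact (hγ i).tight h01 e.symm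
      · have hz := h01.mem_right
        have hu1 := hu.iterate_mem hz k
        have e1 : (nextEdge γ)^[k + 1] (nextEdge γ y) = rev y := by
          rw [e, ← Function.iterate_succ_apply]
        simp only [zero_add, Function.iterate_one, Function.iterate_zero, id_eq] at h01 hz hu1
        rw [e1] at hu1
        refine ih k (by omega) _ hz (rev_eq_iff.2 ?_)
        refine hu (rev y) _ _ ?_ ?_
        · exact ⟨i, takesTurn_iff.2 (Or.inl (by rwa [rev_rev]))⟩
        · exact ⟨i, takesTurn_iff.2 (Or.inr (by rwa [rev_rev]))⟩
  rw [hu.eq_periodicOrbit hγ hp hx] at hx'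
  have hpt := (eq_flatten_of_follows (f := nextEdge γ) (fun a b h => hu.follows h) hx).1
  obtain ⟨k, hk⟩ := (Function.mem_periodicOrbit_iff hpt).1 hx'
  exact key k x hx hk.symm

/-- A jointly primitive family all of whose turns are unique crosses each edge at most once. -/
theorem crossings_le_one_of_uniqueTurns (hγ : ∀ i, IsCircuit G (γ i)) (hu : UniqueTurns γ)
    (hJ : JointlyPrimitive G γ) (e : E) : crossings γ e ≤ 1 := by
  have hnodup : ∀ i, (γ i).Nodup := by
    intro i
    obtain ⟨x, hx⟩ : ∃ x, x ∈ γ i := by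
      have := (hγ i).1
      induction h : γ i using Quotient.inductionOn' with
      | h l =>
        cases l with
        | nil => exact absurd h this
        | cons a l => exact ⟨a, List.mem_cons_self⟩
    rw [hu.eq_periodicOrbit hγ (hJ.1 i) hx]
    exact Function.nodup_periodicOrbit
  have hone : ∀ i j x, x ∈ γ i → x ∈ γ j → i = j := by
    intro i j x hi hj
    by_contra hne
    exact (hJ.2 i j hne).1
      ((hu.eq_periodicOrbit hγ (hJ.1 i) hi).trans (hu.eq_periodicOrbit hγ (hJ.1 j) hj).symm)
  have hrev : ∀ i j x, x ∈ γ i → rev x ∉ γ j := by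
    intro i j x hi hj
    by_cases hij : i = j
    · subst hij
      exact hu.rev_notMem hγ (hJ.1 i) hi hj
    -- The reversal of `γ j` obeys the same successor map and contains `x`, so it would be the same
    -- orbit as `γ i`.
    · refine (hJ.2 i j hij).2 ((hu.eq_periodicOrbit hγ (hJ.1 i) hi).trans (Eq.symm ?_))
      refine eq_periodicOrbit_of_nodup (nodup_revCycle (hnodup j)) ?_ (mem_revCycle.2 hj)
      intro a b h
      rw [follows_revCycle_iff] at h
      exact (hu.nextEdge_eq ⟨j, takesTurn_iff.2 (Or.inr h)⟩).symm
  have hmem : ∀ i x, x ∈ (γ i).toMultiset → x ∈ γ i := by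
    intro i x
    induction γ i using Quotient.inductionOn' with
    | h l => exact id
  have hcount : ∀ i, ((γ i).toMultiset.map Prod.fst).Nodup := by
    intro i
    refine Multiset.Nodup.map_on ?_ ?_
    · intro x hx y hy hxy
      rcases eq_or_eq_rev_of_fst_eq hxy with h | h
      · exact h
      · exact absurd (h ▸ hmem i x hx) (hrev i i y (hmem i y hy))
    · have := hnodup i
      revert this
      induction γ i using Quotient.inductionOn' with
      | h l => exact id
  have hex : ∀ i, e ∈ (γ i).toMultiset.map Prod.fst → ∃ x ∈ γ i, x.1 = e := by
    intro i h
    obtain ⟨x, hx, rfl⟩ := Multiset.mem_map.1 h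
    exact ⟨x, hmem i x hx, rfl⟩
  classical
  unfold crossings
  by_cases h : ∃ i, e ∈ (γ i).toMultiset.map Prod.fst
  · obtain ⟨i, hi⟩ := h
    rw [Finset.sum_eq_single i]
    · exact Multiset.nodup_iff_count_le_one.1 (hcount i) e
    · intro j _ hj
      rw [Multiset.count_eq_zero]
      intro hj'
      obtain ⟨x, hx, hxe⟩ := hex i hi
      obtain ⟨y, hy, hye⟩ := hex j hj'
      rcases eq_or_eq_rev_of_fst_eq (hxe.trans hye.symm) with h | h
      · exact hj (hone j i y hy (h ▸ hx))
      · exact hrev j i y hy (h ▸ hx)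
    · simp
  · push Not at h
    rw [Finset.sum_eq_zero fun i _ => Multiset.count_eq_zero.2 (h i)]
    exact Nat.zero_le _

end Primitive

/-! ### Joint primitivity is necessary. -/

section JointPrimitivity

variable {V E : Type*} {G : Multigraph V E} {n K : ℕ} {m : G.Marking n}

theorem IsPath.flatten_replicate {l : List (E × Bool)} {v : V} (h : G.IsPath v l v) (k : ℕ) :
    G.IsPath v (List.replicate k l).flatten v := by
  induction k with
  | zero => rfl
  | succ k ih => rw [List.replicate_succ, List.flatten_cons]; exact h.append ih

theorem mk_flatten_replicate (l : List (E × Bool)) (k : ℕ) :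
    FreeGroup.mk (List.replicate k l).flatten = FreeGroup.mk l ^ k := by
  induction k with
  | zero => rfl
  | succ k ih => rw [List.replicate_succ, List.flatten_cons, mk_append, ih, pow_succ']

theorem Represents.revCycle {c : Cycle (E × Bool)} {g : FreeGroup (Fin n)}
    (h : Represents m c (ConjClasses.mk g)) :
    Represents m (revCycle c) (ConjClasses.mk g⁻¹) := by
  obtain ⟨l, q, v, rfl, hv, hq, e⟩ := h.exists_of_mk
  refine ⟨g⁻¹, FreeGroup.invRev l, q, v, rfl, rfl, hv.invRev, hq, ?_⟩
  rw [map_inv]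
  push_cast
  rw [e, mk_invRev]
  group

/-- A circuit family that represents a partial free basis is jointly primitive. -/
theorem FamilyRepresentsPartialFreeBasis.jointlyPrimitive {γ : Fin K → Cycle (E × Bool)}
    (hrep : FamilyRepresentsPartialFreeBasis m γ) (hG : G.IsConnected) :
    JointlyPrimitive G γ := by
  classical
  obtain ⟨C, hC, g, hg, hgC, κ, b, hb⟩ := hrep
  have hk : ∀ i, ∃ k, b k = g i := fun i => hb ⟨i, rfl⟩
  choose k hk using hk
  -- `χ i` is the exponent sum in the basis element `g i`. Constant on conjugacy classes, it shows
  -- that `g i` is conjugate neither to a proper `p`-th power, since `p ∣ 1` would follow, nor to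
  -- another `g j` or its inverse.
  let χ : Fin K → FreeGroup (Fin n) →* Multiplicative ℤ := fun i =>
    b.lift fun j => if j = k i then Multiplicative.ofAdd 1 else 1
  have hself : ∀ i, χ i (g i) = Multiplicative.ofAdd 1 := by
    intro i
    rw [← hk i]
    simp [χ]
  have hother : ∀ i j, i ≠ j → χ i (g j) = 1 := by
    intro i j hij
    have : k j ≠ k i := fun e => hij (hg (by rw [← hk, ← hk, e]))
    rw [← hk j]
    simp [χ, this]
  have hconj : ∀ i (x y : FreeGroup (Fin n)), ConjClasses.mk x = ConjClasses.mk y → χ i x = χ i y := by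
    intro i x y h
    exact isConj_iff_eq.1 (MonoidHom.map_isConj (χ i) (ConjClasses.mk_eq_mk_iff_isConj.1 h))
  have hne : (Multiplicative.ofAdd (1 : ℤ)) ≠ 1 := by decide
  have hrepr : ∀ i, Represents m (γ i) (ConjClasses.mk (g i)) := fun i => hgC i ▸ hC i
  refine ⟨?_, fun i j hij => ⟨fun e => ?_, fun e => ?_⟩⟩
  · rintro i ⟨l, p, hl, hp, e⟩
    obtain ⟨-, v, hv⟩ := hl.exists_isPath
    obtain ⟨q, hq⟩ := hG.exists_isPath m.base v
    obtain ⟨x, hx⟩ := m.iso.surjective ⟨_, ((hq.append hv).append hq.invRev).mem_pi1⟩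
    have h2 : Represents m (γ i) (ConjClasses.mk (x ^ p)) := by
      rw [e]
      refine ⟨x ^ p, _, q, v, rfl, rfl, IsPath.flatten_replicate hv p, hq, ?_⟩
      rw [map_pow, hx, mk_flatten_replicate]
      push_cast
      simp only [mk_append, mk_invRev, conj_pow]
    have h3 := hconj i _ _ ((hrepr i).unique h2)
    rw [hself, map_pow] at h3
    have h4 : (1 : ℤ) = p * Multiplicative.toAdd (χ i x) := by
      have := congrArg Multiplicative.toAdd h3
      simpa using this
    have h5 : (p : ℤ) ∣ 1 := ⟨_, h4⟩
    have h6 : p ∣ 1 := by exact_mod_cast h5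
    have := Nat.le_of_dvd one_pos h6
    omega
  · have h1 := hrepr j
    rw [← e] at h1
    have h3 := hconj i _ _ ((hrepr i).unique h1)
    rw [hself, hother i j hij] at h3
    exact hne h3
  · have h1 := (hrepr j).revCycle
    rw [← e] at h1
    have h3 := hconj i _ _ ((hrepr i).unique h1)
    rw [hself, map_inv, hother i j hij, inv_one] at h3
    exact hne h3

end JointPrimitivity

/-! ### Near visibility, cut vertices and cuts in terms of turns. -/

section WhiteheadGraphs

variable {V E : Type*} {G : Multigraph V E} {K : ℕ} {γ : Fin K → Cycle (E × Bool)}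

theorem TurnOf.init_eq (hγ : ∀ i, IsCircuit G (γ i)) {x y : E × Bool} (h : TurnOf γ x y) :
    G.init x = G.init y := by
  obtain ⟨i, hi⟩ := h
  rcases takesTurn_iff.1 hi with hi | hi
  · simpa using (hγ i).term_eq hi
  · simpa using ((hγ i).term_eq hi).symm

theorem whiteheadGraph_adj_iff (hγ : ∀ i, IsCircuit G (γ i)) {v : V} {x y : E × Bool} :
    (whiteheadGraph G γ v).Adj x y ↔ G.init x = v ∧ TurnOf γ x y := by
  constructor
  · rintro ⟨-, hx, -, h⟩
    exact ⟨hx, h⟩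
  · rintro ⟨hx, h⟩
    exact ⟨((tight_of_isCircuit hγ).turn_ne h).symm, hx, (h.init_eq hγ).symm.trans hx, h⟩

theorem nearVisible_iff (hγ : ∀ i, IsCircuit G (γ i)) : NearVisible G γ ↔ UniqueTurns γ := by
  constructor
  · intro h x y z hy hz
    exact (h (G.init x) ⟨rfl, hy.crossed⟩).unique
      ((whiteheadGraph_adj_iff hγ).2 ⟨rfl, hy⟩) ((whiteheadGraph_adj_iff hγ).2 ⟨rfl, hz⟩)
  · rintro h v x ⟨hx, hc⟩
    obtain ⟨y, hy⟩ := CrossedBy.exists_turn hc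
    exact ⟨y, (whiteheadGraph_adj_iff hγ).2 ⟨hx, hy⟩, fun z hz =>
      h _ _ _ ((whiteheadGraph_adj_iff hγ).1 hz).2 hy⟩

/-- Until the walk first hits `w` it stays in `T`, so it enters `w` from `T`. -/
theorem exists_turn_of_walk (hγ : ∀ i, IsCircuit G (γ i)) {v : V} {w : E × Bool} {T : Set (E × Bool)}
    (hT : ∀ p q, TurnOf γ p q → q ≠ w → p ∈ T → q ∈ T) {a b : E × Bool}
    (p : (whiteheadGraph G γ v).spanningCoe.Walk a b) (ha : a ∈ T) (haw : a ≠ w)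
    (hp : w ∈ p.support) : ∃ z ∈ T, z ≠ w ∧ TurnOf γ w z := by
  induction p with
  | nil => rw [SimpleGraph.Walk.support_nil, List.mem_singleton] at hp; exact absurd hp.symm haw
  | @cons a c b h p ih =>
    have h' := ((whiteheadGraph_adj_iff hγ).1 h).2
    by_cases hc : c = w
    · subst hc
      exact ⟨a, ha, haw, h'.symm⟩
    · refine ih (hT _ _ h' hc ha) hc ?_
      rw [SimpleGraph.Walk.support_cons, List.mem_cons] at hp
      exact hp.resolve_left fun e => haw e.symm

theorem mem_of_walk (hγ : ∀ i, IsCircuit G (γ i)) {v : V} {w : E × Bool} {T : Set (E × Bool)}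
    (hT : ∀ p q, TurnOf γ p q → q ≠ w → p ∈ T → q ∈ T) {a b : E × Bool}
    (p : (whiteheadGraph G γ v).spanningCoe.Walk a b) (ha : a ∈ T) (hp : w ∉ p.support) :
    b ∈ T := by
  induction p with
  | nil => exact ha
  | @cons a c b h p ih =>
    rw [SimpleGraph.Walk.support_cons, List.mem_cons, not_or] at hp
    refine ih (hT _ _ ((whiteheadGraph_adj_iff hγ).1 h).2 ?_ ha) hp.2
    rintro rfl
    exact hp.2 p.start_mem_support

/-- If `w` separates `x` from `y`, the directions reachable from `x` by turns that avoid `w` form a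
cut set: a walk from `x` to `y` enters `w` from inside, and its reverse enters `w` from outside.
Conversely, two neighbours of `w` inside and outside `S` are joined through `w`, and only through
`w`. -/
theorem cutVertexCondition_iff (hγ : ∀ i, IsCircuit G (γ i)) :
    CutVertexCondition G γ ↔ HasCut γ := by
  constructor
  · rintro ⟨v, w, x, y, hw, hx, hy, ⟨p⟩, h⟩
    have hxv : G.init x = v := by
      cases p with
      | nil => exact absurd (by simpa using h SimpleGraph.Walk.nil) (Ne.symm hx)
      | cons h' _ => exact ((whiteheadGraph_adj_iff hγ).1 h').1
    let R : E × Bool → E × Bool → Prop := fun a b => TurnOf γ a b ∧ b ≠ w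
    have hS : ∀ z, Relation.ReflTransGen R x z → G.init z = v ∧
        ∃ p : (whiteheadGraph G γ v).spanningCoe.Walk x z, w ∉ p.support := by
      intro z hz
      induction hz with
      | refl => exact ⟨hxv, SimpleGraph.Walk.nil, by simpa using hx.symm⟩
      | @tail b c _ hbc ih =>
        obtain ⟨hb, q, hq⟩ := ih
        have hadj : (whiteheadGraph G γ v).spanningCoe.Adj b c :=
          (whiteheadGraph_adj_iff hγ).2 ⟨hb, hbc.1⟩
        refine ⟨(hbc.1.init_eq hγ).symm.trans hb, q.concat hadj, ?_⟩
        rw [SimpleGraph.Walk.support_concat, List.mem_append, List.mem_singleton, not_or]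
        exact ⟨hq, hbc.2.symm⟩
    have hclosed : ∀ p q, TurnOf γ p q → q ≠ w → p ∈ {z | Relation.ReflTransGen R x z} →
        q ∈ {z | Relation.ReflTransGen R x z} := fun p q hpq hq hp => hp.tail ⟨hpq, hq⟩
    have hwS : ¬ Relation.ReflTransGen R x w := by
      intro hw'
      obtain ⟨-, q, hq⟩ := hS w hw'
      exact hq q.end_mem_support
    refine ⟨w, {z | Relation.ReflTransGen R x z}, hwS, ?_, ?_, hclosed⟩
    · obtain ⟨z, hz, -, hwz⟩ := exists_turn_of_walk hγ hclosed p .refl hx (h p)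
      exact ⟨z, hz, hwz⟩
    · have hy' : ¬ Relation.ReflTransGen R x y := by
        intro hy'
        obtain ⟨-, q, hq⟩ := hS y hy'
        exact hq (h q)
      have hclosed' : ∀ p q, TurnOf γ p q → q ≠ w →
          p ∈ {z | ¬ Relation.ReflTransGen R x z ∧ z ≠ w} →
          q ∈ {z | ¬ Relation.ReflTransGen R x z ∧ z ≠ w} := fun a b hab hb ha =>
        ⟨fun hb' => ha.1 (hclosed _ _ hab.symm ha.2 hb'), hb⟩
      obtain ⟨z, hz, hzw, hwz⟩ := exists_turn_of_walk hγ hclosed' p.reverse ⟨hy', hy⟩ hy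
        (by rw [SimpleGraph.Walk.support_reverse, List.mem_reverse]; exact h p)
      exact ⟨z, hz.1, hzw, hwz⟩
  · rintro ⟨w, S, h⟩
    obtain ⟨x, hx, hwx⟩ := h.inside
    obtain ⟨y, hy, hyw, hwy⟩ := h.outside
    refine ⟨G.init w, w, x, y, ⟨rfl, hwx.crossed⟩, fun e => h.notMem (e ▸ hx), hyw, ?_, fun p => ?_⟩
    · exact (SimpleGraph.Adj.reachable ((whiteheadGraph_adj_iff hγ).2
        ⟨(hwx.init_eq hγ).symm, hwx.symm⟩)).trans
        (SimpleGraph.Adj.reachable ((whiteheadGraph_adj_iff hγ).2 ⟨rfl, hwy⟩))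
    · by_contra hp
      exact hy (mem_of_walk hγ h.closed p hx hp)

/-- The directions that are attached to the new vertex when `G` is split along `d`. -/
def splitSet (G : Multigraph V E) (d : E × Bool) (T : Set (E × Bool)) : Set (E × Bool) :=
  {a | a ∈ T ∧ a ≠ d ∧ G.init a = G.init d}

theorem IsCut.init_eq {v : V} {d : E × Bool} {W₁ W₂ : (⊤ : SimpleGraph (E × Bool)).Subgraph}
    (h : IsCut G γ v d W₁ W₂) : G.init d = v := h.mem.1

/-- Each turn at the vertex is an edge of one of the two sides, and the sides meet only in `d`. -/
theorem IsCut.isCutSet (hγ : ∀ i, IsCircuit G (γ i)) {v : V} {d : E × Bool}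
    {W₁ W₂ : (⊤ : SimpleGraph (E × Bool)).Subgraph}
    (h : IsCut G γ v d W₁ W₂) : IsCutSet γ d (splitSet G d W₂.verts) := by
  have hv := h.init_eq
  have hadj : ∀ a b, W₁.Adj a b ∨ W₂.Adj a b ↔ G.init a = v ∧ TurnOf γ a b := by
    intro a b
    rw [← SimpleGraph.Subgraph.sup_adj, h.union]
    exact whiteheadGraph_adj_iff hγ
  have hinter : ∀ a, a ∈ W₁.verts → a ∈ W₂.verts → a = d := by
    intro a h1 h2
    have : a ∈ (W₁ ⊓ W₂).verts := ⟨h1, h2⟩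
    rw [h.inter] at this
    simpa using this
  refine ⟨fun hd => hd.2.1 rfl, ?_, ?_, ?_⟩
  · obtain ⟨x, hx⟩ := h.edge₂
    have := (hadj d x).1 (Or.inr hx)
    exact ⟨x, ⟨W₂.edge_vert hx.symm, ((tight_of_isCircuit hγ).turn_ne this.2),
      (this.2.init_eq hγ).symm⟩, this.2⟩
  · obtain ⟨x, hx⟩ := h.edge₁
    have := (hadj d x).1 (Or.inl hx)
    have hne := (tight_of_isCircuit hγ).turn_ne this.2
    exact ⟨x, fun h' => hne (hinter x (W₁.edge_vert hx.symm) h'.1), hne, this.2⟩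
  · rintro p q hpq hq ⟨hp, hpd, hpv⟩
    rcases (hadj p q).2 ⟨hpv.trans hv, hpq⟩ with h' | h'
    · exact absurd (hinter p (W₁.edge_vert h') hp) hpd
    · exact ⟨W₂.edge_vert h'.symm, hq, (hpq.init_eq hγ).symm.trans hpv⟩

theorem IsCutSet.exists_isCut (hγ : ∀ i, IsCircuit G (γ i)) {d : E × Bool} {S : Set (E × Bool)}
    (h : IsCutSet γ d S) : ∃ W₁ W₂, IsCut G γ (G.init d) d W₁ W₂ := by
  obtain ⟨x, hx, hdx⟩ := h.inside
  obtain ⟨y, hy, hyd, hdy⟩ := h.outside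
  have hxv := hdx.init_eq hγ
  have hyv := hdy.init_eq hγ
  set A := augmentedWhiteheadGraph G γ (G.init d) with hA
  have hAadj : ∀ a b, A.Adj a b ↔ G.init a = G.init d ∧ TurnOf γ a b := fun a b =>
    whiteheadGraph_adj_iff hγ
  -- `W₂` is spanned by `d` and the part of `S` at the vertex, `W₁` by everything else there and
  -- `d`; so uncrossed directions outside `S` go to `W₁`.
  refine ⟨A.induce {a | G.init a = G.init d ∧ a ∉ S},
    A.induce {a | G.init a = G.init d ∧ (a ∈ S ∨ a = d)}, ?_, ?_, ⟨rfl, hdx.crossed⟩,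
    ⟨y, ⟨rfl, h.notMem⟩, ⟨hyv.symm, hy⟩, (hAadj _ _).2 ⟨rfl, hdy⟩⟩,
    ⟨x, ⟨rfl, Or.inr rfl⟩, ⟨hxv.symm, Or.inl hx⟩, (hAadj _ _).2 ⟨rfl, hdx⟩⟩⟩
  · refine SimpleGraph.Subgraph.ext ?_ ?_
    · ext a
      simp only [SimpleGraph.Subgraph.verts_sup, SimpleGraph.Subgraph.induce_verts, Set.mem_union,
        Set.mem_ofPred_eq, hA, augmentedWhiteheadGraph, directions]
      tauto
    · ext a b
      simp only [SimpleGraph.Subgraph.sup_adj, SimpleGraph.Subgraph.induce_adj, Set.mem_ofPred_eq]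
      constructor
      · rintro (h | h) <;> exact h.2.2
      · intro hab
        have hab' := (hAadj a b).1 hab
        have hbv := (hab'.2.init_eq hγ).symm.trans hab'.1
        have h1 := h.closed a b hab'.2
        have h2 := h.closed b a hab'.2.symm
        have h3 := h.notMem
        by_cases ha : a = d
        · subst ha
          tauto
        · by_cases hb : b = d
          · subst hb
            tauto
          · tauto
  · refine SimpleGraph.Subgraph.ext ?_ ?_
    · ext a
      simp only [SimpleGraph.Subgraph.verts_inf, SimpleGraph.Subgraph.induce_verts, Set.mem_inter_iff,
        Set.mem_ofPred_eq, SimpleGraph.singletonSubgraph_verts, Set.mem_singleton_iff]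
      constructor
      · tauto
      · rintro rfl
        exact ⟨⟨rfl, h.notMem⟩, rfl, Or.inr rfl⟩
    · ext a b
      simp only [SimpleGraph.Subgraph.inf_adj, SimpleGraph.Subgraph.induce_adj, Set.mem_ofPred_eq,
        SimpleGraph.singletonSubgraph_adj]
      constructor
      · rintro ⟨⟨⟨-, h1⟩, ⟨-, h2⟩, h3⟩, ⟨-, h4⟩, ⟨-, h5⟩, -⟩
        obtain rfl := h4.resolve_left h1
        obtain rfl := h5.resolve_left h2
        exact absurd rfl ((tight_of_isCircuit hγ).turn_ne ((hAadj _ _).1 h3).2)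
      · exact False.elim

end WhiteheadGraphs

/-! ### The split graph and its fold. -/

section SplitGraph

variable {V E : Type*} {G : Multigraph V E} {d : E × Bool} {T : Set (E × Bool)}

theorem attach_of_mem {a : E × Bool} (h : a ∈ splitSet G d T) : attach G d T a = none := if_pos h

theorem attach_of_notMem {a : E × Bool} (h : a ∉ splitSet G d T) :
    attach G d T a = some (G.init a) := if_neg h

theorem self_notMem_splitSet : d ∉ splitSet G d T := fun h => h.2.1 rfl

theorem attach_self : attach G d T d = some (G.init d) := attach_of_notMem self_notMem_splitSet

theorem attach_of_ne {a : E × Bool} (h : G.init a ≠ G.init d) :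
    attach G d T a = some (G.init a) := attach_of_notMem fun h' => h h'.2.2

theorem split_init_some (a : E × Bool) : (split G d T).init (some a.1, a.2) = attach G d T a := rfl

theorem split_init_none : (split G d T).init (none, d.2) = none := if_pos rfl

theorem split_init_none_not :
    (split G d T).init (none, !d.2) = attach G d T (rev d) := if_neg (by simp)

/-- The edge of `G` onto which an edge of the split graph is folded. -/
def splitDir (d : E × Bool) (y : Option E × Bool) : E × Bool := (y.1.getD d.1, y.2)

theorem splitDir_rev (y : Option E × Bool) : splitDir d (rev y) = rev (splitDir d y) := rfl

theorem splitFold_onDir (y : Option E × Bool) : (splitFold G d T).onDir y = [splitDir d y] := by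
  obtain ⟨z, b⟩ := y
  cases b <;> rfl

theorem splitFold_onCycle (c : Cycle (Option E × Bool)) :
    (splitFold G d T).onCycle c = c.map (splitDir d) := by
  induction c using Quotient.inductionOn' with
  | h l =>
    change ((splitFold G d T).onPath l : Cycle (E × Bool)) = (l.map (splitDir d) : List _)
    congr 1
    induction l with
    | nil => rfl
    | cons a l ih => rw [GraphMap.onPath_cons, ih, splitFold_onDir]; rfl

theorem splitDir_eq_iff {x y : Option E × Bool} : splitDir d x = splitDir d y ↔
    x = y ∨ (x.2 = y.2 ∧ ((x.1 = some d.1 ∧ y.1 = none) ∨ (x.1 = none ∧ y.1 = some d.1))) := by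
  obtain ⟨x, b⟩ := x
  obtain ⟨y, b'⟩ := y
  cases x <;> cases y <;> simp [splitDir] <;> grind

theorem split_init_of_ne {y : Option E × Bool} (h : splitDir d y ≠ d) :
    (split G d T).init y = attach G d T (splitDir d y) := by
  obtain ⟨_ | x, b⟩ := y
  · exact if_neg fun hb => h (by rw [hb]; rfl)
  · rfl

/-- A path from `some (init d)` to `none` in the split graph that is folded to a trivial path. -/
def splitJump (d : E × Bool) : Option V → List (Option E × Bool)
  | some _ => []
  | none => [(some d.1, d.2), (none, !d.2)]

theorem isPath_splitJump (u : Option V) :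
    (split G d T).IsPath (some (u.getD (G.init d))) (splitJump d u) u := by
  cases u with
  | some u => rfl
  | none =>
    refine ⟨attach_self, ?_, ?_⟩
    · rw [split_init_none_not]
      rfl
    · change (split G d T).init (none, !!d.2) = none
      rw [Bool.not_not, split_init_none]

/-- A homotopy inverse of the fold. -/
noncomputable def splitSection (G : Multigraph V E) (d : E × Bool) (T : Set (E × Bool)) :
    GraphMap G (split G d T) where
  onV := some
  onE e := splitJump d (attach G d T (e, true)) ++ ([(some e, true)] ++
    FreeGroup.invRev (splitJump d (attach G d T (e, false))))
  isPath e := by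
    have h1 := isPath_splitJump (G := G) (d := d) (T := T) (attach G d T (e, true))
    have h2 := (isPath_splitJump (G := G) (d := d) (T := T) (attach G d T (e, false))).invRev
    rw [attach_getD] at h1 h2
    exact h1.append ((isPath_singleton (some e, true)).append h2)

theorem splitFold_hom_jump (u : Option V) :
    (splitFold G d T).hom (FreeGroup.mk (splitJump d u)) = 1 := by
  cases u with
  | some u => exact map_one _
  | none =>
    rw [GraphMap.hom_mk]
    simp only [splitJump, GraphMap.onPath_cons, splitFold_onDir, GraphMap.onPath_nil, splitDir,
      Option.getD_some, Option.getD_none, List.append_nil, mk_append]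
    exact (congrArg (FreeGroup.mk [d] * ·) (mk_rev d)).trans (mul_inv_cancel _)

theorem splitSection_hom_of (e : E) : (splitSection G d T).hom (FreeGroup.of e) =
    FreeGroup.mk (splitJump d (attach G d T (e, true))) * FreeGroup.of (some e) *
      (FreeGroup.mk (splitJump d (attach G d T (e, false))))⁻¹ := by
  rw [GraphMap.hom, FreeGroup.lift_apply_of]
  simp only [splitSection, mk_append, mk_invRev, mul_assoc]
  rfl

theorem splitFold_hom_section (x : FreeGroup E) :
    (splitFold G d T).hom ((splitSection G d T).hom x) = x := by
  have : (splitFold G d T).hom.comp (splitSection G d T).hom = MonoidHom.id _ := by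
    refine FreeGroup.ext_hom _ _ fun e => ?_
    rw [MonoidHom.comp_apply, splitSection_hom_of, map_mul, map_mul, map_inv, splitFold_hom_jump,
      splitFold_hom_jump, GraphMap.hom, FreeGroup.lift_apply_of]
    simp only [one_mul, inv_one, mul_one]
    rfl
  exact DFunLike.congr_fun this x

/-- The section sends `v` to `v₁` and makes the detour `splitJump` at directions attached to `v₂`.
Detours fold to trivial paths, so `f ∘ s` is homotopic to the identity, and `s ∘ f` is so with track
`splitJump`. -/
theorem isPi1Equiv_splitFold (G : Multigraph V E) (d : E × Bool) (T : Set (E × Bool)) :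
    (splitFold G d T).IsPi1Equiv := by
  refine GraphMap.isPi1Equiv_of_inverse (s := splitSection G d T) (c := splitJump d)
    (k := fun _ => []) isPath_splitJump (fun u => rfl) ?_ ?_
  · intro z
    have hz : (splitFold G d T).hom (FreeGroup.of z) = FreeGroup.of (z.getD d.1) := by
      rw [GraphMap.hom, FreeGroup.lift_apply_of]; rfl
    rw [hz, splitSection_hom_of]
    cases z with
    | some x => rfl
    -- Only `E₂` needs care: `s ∘ f` takes it to the image of `E₁`, and the jump at its terminal
    -- vertex accounts for the difference.
    | none =>
      have h1 : FreeGroup.mk (splitJump d (none : Option V)) =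
          FreeGroup.mk [(some d.1, d.2)] * FreeGroup.mk [(none, !d.2)] := by
        rw [← mk_append]; rfl
      have h2 : (split G d T).init (none, d.2) = none := split_init_none
      have h3 : (split G d T).init (none, !d.2) = attach G d T (d.1, !d.2) := split_init_none_not
      have h4 : attach G d T (d.1, d.2) = some (G.init d) := attach_self
      have h5 : FreeGroup.mk (splitJump d (some (G.init d))) = 1 := rfl
      simp only [Option.getD_none]
      cases hd : d.2 with
      | true =>
        rw [hd] at h1 h2 h3 h4
        simp only [Bool.not_true] at h1 h3
        rw [h4, h5, h2, h3, h1]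
        have : FreeGroup.mk [((none : Option E), false)] = (FreeGroup.of none)⁻¹ := mk_rev (none, true)
        rw [this]
        change 1 * FreeGroup.of (some d.1) * _ = _
        have : FreeGroup.mk [(some d.1, true)] = FreeGroup.of (some d.1) := rfl
        rw [this]
        group
      | false =>
        rw [hd] at h1 h2 h3 h4
        simp only [Bool.not_false] at h1 h3
        rw [h4, h5, h2, h3, h1]
        have : FreeGroup.mk [(some d.1, false)] = (FreeGroup.of (some d.1))⁻¹ :=
          mk_rev (some d.1, true)
        rw [this]
        have : FreeGroup.mk [((none : Option E), true)] = FreeGroup.of none := rfl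
        rw [this]
        group
  · intro e
    rw [splitFold_hom_section, mk_nil]
    group

theorem valence_ne_one_iff {v : V} :
    G.valence v ≠ 1 ↔ ∀ a, G.init a = v → ∃ b, b ≠ a ∧ G.init b = v := by
  rw [Ne, valence, Set.ncard_eq_one]
  push Not
  refine forall_congr' fun a => ⟨fun h ha => ?_, fun h e => ?_⟩
  · by_contra! h'
    refine h (Set.ext fun b => ⟨fun hb => ?_, ?_⟩)
    · by_contra hba
      exact h' b hba hb
    · rintro rfl
      exact ha
  · have ha : a ∈ G.directions v := by rw [e]; rfl
    obtain ⟨b, hb, hb'⟩ := h ha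
    have : b ∈ G.directions v := hb'
    rw [e] at this
    exact hb this

theorem isConnected_split (hG : G.IsConnected) : (split G d T).IsConnected := by
  refine ⟨⟨none⟩, fun u w => ?_⟩
  obtain ⟨l, hl⟩ := hG.exists_isPath (u.getD (G.init d)) (w.getD (G.init d))
  exact ⟨_, ((isPath_splitJump u).invRev.append
    ((splitSection G d T).isPath_onPath hl)).append (isPath_splitJump w)⟩

variable {K : ℕ} {γ : Fin K → Cycle (E × Bool)}

/-- At `v₂` there are the end of `E₂` and a neighbour of `d` inside the cut set, at `v₁` the end of
`E₁` and a neighbour outside; the other vertices keep their directions. -/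
theorem isCore_split (hG : G.IsCore) (hγ : ∀ i, IsCircuit G (γ i))
    (hS : IsCutSet γ d (splitSet G d T)) : (split G d T).IsCore := by
  refine ⟨isConnected_split hG.1, fun w => valence_ne_one_iff.2 ?_⟩
  rintro ⟨_ | x, β⟩ rfl
  · by_cases hβ : β = d.2
    · subst hβ
      obtain ⟨x, hx, -⟩ := hS.inside
      exact ⟨(some x.1, x.2), by simp, (attach_of_mem hx).trans split_init_none.symm⟩
    · obtain rfl : β = !d.2 := by revert hβ; cases β <;> cases d.2 <;> simp
      exact ⟨(some d.1, !d.2), by simp, split_init_none_not.symm⟩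
  · by_cases h : (x, β) ∈ splitSet G d T
    · exact ⟨(none, d.2), by simp, split_init_none.trans (attach_of_mem h).symm⟩
    · rw [show (split G d T).init (some x, β) = _ from attach_of_notMem h]
      by_cases hv : G.init (x, β) = G.init d
      · rw [hv]
        by_cases hx : (x, β) = d
        · obtain ⟨y, hy, hyd, hdy⟩ := hS.outside
          refine ⟨(some y.1, y.2), fun e => hyd ?_, ?_⟩
          · rw [← hx]
            simpa [Prod.ext_iff] using e
          · rw [split_init_some, attach_of_notMem hy, hdy.init_eq hγ]
        · refine ⟨(some d.1, d.2), fun e => hx ?_, attach_self⟩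
          simpa [Prod.ext_iff, eq_comm] using e
      · obtain ⟨b, hb, hb'⟩ := valence_ne_one_iff.1 (hG.2 (G.init (x, β))) (x, β) rfl
        refine ⟨(some b.1, b.2), fun e => hb (by simpa [Prod.ext_iff] using e), ?_⟩
        rw [split_init_some, attach_of_ne (hb' ▸ hv), hb']

theorem exists_init_eq (hG : G.IsCore) {u v : V} (h : u ≠ v) : ∃ a b, a ≠ b ∧ G.init a = u ∧ G.init b = u := by
  obtain ⟨l, hl⟩ := hG.1.exists_isPath u v
  cases l with
  | nil => exact absurd hl h
  | cons a l =>
    obtain ⟨b, hb, hb'⟩ := valence_ne_one_iff.1 (hG.2 u) a hl.1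
    exact ⟨a, b, hb.symm, hl.1, hb'⟩

/-- At `v₁` and `v₂` the two gates come from `d` and from a neighbour of `d` on the respective side
of the cut. -/
theorem isFold_splitFold (hG : G.IsCore) (hγ : ∀ i, IsCircuit G (γ i))
    (hS : IsCutSet γ d (splitSet G d T)) :
    (splitFold G d T).IsFold (splitEdge₁ d) (splitEdge₂ d) := by
  have h1 : (split G d T).term (splitEdge₁ d) = some (G.init d) := by
    have : rev (splitEdge₁ d) = (some d.1, d.2) := by simp [rev, splitEdge₁]
    rw [term, this, split_init_some, attach_self]
  have h2 : (split G d T).term (splitEdge₂ d) = none := by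
    have : rev (splitEdge₂ d) = (none, d.2) := by simp [rev, splitEdge₂]
    rw [term, this, split_init_none]
  refine ⟨by simp [splitEdge₁, splitEdge₂], split_init_none_not.symm, by rw [h1, h2]; simp,
    fun x => ⟨_, splitFold_onDir x⟩, fun y => ⟨(some y.1, y.2), splitFold_onDir _⟩,
    fun v => ⟨some v, rfl⟩, ?_, ?_, ?_⟩
  · simp only [splitFold_onDir, List.head?_cons, ne_eq, Option.some.injEq]
    rintro (_ | u)
    · obtain ⟨x, hx, hdx⟩ := hS.inside
      exact ⟨(none, d.2), (some x.1, x.2), split_init_none, attach_of_mem hx, fun e => hx.2.1 e.symm⟩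
    · by_cases hu : u = G.init d
      · subst hu
        obtain ⟨y, hy, hyd, hdy⟩ := hS.outside
        refine ⟨(some d.1, d.2), (some y.1, y.2), attach_self, ?_, fun e => hyd e.symm⟩
        rw [split_init_some, attach_of_notMem hy, hdy.init_eq hγ]
      · obtain ⟨a, b, hab, ha, hb⟩ := exists_init_eq hG hu
        refine ⟨(some a.1, a.2), (some b.1, b.2), ?_, ?_, hab⟩
        · rw [split_init_some, attach_of_ne (ha ▸ hu), ha]
        · rw [split_init_some, attach_of_ne (hb ▸ hu), hb]
  · intro u w
    rw [h1, h2]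
    cases u <;> cases w <;> simp [splitFold, eq_comm]
  · intro x y
    rw [splitFold_onDir, splitFold_onDir, List.singleton_inj, splitDir_eq_iff]
    obtain ⟨x, b⟩ := x
    obtain ⟨y, b'⟩ := y
    refine or_congr_right ?_
    simp only [splitEdge₁, splitEdge₂, rev, Prod.mk.injEq, Bool.not_not]
    cases b <;> cases b' <;> cases d.2 <;> simp

end SplitGraph

/-! ### Rewriting cyclic words with regard to neighbouring letters. -/

section CyclicMap

variable {α β : Type*}

/-- The entries of a nonempty list, repeated periodically. -/
def cycGet (l : List α) (h : 0 < l.length) (k : ℕ) : α := l[k % l.length]'(Nat.mod_lt _ h)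

theorem cycGet_of_lt {l : List α} {k : ℕ} (hk : k < l.length) (h : 0 < l.length) :
    cycGet l h k = l[k] := by
  simp only [cycGet, Nat.mod_eq_of_lt hk]

theorem cycGet_add_length {l : List α} (h : 0 < l.length) (k : ℕ) :
    cycGet l h (k + l.length) = cycGet l h k := by
  simp only [cycGet, Nat.add_mod_right]

theorem cycGet_mem {l : List α} (h : 0 < l.length) (k : ℕ) : cycGet l h k ∈ l := List.getElem_mem _

theorem cycGet_map {l : List α} {f : α → β} (h : 0 < l.length) (h' : 0 < (l.map f).length) (k : ℕ) :
    cycGet (l.map f) h' k = f (cycGet l h k) := by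
  simp only [cycGet, List.getElem_map, List.length_map]

theorem chain_iff_cycGet {r : α → α → Prop} {l : List α} (h : 0 < l.length) :
    (l : Cycle α).Chain r ↔ ∀ k, r (cycGet l h k) (cycGet l h (k + 1)) := by
  rw [chain_coe_iff]
  constructor
  · intro H k
    have := H (k % l.length) (Nat.mod_lt _ h)
    simpa only [cycGet, Nat.mod_add_mod] using this
  · intro H i hi
    have := H i
    rwa [cycGet_of_lt hi] at this

theorem ext_cycGet {l l' : List α} (h : 0 < l.length) (h' : 0 < l'.length)
    (hl : l.length = l'.length) (H : ∀ k, cycGet l h k = cycGet l' h' k) : l = l' := by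
  refine List.ext_getElem hl fun k h1 h2 => ?_
  rw [← cycGet_of_lt h1 h, ← cycGet_of_lt h2 h', H]

/-- Replace each entry of a cyclic list, in a way that depends on its two neighbours too. -/
def cyclicMap (g : α → α → α → β) (l : List α) : List β :=
  List.ofFn fun i : Fin l.length => g (cycGet l i.pos (i + (l.length - 1))) (cycGet l i.pos i)
    (cycGet l i.pos (i + 1))

@[simp] theorem length_cyclicMap (g : α → α → α → β) (l : List α) :
    (cyclicMap g l).length = l.length := List.length_ofFn

theorem cycGet_cyclicMap (g : α → α → α → β) {l : List α} (h : 0 < l.length)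
    (h' : 0 < (cyclicMap g l).length) (k : ℕ) :
    cycGet (cyclicMap g l) h' k =
      g (cycGet l h (k + (l.length - 1))) (cycGet l h k) (cycGet l h (k + 1)) := by
  simp only [cycGet, cyclicMap, List.getElem_ofFn, List.length_ofFn, Nat.mod_add_mod, Nat.mod_mod]

theorem map_cyclicMap {γ : Type*} (g : α → α → α → β) (f : β → γ) (f' : α → γ)
    (hf : ∀ p a b, f (g p a b) = f' a) (l : List α) : (cyclicMap g l).map f = l.map f' := by
  refine List.ext_getElem (by simp) fun k h1 h2 => ?_
  simp only [List.length_map] at h2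
  rw [List.getElem_map, List.getElem_map]
  simp only [cyclicMap, List.getElem_ofFn, hf, cycGet_of_lt h2]

end CyclicMap

/-! ### Lifting circuits to the split graph. -/

section Lift

variable {V E : Type*} {G : Multigraph V E} {d : E × Bool} {T : Set (E × Bool)}

open Classical in
/-- The lift of the oriented edge `a` to the split graph, if `a` is preceded by `p` and followed by
`b`. -/
noncomputable def liftLetter (G : Multigraph V E) (d : E × Bool) (T : Set (E × Bool))
    (p a b : E × Bool) : Option E × Bool :=
  (if (a = d ∧ rev p ∈ splitSet G d T) ∨ (a = rev d ∧ b ∈ splitSet G d T) then none else some a.1,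
    a.2)

theorem splitDir_liftLetter (p a b : E × Bool) : splitDir d (liftLetter G d T p a b) = a := by
  unfold liftLetter splitDir
  split_ifs with h
  · rcases h with ⟨rfl, -⟩ | ⟨rfl, -⟩ <;> rfl
  · rfl

theorem liftLetter_self (p b : E × Bool) [Decidable (rev p ∈ splitSet G d T)] :
    liftLetter G d T p d b = (if rev p ∈ splitSet G d T then none else some d.1, d.2) := by
  simp [liftLetter, (rev_ne d).symm]

theorem liftLetter_rev (p b : E × Bool) [Decidable (b ∈ splitSet G d T)] :
    liftLetter G d T p (rev d) b = (if b ∈ splitSet G d T then none else some d.1, !d.2) := by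
  simp only [liftLetter, rev_ne d, false_and, true_and, false_or]
  rfl

/-- The choice between `E₁` and `E₂` in `liftLetter` is made to this end: the lift of `d` starts
where the preceding letter arrives. `term_liftLetter_rev` is the counterpart for the opposite
orientation. -/
theorem init_liftLetter_self {p b : E × Bool} (hp : G.term p = G.init d) :
    (split G d T).init (liftLetter G d T p d b) = attach G d T (rev p) := by
  classical
  rw [liftLetter_self]
  split_ifs with h
  · rw [split_init_none, attach_of_mem h]
  · rw [split_init_some, attach_self, attach_of_notMem h, ← hp]
    rfl

theorem term_liftLetter_rev {p b : E × Bool} (hb : G.init d = G.init b) :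
    (split G d T).term (liftLetter G d T p (rev d) b) = attach G d T b := by
  classical
  rw [liftLetter_rev]
  split_ifs with h
  · rw [term, rev, Bool.not_not, split_init_none, attach_of_mem h]
  · rw [term, rev, Bool.not_not, split_init_some, attach_self, attach_of_notMem h, hb]

theorem split_term_of_ne {y : Option E × Bool} (h : splitDir d y ≠ rev d) :
    (split G d T).term y = attach G d T (rev (splitDir d y)) := by
  rw [term, split_init_of_ne, splitDir_rev]
  rwa [splitDir_rev, Ne, rev_eq_iff]

/-- Uniqueness of lifts of letters. -/
theorem eq_liftLetter {p b : E × Bool} {y : Option E × Bool}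
    (h1 : splitDir d y = d → (split G d T).init y = attach G d T (rev p))
    (h2 : splitDir d y = rev d → (split G d T).term y = attach G d T b) :
    y = liftLetter G d T p (splitDir d y) b := by
  classical
  rcases splitDir_eq_iff.1 (splitDir_liftLetter (G := G) (T := T) p (splitDir d y) b) with
    h | ⟨hβ, h | h⟩
  · exact h.symm
  · exfalso
    obtain ⟨z, β⟩ := y
    obtain rfl : z = none := h.2
    have h3 := h.1
    by_cases hd : splitDir d (none, β) = d
    · have h4 := h1 hd
      rw [hd, liftLetter_self] at h3
      have hβ' : β = d.2 := congrArg Prod.snd hd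
      rw [hβ', split_init_none] at h4
      split_ifs at h3 with h5
      rw [attach_of_notMem h5] at h4
      exact absurd h4 (by simp)
    · have hd' : splitDir d (none, β) = rev d :=
        (eq_or_eq_rev_of_fst_eq (show (splitDir d (none, β)).1 = d.1 from rfl)).resolve_left hd
      have h4 := h2 hd'
      rw [hd', liftLetter_rev] at h3
      have hβ' : β = !d.2 := congrArg Prod.snd hd'
      rw [hβ', term, rev, Bool.not_not, split_init_none] at h4
      split_ifs at h3 with h5
      rw [attach_of_notMem h5] at h4
      exact absurd h4 (by simp)
  · exfalso
    obtain ⟨z, β⟩ := y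
    obtain rfl : z = some d.1 := h.2
    have h3 := h.1
    by_cases hd : splitDir d (some d.1, β) = d
    · have h4 := h1 hd
      rw [hd, liftLetter_self] at h3
      have hβ' : β = d.2 := congrArg Prod.snd hd
      rw [hβ', split_init_some, attach_self] at h4
      split_ifs at h3 with h5
      rw [attach_of_mem h5] at h4
      exact absurd h4 (by simp)
    · have hd' : splitDir d (some d.1, β) = rev d :=
        (eq_or_eq_rev_of_fst_eq (show (splitDir d (some d.1, β)).1 = d.1 from rfl)).resolve_left hd
      have h4 := h2 hd'
      rw [hd', liftLetter_rev] at h3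
      have hβ' : β = !d.2 := congrArg Prod.snd hd'
      rw [hβ', term, rev, Bool.not_not, split_init_some, attach_self] at h4
      split_ifs at h3 with h5
      rw [attach_of_mem h5] at h4
      exact absurd h4 (by simp)

/-- The lift of a circuit to the split graph. -/
noncomputable def liftList (G : Multigraph V E) (d : E × Bool) (T : Set (E × Bool))
    (l : List (E × Bool)) : List (Option E × Bool) := cyclicMap (liftLetter G d T) l

theorem map_liftList (l : List (E × Bool)) : (liftList G d T l).map (splitDir d) = l := by
  rw [liftList, map_cyclicMap _ _ id splitDir_liftLetter, List.map_id]

variable {K : ℕ} {γ : Fin K → Cycle (E × Bool)}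

/-- Consecutive lifts fit together. At a turn involving `d` this holds by the choice of the lift of
`d` or `rev d`; at any other turn both directions lie on the same side of the cut
(`IsCutSet.closed`). -/
theorem isCircuit_liftList (hγ : ∀ i, IsCircuit G (γ i)) (hS : IsCutSet γ d (splitSet G d T))
    {i : Fin K} {l : List (E × Bool)} (hl : (l : Cycle (E × Bool)) = γ i) :
    IsCircuit (split G d T) (liftList G d T l : Cycle (Option E × Bool)) := by
  have hi := hγ i
  rw [← hl] at hi
  have h0 : 0 < l.length := List.length_pos_iff.2 fun e => hi.1 (by rw [e]; rfl)
  have h0' : 0 < (liftList G d T l).length := by rwa [liftList, length_cyclicMap]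
  have hch := (chain_iff_cycGet h0).1 hi.2
  refine ⟨fun e => h0'.ne' (by rw [(Cycle.coe_eq_nil _).1 e]; rfl), (chain_iff_cycGet h0').2 fun k => ?_⟩
  have hmap : ∀ k, splitDir d (cycGet (liftList G d T l) h0' k) = cycGet l h0 k := by
    intro k
    rw [← cycGet_map (f := splitDir d) h0' (by rwa [map_liftList])]
    simp only [map_liftList]
  constructor
  swap
  · intro e
    have := congrArg (splitDir d) e
    rw [splitDir_rev, hmap, hmap] at this
    exact (hch k).2 this
  have e1 : cycGet (liftList G d T l) h0' k = _ := cycGet_cyclicMap _ h0 h0' k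
  have e2 : cycGet (liftList G d T l) h0' (k + 1) = _ := cycGet_cyclicMap _ h0 h0' (k + 1)
  rw [show k + 1 + (l.length - 1) = k + l.length by omega, cycGet_add_length] at e2
  set a := cycGet l h0 k with ha
  set b := cycGet l h0 (k + 1) with hb
  obtain ⟨hab, hne⟩ := hch k
  rw [← ha, ← hb] at hab hne
  by_cases hbd : b = d
  · rw [hbd] at hne hab
    rw [e2, hbd, init_liftLetter_self hab, split_term_of_ne, hmap]
    rw [hmap, ← ha]
    intro e
    exact hne (by rw [e, rev_rev])
  · have hb1 : splitDir d (cycGet (liftList G d T l) h0' (k + 1)) = b := hmap _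
    have hinit := split_init_of_ne (G := G) (T := T) (hb1 ▸ hbd)
    rw [hinit, hb1]
    by_cases had : a = rev d
    · rw [e1, had, term_liftLetter_rev]
      rw [← hab, had, term, rev_rev]
    · rw [split_term_of_ne (by rwa [hmap]), hmap, ← ha]
      have hturn : TurnOf γ (rev a) b := by
        refine ⟨i, takesTurn_iff.2 (Or.inl ?_)⟩
        rw [rev_rev, ← hl]
        intro hc
        exact (chain_iff_cycGet h0).1 hc k ⟨rfl, rfl⟩
      have hrad : rev a ≠ d := by rwa [Ne, rev_eq_iff]
      by_cases hbS : b ∈ splitSet G d T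
      · rw [attach_of_mem hbS, attach_of_mem (hS.closed _ _ hturn.symm hrad hbS)]
      · rw [attach_of_notMem hbS,
          attach_of_notMem fun h => hbS (hS.closed _ _ hturn hbd h), ← hab]
        rfl

/-- By tightness the letter next to an end `d` is not itself attached there by `d`, so its attaching
vertex is known, and it forces the choice between `E₁` and `E₂`. -/
theorem eq_liftList {m : List (Option E × Bool)}
    (hm : IsCircuit (split G d T) (m : Cycle (Option E × Bool)))
    (hl : IsCircuit G (m.map (splitDir d) : List (E × Bool))) :
    m = liftList G d T (m.map (splitDir d)) := by
  have h0 : 0 < m.length := List.length_pos_iff.2 fun e => hm.1 (by rw [e]; rfl)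
  have h0' : 0 < (m.map (splitDir d)).length := by simpa using h0
  have h0'' : 0 < (liftList G d T (m.map (splitDir d))).length := by
    rwa [liftList, length_cyclicMap]
  refine ext_cycGet h0 h0'' (by rw [liftList, length_cyclicMap, List.length_map]) fun k => ?_
  have e : cycGet (liftList G d T (m.map (splitDir d))) h0'' k = _ := cycGet_cyclicMap _ h0' h0'' k
  rw [e]
  have hch := (chain_iff_cycGet h0).1 hm.2
  have hcl := (chain_iff_cycGet h0').1 hl.2
  simp only [cycGet_map h0] at hcl ⊢
  rw [List.length_map]
  have hk : cycGet m h0 (k + (m.length - 1) + 1) = cycGet m h0 k := by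
    rw [show k + (m.length - 1) + 1 = k + m.length by omega, cycGet_add_length]
  have h1 := hch (k + (m.length - 1))
  have h2 := hcl (k + (m.length - 1))
  rw [hk] at h1 h2
  refine eq_liftLetter (fun hd => ?_) (fun hd => ?_)
  · rw [← h1.1, split_term_of_ne]
    intro e
    rw [e, rev_rev] at h2
    exact h2.2 hd
  · rw [(hch k).1, split_init_of_ne]
    intro e
    have := (hcl k).2
    rw [e, hd, rev_rev] at this
    exact this rfl

theorem isSplitFamily_iff (hγ : IsCircuitFamily G γ) (hS : IsCutSet γ d (splitSet G d T))
    {y : Fin K → List (E × Bool)} (hy : ∀ i, (y i : Cycle (E × Bool)) = γ i)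
    {δ : Fin K → Cycle (Option E × Bool)} :
    IsSplitFamily G d T γ δ ↔ δ = fun i => (liftList G d T (y i) : Cycle (Option E × Bool)) := by
  constructor
  · rintro ⟨⟨hδ, -⟩, -, hf⟩
    funext i
    have h1 := hδ i
    have h2 := hf i
    rw [splitFold_onCycle, ← hy i] at h2
    revert h1 h2
    induction δ i using Quotient.inductionOn' with
    | h m =>
      intro h1 h2
      change ((m.map (splitDir d) : List _) : Cycle (E × Bool)) = _ at h2
      obtain ⟨k, hk⟩ := Cycle.coe_eq_coe.1 h2
      rw [← List.map_rotate] at hk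
      have e : (m : Cycle (Option E × Bool)) = (m.rotate k : List _) :=
        Cycle.coe_eq_coe.2 ⟨k, rfl⟩
      change IsCircuit _ (m : Cycle (Option E × Bool)) at h1
      change (m : Cycle (Option E × Bool)) = _
      rw [e] at h1 ⊢
      have h3 := eq_liftList h1 (by rw [hk, hy i]; exact hγ.1 i)
      rw [hk] at h3
      rw [h3]
  · rintro rfl
    have hmap : ∀ i, (splitFold G d T).onCycle (liftList G d T (y i) : Cycle (Option E × Bool)) =
        γ i := by
      intro i
      rw [splitFold_onCycle, ← hy i, Cycle.map_coe, map_liftList]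
    refine ⟨⟨fun i => isCircuit_liftList hγ.1 hS (hy i), fun i j hij => hγ.2 ?_⟩, ?_, hmap⟩
    · rw [← hmap i, ← hmap j]
      exact congrArg _ hij
    -- An illegal turn taken by the lift would be folded to a degenerate turn, that is, a
    -- backtracking of `γ`.
    · rintro i a b ⟨hne, -, hab⟩ hturn
      rw [splitFold_onDir, splitFold_onDir] at hab
      have hab' : splitDir d a = splitDir d b := by simpa using hab
      have : TurnOf γ (splitDir d a) (splitDir d b) := by
        have h := (turnOf_map (D := splitDir d) (splitDir_rev)
          (δ := fun i => (liftList G d T (y i) : Cycle (Option E × Bool)))).2 ⟨a, b, ⟨i, hturn⟩, rfl, rfl⟩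
        simpa only [← splitFold_onCycle (G := G) (T := T), hmap] using h
      exact (tight_of_isCircuit hγ.1).turn_ne this hab'.symm

theorem existsUnique_isSplitFamily (hγ : IsCircuitFamily G γ)
    (hS : IsCutSet γ d (splitSet G d T)) : ∃! δ, IsSplitFamily G d T γ δ := by
  have h : ∀ i, ∃ l : List (E × Bool), (l : Cycle (E × Bool)) = γ i := fun i =>
    (γ i).exists_rep
  choose y hy using h
  exact ⟨_, (isSplitFamily_iff hγ hS hy).2 rfl, fun δ hδ => (isSplitFamily_iff hγ hS hy).1 hδ⟩

end Lift

/-! ### Crossing numbers and natural weights. -/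

section Counting

variable {V E : Type*} {G : Multigraph V E} {K : ℕ} {γ : Fin K → Cycle (E × Bool)}

/-- Trades the classical equality test in `crossings` for a given one. -/
theorem crossings_def [DecidableEq E] (γ : Fin K → Cycle (E × Bool)) (e : E) :
    crossings γ e = ∑ i, ((γ i).toMultiset.map Prod.fst).count e := by
  unfold crossings
  congr!

/-- Passing to the successor permutes the positions and matches the occurrences of `p` with those of
`q`. -/
theorem count_eq_of_follows {α : Type*} [DecidableEq α] {c : Cycle α} {p q : α}
    (h : ∀ x y, Follows c x y → (x = p ↔ y = q)) : c.toMultiset.count p = c.toMultiset.count q := by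
  induction c using Quotient.inductionOn' with
  | h l =>
    change (l : Multiset α).count p = (l : Multiset α).count q
    rw [Multiset.coe_count, Multiset.coe_count, ← (List.rotate_perm l 1).count_eq q]
    have key : l.map (fun x => decide (x = p)) = (l.rotate 1).map fun x => decide (x = q) := by
      refine List.ext_getElem (by simp) fun i h1 h2 => ?_
      simp only [List.length_map] at h1
      simp only [List.getElem_map, List.getElem_rotate, decide_eq_decide]
      exact h _ _ (follows_coe_iff.2 ⟨i, h1, rfl, rfl⟩)
    have hc : ∀ (r : α) (l : List α), l.count r = (l.map fun x => decide (x = r)).count true := by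
      intro r l
      induction l with
      | nil => rfl
      | cons a l ih =>
        rw [List.count_cons, List.map_cons, List.count_cons, ih]
        simp
    rw [hc, hc, key]

theorem crossings_eq_sum [DecidableEq E] (γ : Fin K → Cycle (E × Bool)) (a : E × Bool) : crossings γ a.1 =
    ∑ i, ((γ i).toMultiset.count a + (γ i).toMultiset.count (rev a)) := by
  rw [crossings_def]
  refine Finset.sum_congr rfl fun i _ => ?_
  induction (γ i).toMultiset using Multiset.induction_on with
  | empty => simp
  | cons b s ih =>
    rw [Multiset.map_cons, Multiset.count_cons, Multiset.count_cons, Multiset.count_cons, ih]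
    by_cases hab : a.1 = b.1
    · rcases eq_or_eq_rev_of_fst_eq hab with rfl | rfl
      · simp [(rev_ne a)]
        omega
      · simp [rev_rev, rev_ne]
        omega
    · have h1 : a ≠ b := fun e => hab (by rw [e])
      have h2 : rev a ≠ b := fun e => hab (by rw [← e]; rfl)
      rw [if_neg hab, if_neg h1, if_neg h2]
      omega

theorem eq_or_eq_of_valence_two {a b c : E × Bool} (h : G.valence (G.init a) = 2) (hab : a ≠ b)
    (hb : G.init b = G.init a) (hc : G.init c = G.init a) : c = a ∨ c = b := by
  obtain ⟨x, y, -, e⟩ := Set.ncard_eq_two.1 h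
  have ha' : a ∈ G.directions (G.init a) := rfl
  have hb' : b ∈ G.directions (G.init a) := hb
  have hc' : c ∈ G.directions (G.init a) := hc
  rw [e] at ha' hb' hc'
  simp only [Set.mem_insert_iff, Set.mem_singleton_iff] at ha' hb' hc'
  grind

theorem valence_eq_two {a b : E × Bool} (hab : a ≠ b) (hb : G.init b = G.init a)
    (h : ∀ c, G.init c = G.init a → c = a ∨ c = b) : G.valence (G.init a) = 2 := by
  refine Set.ncard_eq_two.2 ⟨a, b, hab, Set.ext fun c => ⟨fun hc => h c hc, ?_⟩⟩
  rintro (rfl | rfl)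
  · rfl
  · exact hb

/-- A circuit family crosses the two edges at a vertex of valence two equally often. -/
theorem crossings_eq_of_valence_two (hγ : ∀ i, IsCircuit G (γ i)) {a b : E × Bool}
    (hb : G.init b = G.init a) (h : G.valence (G.init a) = 2) :
    crossings γ a.1 = crossings γ b.1 := by
  classical
  by_cases hab : a = b
  · rw [hab]
  have key : ∀ a b, a ≠ b → G.init b = G.init a → G.valence (G.init a) = 2 → ∀ i,
      (γ i).toMultiset.count a = (γ i).toMultiset.count (rev b) := by
    intro a b hab hb h i
    refine (count_eq_of_follows fun x y hxy => ?_).symm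
    have h1 := (hγ i).term_eq hxy
    have h2 := (hγ i).tight hxy
    constructor
    · rintro rfl
      rw [rev_rev] at h2
      rw [term_rev, hb] at h1
      exact (eq_or_eq_of_valence_two h hab hb h1.symm).resolve_right h2
    · rintro rfl
      have := (eq_or_eq_of_valence_two h hab hb h1).resolve_left (Ne.symm h2)
      rw [← this, rev_rev]
  rw [crossings_eq_sum γ a, crossings_eq_sum γ b]
  refine Finset.sum_congr rfl fun i _ => ?_
  rw [key a b hab hb h i, ← key b a (Ne.symm hab) hb.symm (by rwa [hb]) i, add_comm]

theorem crossings_eq_of_natural (hγ : ∀ i, IsCircuit G (γ i)) {e e' : E}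
    (h : naturalSetoid G e e') : crossings γ e = crossings γ e' := by
  replace h : Relation.EqvGen _ e e' := h
  induction h with
  | rel x y h =>
    obtain ⟨β, β', hi, hv⟩ := h
    exact crossings_eq_of_valence_two hγ (a := (x, β)) (b := (y, β')) hi.symm hv
  | refl => rfl
  | symm _ _ _ ih => exact ih.symm
  | trans _ _ _ _ _ ih ih' => exact ih.trans ih'

theorem naturalWeight_eq_ncard {k : ℕ}
    (h : ∀ e e', crossings γ e = k → naturalSetoid G e e' → e = e') :
    naturalWeight G γ k = {e | crossings γ e = k}.ncard := by
  have : {N : Quotient (naturalSetoid G) | ∃ e, Quotient.mk (naturalSetoid G) e = N ∧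
      crossings γ e = k} = Quotient.mk (naturalSetoid G) '' {e | crossings γ e = k} := by
    ext N
    exact ⟨fun ⟨e, h1, h2⟩ => ⟨e, h2, h1⟩, fun ⟨e, h1, h2⟩ => ⟨e, h2, h1⟩⟩
  rw [naturalWeight, this]
  exact Set.InjOn.ncard_image fun e he e' he' hee => h e e' he (Quotient.exact hee)

/-- Lets natural edges be counted as edges: in the application `p` fixes the crossing number, and at
that level no two different edges are linked at a vertex of valence two. -/
theorem eq_of_natural {p : E → Prop} (hp : ∀ e e', naturalSetoid G e e' → (p e ↔ p e'))
    (h : ∀ a b : E × Bool, p a.1 → p b.1 → G.init a = G.init b → G.valence (G.init a) = 2 →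
      a.1 = b.1) {e e' : E} (he : p e) (hee : naturalSetoid G e e') : e = e' := by
  replace hee : Relation.EqvGen _ e e' := hee
  induction hee with
  | rel x y hxy =>
    obtain ⟨β, β', hi, hv⟩ := hxy
    exact h (x, β) (y, β') he ((hp _ _ (Relation.EqvGen.rel _ _ ⟨β, β', hi, hv⟩)).1 he) hi hv
  | refl => rfl
  | symm x y hxy ih => exact (ih ((hp _ _ hxy).2 he)).symm
  | trans x y z hxy hyz ih ih' =>
    exact (ih he).trans (ih' ((hp _ _ hxy).1 he))

theorem eq_of_natural_of_valence_ne_two (h : ∀ v, G.valence v ≠ 2) {e e' : E}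
    (hee : naturalSetoid G e e') : e = e' :=
  eq_of_natural (p := fun _ => True) (fun _ _ _ => Iff.rfl) (fun _ _ _ _ _ hv => absurd hv (h _))
    trivial hee

end Counting

/-! ### Splitting decreases the natural weight. -/

section SplitWeight

variable {V E : Type*} {G : Multigraph V E} {d : E × Bool} {T : Set (E × Bool)} {K : ℕ}
  {γ : Fin K → Cycle (E × Bool)} {δ : Fin K → Cycle (Option E × Bool)}

theorem crossings_map_splitDir [DecidableEq E] (h : ∀ i, (δ i).map (splitDir d) = γ i) (x : E) :
    crossings γ x = crossings δ (some x) + if x = d.1 then crossings δ none else 0 := by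
  have hi : ∀ i, ((γ i).toMultiset.map Prod.fst).count x =
      ((δ i).toMultiset.map Prod.fst).count (some x) +
        if x = d.1 then ((δ i).toMultiset.map Prod.fst).count none else 0 := by
    intro i
    have : (γ i).toMultiset = (δ i).toMultiset.map (splitDir d) := by
      rw [← h i]
      induction δ i using Quotient.inductionOn' with
      | h l => rfl
    rw [this]
    induction (δ i).toMultiset using Multiset.induction_on with
    | empty => simp
    | cons b s ih =>
      rw [Multiset.map_cons, Multiset.map_cons, Multiset.map_cons, Multiset.count_cons,
        Multiset.count_cons, Multiset.count_cons, ih]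
      obtain ⟨_ | y, β⟩ := b
      · simp only [splitDir, Option.getD_none, reduceCtorEq, if_false, if_true, add_zero]
        by_cases hx : x = d.1
        · simp only [hx, if_true]
          omega
        · simp only [hx, if_false]
      · simp only [splitDir, Option.getD_some, reduceCtorEq, if_false, add_zero, Option.some.injEq]
        by_cases hxy : x = y <;> simp only [hxy, if_true, if_false] <;> omega
  rw [crossings_def, crossings_def, crossings_def, Finset.sum_congr rfl fun i _ => hi i, Finset.sum_add_distrib]
  split_ifs
  · rfl
  · simp

/-- A cut needs three directions, namely `d` and a neighbour on each side, so the graph is not a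
circle. -/
theorem valence_ne_two_of_isCutSet (hγ : ∀ i, IsCircuit G (γ i)) (hn : G.IsNatural)
    (hS : IsCutSet γ d (splitSet G d T)) (v : V) : G.valence v ≠ 2 := by
  rcases hn with h | h
  · exact h v
  · obtain ⟨x, hx, hdx⟩ := hS.inside
    obtain ⟨y, hy, hyd, hdy⟩ := hS.outside
    rcases eq_or_eq_of_valence_two (h (G.init d)) (Ne.symm hx.2.1) (hdx.init_eq hγ).symm
      (hdy.init_eq hγ).symm with e | e
    · exact absurd e hyd
    · exact absurd (e ▸ hx) hy

theorem split_valence_ne_two (hG : G.IsCore) (h2 : ∀ v, G.valence v ≠ 2) {u : V}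
    (hu : u ≠ G.init d) : (split G d T).valence (some u) ≠ 2 := by
  intro h
  obtain ⟨a, b, hab, ha, hb⟩ := exists_init_eq hG hu
  have key : ∀ c, G.init c = u → (split G d T).init (some c.1, c.2) = some u := by
    intro c hc
    rw [split_init_some, attach_of_ne (hc ▸ hu), hc]
  have hinj : ∀ c c' : E × Bool, ((some c.1, c.2) : Option E × Bool) = (some c'.1, c'.2) → c = c' := by
    intro c c' h
    simpa [Prod.ext_iff] using h
  refine h2 u ?_
  rw [← ha]
  refine valence_eq_two hab (hb.trans ha.symm) fun c hc => ?_
  have := eq_or_eq_of_valence_two (G := split G d T) (a := (some a.1, a.2)) (b := (some b.1, b.2))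
    (c := (some c.1, c.2)) (by rwa [key a ha]) (fun e => hab (hinj _ _ e))
    ((key b hb).trans (key a ha).symm) ((key c (hc.trans ha)).trans (key a ha).symm)
  exact this.imp (hinj _ _) (hinj _ _)

/-- The turns that join `d` to the two sides lift to turns at `v₂` and `v₁`, which involve `E₂` and
`E₁`. -/
theorem crossings_none_pos (hS : IsCutSet γ d (splitSet G d T))
    (hδ : ∀ i, IsCircuit (split G d T) (δ i)) (h : ∀ i, (δ i).map (splitDir d) = γ i) :
    0 < crossings δ none ∧ 0 < crossings δ (some d.1) := by
  have key : ∀ x, x ≠ d → TurnOf γ d x → ∃ y : Option E × Bool, (∃ i, y ∈ δ i ∨ rev y ∈ δ i) ∧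
      splitDir d y = d ∧ (split G d T).init y = attach G d T x := by
    intro x hxd hx
    have hx' : TurnOf (fun i => (δ i).map (splitDir d)) d x := by simpa only [h] using hx
    obtain ⟨y, z, hyz, hy, hz⟩ := (turnOf_map splitDir_rev).1 hx'
    refine ⟨y, hyz.crossed, hy, ?_⟩
    rw [hyz.init_eq hδ, split_init_of_ne (hz ▸ hxd), hz]
  have pos : ∀ y : Option E × Bool, (∃ i, y ∈ δ i ∨ rev y ∈ δ i) → 0 < crossings δ y.1 := by
    rintro y ⟨i, hi | hi⟩
    · exact crossings_pos_of_mem hi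
    · exact crossings_pos_of_mem (x := rev y) hi
  obtain ⟨x, hx, hdx⟩ := hS.inside
  obtain ⟨y, hy, hyd, hdy⟩ := hS.outside
  constructor
  · obtain ⟨⟨_ | z, β⟩, hc, e, hi⟩ := key x hx.2.1 hdx
    · exact pos _ hc
    · obtain rfl : (z, β) = d := e
      rw [attach_of_mem hx] at hi
      exact absurd (attach_self.symm.trans hi) (by simp)
  · obtain ⟨⟨_ | z, β⟩, hc, e, hi⟩ := key y hyd hdy
    · obtain rfl : β = d.2 := congrArg Prod.snd e
      rw [attach_of_notMem hy, split_init_none] at hi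
      exact absurd hi (by simp)
    · obtain rfl : (z, β) = d := e
      exact pos _ hc

/-- Splitting decreases the natural weight sequence. -/
theorem weightLT_split [Finite E] (hG : G.IsCore) (hn : G.IsNatural) (hγ : ∀ i, IsCircuit G (γ i))
    (hS : IsCutSet γ d (splitSet G d T)) (hδ : ∀ i, IsCircuit (split G d T) (δ i))
    (h : ∀ i, (δ i).map (splitDir d) = γ i) :
    WeightLT (naturalWeight (split G d T) δ) (naturalWeight G γ) := by
  classical
  have h2 := valence_ne_two_of_isCutSet hγ hn hS
  obtain ⟨hpos1, hpos2⟩ := crossings_none_pos hS hδ h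
  have hd := crossings_map_splitDir h d.1
  rw [if_pos rfl] at hd
  have hx : ∀ x, x ≠ d.1 → crossings δ (some x) = crossings γ x := by
    intro x hx
    rw [crossings_map_splitDir h x, if_neg hx, add_zero]
  have hG' : ∀ i, naturalWeight G γ i = {e | crossings γ e = i}.ncard := fun i =>
    naturalWeight_eq_ncard fun e e' _ hee => eq_of_natural_of_valence_ne_two h2 hee
  -- `E₁` and `E₂` are crossed less often than `E`, and any vertex of valence two in the split graph
  -- is an end of one of them. So at the levels considered no edges are merged, and only `E` is
  -- missing.
  have hH : ∀ i, crossings γ d.1 ≤ i → naturalWeight (split G d T) δ i =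
      {e | e ≠ d.1 ∧ crossings γ e = i}.ncard := by
    intro i hi
    have e : {z | crossings δ z = i} = some '' {e | e ≠ d.1 ∧ crossings γ e = i} := by
      ext z
      constructor
      · intro hz
        have hz' : crossings δ z = i := hz
        cases z with
        | none => omega
        | some x =>
          have hxd : x ≠ d.1 := by
            rintro rfl
            omega
          exact ⟨x, ⟨hxd, by rw [← hx x hxd, hz']⟩, rfl⟩
      · rintro ⟨x, ⟨hxd, hxi⟩, rfl⟩
        exact (hx x hxd).trans hxi
    rw [naturalWeight_eq_ncard, e, Set.ncard_image_of_injective _ (Option.some_injective _)]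
    intro z z' hz hzz
    refine eq_of_natural (p := fun z => crossings δ z = i) (fun z z' hzz => ?_) ?_ hz hzz
    · rw [crossings_eq_of_natural hδ hzz]
    · rintro a b ha hb hab hv
      by_contra hne
      have hne' : a ≠ b := fun e => hne (by rw [e])
      cases hw : (split G d T).init a with
      | none =>
        have := eq_or_eq_of_valence_two hv hne' hab.symm
          (c := (none, d.2)) (split_init_none.trans hw.symm)
        rcases this with rfl | rfl
        · simp only at ha
          omega
        · simp only at hb
          omega
      | some u =>
        rw [hw] at hv
        have hu : u = G.init d := by
          by_contra hu
          exact split_valence_ne_two hG h2 hu hv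
        rw [← hw] at hv
        have := eq_or_eq_of_valence_two hv hne' hab.symm (c := (some d.1, d.2))
          (attach_self.trans (by rw [hw, hu]))
        rcases this with rfl | rfl
        · simp only at ha
          omega
        · simp only at hb
          omega
  -- The last difference occurs at the crossing number of `E`, where `E` itself is lost.
  refine ⟨crossings γ d.1, fun i hi => ?_, ?_⟩
  · rw [hG', hH i hi.le]
    congr 1
    ext e
    refine ⟨fun h => h.2, fun h => ⟨?_, h⟩⟩
    rintro rfl
    exact hi.ne h
  · rw [hG', hH _ le_rfl]
    refine Set.ncard_lt_ncard ⟨fun e h => h.2, fun h => ?_⟩ (Set.toFinite _)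
    exact (h (show d.1 ∈ {e | crossings γ e = crossings γ d.1} from rfl)).1 rfl

end SplitWeight

/-! ### Graph maps that cover each edge exactly once. -/

section Cover

variable {V E V' E' : Type*} {G : Multigraph V E} {G' : Multigraph V' E'}

/-- Each edge of the target is crossed exactly once by the images of the edges. -/
structure GraphMap.Covers (h : GraphMap G G') : Prop where
  surj : ∀ x, ∃ e, x ∈ (h.onE e).map Prod.fst
  nodup : ∀ e, ((h.onE e).map Prod.fst).Nodup
  inj : ∀ x e e', x ∈ (h.onE e).map Prod.fst → x ∈ (h.onE e').map Prod.fst → e = e'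

/-- `Covers` separates existence from the two kinds of uniqueness, which makes it easier to compose.
-/
theorem GraphMap.covers_iff {h : GraphMap G G'} : h.Covers ↔
    ∀ x : E', ∃! p : (e : E) × Fin (h.onE e).length, ((h.onE p.1).get p.2).1 = x := by
  have hmem : ∀ {x e}, x ∈ (h.onE e).map Prod.fst →
      ∃ i : Fin (h.onE e).length, ((h.onE e).get i).1 = x := by
    intro x e hx
    obtain ⟨y, hy, rfl⟩ := List.mem_map.1 hx
    obtain ⟨i, hi⟩ := List.mem_iff_get.1 hy
    exact ⟨i, by rw [hi]⟩
  have hmem' : ∀ p : (e : E) × Fin (h.onE e).length,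
      ((h.onE p.1).get p.2).1 ∈ (h.onE p.1).map Prod.fst := fun p =>
    List.mem_map.2 ⟨_, List.get_mem _ _, rfl⟩
  constructor
  · intro hc x
    obtain ⟨e, he⟩ := hc.surj x
    obtain ⟨i, hi⟩ := hmem he
    refine ⟨⟨e, i⟩, hi, ?_⟩
    rintro ⟨e', j⟩ hj
    simp only at hj
    obtain rfl := hc.inj x e e' he (hj ▸ hmem' ⟨e', j⟩)
    have := List.nodup_iff_injective_get.1 (hc.nodup e)
    have hij := @this ⟨i, by simp⟩ ⟨j, by simp⟩ (by simpa using hi.trans hj.symm)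
    simp only [Fin.mk.injEq] at hij
    rw [Fin.ext hij]
  · intro H
    refine ⟨fun x => ?_, fun e => ?_, fun x e e' he he' => ?_⟩
    · obtain ⟨p, hp, -⟩ := H x
      exact ⟨p.1, hp ▸ hmem' p⟩
    · rw [List.nodup_iff_injective_get]
      intro i j hij
      have hi : (i : ℕ) < (h.onE e).length := by simpa using i.2
      have hj : (j : ℕ) < (h.onE e).length := by simpa using j.2
      have := (H ((h.onE e).get ⟨i, hi⟩).1).unique (y₁ := ⟨e, ⟨i, hi⟩⟩) (y₂ := ⟨e, ⟨j, hj⟩⟩) rfl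
        (by simpa using hij.symm)
      simpa [Fin.ext_iff] using this
    · obtain ⟨i, hi⟩ := hmem he
      obtain ⟨j, hj⟩ := hmem he'
      exact congrArg Sigma.fst ((H x).unique (y₁ := ⟨e, i⟩) (y₂ := ⟨e', j⟩) hi hj)

theorem GraphMap.map_fst_onDir_perm (h : GraphMap G G') (a : E × Bool) :
    ((h.onDir a).map Prod.fst).Perm ((h.onE a.1).map Prod.fst) := by
  obtain ⟨e, b⟩ := a
  cases b
  · rw [onDir_false, invRev_eq_map_rev, List.map_reverse, List.map_map]
    exact List.reverse_perm _
  · rw [onDir_true]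

theorem GraphMap.Covers.nodup_onDir {h : GraphMap G G'} (hc : h.Covers) (a : E × Bool) :
    ((h.onDir a).map Prod.fst).Nodup := (h.map_fst_onDir_perm a).nodup_iff.2 (hc.nodup _)

theorem GraphMap.Covers.fst_eq {h : GraphMap G G'} (hc : h.Covers) {a b : E × Bool} {x : E'}
    (ha : x ∈ (h.onDir a).map Prod.fst) (hb : x ∈ (h.onDir b).map Prod.fst) : a.1 = b.1 :=
  hc.inj x _ _ ((h.map_fst_onDir_perm a).mem_iff.1 ha) ((h.map_fst_onDir_perm b).mem_iff.1 hb)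

theorem GraphMap.Covers.exists_mem_onDir {h : GraphMap G G'} (hc : h.Covers) (y : E' × Bool) :
    ∃ a, y ∈ h.onDir a := by
  obtain ⟨e, he⟩ := hc.surj y.1
  obtain ⟨z, hz, hzy⟩ := List.mem_map.1 he
  rcases eq_or_eq_rev_of_fst_eq hzy with rfl | rfl
  · exact ⟨(e, true), by rwa [onDir_true]⟩
  · refine ⟨(e, false), ?_⟩
    rw [onDir_false, invRev_eq_map_rev, List.mem_reverse, List.mem_map]
    exact ⟨_, hz, rev_rev y⟩

theorem GraphMap.Covers.crossings_onCycle {h : GraphMap G G'} (hc : h.Covers) {K : ℕ}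
    (γ : Fin K → Cycle (E × Bool)) {e : E} {x : E'} (hx : x ∈ (h.onE e).map Prod.fst) :
    crossings (fun i => h.onCycle (γ i)) x = crossings γ e := by
  classical
  rw [crossings_def, crossings_def]
  refine Finset.sum_congr rfl fun i _ => ?_
  induction γ i using Quotient.inductionOn' with
  | h l =>
    change ((h.onPath l : Multiset (E' × Bool)).map Prod.fst).count x =
      ((l : Multiset (E × Bool)).map Prod.fst).count e
    rw [Multiset.map_coe, Multiset.map_coe, Multiset.coe_count, Multiset.coe_count]
    induction l with
    | nil => rfl
    | cons a l ih =>
      rw [onPath_cons, List.map_append, List.count_append, ih, List.map_cons, List.count_cons,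
        (h.map_fst_onDir_perm a).count_eq, add_comm]
      congr 1
      by_cases hae : a.1 = e
      · rw [hae, List.count_eq_one_of_mem (hc.nodup e) hx]
        simp
      · rw [List.count_eq_zero.2 fun hx' => hae (hc.inj x _ _ hx' hx)]
        simp [hae]

end Cover

/-! ### Natural cell structures and invariance of the weight. -/

section NaturalStructure

variable {V E V' E' : Type*} {G : Multigraph V E} {G' : Multigraph V' E'} {h : GraphMap G G'}

theorem GraphMap.IsNaturalStructure.covers (hn : h.IsNaturalStructure) : h.Covers :=
  GraphMap.covers_iff.2 hn.cover

theorem GraphMap.IsNaturalStructure.onDir_ne_nil (hn : h.IsNaturalStructure) (a : E × Bool) :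
    h.onDir a ≠ [] := by
  have := hn.nonempty a.1
  obtain ⟨e, b⟩ := a
  cases b
  · rw [onDir_false]
    intro e'
    exact this (by simpa [invRev_eq_map_rev] using e')
  · rwa [onDir_true]

theorem GraphMap.IsNaturalStructure.valence_eq_two (hn : h.IsNaturalStructure) {a : E × Bool}
    {l₁ l₂ : List (E' × Bool)} {p q : E' × Bool} (e : h.onDir a = l₁ ++ p :: q :: l₂) :
    G'.valence (G'.term p) = 2 ∧ G'.term p = G'.init q := by
  have hp := h.isPath_onDir a
  rw [e] at hp
  obtain ⟨u, -, -, hq, -⟩ := isPath_append_iff.1 hp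
  refine ⟨?_, hq.symm⟩
  have hi := hn.interior a.1
  obtain ⟨x, b⟩ := a
  cases b
  · have e' : h.onE x = FreeGroup.invRev l₂ ++ rev q :: rev p :: FreeGroup.invRev l₁ := by
      rw [← FreeGroup.invRev_invRev (L₁ := h.onE x), ← onDir_false, e, invRev_append]
      simp [FreeGroup.invRev, rev]
    rw [e', List.isChain_append_cons_cons] at hi
    rw [← hq, ← term_rev]
    exact hi.2.1
  · rw [← onDir_true, e, List.isChain_append_cons_cons] at hi
    exact hi.2.1

/-- If `y` were preceded by another letter in its chain, its initial vertex would be interior to the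
chain, hence of valence two. -/
theorem GraphMap.IsNaturalStructure.exists_onDir_eq_cons (hn : h.IsNaturalStructure) {y : E' × Bool}
    (hy : G'.valence (G'.init y) ≠ 2) : ∃ a r, h.onDir a = y :: r := by
  obtain ⟨a, ha⟩ := hn.covers.exists_mem_onDir y
  obtain ⟨l₁, l₂, e⟩ := List.append_of_mem ha
  rcases List.eq_nil_or_concat l₁ with rfl | ⟨l, z, rfl⟩
  · exact ⟨a, l₂, e⟩
  · rw [List.concat_eq_append, List.append_assoc] at e
    obtain ⟨h1, h2⟩ := hn.valence_eq_two e
    rw [h2] at h1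
    exact absurd h1 hy

theorem GraphMap.init_of_onDir_eq_cons {a : E × Bool} {y : E' × Bool} {r : List (E' × Bool)}
    (e : h.onDir a = y :: r) : G'.init y = h.onV (G.init a) := by
  have := h.isPath_onDir a
  rw [e] at this
  exact this.1

/-- Both have the same underlying edge. If they were reverse to each other, the reverse of `y` would
be the last letter of the image, so the image would cross an edge twice or `y` would be its own
reverse. -/
theorem GraphMap.Covers.eq_of_onDir_eq_cons (hc : h.Covers) {a b : E × Bool} {y : E' × Bool}
    {r r' : List (E' × Bool)} (ha : h.onDir a = y :: r) (hb : h.onDir b = y :: r') : a = b := by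
  have h1 : a.1 = b.1 := hc.fst_eq (x := y.1) (by simp [ha]) (by simp [hb])
  rcases eq_or_eq_rev_of_fst_eq h1 with h2 | h2
  · exact h2
  · exfalso
    have hnd := hc.nodup_onDir b
    rw [h2, onDir_rev, hb] at ha
    have e : FreeGroup.invRev (y :: r') = FreeGroup.invRev r' ++ [rev y] := by
      simp [FreeGroup.invRev, rev]
    rw [e] at ha
    cases hr : FreeGroup.invRev r' with
    | nil =>
      rw [hr] at ha
      exact rev_ne y (by simpa using (List.cons.inj ha).1)
    | cons z t =>
      rw [hr] at ha
      obtain rfl : z = y := (List.cons.inj ha).1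
      have hm : z ∈ FreeGroup.invRev r' := by rw [hr]; exact List.mem_cons_self
      rw [invRev_eq_map_rev, List.mem_reverse, List.mem_map] at hm
      obtain ⟨x, hx, rfl⟩ := hm
      rw [hb, List.map_cons, List.nodup_cons] at hnd
      exact hnd.1 (List.mem_map.2 ⟨x, hx, rfl⟩)

/-- First letters of image chains match the directions at `u` with those at its image. -/
theorem GraphMap.IsNaturalStructure.valence_ne_two (hn : h.IsNaturalStructure) (u : V) :
    G.valence u ≠ 2 := by
  intro hu
  have hw : G'.valence (h.onV u) ≠ 2 := by
    have : h.onV u ∈ {w | G'.valence w ≠ 2} := hn.range ▸ ⟨u, rfl⟩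
    exact this
  obtain ⟨a, b, hab, e⟩ := Set.ncard_eq_two.1 hu
  have ha : G.init a = u := show a ∈ G.directions u by rw [e]; simp
  have hb : G.init b = u := show b ∈ G.directions u by rw [e]; simp
  obtain ⟨x, r, hx⟩ := List.exists_cons_of_ne_nil (hn.onDir_ne_nil a)
  obtain ⟨y, r', hy⟩ := List.exists_cons_of_ne_nil (hn.onDir_ne_nil b)
  have hx' := GraphMap.init_of_onDir_eq_cons hx
  have hy' := GraphMap.init_of_onDir_eq_cons hy
  rw [ha] at hx'
  rw [hb] at hy'
  refine hw ?_
  rw [← hx']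
  refine Whitehead.valence_eq_two (b := y) ?_ (hy'.trans hx'.symm) fun c hc => ?_
  · rintro rfl
    exact hab (hn.covers.eq_of_onDir_eq_cons hx hy)
  · obtain ⟨a', r'', hc'⟩ := hn.exists_onDir_eq_cons (y := c) (by rw [hc, hx']; exact hw)
    have h3 := GraphMap.init_of_onDir_eq_cons hc'
    rw [hc, hx'] at h3
    have h4 : a' ∈ G.directions u := (hn.inj h3).symm
    rw [e] at h4
    rcases h4 with rfl | rfl
    · left
      rw [hx] at hc'
      exact (List.cons.inj hc').1.symm
    · right
      rw [hy] at hc'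
      exact (List.cons.inj hc').1.symm

/-- Linked edges lie in the image of the same edge. -/
theorem GraphMap.IsNaturalStructure.eq_of_natural (hn : h.IsNaturalStructure) {x x' : E'}
    (hxx : naturalSetoid G' x x') :
    ∀ e, x ∈ (h.onE e).map Prod.fst ↔ x' ∈ (h.onE e).map Prod.fst := by
  replace hxx : Relation.EqvGen _ x x' := hxx
  induction hxx with
  | rel x y hxy =>
    obtain ⟨β, β', hi, hv⟩ := hxy
    have key : ∀ x y : E' × Bool, G'.init x = G'.init y → G'.valence (G'.init x) = 2 → ∀ e,
        x.1 ∈ (h.onE e).map Prod.fst → y.1 ∈ (h.onE e).map Prod.fst := by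
      intro x y hi hv e hx
      obtain ⟨a, ha⟩ := hn.covers.exists_mem_onDir x
      obtain rfl : e = a.1 := hn.covers.inj _ _ _ hx
        ((h.map_fst_onDir_perm a).mem_iff.1 (List.mem_map.2 ⟨x, ha, rfl⟩))
      rw [← (h.map_fst_onDir_perm a).mem_iff]
      obtain ⟨l₁, l₂, e⟩ := List.append_of_mem ha
      rcases List.eq_nil_or_concat l₁ with rfl | ⟨l, z, rfl⟩
      · exfalso
        have : G'.init x ∈ {w | G'.valence w ≠ 2} := by
          rw [← hn.range]
          exact ⟨_, (GraphMap.init_of_onDir_eq_cons e).symm⟩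
        exact this hv
      · rw [List.concat_eq_append, List.append_assoc] at e
        have h2 := (hn.valence_eq_two e).2
        have hne : x ≠ rev z := by
          rintro rfl
          have := hn.covers.nodup_onDir a
          rw [e] at this
          simp only [rev, List.map_append, List.map_cons, List.cons_append,
            List.nil_append] at this
          exact (List.nodup_cons.1 (List.nodup_append.1 this).2.1).1 List.mem_cons_self
        rcases eq_or_eq_of_valence_two hv hne h2 hi.symm with rfl | rfl
        · exact List.mem_map.2 ⟨_, ha, rfl⟩
        · rw [e]
          simp [rev]
    exact fun e => ⟨key (x, β) (y, β') hi hv e, key (y, β') (x, β) hi.symm (hi ▸ hv) e⟩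
  | refl => exact fun e => Iff.rfl
  | symm x y hxy ih => exact fun e => (ih e).symm
  | trans x y z hxy hyz ih ih' => exact fun e => (ih e).trans (ih' e)

theorem natural_of_isChain {l : List (E' × Bool)} :
    ∀ {u w : V'}, G'.IsPath u l w → l.IsChain (fun a _ => G'.valence (G'.term a) = 2) →
      ∀ y ∈ l, ∀ z ∈ l.head?, naturalSetoid G' z.1 y.1 := by
  induction l with
  | nil => intro u w _ _ y hy; exact absurd hy List.not_mem_nil
  | cons a l ih =>
    intro u w hp hch y hy z hz
    obtain rfl : a = z := by simpa using hz
    rcases List.mem_cons.1 hy with rfl | hy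
    · exact (naturalSetoid G').refl _
    · cases l with
      | nil => exact absurd hy List.not_mem_nil
      | cons b l =>
        rw [List.isChain_cons_cons] at hch
        refine (naturalSetoid G').trans ?_ (ih hp.2 hch.2 y hy b rfl)
        exact Relation.EqvGen.rel _ _ ⟨!a.2, b.2, hp.2.1.symm, hch.1⟩

/-- Edges of `G` correspond to natural edges of `G'`: a chain lies in one class
(`natural_of_isChain`), and a class lies in one chain (`IsNaturalStructure.eq_of_natural`). -/
theorem GraphMap.IsNaturalStructure.naturalWeight_eq (hn : h.IsNaturalStructure) {K : ℕ}
    (γ : Fin K → Cycle (E × Bool)) :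
    naturalWeight G' (fun i => h.onCycle (γ i)) = naturalWeight G γ := by
  funext k
  rw [naturalWeight_eq_ncard (G := G) fun e e' _ hee =>
    eq_of_natural_of_valence_ne_two hn.valence_ne_two hee]
  have hhead : ∀ e, ∃ x, x ∈ (h.onE e).head? := by
    intro e
    obtain ⟨x, r, hx⟩ := List.exists_cons_of_ne_nil (hn.nonempty e)
    exact ⟨x, by rw [hx]; rfl⟩
  choose f hf using hhead
  have hfm : ∀ e, (f e).1 ∈ (h.onE e).map Prod.fst := fun e =>
    List.mem_map.2 ⟨_, List.mem_of_mem_head? (hf e), rfl⟩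
  have : {N : Quotient (naturalSetoid G') | ∃ x, Quotient.mk (naturalSetoid G') x = N ∧
      crossings (fun i => h.onCycle (γ i)) x = k} =
      (fun e => Quotient.mk (naturalSetoid G') (f e).1) '' {e | crossings γ e = k} := by
    ext N
    constructor
    · rintro ⟨x, rfl, hx⟩
      obtain ⟨e, he⟩ := hn.covers.surj x
      refine ⟨e, ?_, Quotient.sound ?_⟩
      · rw [hn.covers.crossings_onCycle γ he] at hx
        exact hx
      · obtain ⟨y, hy, rfl⟩ := List.mem_map.1 he
        exact natural_of_isChain (h.isPath e) (hn.interior e) y hy _ (hf e)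
    · rintro ⟨e, he, rfl⟩
      exact ⟨_, rfl, (hn.covers.crossings_onCycle γ (hfm e)).trans he⟩
  rw [naturalWeight, this, Set.InjOn.ncard_image]
  intro e _ e' _ hee
  exact hn.covers.inj _ _ _ ((hn.eq_of_natural (Quotient.exact hee) e).1 (hfm e)) (hfm e')

end NaturalStructure

/-! ### Images of backtracking. -/

section Backtracking

variable {V E V' E' : Type*} {G : Multigraph V E} {G' : Multigraph V' E'} {α : Type*}

/-- A rotation brings the pair to the front. A cycle of length one is the exception: its only pair
is `(x, x)`, which no word for it displays. -/
theorem Follows.exists_eq {c : Cycle α} {x y : α} (h : Follows c x y) :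
    (∃ t : List α, (x :: y :: t : List α) = c) ∨ y = x := by
  induction c using Quotient.inductionOn' with
  | h l =>
    obtain ⟨i, hi, rfl, rfl⟩ := follows_coe_iff.1 h
    have e : l = l.take i ++ l[i] :: l.drop (i + 1) := by
      rw [← List.drop_eq_getElem_cons hi, List.take_append_drop]
    have e' : (l[i] :: (l.drop (i + 1) ++ l.take i) : List α) = (l : Cycle α) := by
      conv_rhs => rw [e]
      exact Quotient.sound' (List.isRotated_append (l := l[i] :: l.drop (i + 1)) (l' := l.take i))
    by_cases h1 : i + 1 < l.length
    · left
      refine ⟨l.drop (i + 2) ++ l.take i, Eq.trans ?_ e'⟩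
      simp only [Nat.mod_eq_of_lt h1]
      rw [← List.cons_append, ← List.drop_eq_getElem_cons h1]
    · have h2 : i + 1 = l.length := by omega
      rw [List.drop_eq_nil_of_le h2.ge, List.nil_append] at e'
      simp only [h2, Nat.mod_self]
      rcases Nat.eq_zero_or_pos i with rfl | h0
      · exact Or.inr rfl
      · left
        refine ⟨(l.take i).drop 1, Eq.trans ?_ e'⟩
        have h3 : 0 < (l.take i).length := by rw [List.length_take]; omega
        have : l[0] = (l.take i)[0] := by rw [List.getElem_take]
        simp only [this]
        rw [← List.drop_eq_getElem_cons h3, List.drop_zero]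

theorem follows_append_cons_cons (M N : List α) (x y : α) :
    Follows (M ++ x :: y :: N : List α) x y := by
  refine follows_coe_iff.2 ⟨M.length, by simp, by simp, ?_⟩
  have : M.length + 1 < (M ++ x :: y :: N).length := by simp
  simp only [Nat.mod_eq_of_lt this]
  rw [List.getElem_append_right (by omega)]
  simp

/-- The image of `x` followed by its inverse backtracks at the last letter of the image of `x`. -/
theorem exists_backtracking {h : GraphMap G G'} (hne : ∀ a, h.onDir a ≠ []) {c : Cycle (E × Bool)}
    {x : E × Bool} (hx : Follows c x (rev x)) : ∃ z, Follows (h.onCycle c) z (rev z) := by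
  rcases hx.exists_eq with ⟨t, rfl⟩ | e
  · rcases List.eq_nil_or_concat (h.onDir x) with e | ⟨M, z, e⟩
    · exact absurd e (hne x)
    · refine ⟨z, ?_⟩
      rw [GraphMap.onCycle_coe, GraphMap.onPath_cons, GraphMap.onPath_cons, GraphMap.onDir_rev, e,
        List.concat_eq_append, invRev_append, List.append_assoc]
      exact follows_append_cons_cons _ _ _ _
  · exact absurd e (rev_ne x)

end Backtracking

/-! ### Subdivisions. -/

section Subdivision

variable {V E V' E' V'' E'' : Type*} {G : Multigraph V E} {G' : Multigraph V' E'}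
  {G'' : Multigraph V'' E''}

/-- `G'` arises from `G` by subdividing edges. -/
structure GraphMap.IsSubdivision (h : GraphMap G G') : Prop where
  covers : h.Covers
  inj : Function.Injective h.onV
  valence : ∀ u, G'.valence (h.onV u) = G.valence u
  range : ∀ w, G'.valence w ≠ 2 → ∃ u, h.onV u = w
  nonempty : ∀ e, h.onE e ≠ []
  interior : ∀ e, (h.onE e).IsChain fun a _ => G'.valence (G'.term a) = 2

theorem GraphMap.IsSubdivision.isNaturalStructure {h : GraphMap G G'} (hs : h.IsSubdivision)
    (hv : ∀ u, G.valence u ≠ 2) : h.IsNaturalStructure where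
  inj := hs.inj
  range := by
    ext w
    refine ⟨?_, fun hw => hs.range w hw⟩
    rintro ⟨u, rfl⟩
    change G'.valence _ ≠ 2
    rw [hs.valence]
    exact hv u
  nonempty := hs.nonempty
  interior := hs.interior
  cover := GraphMap.covers_iff.1 hs.covers

theorem GraphMap.onDir_ne_nil {h : GraphMap G G'} (hn : ∀ e, h.onE e ≠ []) (a : E × Bool) :
    h.onDir a ≠ [] := by
  have := hn a.1
  obtain ⟨e, b⟩ := a
  cases b
  · rw [onDir_false]
    intro e'
    exact this (by simpa [invRev_eq_map_rev] using e')
  · rwa [onDir_true]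

theorem isChain_invRev {l : List (E' × Bool)} {u w : V'} (hp : G'.IsPath u l w)
    (hl : l.IsChain fun a _ => G'.valence (G'.term a) = 2) :
    (FreeGroup.invRev l).IsChain fun a _ => G'.valence (G'.term a) = 2 := by
  induction l generalizing u with
  | nil => exact List.IsChain.nil
  | cons a l ih =>
    have e : FreeGroup.invRev (a :: l) = FreeGroup.invRev l ++ [rev a] := by
      simp [FreeGroup.invRev, rev]
    rw [e, List.isChain_append]
    refine ⟨ih hp.2 hl.of_cons, List.isChain_singleton _, ?_⟩
    intro x hx y _
    cases l with
    | nil => simp [FreeGroup.invRev] at hx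
    | cons b l =>
      rw [List.isChain_cons_cons] at hl
      have : x = rev b := by
        simpa [FreeGroup.invRev, rev] using hx.symm
      rw [this, term_rev, hp.2.1]
      exact hl.1

/-- Allows vertices of valence two to be removed one at a time. -/
theorem GraphMap.IsSubdivision.comp {f : GraphMap G' G''} {h : GraphMap G G'}
    (hf : f.IsSubdivision) (hh : h.IsSubdivision) : (f.comp h).IsSubdivision where
  covers := by
    have hmem : ∀ x e, x ∈ ((f.comp h).onE e).map Prod.fst ↔ ∃ y ∈ (h.onE e).map Prod.fst,
        x ∈ (f.onE y).map Prod.fst := by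
      intro x e
      change x ∈ (f.onPath (h.onE e)).map Prod.fst ↔ _
      induction h.onE e with
      | nil => simp
      | cons a l ih =>
        rw [onPath_cons, List.map_append, List.mem_append, ih, (f.map_fst_onDir_perm a).mem_iff]
        simp
    refine ⟨fun x => ?_, fun e => ?_, fun x e e' he he' => ?_⟩
    · obtain ⟨y, hy⟩ := hf.covers.surj x
      obtain ⟨e, he⟩ := hh.covers.surj y
      exact ⟨e, (hmem x e).2 ⟨y, he, hy⟩⟩
    · change ((f.onPath (h.onE e)).map Prod.fst).Nodup
      have hnd := hh.covers.nodup e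
      revert hnd
      induction h.onE e with
      | nil => exact fun _ => List.nodup_nil
      | cons a l ih =>
        intro hnd
        rw [List.map_cons, List.nodup_cons] at hnd
        rw [onPath_cons, List.map_append, List.nodup_append]
        refine ⟨hf.covers.nodup_onDir a, ih hnd.2, ?_⟩
        rintro x hx _ hy rfl
        obtain ⟨z, hz, hxz⟩ := List.mem_map.1 hy
        obtain ⟨b, hb, hzb⟩ := List.mem_flatMap.1 hz
        have := hf.covers.fst_eq hx (List.mem_map.2 ⟨z, hzb, hxz⟩)
        exact hnd.1 (this ▸ List.mem_map.2 ⟨b, hb, rfl⟩)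
    · obtain ⟨y, hy, hxy⟩ := (hmem x e).1 he
      obtain ⟨y', hy', hxy'⟩ := (hmem x e').1 he'
      obtain rfl := hf.covers.inj x _ _ hxy hxy'
      exact hh.covers.inj y _ _ hy hy'
  inj := hf.inj.comp hh.inj
  valence u := (hf.valence _).trans (hh.valence u)
  range w hw := by
    obtain ⟨u, rfl⟩ := hf.range w hw
    rw [hf.valence] at hw
    obtain ⟨u', rfl⟩ := hh.range u hw
    exact ⟨u', rfl⟩
  nonempty e := by
    change f.onPath (h.onE e) ≠ []
    obtain ⟨a, l, e⟩ := List.exists_cons_of_ne_nil (hh.nonempty e)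
    rw [e, onPath_cons]
    simp [onDir_ne_nil hf.nonempty a]
  interior e := by
    change (f.onPath (h.onE e)).IsChain _
    have hi := hh.interior e
    have hp := h.isPath e
    revert hi hp
    generalize h.onV (G.init (e, true)) = u
    induction h.onE e generalizing u with
    | nil => intros; exact List.IsChain.nil
    | cons a l ih =>
      intro hi hp
      rw [onPath_cons, List.isChain_append]
      refine ⟨?_, ih _ hi.of_cons hp.2, ?_⟩
      · obtain ⟨e, b⟩ := a
        cases b
        · rw [onDir_false]
          exact isChain_invRev (f.isPath e) (hf.interior e)
        · rw [onDir_true]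
          exact hf.interior e
      · intro x hx y hy
        cases l with
        | nil => simp at hy
        | cons b l =>
          rw [List.isChain_cons_cons] at hi
          have hpa := f.isPath_onDir a
          obtain ⟨M, e⟩ : ∃ M, f.onDir a = M ++ [x] := List.getLast?_eq_some_iff.1 hx
          rw [e] at hpa
          obtain ⟨v, -, -, hv⟩ := isPath_append_iff.1 hpa
          have hv' : G''.term x = f.onV (G'.term a) := hv
          rw [hv', hf.valence]
          exact hi.1

/-- Markings and circuit families are transferred to a graph of which `G` is a subdivision. -/
theorem GraphMap.IsSubdivision.transfer {n K : ℕ} {G₁ : Multigraph V' E'} {h : GraphMap G₁ G}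
    (hs : h.IsSubdivision) (hG : G.IsCore) {s : GraphMap G G₁} (hpi : h.IsPi1Equiv)
    (hsv : ∀ u, s.onV (h.onV u) = u) (m : G.Marking n) {γ : Fin K → Cycle (E × Bool)}
    (hγ : IsCircuitFamily G γ)
    (hlift : ∀ i, ∃ (l : List (E × Bool)) (v : V), (l : Cycle (E × Bool)) = γ i ∧ G.IsPath v l v ∧ h.onPath (s.onPath l) = l) :
    G₁.IsCore ∧ ∃ (m₁ : G₁.Marking n) (γ₁ : Fin K → Cycle (E' × Bool)), h.PreservesMarking m₁ m ∧
      IsCircuitFamily G₁ γ₁ ∧ ∀ i, h.onCycle (γ₁ i) = γ i := by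
  have hconn : G₁.IsConnected := by
    refine ⟨⟨s.onV m.base⟩, fun u w => ?_⟩
    obtain ⟨l, hl⟩ := hG.1.exists_isPath (h.onV u) (h.onV w)
    have := s.isPath_onPath hl
    rw [hsv, hsv] at this
    exact ⟨_, this⟩
  refine ⟨⟨hconn, fun u => ?_⟩, ?_⟩
  · rw [← hs.valence]
    exact hG.2 _
  obtain ⟨q, hq⟩ := hG.1.exists_isPath (h.onV (s.onV m.base)) m.base
  obtain ⟨m₁, -, hm₁, -⟩ := hpi.exists_marking m hq
  choose l v hl hv hls using hlift
  have hon : ∀ i, h.onCycle (s.onPath (l i) : List (E' × Bool)) = γ i := fun i => by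
    rw [onCycle_coe, hls, hl]
  refine ⟨m₁, fun i => (s.onPath (l i) : List (E' × Bool)), hm₁, ⟨fun i => ?_, fun i j hij => ?_⟩, hon⟩
  · refine (isCircuit_iff (s.isPath_onPath (hv i))).2 ⟨fun e => ?_, ?_⟩
    · refine (hγ.1 i).1 ?_
      rw [← hl i, ← hls i, e]
      rfl
    -- A backtracking in the transferred circuit would survive in `γ i`.
    · rintro a _ hab rfl
      obtain ⟨z, hz⟩ := exists_backtracking (onDir_ne_nil hs.nonempty) hab
      rw [hon] at hz
      exact (hγ.1 i).tight hz rfl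
  · refine hγ.2 ?_
    rw [← hon i, ← hon j]
    exact congrArg _ hij

end Subdivision

/-! ### Renumbering vertices and edges. -/

section Relabel

variable {V E V' E' : Type*}

/-- Rename vertices and edges. -/
def Multigraph.relabel (iV : V ≃ V') (iE : E ≃ E') (G : Multigraph V E) : Multigraph V' E' where
  init a := iV (G.init (iE.symm a.1, a.2))

def relabelMap (iV : V ≃ V') (iE : E ≃ E') (G : Multigraph V E) : GraphMap (G.relabel iV iE) G where
  onV := iV.symm
  onE e := [(iE.symm e, true)]
  isPath e := by
    simp only [relabel, Equiv.symm_apply_apply]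
    exact isPath_singleton _

def relabelInv (iV : V ≃ V') (iE : E ≃ E') (G : Multigraph V E) : GraphMap G (G.relabel iV iE) where
  onV := iV
  onE e := [(iE e, true)]
  isPath e := by
    refine ⟨by simp [relabel], ?_⟩
    simp only [IsPath, term, rev, relabel]
    simp

variable {iV : V ≃ V'} {iE : E ≃ E'} {G : Multigraph V E}

theorem relabelMap_onDir (a : E' × Bool) :
    (relabelMap iV iE G).onDir a = [(iE.symm a.1, a.2)] := by
  obtain ⟨e, b⟩ := a
  cases b <;> rfl

theorem relabelInv_onDir (a : E × Bool) : (relabelInv iV iE G).onDir a = [(iE a.1, a.2)] := by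
  obtain ⟨e, b⟩ := a
  cases b <;> rfl

theorem isPi1Equiv_relabelMap : (relabelMap iV iE G).IsPi1Equiv := by
  refine GraphMap.isPi1Equiv_of_inverse (s := relabelInv iV iE G) (c := fun _ => [])
    (k := fun _ => []) (fun u => iV.apply_symm_apply u) (fun u => iV.symm_apply_apply u) ?_ ?_
  · intro e
    rw [GraphMap.hom, GraphMap.hom, FreeGroup.lift_apply_of]
    change FreeGroup.lift _ (FreeGroup.of (iE.symm e)) = _
    rw [FreeGroup.lift_apply_of, mk_nil]
    simp [relabelInv, FreeGroup.of]
  · intro e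
    rw [GraphMap.hom, GraphMap.hom, FreeGroup.lift_apply_of]
    change FreeGroup.lift _ (FreeGroup.of (iE e)) = _
    rw [FreeGroup.lift_apply_of, mk_nil]
    simp [relabelMap, FreeGroup.of]

theorem relabelMap_onPath_inv (l : List (E × Bool)) :
    (relabelMap iV iE G).onPath ((relabelInv iV iE G).onPath l) = l := by
  induction l with
  | nil => rfl
  | cons a l ih =>
    rw [GraphMap.onPath_cons, GraphMap.onPath_append, ih, relabelInv_onDir, GraphMap.onPath_cons,
      relabelMap_onDir]
    simp

theorem valence_relabel (u : V') : G.valence (iV.symm u) = (G.relabel iV iE).valence u := by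
  have : G.directions (iV.symm u) =
      (fun a : E' × Bool => (iE.symm a.1, a.2)) '' (G.relabel iV iE).directions u := by
    ext a
    constructor
    · intro ha
      refine ⟨(iE a.1, a.2), ?_, by simp⟩
      have : G.init a = iV.symm u := ha
      simp [directions, relabel, this]
    · rintro ⟨b, hb, rfl⟩
      have : iV (G.init (iE.symm b.1, b.2)) = u := hb
      simp [directions, ← this]
  rw [valence, valence, this, Set.ncard_image_of_injective]
  rintro ⟨x, b⟩ ⟨y, b'⟩ h
  simpa using h

theorem isSubdivision_relabelMap : (relabelMap iV iE G).IsSubdivision where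
  covers := ⟨fun x => ⟨iE x, by simp [relabelMap]⟩, fun e => by simp [relabelMap],
    fun x e e' he he' => by
      simp only [relabelMap, List.map_cons, List.map_nil, List.mem_singleton] at he he'
      exact iE.symm.injective (he.symm.trans he')⟩
  inj := iV.symm.injective
  valence := valence_relabel
  range w _ := ⟨iV w, iV.symm_apply_apply w⟩
  nonempty _ := List.cons_ne_nil _ _
  interior _ := List.isChain_singleton _

end Relabel

/-! ### Removing a vertex of valence two. -/

section Merge

variable {V E : Type*}

open Classical in
/-- The vertex to which `u` is moved if the oriented edge `b` is collapsed to its terminal vertex. -/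
noncomputable def mergeVert (G : Multigraph V E) (b : E × Bool) (hb : G.term b ≠ G.init b) (u : V) :
    {u // u ≠ G.init b} :=
  if h : u = G.init b then ⟨G.term b, hb⟩ else ⟨u, h⟩

/-- Collapse the oriented edge `b`. -/
noncomputable def mergeGraph (G : Multigraph V E) (b : E × Bool) (hb : G.term b ≠ G.init b) :
    Multigraph {u // u ≠ G.init b} {x // x ≠ b.1} where
  init x := mergeVert G b hb (G.init (x.1.1, x.2))

open Classical in
/-- The path along which `u` has been moved in the collapse of `b`. -/
noncomputable def mergeJump (G : Multigraph V E) (b : E × Bool) (u : V) : List (E × Bool) :=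
  if u = G.init b then [rev b] else []

variable {G : Multigraph V E} {b : E × Bool} {hb : G.term b ≠ G.init b}

theorem mergeVert_init : mergeVert G b hb (G.init b) = ⟨G.term b, hb⟩ := dif_pos rfl

theorem mergeVert_of_ne {u : V} (h : u ≠ G.init b) : mergeVert G b hb u = ⟨u, h⟩ := dif_neg h

theorem mergeJump_init : mergeJump G b (G.init b) = [rev b] := if_pos rfl

theorem mergeJump_of_ne {u : V} (h : u ≠ G.init b) : mergeJump G b u = [] := if_neg h

theorem isPath_mergeJump (u : V) : G.IsPath (mergeVert G b hb u).1 (mergeJump G b u) u := by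
  by_cases h : u = G.init b
  · subst h
    rw [mergeVert_init, mergeJump_init]
    exact ⟨rfl, term_rev b⟩
  · rw [mergeVert_of_ne h, mergeJump_of_ne h]
    rfl

noncomputable def mergeMap (G : Multigraph V E) (b : E × Bool) (hb : G.term b ≠ G.init b) :
    GraphMap (mergeGraph G b hb) G where
  onV u := u.1
  onE x := mergeJump G b (G.init (x.1, true)) ++ ([(x.1, true)] ++
    FreeGroup.invRev (mergeJump G b (G.init (x.1, false))))
  isPath x := (isPath_mergeJump _).append ((isPath_singleton (x.1, true)).append
    (isPath_mergeJump (hb := hb) (G.init (x.1, false))).invRev)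

open Classical in
noncomputable def mergeCollapse (G : Multigraph V E) (b : E × Bool) (hb : G.term b ≠ G.init b) :
    GraphMap G (mergeGraph G b hb) where
  onV := mergeVert G b hb
  onE x := if h : x = b.1 then [] else [(⟨x, h⟩, true)]
  isPath x := by
    by_cases h : x = b.1
    · subst h
      rw [dif_pos rfl]
      have key : mergeVert G b hb (G.init b) = mergeVert G b hb (G.term b) := by
        rw [mergeVert_init, mergeVert_of_ne hb]
      obtain ⟨e, β⟩ := b
      cases β
      · exact key.symm
      · exact key
    · rw [dif_neg h]
      exact ⟨rfl, rfl⟩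

theorem mergeMap_onDir (x : {x // x ≠ b.1} × Bool) : (mergeMap G b hb).onDir x =
    mergeJump G b (G.init (x.1.1, x.2)) ++ ([(x.1.1, x.2)] ++
      FreeGroup.invRev (mergeJump G b (G.init (x.1.1, !x.2)))) := by
  obtain ⟨e, β⟩ := x
  cases β
  · rw [GraphMap.onDir_false]
    simp only [mergeMap, invRev_append, FreeGroup.invRev_invRev, List.append_assoc]
    rfl
  · rfl

theorem mergeCollapse_onDir_of_eq {x : E × Bool} (h : x.1 = b.1) :
    (mergeCollapse G b hb).onDir x = [] := by
  obtain ⟨e, β⟩ := x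
  obtain rfl : e = b.1 := h
  cases β
  · rw [GraphMap.onDir_false]
    simp [mergeCollapse, FreeGroup.invRev]
  · rw [GraphMap.onDir_true]
    simp [mergeCollapse]

theorem mergeCollapse_onDir_of_ne {x : E × Bool} (h : x.1 ≠ b.1) :
    (mergeCollapse G b hb).onDir x = [(⟨x.1, h⟩, x.2)] := by
  obtain ⟨e, β⟩ := x
  cases β
  · rw [GraphMap.onDir_false]
    simp only [mergeCollapse, dif_neg h]
    rfl
  · rw [GraphMap.onDir_true]
    simp only [mergeCollapse, dif_neg h]

theorem mergeMap_hom_of (x : {x // x ≠ b.1}) : (mergeMap G b hb).hom (FreeGroup.of x) =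
    FreeGroup.mk (mergeJump G b (G.init (x.1, true))) * FreeGroup.of x.1 *
      (FreeGroup.mk (mergeJump G b (G.init (x.1, false))))⁻¹ := by
  rw [GraphMap.hom, FreeGroup.lift_apply_of]
  simp only [mergeMap, mk_append, mk_invRev, mul_assoc]
  rfl

theorem mergeCollapse_hom_jump (u : V) :
    (mergeCollapse G b hb).hom (FreeGroup.mk (mergeJump G b u)) = 1 := by
  rw [GraphMap.hom_mk]
  by_cases h : u = G.init b
  · rw [h, mergeJump_init, GraphMap.onPath_cons, mergeCollapse_onDir_of_eq (b := b) (x := rev b) rfl]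
    rfl
  · rw [mergeJump_of_ne h]
    rfl

theorem mergeCollapse_hom_of {x : E} (h : x ≠ b.1) :
    (mergeCollapse G b hb).hom (FreeGroup.of x) = FreeGroup.of ⟨x, h⟩ := by
  rw [GraphMap.hom, FreeGroup.lift_apply_of]
  simp only [mergeCollapse, dif_neg h]
  rfl

theorem isPi1Equiv_mergeMap : (mergeMap G b hb).IsPi1Equiv := by
  refine GraphMap.isPi1Equiv_of_inverse (s := mergeCollapse G b hb) (c := fun _ => [])
    (k := mergeJump G b) (fun u => mergeVert_of_ne u.2) isPath_mergeJump ?_ ?_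
  · intro x
    rw [mergeMap_hom_of, map_mul, map_mul, map_inv, mergeCollapse_hom_jump, mergeCollapse_hom_jump,
      mergeCollapse_hom_of x.2, mk_nil]
  · intro x
    by_cases h : x = b.1
    · subst h
      have h1 : (mergeCollapse G b hb).hom (FreeGroup.of b.1) = 1 := by
        rw [GraphMap.hom, FreeGroup.lift_apply_of]
        simp [mergeCollapse]
        rfl
      rw [h1, map_one]
      obtain ⟨e, β⟩ := b
      cases β
      · rw [mergeJump_init, show G.init (e, true) = G.term (e, false) from rfl, mergeJump_of_ne hb,
          mk_nil, one_mul]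
        exact (mul_inv_cancel _).symm
      · rw [mergeJump_init, show G.init (e, false) = G.term (e, true) from rfl, mergeJump_of_ne hb,
          mk_nil, mk_rev, inv_one, mul_one]
        exact (inv_mul_cancel _).symm
    · rw [mergeCollapse_hom_of h, mergeMap_hom_of]

theorem mergeJump_map_fst [DecidableEq E] {a : E × Bool} (ha : G.init a = G.init b)
    (hw : ∀ c, G.init c = G.init b → c = a ∨ c = b) {x : E × Bool} (hx : x.1 ≠ b.1) :
    mergeJump G b (G.init x) = if x = a then [rev b] else [] := by
  by_cases h : x = a
  · rw [if_pos h, h, ha, mergeJump_init]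
  · rw [if_neg h, mergeJump_of_ne]
    intro h'
    rcases hw x h' with h1 | h1
    · exact h h1
    · exact hx (by rw [h1])

/-- The edge of `a` takes over the collapsed edge of `b`; all other edges are unchanged, as `hE`
records. -/
theorem isSubdivision_mergeMap {a : E × Bool} (hab : a.1 ≠ b.1) (ha : G.init a = G.init b)
    (hw : ∀ c, G.init c = G.init b → c = a ∨ c = b) : (mergeMap G b hb).IsSubdivision := by
  classical
  have hval : G.valence (G.init b) = 2 :=
    valence_eq_two (b := a) (fun e => hab (by rw [e])) ha fun c hc => (hw c hc).symm
  have hE : ∀ x : {x // x ≠ b.1}, (mergeMap G b hb).onE x =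
      (if (x.1, true) = a then [rev b] else []) ++ ([(x.1, true)] ++
        (if (x.1, false) = a then [b] else [])) := by
    intro x
    change mergeJump G b _ ++ ([_] ++ FreeGroup.invRev (mergeJump G b _)) = _
    rw [mergeJump_map_fst ha hw (x := (x.1, true)) x.2,
      mergeJump_map_fst ha hw (x := (x.1, false)) x.2]
    congr 2
    split_ifs
    · simp [FreeGroup.invRev, rev]
    · rfl
  refine ⟨⟨fun y => ?_, fun x => ?_, fun y x x' hx hx' => ?_⟩, Subtype.val_injective, fun u => ?_,
    fun u hu => ⟨⟨u, fun e => hu (e ▸ hval)⟩, rfl⟩, fun x => ?_, fun x => ?_⟩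
  · by_cases hy : y = b.1
    · refine ⟨⟨a.1, hab⟩, ?_⟩
      rw [hE, hy]
      obtain ⟨e, β⟩ := a
      cases β <;> simp [rev]
    · exact ⟨⟨y, hy⟩, by rw [hE]; simp⟩
  · rw [hE]
    have := x.2
    obtain ⟨e, β⟩ := a
    cases β <;> by_cases h : x.1 = e <;> simp [h, rev] <;> grind
  · rw [hE] at hx hx'
    have := x.2
    have := x'.2
    refine Subtype.ext ?_
    obtain ⟨e, β⟩ := a
    cases β <;> by_cases h : x.1 = e <;> by_cases h' : x'.1 = e <;> simp [h, h', rev] at hx hx' ⊢ <;>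
      grind
  -- The direction `a`, now based at `term b`, stands for `rev b`; the other directions are
  -- unchanged.
  · have hu : G.directions u.1 = (fun x : {x // x ≠ b.1} × Bool =>
        if (x.1.1, x.2) = a then rev b else (x.1.1, x.2)) '' (mergeGraph G b hb).directions u := by
      ext y
      constructor
      · intro hy
        have hy' : G.init y = u.1 := hy
        by_cases hyb : y.1 = b.1
        · obtain rfl := (eq_or_eq_rev_of_fst_eq hyb).resolve_left
            fun e => u.2 (by rw [← hy', e])
          refine ⟨(⟨a.1, hab⟩, a.2), ?_, by simp⟩
          refine Subtype.ext ?_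
          change (mergeVert G b hb (G.init a)).1 = u.1
          rw [ha, mergeVert_init, ← hy']
          rfl
        · refine ⟨(⟨y.1, hyb⟩, y.2), ?_, ?_⟩
          · refine Subtype.ext ?_
            change (mergeVert G b hb (G.init y)).1 = u.1
            have hyw : G.init y ≠ G.init b := by rw [hy']; exact u.2
            rw [mergeVert_of_ne hyw]
            exact hy'
          · refine if_neg fun e => u.2 ?_
            rw [← hy', ← ha, ← e]
      · rintro ⟨x, hx, rfl⟩
        have hx' : mergeVert G b hb (G.init (x.1.1, x.2)) = u := hx
        by_cases h : (x.1.1, x.2) = a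
        · rw [h, ha, mergeVert_init] at hx'
          simp only [if_pos h]
          rw [← hx']
          rfl
        · simp only [if_neg h]
          rw [mergeVert_of_ne] at hx'
          · rw [← hx']
            rfl
          · intro h'
            rcases hw _ h' with h1 | h1
            · exact h h1
            · exact x.1.2 (congrArg Prod.fst h1)
    change G.valence u.1 = _
    rw [valence, valence, hu, Set.ncard_image_of_injective]
    rintro ⟨⟨x, hx⟩, β⟩ ⟨⟨y, hy⟩, β'⟩ hxy
    have hb1 : (rev b).1 = b.1 := rfl
    simp only at hxy
    split_ifs at hxy with h1 h2 h2
    · rw [← h2] at h1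
      simpa using h1
    · exact absurd (congrArg Prod.fst hxy).symm hy
    · exact absurd (congrArg Prod.fst hxy) hx
    · simpa using hxy
  · rw [hE]
    simp
  · rw [hE]
    have hb2 : G.valence (G.term (rev b)) = 2 := by rwa [term_rev]
    by_cases h1 : (x.1, true) = a
    · have h2 : (x.1, false) ≠ a := by rw [← h1]; simp
      rw [if_pos h1, if_neg h2]
      simpa using hb2
    · rw [if_neg h1]
      by_cases h2 : (x.1, false) = a
      · rw [if_pos h2]
        have : G.term (x.1, true) = G.init b := by rw [← ha, ← h2]; rfl
        simp [this, hval]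
      · rw [if_neg h2]
        simp

/-- A tight path that enters the removed vertex along one of its two edges leaves it along the
other, so the collapsed letter is restored. Such a passage uses up two letters, hence the strong
induction. -/
theorem mergeMap_onPath_collapse {a : E × Bool} (hab : a.1 ≠ b.1) (ha : G.init a = G.init b)
    (hw : ∀ c, G.init c = G.init b → c = a ∨ c = b) {l : List (E × Bool)} {u w : V} (hp : G.IsPath u l w)
    (hu : u ≠ G.init b) (hw' : w ≠ G.init b) (hl : l.IsChain fun x y => y ≠ rev x) :
    (mergeMap G b hb).onPath ((mergeCollapse G b hb).onPath l) = l := by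
  have hta : G.term a ≠ G.init b := by
    intro e
    rcases hw (rev a) e with h | h
    · exact rev_ne a h
    · exact hab (by rw [← h]; rfl)
  induction h : l.length using Nat.strong_induction_on generalizing l u with
  | _ N ih =>
    cases l with
    | nil => rfl
    | cons x t =>
      obtain ⟨rfl, hp⟩ := hp
      by_cases hx : G.term x = G.init b
      · cases t with
        | nil => exact absurd (hp.symm.trans hx) hw'
        | cons y t =>
          obtain ⟨hy, hp⟩ := hp
          rw [hx] at hy
          rw [List.isChain_cons_cons] at hl
          have ih' := fun hty => ih t.length (by simp at h; omega) hp hty hl.2.of_cons rfl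
          rcases hw (rev x) hx with hxa | hxb
          · obtain rfl : y = b := (hw y hy).resolve_left fun e => hl.1 (e.trans hxa.symm)
            have hxe : x = rev a := rev_eq_iff.1 hxa
            subst hxe
            rw [GraphMap.onPath_cons, GraphMap.onPath_cons, mergeCollapse_onDir_of_eq rfl,
              mergeCollapse_onDir_of_ne (x := rev a) hab, List.nil_append, GraphMap.onPath_append, ih' hb,
              GraphMap.onPath_cons, mergeMap_onDir]
            change (mergeJump G _ (G.init (rev a)) ++ ([rev a] ++
              FreeGroup.invRev (mergeJump G _ (G.init (rev (rev a)))))) ++ [] ++ t = _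
            rw [mergeJump_of_ne hu, rev_rev, ha, mergeJump_init]
            simp [FreeGroup.invRev, rev]
          · obtain rfl : y = a := (hw y hy).resolve_right fun e => hl.1 (e.trans hxb.symm)
            have hxe : x = rev b := rev_eq_iff.1 hxb
            subst hxe
            rw [GraphMap.onPath_cons, GraphMap.onPath_cons, mergeCollapse_onDir_of_eq (b := b) (x := rev b) rfl,
              mergeCollapse_onDir_of_ne hab, List.nil_append, GraphMap.onPath_append, ih' hta,
              GraphMap.onPath_cons, mergeMap_onDir]
            change (mergeJump G _ (G.init y) ++ ([y] ++
              FreeGroup.invRev (mergeJump G _ (G.term y)))) ++ [] ++ t = _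
            rw [mergeJump_of_ne hta, ha, mergeJump_init]
            simp [FreeGroup.invRev]
      · have hxb : x.1 ≠ b.1 := by
          intro e
          rcases eq_or_eq_rev_of_fst_eq e with rfl | rfl
          · exact hu rfl
          · exact hx (term_rev b)
        rw [GraphMap.onPath_cons, mergeCollapse_onDir_of_ne hxb, GraphMap.onPath_append,
          ih t.length (by simp at h; omega) hp hx hl.of_cons rfl, GraphMap.onPath_cons, mergeMap_onDir]
        change (mergeJump G _ (G.init x) ++ ([x] ++
          FreeGroup.invRev (mergeJump G _ (G.term x)))) ++ [] ++ t = _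
        rw [mergeJump_of_ne hu, mergeJump_of_ne hx]
        simp [FreeGroup.invRev]

/-- The circuit is started away from the removed vertex, which is possible because no edge is a loop
there. -/
theorem exists_lift_mergeMap {a : E × Bool} (hab : a.1 ≠ b.1) (ha : G.init a = G.init b)
    (hw : ∀ c, G.init c = G.init b → c = a ∨ c = b) {c : Cycle (E × Bool)} (hc : IsCircuit G c) :
    ∃ (l : List (E × Bool)) (v : V), (l : Cycle (E × Bool)) = c ∧ G.IsPath v l v ∧
      (mergeMap G b hb).onPath ((mergeCollapse G b hb).onPath l) = l := by
  have hex : ∃ z ∈ c, G.init z ≠ G.init b := by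
    obtain ⟨y, hy⟩ : ∃ y, y ∈ c := by
      have := hc.1
      induction h : c using Quotient.inductionOn' with
      | h l =>
        cases l with
        | nil => exact absurd h this
        | cons a l => exact ⟨a, List.mem_cons_self⟩
    by_cases h : G.init y = G.init b
    · obtain ⟨z, hz⟩ := exists_follows_right hy
      refine ⟨z, hz.mem_right, ?_⟩
      rw [← hc.term_eq hz]
      rcases hw y h with rfl | rfl
      · intro e
        rcases hw (rev y) e with h | h
        · exact rev_ne y h
        · exact hab (by rw [← h]; rfl)
      · exact hb
    · exact ⟨y, hy, h⟩
  obtain ⟨z, hz, hzb⟩ := hex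
  obtain ⟨t, rfl⟩ := exists_cons_eq_of_mem hz
  have hp := hc.isPath
  refine ⟨z :: t, _, rfl, hp, mergeMap_onPath_collapse hab ha hw hp hzb hzb ?_⟩
  have := hc.2
  rw [Cycle.chain_coe_cons, ← List.cons_append] at this
  exact (List.isChain_append.1 this).1.imp fun _ _ h => h.2

end Merge

/-! ### Existence of natural cell structures. -/

section Existence

variable {n K : ℕ}

/-- Vertices of valence two are merged away until none is left, and then the graph is numbered. The
assumed vertex excludes the circle, whose last vertex cannot be removed. -/
theorem exists_subdivision {V E : Type} [Finite V] (G : Multigraph V E) (hG : G.IsCore)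
    (hv : ∃ v, G.valence v ≠ 2) (m : G.Marking n) (γ : Fin K → Cycle (E × Bool))
    (hγ : IsCircuitFamily G γ) [Finite E] :
    ∃ (p q : ℕ) (G₁ : Multigraph (Fin p) (Fin q)) (h : GraphMap G₁ G) (m₁ : G₁.Marking n)
      (γ₁ : Fin K → Cycle (Fin q × Bool)), G₁.IsCore ∧ (∀ u, G₁.valence u ≠ 2) ∧ h.IsSubdivision ∧
      h.PreservesMarking m₁ m ∧ IsCircuitFamily G₁ γ₁ ∧ ∀ i, h.onCycle (γ₁ i) = γ i := by
  induction hN : Nat.card V using Nat.strong_induction_on generalizing V E with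
  | _ N ih =>
    by_cases h2 : ∃ w, G.valence w = 2
    · obtain ⟨w, hw⟩ := h2
      obtain ⟨b, a, hba, e⟩ := Set.ncard_eq_two.1 hw
      have hb : G.init b = w := show b ∈ G.directions w by rw [e]; simp
      have ha : G.init a = w := show a ∈ G.directions w by rw [e]; simp
      have hdir : ∀ c, G.init c = G.init b → c = a ∨ c = b := by
        intro c hc
        have : c ∈ G.directions w := hc.trans hb
        rw [e] at this
        exact this.symm
      -- If both directions belonged to one edge, this loop would be the whole connected graph.
      have hab : a.1 ≠ b.1 := by
        intro hab
        have hab' := (eq_or_eq_rev_of_fst_eq hab).resolve_left fun e => hba e.symm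
        obtain ⟨v, hv⟩ := hv
        obtain ⟨l, hl⟩ := hG.1.exists_isPath (G.init b) v
        have key : ∀ l, G.IsPath (G.init b) l v → v = G.init b := by
          intro l
          induction l with
          | nil => exact fun h => h.symm
          | cons x l ihl =>
            rintro ⟨hx, hl⟩
            refine ihl ?_
            have : G.term x = G.init b := by
              rcases hdir x hx with rfl | rfl
              · rw [hab', term_rev]
              · change G.init (rev x) = _
                rw [← hab', ha, hb]
            rwa [this] at hl
        rw [key l hl, hb] at hv
        exact hv hw
      have hbt : G.term b ≠ G.init b := by
        intro h
        rcases hdir (rev b) h with h' | h'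
        · exact hab (by rw [← h']; rfl)
        · exact rev_ne b h'
      have hs := isSubdivision_mergeMap (hb := hbt) hab (ha.trans hb.symm) hdir
      obtain ⟨hc, m₁, γ₁, hm₁, hγ₁, hon⟩ := hs.transfer hG (s := mergeCollapse G b hbt)
        isPi1Equiv_mergeMap (fun u => mergeVert_of_ne u.2) m hγ
        (fun i => exists_lift_mergeMap hab (ha.trans hb.symm) hdir (hγ.1 i))
      have hcard : Nat.card {u // u ≠ G.init b} < N := by
        rw [← hN]
        exact Finite.card_subtype_lt (x := G.init b) (by simp)
      obtain ⟨v, hv⟩ := hv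
      obtain ⟨u, rfl⟩ := hs.range v hv
      rw [hs.valence] at hv
      obtain ⟨p, q, G₂, h, m₂, γ₂, h1, h2, h3, h4, h5, h6⟩ :=
        ih _ hcard (mergeGraph G b hbt) hc ⟨u, hv⟩ m₁ γ₁ hγ₁ rfl
      refine ⟨p, q, G₂, (mergeMap G b hbt).comp h, m₂, γ₂, h1, h2, hs.comp h3, hm₁.comp h4, h5,
        fun i => ?_⟩
      rw [GraphMap.comp_onCycle, h6, hon]
    · push Not at h2
      obtain ⟨p, ⟨iV⟩⟩ := Finite.exists_equiv_fin V
      obtain ⟨q, ⟨iE⟩⟩ := Finite.exists_equiv_fin E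
      have hs := isSubdivision_relabelMap (iV := iV) (iE := iE) (G := G)
      obtain ⟨hc, m₁, γ₁, hm₁, hγ₁, hon⟩ := hs.transfer hG (s := relabelInv iV iE G)
        isPi1Equiv_relabelMap (fun u => iV.apply_symm_apply u) m hγ (fun i => by
          have := (hγ.1 i).1
          obtain ⟨l, hl⟩ := (γ i).exists_rep
          change (l : Cycle (E × Bool)) = γ i at hl
          have hci := hγ.1 i
          rw [← hl] at hci
          obtain ⟨-, v, hv⟩ := hci.exists_isPath
          exact ⟨l, v, hl, hv, relabelMap_onPath_inv l⟩)
      exact ⟨p, q, _, _, m₁, γ₁, hc, fun u => by rw [← hs.valence]; exact h2 _, hs, hm₁, hγ₁, hon⟩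

end Existence

/-! ### Marking and natural vertices of the split graph. -/

section SplitOperation

variable {V E : Type*} {G : Multigraph V E} {d : E × Bool} {T : Set (E × Bool)} {n K : ℕ}
  {γ : Fin K → Cycle (E × Bool)}

theorem IsSplitFamily.map_eq {δ : Fin K → Cycle (Option E × Bool)} (h : IsSplitFamily G d T γ δ)
    (i : Fin K) : (δ i).map (splitDir d) = γ i := by
  rw [← h.2.2 i, splitFold_onCycle]

/-- The marking is given explicitly by `splitSection`, a formula that can also be evaluated on
codes. -/
theorem exists_marking_split (d : E × Bool) (T : Set (E × Bool)) (m : G.Marking n) :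
    ∃ mH : (split G d T).Marking n, mH.base = some m.base ∧
      (splitFold G d T).PreservesMarking mH m ∧
      ∀ g, (mH.iso g : FreeGroup (Option E)) = (splitSection G d T).hom (m.iso g) := by
  obtain ⟨mH, hb, hm, hg⟩ := (isPi1Equiv_splitFold G d T).exists_marking m (u := some m.base)
    (q := []) rfl
  refine ⟨mH, hb, hm, fun g => ?_⟩
  have h1 := hg g
  rw [mk_nil, one_mul, inv_one, mul_one] at h1
  obtain ⟨l, hl, e⟩ := exists_isPath_mk_of_mem_pi1 (mH.iso g)
  obtain ⟨l', hl', e'⟩ := exists_isPath_mk_of_mem_pi1 (m.iso g)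
  have h2 := (splitSection G d T).isPath_onPath hl'
  rw [hb] at hl
  have h3 := (isPi1Equiv_splitFold G d T).inj _ _ (hl.append h2.invRev) (by
    rw [mk_append, mk_invRev, map_mul, map_inv, e, h1, ← GraphMap.hom_mk, splitFold_hom_section, e',
      mul_inv_cancel])
  rw [mk_append, mk_invRev, mul_inv_eq_one, e, ← GraphMap.hom_mk, e'] at h3
  exact h3

/-- The vertex at which `E₁` and `E₂` start serves. If `E` is a loop, this vertex also carries the
terminal end of `E₁` or `E₂`, a third direction. -/
theorem exists_split_valence_ne_two (hG : G.IsCore) (h2 : ∀ v, G.valence v ≠ 2) :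
    ∃ v, (split G d T).valence v ≠ 2 := by
  by_cases hv : G.init (rev d) = G.init d
  · refine ⟨attach G d T (rev d), fun h => ?_⟩
    have key : ∀ x : Option E × Bool, (split G d T).init x = attach G d T (rev d) →
        x ≠ (some d.1, !d.2) → x ≠ (none, !d.2) → False := by
      intro x hx h1 h3
      have hx' := eq_or_eq_of_valence_two (G := split G d T) (a := (some d.1, !d.2))
        (b := (none, !d.2)) (c := x) h (by simp) split_init_none_not hx
      exact hx'.elim h1 h3
    by_cases hm : rev d ∈ splitSet G d T
    · exact key (none, d.2) (split_init_none.trans (attach_of_mem hm).symm) (by simp) (by simp)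
    · exact key (some d.1, d.2) (attach_self.trans (by rw [attach_of_notMem hm, hv])) (by simp)
        (by simp)
  · exact ⟨some (G.init (rev d)), split_valence_ne_two hG h2 hv⟩

end SplitOperation

/-! ### Transfer of properties along marked maps. -/

section Transfer

variable {V E V' E' : Type*} {G : Multigraph V E} {G' : Multigraph V' E'} {n K : ℕ}

/-- Two copies of `l` display all its pairs, the closing one included, without wrapping around. -/
theorem Follows.of_replicate {α : Type*} {l : List α} {x y : α} (h : Follows (l : Cycle α) x y)
    {k : ℕ} (hk : 2 ≤ k) : Follows ((List.replicate k l).flatten : List α) x y := by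
  obtain ⟨k, rfl⟩ := Nat.exists_eq_add_of_le' hk
  rw [List.replicate_succ, List.flatten_cons, List.replicate_succ, List.flatten_cons]
  obtain ⟨i, hi, rfl, rfl⟩ := follows_coe_iff.1 h
  have e : l = l.take i ++ l[i] :: l.drop (i + 1) := by
    rw [← List.drop_eq_getElem_cons hi, List.take_append_drop]
  by_cases h1 : i + 1 < l.length
  · simp only [Nat.mod_eq_of_lt h1]
    rw [List.drop_eq_getElem_cons h1] at e
    have := follows_append_cons_cons (l.take i) (l.drop (i + 1 + 1) ++
      (l ++ (List.replicate k l).flatten)) l[i] l[i + 1]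
    rwa [← List.cons_append, ← List.cons_append, ← List.append_assoc, ← e] at this
  · have h2 : i + 1 = l.length := by omega
    rw [List.drop_eq_nil_of_le h2.ge] at e
    simp only [h2, Nat.mod_self]
    have h3 : l = l[0] :: l.drop 1 := by
      rw [← List.drop_eq_getElem_cons, List.drop_zero]
    have := follows_append_cons_cons (l.take i) (l.drop 1 ++ (List.replicate k l).flatten) l[i] l[0]
    have e2 : l.take i ++ l[i] :: l[0] :: (l.drop 1 ++ (List.replicate k l).flatten) =
        (l.take i ++ [l[i]]) ++ ((l[0] :: l.drop 1) ++ (List.replicate k l).flatten) := by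
      rw [List.append_assoc]
      rfl
    rwa [e2, ← e, ← h3] at this

theorem IsCircuit.of_replicate {l : List (E × Bool)} {k : ℕ} (hk : 2 ≤ k)
    (h : IsCircuit G ((List.replicate k l).flatten : List (E × Bool))) :
    IsCircuit G (l : Cycle (E × Bool)) := by
  refine ⟨fun e => h.1 ?_, chain_iff_follows.2 fun a b hab =>
    chain_iff_follows.1 h.2 a b (hab.of_replicate hk)⟩
  rw [(Cycle.coe_eq_nil _).1 e]
  simp

theorem GraphMap.onCycle_revCycle (f : GraphMap G G') (c : Cycle (E × Bool)) :
    f.onCycle (revCycle c) = revCycle (f.onCycle c) := by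
  induction c using Quotient.inductionOn' with
  | h l =>
    change ((f.onPath (FreeGroup.invRev l) : List (E' × Bool)) : Cycle (E' × Bool)) =
      (FreeGroup.invRev (f.onPath l) : List (E' × Bool))
    rw [onPath_invRev]

/-- Powers, coincidences and reversals in the source are carried over to the image family. -/
theorem JointlyPrimitive.of_onCycle {f : GraphMap G G'} {γ : Fin K → Cycle (E × Bool)}
    (hγ : ∀ i, IsCircuit G' (f.onCycle (γ i))) (h : JointlyPrimitive G' fun i => f.onCycle (γ i)) :
    JointlyPrimitive G γ := by
  refine ⟨?_, fun i j hij => ⟨fun e => ?_, fun e => ?_⟩⟩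
  · rintro i ⟨l, k, hl, hk, e⟩
    have hpow : f.onPath (List.replicate k l).flatten = (List.replicate k (f.onPath l)).flatten := by
      clear e hk
      induction k with
      | zero => rfl
      | succ k ih =>
        rw [List.replicate_succ, List.replicate_succ, List.flatten_cons, List.flatten_cons,
          GraphMap.onPath_append, ih]
    have hi := hγ i
    have he : f.onCycle (γ i) = ((List.replicate k (f.onPath l)).flatten : List _) := by
      rw [e, GraphMap.onCycle_coe, hpow]
    rw [he] at hi
    exact h.1 i ⟨_, k, hi.of_replicate hk, hk, he⟩
  · exact (h.2 i j hij).1 (congrArg _ e)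
  · exact (h.2 i j hij).2 ((congrArg f.onCycle e).trans (f.onCycle_revCycle _))

theorem familyRepresents_onCycle_iff {f : GraphMap G G'} {m : G.Marking n} {m' : G'.Marking n}
    (hf : f.PreservesMarking m m') (hG : G.IsConnected) {γ : Fin K → Cycle (E × Bool)}
    (hγ : ∀ i, IsCircuit G (γ i)) : FamilyRepresentsPartialFreeBasis m γ ↔
      FamilyRepresentsPartialFreeBasis m' fun i => f.onCycle (γ i) := by
  have : ∀ i, ∃ C, Represents m (γ i) C := by
    intro i
    have hi := hγ i
    obtain ⟨l, hl⟩ := (γ i).exists_rep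
    change (l : Cycle (E × Bool)) = γ i at hl
    rw [← hl] at hi ⊢
    obtain ⟨-, v, hv⟩ := hi.exists_isPath
    exact exists_represents hG m hv
  choose C hC using this
  exact familyRepresents_congr hC fun i => (hC i).map hf

end Transfer

/-! ### The algorithm: splits exist, runs are finite, answers are correct. -/

section Algorithm

variable {n K : ℕ}

theorem exists_splitStep (s : State n K) (h : CutVertexCondition s.graph s.family) :
    ∃ t, SplitStep s t := by
  have hγ := s.isFamily.1
  obtain ⟨d, S, hS⟩ := (cutVertexCondition_iff hγ).1 h
  obtain ⟨W₁, W₂, hW⟩ := hS.exists_isCut hγ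
  have hS := hW.isCutSet hγ
  obtain ⟨mH, -, hm, -⟩ := exists_marking_split d W₂.verts s.marking
  obtain ⟨δ, hδ, -⟩ := existsUnique_isSplitFamily s.isFamily hS
  obtain ⟨p, q, G₁, f, m₁, γ₁, hc, hv, hf, hm₁, hγ₁, hon⟩ := exists_subdivision
    (split s.graph d W₂.verts) (isCore_split s.core hγ hS)
    (exists_split_valence_ne_two s.core (valence_ne_two_of_isCutSet hγ s.natural hS)) mH δ hδ.1
  exact ⟨⟨p, q, G₁, hc, Or.inl hv, m₁, γ₁, hγ₁⟩, _, d, W₁, W₂, hW, mH, δ, f, hm, hδ,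
    hf.isNaturalStructure hv, hm₁, hon⟩

theorem weightLT_of_splitStep {s t : State n K} (h : SplitStep s t) :
    WeightLT (naturalWeight t.graph t.family) (naturalWeight s.graph s.family) := by
  obtain ⟨v, d, W₁, W₂, hW, mH, δ, f, -, hδ, hf, -, hon⟩ := h
  rw [← hf.naturalWeight_eq, funext hon]
  exact weightLT_split s.core s.natural s.isFamily.1 (hW.isCutSet s.isFamily.1) hδ.1.1 hδ.map_eq

theorem finite_support_naturalWeight {V E : Type*} [Finite E] (G : Multigraph V E)
    (γ : Fin K → Cycle (E × Bool)) : (Function.support (naturalWeight G γ)).Finite := by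
  refine (Set.finite_range (crossings γ)).subset fun k hk => ?_
  obtain ⟨N, e, -, he⟩ := Set.nonempty_of_ncard_ne_zero hk
  exact ⟨e, he⟩

theorem wellFounded_splitStep : WellFounded fun t s : State n K => SplitStep s t := by
  let w : State n K → ℕ →₀ ℕ := fun s =>
    Finsupp.ofSupportFinite (naturalWeight s.graph s.family) (finite_support_naturalWeight _ _)
  -- The order of the indices is reversed, because the largest index at which the weights differ
  -- decides.
  have hwf : WellFounded (Finsupp.Lex (fun a b : ℕ => b < a) (fun a b : ℕ => a < b)) :=
    Finsupp.Lex.wellFounded' (fun _ => Nat.not_lt_zero _) wellFounded_lt (wellFounded_lt (α := ℕ))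
  refine Subrelation.wf (r := InvImage _ w) ?_ (InvImage.wf w hwf)
  intro t s h
  obtain ⟨k, hk, hlt⟩ := weightLT_of_splitStep h
  exact ⟨k, hk, hlt⟩

theorem exists_loopOutput (s : State n K) : ∃ b, LoopOutput s b := by
  induction s using wellFounded_splitStep.induction with
  | _ s ih =>
    by_cases hv : NearVisible s.graph s.family
    · exact ⟨_, .visible s hv⟩
    · by_cases hc : CutVertexCondition s.graph s.family
      · obtain ⟨t, ht⟩ := exists_splitStep s hc
        obtain ⟨b, hb⟩ := ih t ht
        exact ⟨b, .split s t b hv hc ht hb⟩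
      · exact ⟨_, .noCut s hv hc⟩

theorem exists_algorithmOutput (s : State n K) : ∃ b, AlgorithmOutput s b := by
  by_cases h : JointlyPrimitive s.graph s.family
  · obtain ⟨b, hb⟩ := exists_loopOutput s
    exact ⟨b, Or.inr ⟨h, hb⟩⟩
  · exact ⟨false, Or.inl ⟨h, rfl⟩⟩

theorem SplitStep.transfer {s t : State n K} (h : SplitStep s t) :
    (JointlyPrimitive s.graph s.family → JointlyPrimitive t.graph t.family) ∧
    (FamilyRepresentsPartialFreeBasis t.marking t.family ↔
      FamilyRepresentsPartialFreeBasis s.marking s.family) := by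
  obtain ⟨v, d, W₁, W₂, hW, mH, δ, f, hm, hδ, hf, hm', hon⟩ := h
  have hon' : ∀ i, ((splitFold s.graph d W₂.verts).comp f).onCycle (t.family i) = s.family i := by
    intro i
    rw [GraphMap.comp_onCycle, hon, hδ.2.2]
  constructor
  · intro hJ
    refine JointlyPrimitive.of_onCycle (f := (splitFold s.graph d W₂.verts).comp f) ?_ ?_
    · intro i
      rw [hon']
      exact s.isFamily.1 i
    · simpa only [hon'] using hJ
  · rw [familyRepresents_onCycle_iff (hm.comp hm') t.core.1 t.isFamily.1]
    simp only [hon']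

/-- The stopping rule for "yes" rests on `crossings_le_one_of_uniqueTurns` and
`familyRepresents_of_crossings_le_one`, the one for "no" on the cut vertex lemma; a split keeps
joint primitivity and the represented classes. -/
theorem LoopOutput.correct {s : State n K} {b : Bool} (h : LoopOutput s b)
    (hJ : JointlyPrimitive s.graph s.family) :
    b = true ↔ FamilyRepresentsPartialFreeBasis s.marking s.family := by
  induction h with
  | visible s hv =>
    refine ⟨fun _ => ?_, fun _ => rfl⟩
    exact familyRepresents_of_crossings_le_one s.core.1 _ s.isFamily.1
      (crossings_le_one_of_uniqueTurns s.isFamily.1 ((nearVisible_iff s.isFamily.1).1 hv) hJ)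
  | noCut s hv hc =>
    refine ⟨fun h => absurd h Bool.false_ne_true, fun hrep => absurd ?_ hv⟩
    exact (nearVisible_iff s.isFamily.1).2 (uniqueTurns_of_familyRepresents s.isFamily.1 hrep
      fun h => hc ((cutVertexCondition_iff s.isFamily.1).2 h))
  | split s t b hv hc hst ht ih =>
    exact (ih (hst.transfer.1 hJ)).trans hst.transfer.2

theorem AlgorithmOutput.correct {s : State n K} {b : Bool} (h : AlgorithmOutput s b) :
    b = true ↔ FamilyRepresentsPartialFreeBasis s.marking s.family := by
  rcases h with ⟨hJ, rfl⟩ | ⟨hJ, h⟩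
  · exact ⟨fun h => absurd h Bool.false_ne_true, fun h => absurd (h.jointlyPrimitive s.core.1) hJ⟩
  · exact h.correct hJ

end Algorithm

/-! ### Listing the turns of cyclic words. -/

section CyclicMaps

variable {α β : Type*}

theorem mem_cyclicMap {g : α → α → α → β} {l : List α} {x : β} : x ∈ cyclicMap g l ↔
    ∃ (h : 0 < l.length) (k : ℕ), g (cycGet l h (k + (l.length - 1))) (cycGet l h k)
      (cycGet l h (k + 1)) = x := by
  constructor
  · intro hx
    obtain ⟨k, hk, rfl⟩ := List.getElem_of_mem hx
    rw [length_cyclicMap] at hk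
    refine ⟨by omega, k, ?_⟩
    simp only [cyclicMap, List.getElem_ofFn]
  · rintro ⟨h, k, rfl⟩
    have h' : 0 < (cyclicMap g l).length := by rwa [length_cyclicMap]
    rw [← cycGet_cyclicMap g h h' k]
    exact cycGet_mem h' k

theorem follows_iff_cycGet {l : List α} {a b : α} : Follows (l : Cycle α) a b ↔
    ∃ (h : 0 < l.length) (k : ℕ), cycGet l h k = a ∧ cycGet l h (k + 1) = b := by
  rw [follows_coe_iff]
  constructor
  · rintro ⟨i, hi, rfl, rfl⟩
    exact ⟨by omega, i, cycGet_of_lt hi _, rfl⟩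
  · rintro ⟨h, k, rfl, rfl⟩
    refine ⟨k % l.length, Nat.mod_lt _ h, rfl, ?_⟩
    simp only [cycGet, Nat.mod_add_mod]

theorem mem_cyclicMap_pair {g : α → α → β} {l : List α} {x : β} :
    x ∈ cyclicMap (fun _ a b => g a b) l ↔ ∃ a b, Follows (l : Cycle α) a b ∧ g a b = x := by
  rw [mem_cyclicMap]
  constructor
  · rintro ⟨h, k, rfl⟩
    exact ⟨_, _, follows_iff_cycGet.2 ⟨h, k, rfl, rfl⟩, rfl⟩
  · rintro ⟨a, b, hab, rfl⟩
    obtain ⟨h, k, rfl, rfl⟩ := follows_iff_cycGet.1 hab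
    exact ⟨h, k, rfl⟩

/-- The list of turns taken by a list of cyclic words. -/
def turnList {E : Type*} (W : List (List (E × Bool))) : List ((E × Bool) × (E × Bool)) :=
  W.flatMap fun l => cyclicMap (fun _ a b => (rev a, b)) l ++ cyclicMap (fun _ a b => (b, rev a)) l

theorem mem_turnList {E : Type*} {K : ℕ} {y : Fin K → List (E × Bool)} {s t : E × Bool} :
    (s, t) ∈ turnList (List.ofFn y) ↔ TurnOf (fun i => (y i : Cycle (E × Bool))) s t := by
  unfold turnList TurnOf
  simp only [List.mem_flatMap, List.mem_append, mem_cyclicMap_pair, takesTurn_iff, List.mem_ofFn]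
  constructor
  · rintro ⟨_, ⟨i, rfl⟩, ⟨a, b, h, e⟩ | ⟨a, b, h, e⟩⟩
    · obtain ⟨rfl, rfl⟩ := Prod.mk.inj e
      exact ⟨i, Or.inl (by rwa [rev_rev])⟩
    · obtain ⟨rfl, rfl⟩ := Prod.mk.inj e
      exact ⟨i, Or.inr (by rwa [rev_rev])⟩
  · rintro ⟨i, h | h⟩
    · exact ⟨_, ⟨i, rfl⟩, Or.inl ⟨_, _, h, by rw [rev_rev]⟩⟩
    · exact ⟨_, ⟨i, rfl⟩, Or.inr ⟨_, _, h, by rw [rev_rev]⟩⟩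

end CyclicMaps

/-! ### The decision procedure on coded words. -/

section CodedWords

/-- The set `S` of letters is a cut set for the letter `d` and the list `t` of turns. -/
def CutTest (t : List ((ℕ × Bool) × (ℕ × Bool))) (c : (ℕ × Bool) × List (ℕ × Bool)) : Prop :=
  (c.1 ∉ c.2 ∧ (∃ x ∈ t, x.1 = c.1 ∧ x.2 ∈ c.2)) ∧
    (∃ x ∈ t, x.1 = c.1 ∧ x.2 ∉ c.2 ∧ x.2 ≠ c.1) ∧
    ∀ x ∈ t, x.1 ∈ c.2 → x.2 ≠ c.1 → x.2 ∈ c.2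

instance (t : List ((ℕ × Bool) × (ℕ × Bool))) : DecidablePred (CutTest t) := fun c => by
  unfold CutTest
  infer_instance

def subsequences (l : List (ℕ × Bool)) : List (List (ℕ × Bool)) :=
  l.foldr (fun a s => s ++ s.map (a :: ·)) [[]]

/-- A cut set matters only through the letters that occur in turns, so it is enough to search the
sublists of a list of these letters. -/
theorem filter_mem_subsequences (p : ℕ × Bool → Bool) (l : List (ℕ × Bool)) :
    l.filter p ∈ subsequences l := by
  induction l with
  | nil => simp [subsequences]
  | cons a l ih =>
    change _ ∈ subsequences l ++ (subsequences l).map (a :: ·)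
    rw [List.mem_append, List.mem_map, List.filter_cons]
    split_ifs
    · exact Or.inr ⟨_, ih, rfl⟩
    · exact Or.inl ih

/-- The first cut that is found. -/
def findCut (t : List ((ℕ × Bool) × (ℕ × Bool))) : Option ((ℕ × Bool) × List (ℕ × Bool)) :=
  ((t.flatMap fun x => (subsequences (t.map Prod.fst)).map fun S => (x.1, S)).filter
    fun c => CutTest t c).head?

/-- `q` is the number of the new edge `E₂`; the counterpart on graphs is `liftLetter`. -/
def liftLetterCode (d : ℕ × Bool) (S : List (ℕ × Bool)) (q : ℕ) (p a b : ℕ × Bool) : ℕ × Bool :=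
  (if (a = d ∧ rev p ∈ S) ∨ (a = rev d ∧ b ∈ S) then q else a.1, a.2)

def liftWord (d : ℕ × Bool) (S : List (ℕ × Bool)) (q : ℕ) (l : WordCode) : WordCode :=
  cyclicMap (liftLetterCode d S q) l

/-- Split along the first cut that is found, if there is one. -/
def splitWords (s : ℕ × List WordCode) : ℕ × List WordCode :=
  (findCut (turnList s.2)).elim s fun c => (s.1 + 1, s.2.map (liftWord c.1 c.2 s.1))

def lettersOnce (W : List WordCode) : Bool :=
  decide (∀ a ∈ W.flatten.map Prod.fst, ((W.flatten.map Prod.fst).filter (· = a)).length ≤ 1)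

/-- Split as often as possible, and then check whether each letter occurs at most once. -/
def splitLoop (s : ℕ × List WordCode) : Bool :=
  lettersOnce (splitWords^[s.2.flatten.length] s).2

theorem findCut_eq_some {t : List ((ℕ × Bool) × (ℕ × Bool))} {c : (ℕ × Bool) × List (ℕ × Bool)}
    (h : findCut t = some c) : (∃ x ∈ t, x.1 = c.1) ∧ CutTest t c := by
  have := List.mem_of_head? h
  rw [List.mem_filter, List.mem_flatMap] at this
  obtain ⟨⟨x, hx, hc⟩, ht⟩ := this
  obtain ⟨S, -, rfl⟩ := List.mem_map.1 hc
  exact ⟨⟨x, hx, rfl⟩, by simpa using ht⟩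

theorem exists_findCut_eq_some {t : List ((ℕ × Bool) × (ℕ × Bool))} {x : (ℕ × Bool) × (ℕ × Bool)}
    {p : ℕ × Bool → Bool} (hx : x ∈ t) (h : CutTest t (x.1, (t.map Prod.fst).filter p)) :
    ∃ c, findCut t = some c := by
  have hm : (x.1, (t.map Prod.fst).filter p) ∈ ((t.flatMap fun x =>
      (subsequences (t.map Prod.fst)).map fun S => (x.1, S)).filter fun c => CutTest t c) := by
    rw [List.mem_filter, List.mem_flatMap]
    exact ⟨⟨x, hx, List.mem_map.2 ⟨_, filter_mem_subsequences p _, rfl⟩⟩, by simpa using h⟩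
  unfold findCut
  cases hl : ((t.flatMap fun x =>
      (subsequences (t.map Prod.fst)).map fun S => (x.1, S)).filter fun c => CutTest t c) with
  | nil => rw [hl] at hm; exact absurd hm List.not_mem_nil
  | cons a l => exact ⟨a, rfl⟩

end CodedWords

/-! ### Codes compared with graphs. -/

section Coding

variable {V E : Type*} {q K : ℕ}

def letterCode (iE : E ≃ Fin q) (a : E × Bool) : ℕ × Bool := ((iE a.1 : ℕ), a.2)

theorem letterCode_rev (iE : E ≃ Fin q) (a : E × Bool) :
    letterCode iE (rev a) = rev (letterCode iE a) := rfl

theorem letterCode_injective (iE : E ≃ Fin q) : Function.Injective (letterCode iE) := by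
  rintro ⟨x, b⟩ ⟨y, b'⟩ h
  simpa [letterCode, Fin.ext_iff.symm] using h

theorem letterCode_inj (iE : E ≃ Fin q) {a b : E × Bool} : letterCode iE a = letterCode iE b ↔ a = b :=
  (letterCode_injective iE).eq_iff

theorem turnOf_code {iE : E ≃ Fin q} {y : Fin K → List (E × Bool)} {s t : ℕ × Bool} :
    (s, t) ∈ turnList (List.ofFn fun i => wordCode iE (y i)) ↔ ∃ a b,
      TurnOf (fun i => (y i : Cycle (E × Bool))) a b ∧ letterCode iE a = s ∧ letterCode iE b = t := by
  rw [mem_turnList]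
  exact turnOf_map (D := letterCode iE) (letterCode_rev iE)
    (δ := fun i => (y i : Cycle (E × Bool)))

theorem cutTest_iff {iE : E ≃ Fin q} {y : Fin K → List (E × Bool)} {d : E × Bool}
    {S : List (ℕ × Bool)} :
    CutTest (turnList (List.ofFn fun i => wordCode iE (y i))) (letterCode iE d, S) ↔
      IsCutSet (fun i => (y i : Cycle (E × Bool))) d {a | letterCode iE a ∈ S} := by
  constructor
  · rintro ⟨⟨h1, ⟨⟨_, _⟩, h2, e2, h2'⟩⟩, ⟨⟨_, _⟩, h3, e3, h3', h3''⟩, h4⟩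
    obtain ⟨a, x, hx, rfl, rfl⟩ := turnOf_code.1 h2
    obtain rfl := (letterCode_inj iE).1 e2
    obtain ⟨a', z, hz, rfl, rfl⟩ := turnOf_code.1 h3
    obtain rfl := (letterCode_inj iE).1 e3
    refine ⟨h1, ⟨x, h2', hx⟩, ⟨z, h3', fun e => h3'' (by rw [e]), hz⟩, fun p r hpr hr hp => ?_⟩
    exact h4 _ (turnOf_code.2 ⟨p, r, hpr, rfl, rfl⟩) hp fun e => hr ((letterCode_inj iE).1 e)
  · intro h
    obtain ⟨x, hx, hdx⟩ := h.inside
    obtain ⟨z, hz, hzd, hdz⟩ := h.outside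
    refine ⟨⟨h.notMem, ⟨_, turnOf_code.2 ⟨_, _, hdx, rfl, rfl⟩, rfl, hx⟩⟩,
      ⟨_, turnOf_code.2 ⟨_, _, hdz, rfl, rfl⟩, rfl, hz, fun e => hzd ((letterCode_inj iE).1 e)⟩, ?_⟩
    rintro ⟨_, _⟩ ht hs hd
    obtain ⟨p, r, hpr, rfl, rfl⟩ := turnOf_code.1 ht
    exact h.closed p r hpr (fun e => hd (by rw [e])) hs

/-- The cut set is replaced by the list of those of its members that occur in turns; the conditions
of `IsCutSet` test no other letters. -/
theorem exists_findCut {iE : E ≃ Fin q} {y : Fin K → List (E × Bool)}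
    (h : HasCut fun i => (y i : Cycle (E × Bool))) :
    ∃ c, findCut (turnList (List.ofFn fun i => wordCode iE (y i))) = some c := by
  classical
  obtain ⟨d, S, hS⟩ := h
  obtain ⟨x, hx, hdx⟩ := hS.inside
  refine exists_findCut_eq_some (x := (letterCode iE d, letterCode iE x))
    (p := fun s => s ∈ letterCode iE '' S) (turnOf_code.2 ⟨_, _, hdx, rfl, rfl⟩) ?_
  rw [cutTest_iff]
  have hmem : ∀ a b, TurnOf (fun i => (y i : Cycle (E × Bool))) a b →
      (a ∈ {a | letterCode iE a ∈ ((turnList (List.ofFn fun i => wordCode iE (y i))).map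
        Prod.fst).filter fun s => s ∈ letterCode iE '' S} ↔ a ∈ S) := by
    intro a b hab
    rw [Set.mem_ofPred_eq, List.mem_filter, decide_eq_true_iff,
      (letterCode_injective iE).mem_set_image]
    exact and_iff_right (List.mem_map.2 ⟨_, turnOf_code.2 ⟨_, _, hab, rfl, rfl⟩, rfl⟩)
  refine ⟨fun h => hS.notMem ((hmem _ _ hdx).1 h), ⟨x, (hmem _ _ hdx.symm).2 hx, hdx⟩, ?_, ?_⟩
  · obtain ⟨z, hz, hzd, hdz⟩ := hS.outside
    exact ⟨z, fun h => hz ((hmem _ _ hdz.symm).1 h), hzd, hdz⟩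
  · intro p r hpr hr hp
    exact (hmem _ _ hpr.symm).2 (hS.closed p r hpr hr ((hmem _ _ hpr).1 hp))

/-- The numbering of the edges of the split graph. -/
def splitEquiv {q : ℕ} (iE : E ≃ Fin q) : Option E ≃ Fin (q + 1) :=
  (Equiv.optionCongr iE).trans finSuccEquivLast.symm

theorem splitEquiv_some (iE : E ≃ Fin q) (x : E) : (splitEquiv iE (some x) : ℕ) = iE x := by
  simp [splitEquiv]

theorem splitEquiv_none (iE : E ≃ Fin q) : (splitEquiv iE none : ℕ) = q := by
  simp [splitEquiv]

/-- `splitSet` requires in addition that a letter is based at the vertex of `d` and differs from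
`d`; for the neighbours of `d` in a circuit both are automatic. -/
theorem wordCode_liftList {G : Multigraph V E} {iE : E ≃ Fin q} {d : E × Bool} {T : Set (E × Bool)}
    {S : List (ℕ × Bool)} {l : List (E × Bool)} (hl : IsCircuit G (l : Cycle (E × Bool)))
    (hS : ∀ a, G.init a = G.init d → a ≠ d → (letterCode iE a ∈ S ↔ a ∈ T)) :
    wordCode (splitEquiv iE) (liftList G d T l) = liftWord (letterCode iE d) S q (wordCode iE l) := by
  have h0 : 0 < l.length := List.length_pos_iff.2 fun e => hl.1 (by rw [e]; rfl)
  have h1 : 0 < (wordCode iE l).length := by simpa [wordCode] using h0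
  have h2 : 0 < (liftList G d T l).length := by rwa [liftList, length_cyclicMap]
  have h3 : 0 < (liftWord (letterCode iE d) S q (wordCode iE l)).length := by
    rwa [liftWord, length_cyclicMap]
  have h4 : 0 < (wordCode (splitEquiv iE) (liftList G d T l)).length := by
    simpa [wordCode] using h2
  have hch := (chain_iff_cycGet h0).1 hl.2
  refine ext_cycGet h4 h3 (by simp [wordCode, liftList, liftWord]) fun k => ?_
  have e1 : cycGet (wordCode (splitEquiv iE) (liftList G d T l)) h4 k =
      letterCode (splitEquiv iE) (cycGet (liftList G d T l) h2 k) := cycGet_map h2 h4 k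
  have e2 : cycGet (liftList G d T l) h2 k = _ := cycGet_cyclicMap _ h0 h2 k
  have e3 : cycGet (liftWord (letterCode iE d) S q (wordCode iE l)) h3 k = _ :=
    cycGet_cyclicMap _ h1 h3 k
  have e4 : ∀ k, cycGet (wordCode iE l) h1 k = letterCode iE (cycGet l h0 k) := fun k =>
    cycGet_map h0 h1 k
  have e5 : (wordCode iE l).length = l.length := by simp [wordCode]
  rw [e1, e2, e3, e4, e4, e4, e5]
  have hk := hch (k + (l.length - 1))
  have e6 : cycGet l h0 (k + (l.length - 1) + 1) = cycGet l h0 k := by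
    rw [show k + (l.length - 1) + 1 = k + l.length by omega, cycGet_add_length]
  rw [e6] at hk
  have hk' := hch k
  generalize cycGet l h0 (k + (l.length - 1)) = p at hk ⊢
  generalize cycGet l h0 (k + 1) = b at hk' ⊢
  generalize cycGet l h0 k = a at hk hk' ⊢
  have hiff : (a = d ∧ rev p ∈ splitSet G d T) ∨ (a = rev d ∧ b ∈ splitSet G d T) ↔
      (letterCode iE a = letterCode iE d ∧ rev (letterCode iE p) ∈ S) ∨
        (letterCode iE a = rev (letterCode iE d) ∧ letterCode iE b ∈ S) := by
    rw [← letterCode_rev, ← letterCode_rev, letterCode_inj, letterCode_inj]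
    refine or_congr (and_congr_right fun had => ?_) (and_congr_right fun had => ?_)
    · have hp : G.init (rev p) = G.init d := had ▸ hk.1
      have hpd : rev p ≠ d := fun e => hk.2 (by rw [had, e])
      rw [hS _ hp hpd]
      exact ⟨fun h => h.1, fun h => ⟨h, hpd, hp⟩⟩
    · have hb : G.init b = G.init d := by rw [← hk'.1, had, term_rev]
      have hbd : b ≠ d := fun e => hk'.2 (by rw [had, e, rev_rev])
      rw [hS _ hb hbd]
      exact ⟨fun h => h.1, fun h => ⟨h, hbd, hb⟩⟩
  unfold liftLetter liftLetterCode
  by_cases h : (a = d ∧ rev p ∈ splitSet G d T) ∨ (a = rev d ∧ b ∈ splitSet G d T)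
  · rw [if_pos h, if_pos (hiff.1 h), letterCode, splitEquiv_none]
    rfl
  · rw [if_neg h, if_neg fun h' => h (hiff.2 h'), letterCode, splitEquiv_some]
    rfl

theorem lettersOnce_iff {iE : E ≃ Fin q} {y : Fin K → List (E × Bool)} :
    lettersOnce (List.ofFn fun i => wordCode iE (y i)) = true ↔
      ∀ e, crossings (fun i => (y i : Cycle (E × Bool))) e ≤ 1 := by
  classical
  have hcount : ∀ e, crossings (fun i => (y i : Cycle (E × Bool))) e =
      (((List.ofFn fun i => wordCode iE (y i)).flatten.map Prod.fst).filter
        (· = (iE e : ℕ))).length := by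
    intro e
    rw [crossings_def]
    have h1 : ∀ i, (((y i : Cycle (E × Bool)).toMultiset.map Prod.fst).count e) =
        ((wordCode iE (y i)).map Prod.fst).count (iE e : ℕ) := by
      intro i
      change ((y i : Multiset (E × Bool)).map Prod.fst).count e = _
      rw [Multiset.map_coe, Multiset.coe_count, wordCode, List.map_map]
      have : (Prod.fst ∘ fun a : E × Bool => ((iE a.1 : ℕ), a.2)) =
          (fun x => (iE x : ℕ)) ∘ Prod.fst := rfl
      rw [this, ← List.map_map]
      exact (List.count_map_of_injective _ (fun x => (iE x : ℕ))
        (Fin.val_injective.comp iE.injective) e).symm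
    simp only [h1]
    rw [List.map_flatten, List.map_ofFn, ← List.sum_ofFn]
    have h2 : ∀ (L : List (List ℕ)) (r : ℕ), (L.flatten.filter (· = r)).length =
        (L.map fun l => l.count r).sum := by
      intro L r
      induction L with
      | nil => rfl
      | cons l L ih =>
        rw [List.flatten_cons, List.filter_append, List.length_append, ih, List.map_cons,
          List.sum_cons, List.count_eq_length_filter]
        congr 3
    rw [h2, List.map_ofFn]
    rfl
  unfold lettersOnce
  rw [decide_eq_true_iff]
  constructor
  · intro h e
    rw [hcount]
    by_contra hc
    push Not at hc
    obtain ⟨a, ha⟩ := List.exists_mem_of_length_pos (Nat.zero_lt_of_lt hc)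
    rw [List.mem_filter, decide_eq_true_iff] at ha
    have := h a ha.1
    rw [ha.2] at this
    omega
  · intro h a ha
    obtain ⟨⟨_, b⟩, hx, rfl⟩ := List.mem_map.1 ha
    obtain ⟨l, hl, hx⟩ := List.mem_flatten.1 hx
    obtain ⟨i, rfl⟩ := List.mem_ofFn.1 hl
    obtain ⟨x, -, e⟩ := List.mem_map.1 hx
    obtain ⟨rfl, rfl⟩ := Prod.mk.inj e
    rw [← hcount]
    exact h _

end Coding

/-! ### Correctness of the decision procedure. -/

section Correctness

variable {n K : ℕ}

theorem sum_crossings_eq {E : Type*} [Fintype E] (y : Fin K → List (E × Bool)) :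
    ∑ e, crossings (fun i => (y i : Cycle (E × Bool))) e = ∑ i, (y i).length := by
  classical
  simp only [crossings_def]
  rw [Finset.sum_comm]
  refine Finset.sum_congr rfl fun i _ => ?_
  rw [Multiset.sum_count_eq_card fun a _ => Finset.mem_univ a]
  change Multiset.card ((y i : Multiset (E × Bool)).map Prod.fst) = _
  rw [Multiset.card_map, Multiset.coe_card]

/-- If `k = k₁ + k₂` with positive summands, then `(k₁ - 1) + (k₂ - 1) < k - 1`. Unlike the natural
weight, this potential does not refer to natural edges, so vertices of valence two need not be
removed. -/
theorem sum_crossings_sub_one_split {V E : Type*} [Fintype E] {G : Multigraph V E} {d : E × Bool}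
    {T : Set (E × Bool)} {γ : Fin K → Cycle (E × Bool)} {δ : Fin K → Cycle (Option E × Bool)}
    (hS : IsCutSet γ d (splitSet G d T)) (hδ : ∀ i, IsCircuit (split G d T) (δ i))
    (h : ∀ i, (δ i).map (splitDir d) = γ i) :
    ∑ e, (crossings δ e - 1) < ∑ e, (crossings γ e - 1) := by
  classical
  obtain ⟨h1, h2⟩ := crossings_none_pos hS hδ h
  have hx := crossings_map_splitDir h
  rw [Fintype.sum_option, ← Finset.add_sum_erase _ _ (Finset.mem_univ d.1),
    ← Finset.add_sum_erase _ _ (Finset.mem_univ d.1), hx d.1, if_pos rfl]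
  have : ∑ x ∈ Finset.univ.erase d.1, (crossings γ x - 1) =
      ∑ x ∈ Finset.univ.erase d.1, (crossings δ (some x) - 1) := by
    refine Finset.sum_congr rfl fun x hxm => ?_
    rw [hx x, if_neg (Finset.ne_of_mem_erase hxm), add_zero]
  rw [this]
  omega

/-- Induction on a bound for the excess crossings. Without excess both sides hold. If no cut is
found, `splitWords` is stationary and the cut vertex lemma, with joint primitivity, decides;
otherwise one split lowers the bound. -/
theorem splitWords_correct (N : ℕ) : ∀ {V E : Type} [Fintype E] {q : ℕ} (iE : E ≃ Fin q)
    {G : Multigraph V E} (_ : G.IsConnected) (m : G.Marking n) {y : Fin K → List (E × Bool)}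
    (_ : ∀ i, IsCircuit G (y i : Cycle (E × Bool))),
    ∑ e, (crossings (fun i => (y i : Cycle (E × Bool))) e - 1) ≤ N →
    (lettersOnce (splitWords^[N] (q, List.ofFn fun i => wordCode iE (y i))).2 = true ↔
      FamilyRepresentsPartialFreeBasis m fun i => (y i : Cycle (E × Bool))) := by
  induction N with
  | zero =>
    intro V E _ q iE G hG m y hy hN
    have h1 : ∀ e, crossings (fun i => (y i : Cycle (E × Bool))) e ≤ 1 := fun e => by
      have := Finset.sum_eq_zero_iff.1 (Nat.le_zero.1 hN) e (Finset.mem_univ e)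
      omega
    exact iff_of_true (lettersOnce_iff.2 h1) (familyRepresents_of_crossings_le_one hG m hy h1)
  | succ N ih =>
    intro V E _ q iE G hG m y hy hN
    rw [Function.iterate_succ_apply]
    cases hc : findCut (turnList (List.ofFn fun i => wordCode iE (y i))) with
    | none =>
      have hfix : splitWords (q, List.ofFn fun i => wordCode iE (y i)) =
          (q, List.ofFn fun i => wordCode iE (y i)) := by
        rw [splitWords, hc]
        rfl
      rw [hfix, Function.iterate_fixed hfix, lettersOnce_iff]
      refine ⟨familyRepresents_of_crossings_le_one hG m hy, fun hrep => ?_⟩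
      refine crossings_le_one_of_uniqueTurns hy (uniqueTurns_of_familyRepresents hy hrep fun h => ?_)
        (hrep.jointlyPrimitive hG)
      obtain ⟨c, hc'⟩ := exists_findCut (iE := iE) h
      rw [hc] at hc'
      exact Option.some_ne_none c hc'.symm
    | some c =>
      obtain ⟨⟨⟨_, _⟩, hx, hx1⟩, ht⟩ := findCut_eq_some hc
      obtain ⟨d, x, -, rfl, -⟩ := turnOf_code.1 hx
      obtain ⟨_, S⟩ := c
      change letterCode iE d = _ at hx1
      subst hx1
      have hT := cutTest_iff.1 ht
      set T : Set (E × Bool) := {a | letterCode iE a ∈ S} with hTdef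
      -- The list found may contain directions at other vertices; restricted to the vertex of `d` it
      -- is still a cut set.
      have hS : IsCutSet (fun i => (y i : Cycle (E × Bool))) d (splitSet G d T) := by
        obtain ⟨x, hxT, hdx⟩ := hT.inside
        obtain ⟨z, hz, hzd, hdz⟩ := hT.outside
        refine ⟨fun h => h.2.1 rfl, ⟨x, ⟨hxT, ?_, (hdx.init_eq hy).symm⟩, hdx⟩,
          ⟨z, fun h => hz h.1, hzd, hdz⟩, fun p r hpr hr hp => ?_⟩
        · rintro rfl
          exact hT.notMem hxT
        · exact ⟨hT.closed p r hpr hr hp.1, hr, (hpr.init_eq hy).symm.trans hp.2.2⟩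
      have hl : ∀ i, IsCircuit (split G d T)
          (liftList G d T (y i) : Cycle (Option E × Bool)) := fun i =>
        isCircuit_liftList hy hS rfl
      have hm : ∀ i, (liftList G d T (y i) : Cycle (Option E × Bool)).map (splitDir d) =
          (y i : Cycle (E × Bool)) := fun i => congrArg _ (map_liftList ..)
      have hstep : splitWords (q, List.ofFn fun i => wordCode iE (y i)) =
          (q + 1, List.ofFn fun i => wordCode (splitEquiv iE) (liftList G d T (y i))) := by
        rw [splitWords, hc, Option.elim_some, List.map_ofFn]
        congr 2
        funext i
        exact (wordCode_liftList (hy i) fun a _ _ => Iff.rfl).symm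
      obtain ⟨mH, -, hmH, -⟩ := exists_marking_split d T m
      rw [hstep, ih (splitEquiv iE) (isConnected_split hG) mH hl ?_,
        familyRepresents_onCycle_iff hmH (isConnected_split hG) hl]
      · simp only [splitFold_onCycle, hm]
      · have := sum_crossings_sub_one_split hS hl hm
        omega

/-- The excess is at most the total length of the words, which is the number of iterations. -/
theorem splitLoop_correct {V E : Type} {q : ℕ} (iE : E ≃ Fin q) {G : Multigraph V E}
    (hG : G.IsConnected) (m : G.Marking n) {y : Fin K → List (E × Bool)}
    (hy : ∀ i, IsCircuit G (y i : Cycle (E × Bool))) :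
    splitLoop (q, List.ofFn fun i => wordCode iE (y i)) = true ↔
      FamilyRepresentsPartialFreeBasis m fun i => (y i : Cycle (E × Bool)) := by
  have := Fintype.ofEquiv _ iE.symm
  refine splitWords_correct _ iE hG m hy ?_
  refine (Finset.sum_le_sum fun e _ => Nat.sub_le _ 1).trans (sum_crossings_eq y).le |>.trans ?_
  rw [List.length_flatten, List.map_ofFn, List.sum_ofFn]
  exact Finset.sum_le_sum fun i _ => by simp [wordCode]

/-- By `AlgorithmOutput.correct` the answer of a run depends only on what the family represents, so
that of an arbitrary run agrees with `splitLoop`. -/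
theorem splitLoop_algorithmOutput (s : State n K) {c : FamilyCode} (hc : s.IsCode c) :
    AlgorithmOutput s (splitLoop (c.1.2.length, c.2.2)) := by
  obtain ⟨x, y, -, hy, rfl⟩ := hc
  obtain ⟨b, hb⟩ := exists_algorithmOutput s
  have hfam : (fun i => (y i : Cycle (Fin s.numE × Bool))) = s.family := funext hy
  have h1 := splitLoop_correct (Equiv.refl _) s.core.1 s.marking (y := y) fun i => by
    rw [hy i]
    exact s.isFamily.1 i
  rw [hfam] at h1
  have h2 : b = splitLoop (s.numE, List.ofFn fun i => wordCode (Equiv.refl _) (y i)) :=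
    Bool.eq_iff_iff.2 (hb.correct.trans h1.symm)
  simp only [graphCode, List.length_ofFn]
  rwa [h2] at hb

end Correctness

/-! ### Primitive recursiveness of the decision procedure. -/

section Primitive

variable {σ α β : Type*} [Primcodable σ] [Primcodable α] [Primcodable β]

/-- Removes dependent indices. The default value is never used, because positions are taken modulo
the length. -/
theorem cyclicMap_eq_map_range {α β : Type*} (x : α) (g : α → α → α → β) (l : List α) :
    cyclicMap g l = (List.range l.length).map fun i =>
      g (l.getD ((i + (l.length - 1)) % l.length) x) (l.getD (i % l.length) x)
        (l.getD ((i + 1) % l.length) x) := by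
  refine List.ext_getElem (by simp) fun i h1 h2 => ?_
  have h0 : 0 < l.length := by
    rw [length_cyclicMap] at h1
    omega
  have h : ∀ k, cycGet l h0 k = l.getD (k % l.length) x := fun k =>
    (List.getD_eq_getElem _ _ (Nat.mod_lt _ h0)).symm
  simp only [cyclicMap, List.getElem_ofFn, List.getElem_map, List.getElem_range, h]

theorem primrec_cyclicMap [Inhabited α] {f : σ → List α} {g : σ → α × α × α → β} (hf : Primrec f)
    (hg : Primrec₂ g) : Primrec fun s => cyclicMap (fun p a b => g s (p, a, b)) (f s) := by
  have hl : Primrec fun z : σ × ℕ => (f z.1).length := Primrec.list_length.comp (hf.comp .fst)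
  have hget : ∀ {k : σ × ℕ → ℕ}, Primrec k → Primrec fun z => (f z.1).getD (k z % (f z.1).length)
      default := fun hk =>
    (Primrec.list_getD default).comp (hf.comp .fst) (Primrec.nat_mod.comp hk hl)
  have h1 := hget (k := fun z => z.2 + ((f z.1).length - 1))
    (Primrec.nat_add.comp .snd (Primrec.nat_sub.comp hl (.const 1)))
  have h2 := hget Primrec.snd
  have h3 := hget (k := fun z => z.2 + 1) (Primrec.nat_add.comp .snd (.const 1))
  refine (Primrec.list_map (Primrec.list_range.comp (Primrec.list_length.comp hf))
    (hg.comp (g := fun z : σ × ℕ => z.1) .fst (h1.pair (h2.pair h3))).to₂).of_eq fun s => ?_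
  rw [cyclicMap_eq_map_range default]

theorem primrecRel_mem [DecidableEq α] : PrimrecRel fun (a : α) (l : List α) => a ∈ l :=
  (Primrec.eq.exists_mem_list.comp .snd .fst).of_eq fun z => by simp

theorem primrec_rev : Primrec (rev : ℕ × Bool → ℕ × Bool) :=
  Primrec.fst.pair (Primrec.not.comp .snd)

theorem primrec_turnList : Primrec (turnList : List WordCode → _) := by
  unfold turnList
  have h1 : Primrec fun l : WordCode => cyclicMap (fun _ a b => (rev a, b)) l :=
    primrec_cyclicMap (g := fun _ z => (rev z.2.1, z.2.2)) .id
      ((primrec_rev.comp (Primrec.fst.comp (Primrec.snd.comp .snd))).pair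
        (Primrec.snd.comp (Primrec.snd.comp .snd))).to₂
  have h2 : Primrec fun l : WordCode => cyclicMap (fun _ a b => (b, rev a)) l :=
    primrec_cyclicMap (g := fun _ z => (z.2.2, rev z.2.1)) .id
      ((Primrec.snd.comp (Primrec.snd.comp .snd)).pair
        (primrec_rev.comp (Primrec.fst.comp (Primrec.snd.comp .snd)))).to₂
  exact Primrec.list_flatMap .id (Primrec.list_append.comp₂ (h1.comp₂ .right) (h2.comp₂ .right))

section CutTest

variable [DecidableEq α]

theorem primrecRel_inside :
    PrimrecRel fun (x : α × α) (c : α × List α) => x.1 = c.1 ∧ x.2 ∈ c.2 := by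
  have h1 : PrimrecPred fun z : (α × α) × α × List α => z.1.1 = z.2.1 :=
    Primrec.eq.comp (Primrec.fst.comp .fst) (Primrec.fst.comp .snd)
  have h2 : PrimrecPred fun z : (α × α) × α × List α => z.1.2 ∈ z.2.2 :=
    primrecRel_mem.comp (Primrec.snd.comp .fst) (Primrec.snd.comp .snd)
  exact h1.and h2

theorem primrecRel_outside :
    PrimrecRel fun (x : α × α) (c : α × List α) => x.1 = c.1 ∧ x.2 ∉ c.2 ∧ x.2 ≠ c.1 := by
  have h1 : PrimrecPred fun z : (α × α) × α × List α => z.1.1 = z.2.1 :=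
    Primrec.eq.comp (Primrec.fst.comp .fst) (Primrec.fst.comp .snd)
  have h2 : PrimrecPred fun z : (α × α) × α × List α => z.1.2 ∈ z.2.2 :=
    primrecRel_mem.comp (Primrec.snd.comp .fst) (Primrec.snd.comp .snd)
  have h3 : PrimrecPred fun z : (α × α) × α × List α => z.1.2 = z.2.1 :=
    Primrec.eq.comp (Primrec.snd.comp .fst) (Primrec.fst.comp .snd)
  exact h1.and (h2.not.and h3.not)

theorem primrecRel_closed :
    PrimrecRel fun (x : α × α) (c : α × List α) => x.1 ∈ c.2 → x.2 ≠ c.1 → x.2 ∈ c.2 := by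
  have h1 : PrimrecPred fun z : (α × α) × α × List α => z.1.1 ∈ z.2.2 :=
    primrecRel_mem.comp (Primrec.fst.comp .fst) (Primrec.snd.comp .snd)
  have h2 : PrimrecPred fun z : (α × α) × α × List α => z.1.2 ∈ z.2.2 :=
    primrecRel_mem.comp (Primrec.snd.comp .fst) (Primrec.snd.comp .snd)
  have h3 : PrimrecPred fun z : (α × α) × α × List α => z.1.2 = z.2.1 :=
    Primrec.eq.comp (Primrec.snd.comp .fst) (Primrec.fst.comp .snd)
  exact (h1.not.or (h3.or h2)).of_eq fun z => by tauto

end CutTest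

theorem primrecRel_cutTest : PrimrecRel fun c t => CutTest t c := by
  have h0 : PrimrecPred fun z : ((ℕ × Bool) × List (ℕ × Bool)) × List ((ℕ × Bool) × (ℕ × Bool)) =>
      z.1.1 ∉ z.1.2 := (primrecRel_mem.comp (Primrec.fst.comp .fst) (Primrec.snd.comp .fst)).not
  have h1 : PrimrecPred fun z : ((ℕ × Bool) × List (ℕ × Bool)) × List ((ℕ × Bool) × (ℕ × Bool)) =>
      ∃ x ∈ z.2, x.1 = z.1.1 ∧ x.2 ∈ z.1.2 := primrecRel_inside.exists_mem_list.comp .snd .fst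
  have h2 : PrimrecPred fun z : ((ℕ × Bool) × List (ℕ × Bool)) × List ((ℕ × Bool) × (ℕ × Bool)) =>
      ∃ x ∈ z.2, x.1 = z.1.1 ∧ x.2 ∉ z.1.2 ∧ x.2 ≠ z.1.1 :=
    primrecRel_outside.exists_mem_list.comp .snd .fst
  have h3 : PrimrecPred fun z : ((ℕ × Bool) × List (ℕ × Bool)) × List ((ℕ × Bool) × (ℕ × Bool)) =>
      ∀ x ∈ z.2, x.1 ∈ z.1.2 → x.2 ≠ z.1.1 → x.2 ∈ z.1.2 :=
    primrecRel_closed.forall_mem_list.comp .snd .fst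
  exact ((h0.and h1).and (h2.and h3)).of_eq fun z => Iff.rfl

theorem primrec_subsequences : Primrec subsequences := by
  have h1 : Primrec fun z : List (ℕ × Bool) × (ℕ × Bool) × List (List (ℕ × Bool)) => z.2.2 :=
    Primrec.snd.comp .snd
  have h2 : Primrec fun z : List (ℕ × Bool) × (ℕ × Bool) × List (List (ℕ × Bool)) => z.2.1 :=
    Primrec.fst.comp .snd
  have h3 : Primrec fun z : List (ℕ × Bool) × (ℕ × Bool) × List (List (ℕ × Bool)) =>
      z.2.2.map (z.2.1 :: ·) :=
    Primrec.list_map h1 (Primrec.list_cons.comp (h2.comp .fst) .snd).to₂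
  have h4 : Primrec fun z : List (ℕ × Bool) × (ℕ × Bool) × List (List (ℕ × Bool)) =>
      z.2.2 ++ z.2.2.map (z.2.1 :: ·) := Primrec.list_append.comp h1 h3
  exact Primrec.list_foldr (h := fun (_ : List (ℕ × Bool)) z => z.2 ++ z.2.map (z.1 :: ·))
    (Primrec.id (α := List (ℕ × Bool))) (.const [[]]) h4.to₂

theorem primrec_findCut : Primrec findCut := by
  have h1 : Primrec fun t : List ((ℕ × Bool) × (ℕ × Bool)) => subsequences (t.map Prod.fst) :=
    primrec_subsequences.comp (Primrec.list_map .id (Primrec.fst.comp .snd).to₂)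
  have h2 : Primrec fun z : List ((ℕ × Bool) × (ℕ × Bool)) × ((ℕ × Bool) × (ℕ × Bool)) =>
      (subsequences (z.1.map Prod.fst)).map fun S => (z.2.1, S) :=
    Primrec.list_map (h1.comp .fst) ((Primrec.fst.comp (Primrec.snd.comp .fst)).pair .snd).to₂
  have h3 : Primrec fun t : List ((ℕ × Bool) × (ℕ × Bool)) =>
      t.flatMap fun x => (subsequences (t.map Prod.fst)).map fun S => (x.1, S) :=
    Primrec.list_flatMap .id h2.to₂
  exact Primrec.list_head?.comp (primrecRel_cutTest.listFilter.comp h3 .id)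

theorem primrec_liftWord {d : σ → ℕ × Bool} {S : σ → List (ℕ × Bool)} {q : σ → ℕ} {l : σ → WordCode}
    (hd : Primrec d) (hS : Primrec S) (hq : Primrec q) (hl : Primrec l) :
    Primrec fun s => liftWord (d s) (S s) (q s) (l s) := by
  have hd' : Primrec fun z : σ × (ℕ × Bool) × (ℕ × Bool) × (ℕ × Bool) => d z.1 := hd.comp .fst
  have hS' : Primrec fun z : σ × (ℕ × Bool) × (ℕ × Bool) × (ℕ × Bool) => S z.1 := hS.comp .fst
  have hq' : Primrec fun z : σ × (ℕ × Bool) × (ℕ × Bool) × (ℕ × Bool) => q z.1 := hq.comp .fst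
  have hp : Primrec fun z : σ × (ℕ × Bool) × (ℕ × Bool) × (ℕ × Bool) => z.2.1 :=
    Primrec.fst.comp .snd
  have ha : Primrec fun z : σ × (ℕ × Bool) × (ℕ × Bool) × (ℕ × Bool) => z.2.2.1 :=
    Primrec.fst.comp (Primrec.snd.comp .snd)
  have hb : Primrec fun z : σ × (ℕ × Bool) × (ℕ × Bool) × (ℕ × Bool) => z.2.2.2 :=
    Primrec.snd.comp (Primrec.snd.comp .snd)
  have h1 : PrimrecPred fun z : σ × (ℕ × Bool) × (ℕ × Bool) × (ℕ × Bool) => z.2.2.1 = d z.1 :=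
    Primrec.eq.comp ha hd'
  have h2 : PrimrecPred fun z : σ × (ℕ × Bool) × (ℕ × Bool) × (ℕ × Bool) => rev z.2.1 ∈ S z.1 :=
    primrecRel_mem.comp (primrec_rev.comp hp) hS'
  have h3 : PrimrecPred fun z : σ × (ℕ × Bool) × (ℕ × Bool) × (ℕ × Bool) => z.2.2.1 = rev (d z.1) :=
    Primrec.eq.comp ha (primrec_rev.comp hd')
  have h4 : PrimrecPred fun z : σ × (ℕ × Bool) × (ℕ × Bool) × (ℕ × Bool) => z.2.2.2 ∈ S z.1 :=
    primrecRel_mem.comp hb hS'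
  have h5 : Primrec fun z : σ × (ℕ × Bool) × (ℕ × Bool) × (ℕ × Bool) =>
      liftLetterCode (d z.1) (S z.1) (q z.1) z.2.1 z.2.2.1 z.2.2.2 :=
    (Primrec.ite ((h1.and h2).or (h3.and h4)) hq' (Primrec.fst.comp ha)).pair (Primrec.snd.comp ha)
  exact primrec_cyclicMap (g := fun s z => liftLetterCode (d s) (S s) (q s) z.1 z.2.1 z.2.2) hl
    h5.to₂

theorem primrec_splitWords : Primrec splitWords := by
  have h1 : Primrec fun z : ((ℕ × List WordCode) × (ℕ × Bool) × List (ℕ × Bool)) × WordCode =>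
      liftWord z.1.2.1 z.1.2.2 z.1.1.1 z.2 :=
    primrec_liftWord (Primrec.fst.comp (Primrec.snd.comp .fst))
      (Primrec.snd.comp (Primrec.snd.comp .fst)) (Primrec.fst.comp (Primrec.fst.comp .fst)) .snd
  have h2 : Primrec fun z : (ℕ × List WordCode) × (ℕ × Bool) × List (ℕ × Bool) =>
      z.1.2.map (liftWord z.2.1 z.2.2 z.1.1) :=
    Primrec.list_map (Primrec.snd.comp .fst) h1.to₂
  have h3 : Primrec fun z : (ℕ × List WordCode) × (ℕ × Bool) × List (ℕ × Bool) => z.1.1 + 1 :=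
    Primrec.succ.comp (Primrec.fst.comp .fst)
  refine (Primrec.option_casesOn (primrec_findCut.comp (primrec_turnList.comp .snd)) .id
    (h3.pair h2).to₂).of_eq fun s => ?_
  unfold splitWords
  cases findCut (turnList s.2) <;> rfl

theorem primrec_lettersOnce : Primrec lettersOnce := by
  have hL : Primrec fun W : List WordCode => W.flatten.map Prod.fst :=
    Primrec.list_map Primrec.list_flatten (Primrec.fst.comp .snd).to₂
  have h : PrimrecRel fun (a : ℕ) (l : List ℕ) => (l.filter (· = a)).length ≤ 1 :=
    Primrec.nat_le.comp (Primrec.list_length.comp (Primrec.eq.listFilter.comp .snd .fst)) (.const 1)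
  exact primrecPred_iff_primrec_decide.1 (h.forall_mem_list.comp hL hL)

theorem primrec_splitLoop : Primrec splitLoop :=
  primrec_lettersOnce.comp (Primrec.snd.comp (Primrec.nat_iterate
    (Primrec.list_length.comp (Primrec.list_flatten.comp .snd)) .id
    (primrec_splitWords.comp .snd).to₂))

end Primitive

/-! ### Cyclic reduction of words. -/

section CyclicReduction

variable {α β : Type*} [DecidableEq α] [DecidableEq β]

/-- Free reduction of a word. -/
def freeReduce (w : List (α × Bool)) : List (α × Bool) :=
  w.foldr (fun a s => if s.head? = some (rev a) then s.tail else a :: s) []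

/-- Cancel the first letter with the last one, if possible. -/
def trimStep (w : List (α × Bool)) : List (α × Bool) :=
  if w.reverse.head? = w.head?.map rev then w.tail.reverse.tail.reverse else w

def cyclicReduce (w : List (α × Bool)) : List (α × Bool) := trimStep^[w.length] (freeReduce w)

theorem freeReduce_cons (a : α × Bool) (w : List (α × Bool)) : freeReduce (a :: w) =
    if (freeReduce w).head? = some (rev a) then (freeReduce w).tail else a :: freeReduce w := rfl

theorem mk_freeReduce (w : List (α × Bool)) : FreeGroup.mk (freeReduce w) = FreeGroup.mk w := by
  induction w with
  | nil => rfl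
  | cons a w ih =>
    rw [freeReduce_cons, ← List.singleton_append (l := w), mk_append, ← ih]
    split_ifs with h
    · obtain ⟨l, hl⟩ := List.head?_eq_some_iff.1 h
      rw [hl, List.tail_cons, ← List.singleton_append (l := l), mk_append, ← mul_assoc]
      have : FreeGroup.mk [rev a] = (FreeGroup.mk [a])⁻¹ := by
        rw [FreeGroup.inv_mk]
        rfl
      rw [this, mul_inv_cancel, one_mul]
    · rw [← List.singleton_append (l := freeReduce w), mk_append]

theorem length_freeReduce_le (w : List (α × Bool)) : (freeReduce w).length ≤ w.length := by
  induction w with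
  | nil => rfl
  | cons a w ih =>
    rw [freeReduce_cons]
    split_ifs
    · rw [List.length_tail, List.length_cons]
      omega
    · simpa using ih

theorem isChain_freeReduce (w : List (α × Bool)) :
    (freeReduce w).IsChain fun a b => b ≠ rev a := by
  induction w with
  | nil => exact .nil
  | cons a w ih =>
    rw [freeReduce_cons]
    split_ifs with h
    · exact ih.tail
    · cases hw : freeReduce w with
      | nil => exact .singleton _
      | cons b l =>
        rw [hw] at h ih
        exact List.isChain_cons_cons.2 ⟨fun e => h (by rw [e]; rfl), ih⟩

/-- The first alternative records that no cancellation at the ends remains. It includes the empty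
word, which passes the test as `none = none` but is left unchanged. -/
theorem trimStep_eq_or (w : List (α × Bool)) :
    (trimStep w = w ∧ (w ≠ [] → w.getLast? ≠ w.head?.map rev)) ∨
      ∃ a, w = a :: (trimStep w ++ [rev a]) := by
  unfold trimStep
  rw [List.head?_reverse]
  split_ifs with h
  · cases w with
    | nil => exact Or.inl ⟨rfl, fun h => absurd rfl h⟩
    | cons a l =>
      right
      refine ⟨a, ?_⟩
      rcases List.eq_nil_or_concat l with rfl | ⟨l, b, rfl⟩
      · have : a.2 = !a.2 := congrArg Prod.snd (Option.some_inj.1 h)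
        simp at this
      · have : b = rev a := by simpa [List.getLast?_cons] using h
        simp [this]
  · exact Or.inl ⟨rfl, fun _ => h⟩

theorem conj_trimStep (w : List (α × Bool)) :
    ConjClasses.mk (FreeGroup.mk (trimStep w)) = ConjClasses.mk (FreeGroup.mk w) := by
  rcases trimStep_eq_or w with h | ⟨a, h⟩
  · rw [h.1]
  · rw [ConjClasses.mk_eq_mk_iff_isConj, isConj_iff]
    refine ⟨FreeGroup.mk [a], ?_⟩
    conv_rhs => rw [h, ← List.singleton_append, mk_append, mk_append, ← mul_assoc]
    rw [FreeGroup.inv_mk]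
    rfl

theorem isChain_trimStep {w : List (α × Bool)} (hw : w.IsChain fun a b => b ≠ rev a) :
    (trimStep w).IsChain fun a b => b ≠ rev a := by
  rcases trimStep_eq_or w with h | ⟨a, h⟩
  · rwa [h.1]
  · rw [h] at hw
    exact hw.tail.left_of_append

/-- Each effective step removes two letters, so `w.length` steps certainly reach a fixed point. -/
theorem trimStep_iterate (N : ℕ) : ∀ w : List (α × Bool), w.length ≤ N →
    trimStep (trimStep^[N] w) = trimStep^[N] w := by
  induction N with
  | zero =>
    intro w hw
    rw [List.length_eq_zero_iff.1 (Nat.le_zero.1 hw)]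
    rfl
  | succ N ih =>
    intro w hw
    rw [Function.iterate_succ_apply]
    rcases trimStep_eq_or w with h | ⟨a, h⟩
    · rw [h.1, Function.iterate_fixed h.1, h.1]
    · refine ih _ ?_
      have := congrArg List.length h
      simp only [List.length_cons, List.length_append] at this
      omega

theorem conj_cyclicReduce (w : List (α × Bool)) :
    ConjClasses.mk (FreeGroup.mk (cyclicReduce w)) = ConjClasses.mk (FreeGroup.mk w) := by
  rw [← mk_freeReduce w, cyclicReduce]
  induction w.length with
  | zero => rfl
  | succ N ih => rw [Function.iterate_succ_apply', conj_trimStep, ih]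

/-- `freeReduce` takes care of the inner pairs, and a fixed point of `trimStep` has no cancellation
in the closing pair. -/
theorem chain_cyclicReduce (w : List (α × Bool)) :
    (cyclicReduce w : Cycle (α × Bool)).Chain fun a b => b ≠ rev a := by
  have h1 : (cyclicReduce w).IsChain fun a b => b ≠ rev a := by
    rw [cyclicReduce]
    induction w.length with
    | zero => exact isChain_freeReduce w
    | succ N ih =>
      rw [Function.iterate_succ_apply']
      exact isChain_trimStep ih
  have h2 : trimStep (cyclicReduce w) = cyclicReduce w :=
    trimStep_iterate _ _ (length_freeReduce_le w)
  cases hw : cyclicReduce w with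
  | nil => simp
  | cons a l =>
    rw [hw] at h1 h2
    rw [Cycle.chain_coe_cons, ← List.cons_append, List.isChain_append]
    refine ⟨h1, .singleton _, fun x hx y hy => ?_⟩
    obtain rfl : a = y := by simpa using hy
    rintro rfl
    rcases trimStep_eq_or (rev x :: l) with h | ⟨b, h⟩
    · exact h.2 (by simp) (by rw [Option.mem_def.1 hx]; simp)
    · have := congrArg List.length h
      rw [h2] at this
      simp at this

theorem map_freeReduce {f : α → β} (hf : Function.Injective f) (w : List (α × Bool)) :
    freeReduce (w.map fun a => (f a.1, a.2)) = (freeReduce w).map fun a => (f a.1, a.2) := by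
  have hF : Function.Injective fun a : α × Bool => (f a.1, a.2) := by
    rintro ⟨x, b⟩ ⟨y, b'⟩ h
    simpa [hf.eq_iff] using h
  induction w with
  | nil => rfl
  | cons a w ih =>
    rw [List.map_cons, freeReduce_cons, freeReduce_cons, ih, List.head?_map]
    have : ((freeReduce w).head?.map fun a => (f a.1, a.2)) = some (rev (f a.1, a.2)) ↔
        (freeReduce w).head? = some (rev a) := by
      rw [show some (rev (f a.1, a.2)) = (some (rev a)).map fun a => (f a.1, a.2) from rfl,
        (Option.map_injective hF).eq_iff]
    simp only [this]
    split_ifs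
    · rw [List.map_tail]
    · rfl

theorem map_trimStep {f : α → β} (hf : Function.Injective f) (w : List (α × Bool)) :
    trimStep (w.map fun a => (f a.1, a.2)) = (trimStep w).map fun a => (f a.1, a.2) := by
  have hF : Function.Injective fun a : α × Bool => (f a.1, a.2) := by
    rintro ⟨x, b⟩ ⟨y, b'⟩ h
    simpa [hf.eq_iff] using h
  unfold trimStep
  have : (w.map fun a => (f a.1, a.2)).reverse.head? =
      (w.map fun a => (f a.1, a.2)).head?.map rev ↔ w.reverse.head? = w.head?.map rev := by
    rw [← List.map_reverse, List.head?_map, List.head?_map, Option.map_map,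
      show rev ∘ (fun a : α × Bool => (f a.1, a.2)) = (fun a : α × Bool => (f a.1, a.2)) ∘ rev from rfl,
      ← Option.map_map, (Option.map_injective hF).eq_iff]
  simp only [this]
  split_ifs
  · simp only [List.map_reverse, List.map_tail]
  · rfl

/-- Reduction only compares letters. This is the passage from words over `Fin n` to coded words. -/
theorem map_cyclicReduce {f : α → β} (hf : Function.Injective f) (w : List (α × Bool)) :
    cyclicReduce (w.map fun a => (f a.1, a.2)) = (cyclicReduce w).map fun a => (f a.1, a.2) := by
  unfold cyclicReduce
  rw [List.length_map, map_freeReduce hf]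
  induction w.length with
  | zero => rfl
  | succ N ih => rw [Function.iterate_succ_apply', Function.iterate_succ_apply', ih, map_trimStep hf]

theorem primrec_cyclicReduce : Primrec (cyclicReduce : WordCode → WordCode) := by
  have hs : Primrec fun z : WordCode × (ℕ × Bool) × WordCode => z.2.2 := Primrec.snd.comp .snd
  have ha : Primrec fun z : WordCode × (ℕ × Bool) × WordCode => z.2.1 := Primrec.fst.comp .snd
  have h1 : PrimrecPred fun z : WordCode × (ℕ × Bool) × WordCode =>
      z.2.2.head? = some (rev z.2.1) :=
    Primrec.eq.comp (Primrec.list_head?.comp hs) (Primrec.option_some.comp (primrec_rev.comp ha))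
  have h2' : Primrec fun z : WordCode × (ℕ × Bool) × WordCode =>
      if z.2.2.head? = some (rev z.2.1) then z.2.2.tail else z.2.1 :: z.2.2 :=
    Primrec.ite h1 (Primrec.list_tail.comp hs) (Primrec.list_cons.comp ha hs)
  have h2 : Primrec (freeReduce : WordCode → WordCode) :=
    Primrec.list_foldr (f := fun w : WordCode => w) (g := fun _ => [])
      (h := fun _ z => if z.2.head? = some (rev z.1) then z.2.tail else z.1 :: z.2)
      .id (.const []) h2'.to₂
  have h3 : PrimrecPred fun w : WordCode => w.reverse.head? = w.head?.map rev :=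
    Primrec.eq.comp (Primrec.list_head?.comp Primrec.list_reverse)
      (Primrec.option_map Primrec.list_head? (primrec_rev.comp .snd).to₂)
  have h4 : Primrec (trimStep : WordCode → WordCode) :=
    Primrec.ite h3 (Primrec.list_reverse.comp (Primrec.list_tail.comp
      (Primrec.list_reverse.comp Primrec.list_tail))) .id
  exact Primrec.nat_iterate Primrec.list_length h2 (h4.comp .snd).to₂

end CyclicReduction

/-! ### Words as circuits in the rose. -/

section Rose

/-- The rose with `n` petals. -/
def rose (n : ℕ) : Multigraph Unit (Fin n) := ⟨fun _ => ()⟩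

variable {n K : ℕ}

theorem isPath_rose (l : List (Fin n × Bool)) : (rose n).IsPath () l () := by
  induction l with
  | nil => rfl
  | cons a l ih => exact ⟨rfl, ih⟩

theorem isConnected_rose : (rose n).IsConnected := ⟨⟨()⟩, fun _ _ => ⟨[], rfl⟩⟩

theorem pi1_rose : (rose n).pi1 () = ⊤ := by
  refine eq_top_iff.2 fun g _ => ?_
  induction g using Quot.inductionOn with
  | h l => exact ⟨l, isPath_rose l, rfl⟩

noncomputable def roseMarking (n : ℕ) : (rose n).Marking n where
  base := ()
  iso := Subgroup.topEquiv.symm.trans (MulEquiv.subgroupCongr pi1_rose.symm)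

theorem represents_rose (l : List (Fin n × Bool)) :
    Represents (roseMarking n) (l : Cycle (Fin n × Bool)) (ConjClasses.mk (FreeGroup.mk l)) := by
  refine ⟨FreeGroup.mk l, l, [], (), rfl, rfl, isPath_rose l, rfl, ?_⟩
  rw [mk_nil, one_mul, inv_one, mul_one]
  rfl

theorem familyRepresents_rose_iff {y : Fin K → List (Fin n × Bool)} :
    FamilyRepresentsPartialFreeBasis (roseMarking n) (fun i => (y i : Cycle (Fin n × Bool))) ↔
      RepresentedByPartialFreeBasis fun i => ConjClasses.mk (FreeGroup.mk (y i)) := by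
  constructor
  · rintro ⟨C, hC, h⟩
    rwa [show (fun i => ConjClasses.mk (FreeGroup.mk (y i))) = C from
      funext fun i => (represents_rose (y i)).unique (hC i)]
  · exact fun h => ⟨_, fun i => represents_rose (y i), h⟩

theorem RepresentedByPartialFreeBasis.ne_one {C : Fin K → ConjClasses (FreeGroup (Fin n))}
    (h : RepresentedByPartialFreeBasis C) (i : Fin K) : C i ≠ ConjClasses.mk 1 := by
  obtain ⟨g, -, hg, κ, b, hb⟩ := h
  obtain ⟨k, hk⟩ := hb ⟨i, rfl⟩
  rw [← hg i]
  intro e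
  rw [ConjClasses.mk_eq_mk_iff_isConj, isConj_one_left, ← hk] at e
  have := congrArg b.repr e
  rw [FreeGroupBasis.repr_apply_coe, map_one] at this
  exact FreeGroup.of_ne_one k this

/-- The decision procedure for partial free bases that are given by words. -/
def partialBasisTest (c : ℕ × List WordCode) : Bool :=
  decide (∀ w ∈ c.2, cyclicReduce w ≠ []) && splitLoop (c.1, c.2.map cyclicReduce)

theorem primrec_partialBasisTest : Primrec partialBasisTest := by
  have h1 : PrimrecRel fun (w : WordCode) (_ : ℕ × List WordCode) => cyclicReduce w ≠ [] :=
    PrimrecPred.not (Primrec.eq.comp (primrec_cyclicReduce.comp .fst) (.const ([] : WordCode)))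
  have h2 : Primrec fun c : ℕ × List WordCode => decide (∀ w ∈ c.2, cyclicReduce w ≠ []) :=
    primrecPred_iff_primrec_decide.1 (h1.forall_mem_list.comp .snd .id)
  exact Primrec.and.comp h2 (primrec_splitLoop.comp
    (Primrec.fst.pair (Primrec.list_map .snd (primrec_cyclicReduce.comp .snd).to₂)))

/-- A nonempty cyclic reduction is a circuit in the rose, to which `splitLoop_correct` applies; as
that does not ask for distinct circuits, repeated classes need no separate treatment. If some word
reduces to the empty one, its class is trivial and both sides fail. -/
theorem partialBasisTest_correct (ws : List (List (Fin n × Bool))) :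
    partialBasisTest (n, ws.map fun w => w.map fun a => ((a.1 : ℕ), a.2)) = true ↔
      RepresentedByPartialFreeBasis
        fun i : Fin ws.length => ConjClasses.mk (FreeGroup.mk (ws.get i)) := by
  have hred : ∀ w : List (Fin n × Bool), cyclicReduce (w.map fun a => ((a.1 : ℕ), a.2)) =
      wordCode (Equiv.refl _) (cyclicReduce w) := fun w => map_cyclicReduce Fin.val_injective w
  have hC : ∀ i, ConjClasses.mk (FreeGroup.mk (ws.get i)) =
      ConjClasses.mk (FreeGroup.mk (cyclicReduce (ws.get i))) := fun i => (conj_cyclicReduce _).symm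
  have hW : ((ws.map fun w => w.map fun a => ((a.1 : ℕ), a.2)).map cyclicReduce) =
      List.ofFn fun i => wordCode (Equiv.refl _) (cyclicReduce (ws.get i)) := by
    conv_lhs => rw [← List.ofFn_get ws]
    rw [List.map_ofFn, List.map_ofFn]
    congr 1
    funext i
    exact hred _
  unfold partialBasisTest
  rw [Bool.and_eq_true, decide_eq_true_iff, hW, funext hC]
  by_cases hne : ∀ i, cyclicReduce (ws.get i) ≠ []
  · rw [splitLoop_correct (Equiv.refl _) isConnected_rose (roseMarking n) fun i =>
      ⟨fun e => hne i ((Cycle.coe_eq_nil _).1 e),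
        (chain_cyclicReduce (ws.get i)).imp fun _ _ h => ⟨rfl, h⟩⟩, familyRepresents_rose_iff]
    refine and_iff_right fun w hw => ?_
    obtain ⟨w, hw', rfl⟩ := List.mem_map.1 hw
    obtain ⟨i, rfl⟩ := List.mem_iff_get.1 hw'
    rw [hred, wordCode, ne_eq, List.map_eq_nil_iff]
    exact hne i
  · push Not at hne
    obtain ⟨i, hi⟩ := hne
    refine iff_of_false (fun h => ?_) fun h => h.ne_one i (by rw [hi]; rfl)
    refine h.1 _ (List.mem_map.2 ⟨_, List.get_mem ws i, rfl⟩) ?_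
    rw [hred, hi]
    rfl

end Rose

/-! ### The split operation on codes. -/

section SplitCode

/-- The default `(0, 0)` is not reached for codes of actual directions. -/
def initCode (es : List (ℕ × ℕ)) (a : ℕ × Bool) : ℕ :=
  if a.2 = true then (es.getD a.1 (0, 0)).1 else (es.getD a.1 (0, 0)).2

/-- `g.1`, the number of old vertices, is the number given to `v₂`. -/
def attachCode (g : GraphCode) (d : ℕ × Bool) (S : List (ℕ × Bool)) (a : ℕ × Bool) : ℕ :=
  if a ∈ S ∧ a ≠ d ∧ initCode g.2 a = initCode g.2 d then g.1 else initCode g.2 a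

def splitInitCode (g : GraphCode) (d : ℕ × Bool) (S : List (ℕ × Bool)) (β : Bool) : ℕ :=
  if β = d.2 then g.1 else attachCode g d S (d.1, β)

def splitGraphCode (g : GraphCode) (d : ℕ × Bool) (S : List (ℕ × Bool)) : GraphCode :=
  (g.1 + 1, (List.range g.2.length).map (fun j =>
    (attachCode g d S (j, true), attachCode g d S (j, false))) ++
      [(splitInitCode g d S true, splitInitCode g d S false)])

/-- `g.2.length`, the number of old edges, is the number given to `E₂`. -/
def jumpCode (g : GraphCode) (d : ℕ × Bool) (v : ℕ) : WordCode :=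
  if v = g.1 then [d, (g.2.length, !d.2)] else []

def sectionCode (g : GraphCode) (d : ℕ × Bool) (S : List (ℕ × Bool)) (l : WordCode) : WordCode :=
  l.flatMap fun a => jumpCode g d (attachCode g d S a) ++ ([a] ++
    ((jumpCode g d (attachCode g d S (rev a))).map rev).reverse)

def foldCode (g : GraphCode) (d : ℕ × Bool) : MapCode :=
  (List.range g.1 ++ [initCode g.2 d], (List.range g.2.length).map (fun j => [(j, true)]) ++
    [[(d.1, true)]])

/-- The split graph with its marking and circuits, and the fold, in terms of codes. -/
def splitCode (z : FamilyCode × CutCode) : FamilyCode × MapCode :=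
  ((splitGraphCode z.1.1 z.2.1 z.2.2.2,
    (z.1.2.1.1, z.1.2.1.2.map (sectionCode z.1.1 z.2.1 z.2.2.2)),
    z.1.2.2.map (liftWord z.2.1 z.2.2.2 z.1.1.2.length)), foldCode z.1.1 z.2.1)

variable {σ : Type*} [Primcodable σ] {g : σ → GraphCode} {d a : σ → ℕ × Bool}
  {S : σ → List (ℕ × Bool)}

theorem primrec_initCode {es : σ → List (ℕ × ℕ)} (hes : Primrec es) (ha : Primrec a) :
    Primrec fun s => initCode (es s) (a s) := by
  have h1 : Primrec fun s => (es s).getD (a s).1 (0, 0) :=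
    (Primrec.list_getD (0, 0)).comp hes (Primrec.fst.comp ha)
  exact Primrec.ite (Primrec.eq.comp (Primrec.snd.comp ha) (.const true)) (Primrec.fst.comp h1)
    (Primrec.snd.comp h1)

theorem primrec_attachCode (hg : Primrec g) (hd : Primrec d) (hS : Primrec S) (ha : Primrec a) :
    Primrec fun s => attachCode (g s) (d s) (S s) (a s) := by
  have h1 : Primrec fun s => initCode (g s).2 (a s) := primrec_initCode (Primrec.snd.comp hg) ha
  have h2 : Primrec fun s => initCode (g s).2 (d s) := primrec_initCode (Primrec.snd.comp hg) hd
  exact Primrec.ite ((primrecRel_mem.comp ha hS).and ((Primrec.eq.comp ha hd).not.and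
    (Primrec.eq.comp h1 h2))) (Primrec.fst.comp hg) h1

theorem primrec_splitInitCode (hg : Primrec g) (hd : Primrec d) (hS : Primrec S) (β : Bool) :
    Primrec fun s => splitInitCode (g s) (d s) (S s) β :=
  Primrec.ite (Primrec.eq.comp (.const β) (Primrec.snd.comp hd)) (Primrec.fst.comp hg)
    (primrec_attachCode hg hd hS ((Primrec.fst.comp hd).pair (.const β)))

theorem primrec_splitGraphCode (hg : Primrec g) (hd : Primrec d) (hS : Primrec S) :
    Primrec fun s => splitGraphCode (g s) (d s) (S s) := by
  have h1 : ∀ β, Primrec fun z : σ × ℕ => attachCode (g z.1) (d z.1) (S z.1) (z.2, β) := fun β =>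
    primrec_attachCode (hg.comp .fst) (hd.comp .fst) (hS.comp .fst) (Primrec.snd.pair (.const β))
  have h2 : Primrec fun s => (List.range (g s).2.length).map (fun j =>
      (attachCode (g s) (d s) (S s) (j, true), attachCode (g s) (d s) (S s) (j, false))) :=
    Primrec.list_map (Primrec.list_range.comp (Primrec.list_length.comp (Primrec.snd.comp hg)))
      ((h1 true).pair (h1 false)).to₂
  exact (Primrec.succ.comp (Primrec.fst.comp hg)).pair (Primrec.list_concat.comp h2
    ((primrec_splitInitCode hg hd hS true).pair (primrec_splitInitCode hg hd hS false)))

theorem primrec_jumpCode {v : σ → ℕ} (hg : Primrec g) (hd : Primrec d) (hv : Primrec v) :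
    Primrec fun s => jumpCode (g s) (d s) (v s) := by
  have h1 : Primrec fun s => ((g s).2.length, !(d s).2) :=
    (Primrec.list_length.comp (Primrec.snd.comp hg)).pair (Primrec.not.comp (Primrec.snd.comp hd))
  exact Primrec.ite (Primrec.eq.comp hv (Primrec.fst.comp hg))
    (Primrec.list_cons.comp hd (Primrec.list_cons.comp h1 (.const []))) (.const [])

theorem primrec_sectionCode {l : σ → WordCode} (hg : Primrec g) (hd : Primrec d) (hS : Primrec S)
    (hl : Primrec l) : Primrec fun s => sectionCode (g s) (d s) (S s) (l s) := by
  have hg' : Primrec fun z : σ × (ℕ × Bool) => g z.1 := hg.comp .fst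
  have hd' : Primrec fun z : σ × (ℕ × Bool) => d z.1 := hd.comp .fst
  have hS' : Primrec fun z : σ × (ℕ × Bool) => S z.1 := hS.comp .fst
  have h1 : Primrec fun z : σ × (ℕ × Bool) =>
      jumpCode (g z.1) (d z.1) (attachCode (g z.1) (d z.1) (S z.1) z.2) :=
    primrec_jumpCode hg' hd' (primrec_attachCode hg' hd' hS' .snd)
  have h2 : Primrec fun z : σ × (ℕ × Bool) =>
      jumpCode (g z.1) (d z.1) (attachCode (g z.1) (d z.1) (S z.1) (rev z.2)) :=
    primrec_jumpCode hg' hd' (primrec_attachCode hg' hd' hS' (primrec_rev.comp .snd))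
  have h3 : Primrec fun z : σ × (ℕ × Bool) =>
      ((jumpCode (g z.1) (d z.1) (attachCode (g z.1) (d z.1) (S z.1) (rev z.2))).map rev).reverse :=
    Primrec.list_reverse.comp (Primrec.list_map h2 (primrec_rev.comp .snd).to₂)
  exact Primrec.list_flatMap hl (Primrec.list_append.comp h1 (Primrec.list_cons.comp .snd h3)).to₂

theorem primrec_foldCode (hg : Primrec g) (hd : Primrec d) :
    Primrec fun s => foldCode (g s) (d s) := by
  have h1 : Primrec fun s => (List.range (g s).2.length).map fun j => [(j, true)] :=
    Primrec.list_map (Primrec.list_range.comp (Primrec.list_length.comp (Primrec.snd.comp hg)))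
      (Primrec.list_cons.comp (Primrec.snd.pair (.const true)) (.const [])).to₂
  have h2 : Primrec fun s => [((d s).1, true)] :=
    Primrec.list_cons.comp ((Primrec.fst.comp hd).pair (.const true)) (.const [])
  exact (Primrec.list_concat.comp (Primrec.list_range.comp (Primrec.fst.comp hg))
    (primrec_initCode (Primrec.snd.comp hg) hd)).pair (Primrec.list_concat.comp h1 h2)

theorem primrec_splitCode : Primrec splitCode := by
  have hg : Primrec fun z : FamilyCode × CutCode => z.1.1 := Primrec.fst.comp .fst
  have hd : Primrec fun z : FamilyCode × CutCode => z.2.1 := Primrec.fst.comp .snd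
  have hS : Primrec fun z : FamilyCode × CutCode => z.2.2.2 :=
    Primrec.snd.comp (Primrec.snd.comp .snd)
  have hm : Primrec fun z : FamilyCode × CutCode => z.1.2.1 :=
    Primrec.fst.comp (Primrec.snd.comp .fst)
  have h1 : Primrec fun z : (FamilyCode × CutCode) × WordCode =>
      sectionCode z.1.1.1 z.1.2.1 z.1.2.2.2 z.2 :=
    primrec_sectionCode (hg.comp .fst) (hd.comp .fst) (hS.comp .fst) .snd
  have h2 : Primrec fun z : (FamilyCode × CutCode) × WordCode =>
      liftWord z.1.2.1 z.1.2.2.2 z.1.1.1.2.length z.2 :=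
    primrec_liftWord (hd.comp .fst) (hS.comp .fst)
      (Primrec.list_length.comp (Primrec.snd.comp (hg.comp .fst))) .snd
  have h3 : Primrec fun z : FamilyCode × CutCode =>
      z.1.2.1.2.map (sectionCode z.1.1 z.2.1 z.2.2.2) :=
    Primrec.list_map (Primrec.snd.comp hm) h1.to₂
  have h4 : Primrec fun z : FamilyCode × CutCode =>
      z.1.2.2.map (liftWord z.2.1 z.2.2.2 z.1.1.2.length) :=
    Primrec.list_map (Primrec.snd.comp (Primrec.snd.comp .fst)) h2.to₂
  exact ((primrec_splitGraphCode hg hd hS).pair (((Primrec.fst.comp hm).pair h3).pair h4)).pair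
    (primrec_foldCode hg hd)

end SplitCode

/-! ### Correctness of the coded split. -/

section SplitCodeCorrect

variable {V E : Type*} {p q n K : ℕ} {G : Multigraph V E} {d : E × Bool} {T : Set (E × Bool)}
  {S : List (ℕ × Bool)} {iV : V ≃ Fin p} {iE : E ≃ Fin q}

theorem length_graphCode : (graphCode iV iE G).2.length = q := List.length_ofFn

theorem initCode_graphCode (a : E × Bool) :
    initCode (graphCode iV iE G).2 (letterCode iE a) = iV (G.init a) := by
  obtain ⟨e, b⟩ := a
  have : (graphCode iV iE G).2.getD (iE e) (0, 0) =
      ((iV (G.init (e, true)) : ℕ), (iV (G.init (e, false)) : ℕ)) := by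
    rw [List.getD_eq_getElem _ _ (by rw [length_graphCode]; exact (iE e).2)]
    simp [graphCode]
  unfold initCode letterCode
  cases b <;> simp only [this, if_true, Bool.false_eq_true, if_false]

theorem attachCode_graphCode (hS : ∀ a, letterCode iE a ∈ S ↔ a ∈ T) (a : E × Bool) :
    attachCode (graphCode iV iE G) (letterCode iE d) S (letterCode iE a) =
      splitEquiv iV (attach G d T a) := by
  have h : letterCode iE a ∈ S ∧ letterCode iE a ≠ letterCode iE d ∧
      initCode (graphCode iV iE G).2 (letterCode iE a) =
        initCode (graphCode iV iE G).2 (letterCode iE d) ↔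
      a ∈ T ∧ a ≠ d ∧ G.init a = G.init d := by
    rw [hS, ne_eq, letterCode_inj, initCode_graphCode, initCode_graphCode, Fin.val_inj,
      iV.apply_eq_iff_eq]
  unfold attachCode attach
  by_cases h' : a ∈ T ∧ a ≠ d ∧ G.init a = G.init d
  · rw [if_pos (h.2 h'), if_pos h', splitEquiv_none]
    rfl
  · rw [if_neg fun e => h' (h.1 e), if_neg h', splitEquiv_some, initCode_graphCode]

theorem splitInitCode_graphCode (hS : ∀ a, letterCode iE a ∈ S ↔ a ∈ T) (β : Bool) :
    splitInitCode (graphCode iV iE G) (letterCode iE d) S β =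
      splitEquiv iV ((split G d T).init (none, β)) := by
  unfold splitInitCode
  change (if β = d.2 then _ else _) = (splitEquiv iV (if β = d.2 then _ else _) : ℕ)
  split_ifs
  · rw [splitEquiv_none]; rfl
  · exact attachCode_graphCode hS (d.1, β)

/-- The new element is numbered last, so its value is appended to the list of the old ones. -/
theorem ofFn_splitEquiv {X : Type*} {F : Option E → X} {f : ℕ → X}
    (h : ∀ e, f (iE e) = F (some e)) : (List.ofFn fun j => F ((splitEquiv iE).symm j)) =
      (List.range q).map f ++ [F none] := by
  have hs : ∀ j : Fin q, (splitEquiv iE).symm j.castSucc = some (iE.symm j) := fun j => by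
    rw [Equiv.symm_apply_eq, Fin.ext_iff, splitEquiv_some, iE.apply_symm_apply, Fin.val_castSucc]
  have hl : (splitEquiv iE).symm (Fin.last q) = none := by
    rw [Equiv.symm_apply_eq, Fin.ext_iff, splitEquiv_none, Fin.val_last]
  rw [List.ofFn_succ', List.concat_eq_append, hl]
  congr 1
  refine List.ext_getElem (by simp) fun j h1 h2 => ?_
  have hj : j < q := by simpa using h2
  rw [List.getElem_ofFn, List.getElem_map, List.getElem_range, hs, ← h, iE.apply_symm_apply]

theorem splitGraphCode_graphCode (hS : ∀ a, letterCode iE a ∈ S ↔ a ∈ T) :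
    splitGraphCode (graphCode iV iE G) (letterCode iE d) S =
      graphCode (splitEquiv iV) (splitEquiv iE) (split G d T) := by
  unfold splitGraphCode
  rw [length_graphCode, splitInitCode_graphCode hS, splitInitCode_graphCode hS]
  refine congrArg (p + 1, ·) (ofFn_splitEquiv (iE := iE) (F := fun z =>
    ((splitEquiv iV ((split G d T).init (z, true)) : ℕ),
      (splitEquiv iV ((split G d T).init (z, false)) : ℕ))) fun e => ?_).symm
  exact congrArg₂ Prod.mk (attachCode_graphCode hS (e, true)) (attachCode_graphCode hS (e, false))

theorem jumpCode_graphCode (u : Option V) :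
    jumpCode (graphCode iV iE G) (letterCode iE d) (splitEquiv iV u) =
      wordCode (splitEquiv iE) (splitJump d u) := by
  unfold jumpCode
  cases u with
  | none =>
    rw [splitEquiv_none, length_graphCode]
    simp [graphCode, wordCode, splitJump, letterCode, splitEquiv_none, splitEquiv_some]
  | some v =>
    rw [splitEquiv_some]
    exact if_neg (iV v).2.ne

theorem map_rev_wordCode_reverse {E : Type*} {q : ℕ} (iE : E ≃ Fin q) (l : List (E × Bool)) :
    ((wordCode iE l).map rev).reverse = wordCode iE (FreeGroup.invRev l) := by
  simp [wordCode, FreeGroup.invRev, rev]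

theorem sectionCode_graphCode (hS : ∀ a, letterCode iE a ∈ S ↔ a ∈ T) (l : List (E × Bool)) :
    sectionCode (graphCode iV iE G) (letterCode iE d) S (wordCode iE l) =
      wordCode (splitEquiv iE) ((splitSection G d T).onPath l) := by
  have hdir : ∀ a, (splitSection G d T).onDir a = splitJump d (attach G d T a) ++
      ([(some a.1, a.2)] ++ FreeGroup.invRev (splitJump d (attach G d T (rev a)))) := by
    rintro ⟨e, b⟩
    cases b with
    | true => rfl
    | false =>
      simp only [GraphMap.onDir, splitSection, Bool.false_eq_true, if_false, FreeGroup.invRev_append,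
        FreeGroup.invRev_invRev, List.append_assoc]
      rfl
  induction l with
  | nil => rfl
  | cons a l ih =>
    rw [GraphMap.onPath_cons, hdir]
    change (jumpCode _ _ (attachCode _ _ _ (letterCode iE a)) ++ ([letterCode iE a] ++
      ((jumpCode _ _ (attachCode _ _ _ (rev (letterCode iE a)))).map rev).reverse)) ++
      sectionCode _ _ _ (wordCode iE l) = _
    rw [ih, ← letterCode_rev, attachCode_graphCode hS, attachCode_graphCode hS, jumpCode_graphCode,
      jumpCode_graphCode, map_rev_wordCode_reverse]
    simp [wordCode, letterCode, splitEquiv_some]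

theorem foldCode_graphCode : foldCode (graphCode iV iE G) (letterCode iE d) =
    mapCode (splitEquiv iV) (splitEquiv iE) iV iE (splitFold G d T) := by
  unfold foldCode mapCode
  rw [initCode_graphCode, length_graphCode]
  refine congrArg₂ Prod.mk ?_ ?_
  · rw [ofFn_splitEquiv (iE := iV) (F := fun v => (iV ((splitFold G d T).onV v) : ℕ)) (f := id)
      fun _ => rfl, List.map_id]
    rfl
  · rw [ofFn_splitEquiv (iE := iE) (F := fun e => wordCode iE ((splitFold G d T).onE e))
      (f := fun j => [(j, true)]) fun _ => rfl]
    rfl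

/-- The marking is transported by applying `splitSection` to the given words, the family by lifting
the given words for the circuits; both depend on the cut only through `d` and membership in `T`. -/
theorem splitCode_correct {m : G.Marking n} {γ : Fin K → Cycle (E × Bool)} {T₁ : Set (E × Bool)}
    {c : FamilyCode} {c' : CutCode} (hγ : IsCircuitFamily G γ) (hT : IsCutSet γ d (splitSet G d T))
    (hc : IsFamilyCode iV iE G m γ c) (hc' : IsCutCode iE d T₁ T c') :
    ∃ (mH : (split G d T).Marking n) (δ : Fin K → Cycle (Option E × Bool)),
      (splitFold G d T).PreservesMarking mH m ∧ IsSplitFamily G d T γ δ ∧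
      IsFamilyCode (splitEquiv iV) (splitEquiv iE) (split G d T) mH δ (splitCode (c, c')).1 ∧
      (splitCode (c, c')).2 =
        mapCode (splitEquiv iV) (splitEquiv iE) iV iE (splitFold G d T) := by
  obtain ⟨x, y, hx, hy, rfl⟩ := hc
  obtain ⟨l₁, l₂, -, hl, rfl⟩ := hc'
  have hS : ∀ a, letterCode iE a ∈ wordCode iE l₂ ↔ a ∈ T := fun a =>
    ((List.mem_map_of_injective (letterCode_injective iE)).trans (hl a))
  obtain ⟨mH, hb, hm, hg⟩ := exists_marking_split d T m
  refine ⟨mH, _, hm, (isSplitFamily_iff hγ hT hy).2 rfl,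
    ⟨fun i => (splitSection G d T).onPath (x i), fun i => liftList G d T (y i), fun i => ⟨?_, ?_⟩,
      fun i => rfl, ?_⟩, foldCode_graphCode⟩
  · rw [hb]
    exact (splitSection G d T).isPath_onPath (hx i).1
  · rw [hg, ← (hx i).2, GraphMap.hom_mk]
  · have h1 : splitGraphCode _ _ _ = _ := splitGraphCode_graphCode (iV := iV) (G := G) (d := d) hS
    have h2 : ∀ i, _ = _ := fun i => sectionCode_graphCode (iV := iV) (G := G) (d := d) hS (x i)
    have h3 : ∀ i, _ = _ := fun i => wordCode_liftList (G := G) (d := d) (iE := iE)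
      (by rw [hy i]; exact hγ.1 i) fun a _ _ => hS a
    simp only [h3, ← h2, hb, ← h1, splitEquiv_some]
    unfold splitCode
    simp only [length_graphCode, List.map_ofFn]
    rfl

end SplitCodeCorrect

end Whitehead

/-! ### Assembly of the theorem. -/

open Whitehead in
theorem mainTheorem7 :
    -- the split operation
    (∀ (n K : ℕ) (V E : Type*) [Finite V] [Finite E] (G : Multigraph V E) (m : G.Marking n)
      (γ : Fin K → Cycle (E × Bool)) (v : V) (d : E × Bool)
      (W₁ W₂ : (⊤ : SimpleGraph (E × Bool)).Subgraph),
      G.IsCore → G.IsNatural → IsCircuitFamily G γ → IsCut G γ v d W₁ W₂ →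
      (split G d W₂.verts).IsCore ∧
      (splitFold G d W₂.verts).IsFold (splitEdge₁ d) (splitEdge₂ d) ∧
      (∃ mH : (split G d W₂.verts).Marking n, (splitFold G d W₂.verts).PreservesMarking mH m ∧
        ∀ mH' : (split G d W₂.verts).Marking n,
          (splitFold G d W₂.verts).PreservesMarking mH' m → mH'.Homotopic mH) ∧
      (∃! δ : Fin K → Cycle (Option E × Bool), IsSplitFamily G d W₂.verts γ δ) ∧
      ∀ δ : Fin K → Cycle (Option E × Bool), IsSplitFamily G d W₂.verts γ δ →
        WeightLT (naturalWeight (split G d W₂.verts) δ) (naturalWeight G γ)) ∧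
    -- the constructions of the marked graph `H`, the fold `f` and the family `δ` are algorithmic
    (∃ F : FamilyCode × CutCode → FamilyCode × MapCode, Computable F ∧
      ∀ (n K p q : ℕ) (V E : Type) (iV : V ≃ Fin p) (iE : E ≃ Fin q) (G : Multigraph V E)
        (m : G.Marking n) (γ : Fin K → Cycle (E × Bool)) (v : V) (d : E × Bool)
        (W₁ W₂ : (⊤ : SimpleGraph (E × Bool)).Subgraph) (c : FamilyCode) (c' : CutCode),
        G.IsCore → G.IsNatural → IsCircuitFamily G γ → IsCut G γ v d W₁ W₂ →
        IsFamilyCode iV iE G m γ c → IsCutCode iE d W₁.verts W₂.verts c' →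
        ∃ (iV' : Option V ≃ Fin (p + 1)) (iE' : Option E ≃ Fin (q + 1))
          (mH : (split G d W₂.verts).Marking n) (δ : Fin K → Cycle (Option E × Bool)),
          (splitFold G d W₂.verts).PreservesMarking mH m ∧ IsSplitFamily G d W₂.verts γ δ ∧
          IsFamilyCode iV' iE' (split G d W₂.verts) mH δ (F (c, c')).1 ∧
          (F (c, c')).2 = mapCode iV' iE' iV iE (splitFold G d W₂.verts)) ∧
    -- Whitehead's algorithm, for every choice of cuts: a split is possible whenever one is called
    -- for, it decreases the weight, there is no infinite run, and the answer is correct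
    (∀ n K : ℕ,
      (∀ s : State n K, CutVertexCondition s.graph s.family → ∃ t, SplitStep s t) ∧
      (∀ s t : State n K, SplitStep s t →
        WeightLT (naturalWeight t.graph t.family) (naturalWeight s.graph s.family)) ∧
      WellFounded (fun t s : State n K => SplitStep s t) ∧
      (∀ s : State n K, ∃ b, AlgorithmOutput s b) ∧
      (∀ (s : State n K) (b : Bool), AlgorithmOutput s b →
        (b = true ↔ FamilyRepresentsPartialFreeBasis s.marking s.family))) ∧
    -- the algorithm is effective
    (∃ A : FamilyCode → Bool, Computable A ∧
      ∀ (n K : ℕ) (s : State n K) (c : FamilyCode), s.IsCode c → AlgorithmOutput s (A c)) ∧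
    -- hence it is decidable whether conjugacy classes represent a partial free basis
    (∃ D : ℕ × List (List (ℕ × Bool)) → Bool, Computable D ∧
      ∀ (n : ℕ) (ws : List (List (Fin n × Bool))),
        D (n, ws.map fun w => w.map fun a => ((a.1 : ℕ), a.2)) = true ↔
          RepresentedByPartialFreeBasis
            fun i : Fin ws.length => ConjClasses.mk (FreeGroup.mk (ws.get i))) := by
  refine ⟨?_, ⟨splitCode, primrec_splitCode.to_comp, ?_⟩, ?_,
    ⟨fun c => splitLoop (c.1.2.length, c.2.2), ?_, fun n K s c hc => splitLoop_algorithmOutput s hc⟩,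
    ⟨partialBasisTest, primrec_partialBasisTest.to_comp, fun n ws => partialBasisTest_correct ws⟩⟩
  · intro n K V E _ _ G m γ v d W₁ W₂ hG hn hγ hW
    have hS := hW.isCutSet hγ.1
    have hH := isCore_split hG hγ.1 hS
    obtain ⟨mH, -, hm, -⟩ := exists_marking_split d W₂.verts m
    exact ⟨hH, isFold_splitFold hG hγ.1 hS, ⟨mH, hm, fun mH' hm' =>
      (isPi1Equiv_splitFold G d W₂.verts).marking_unique hH.1 hm' hm⟩,
      existsUnique_isSplitFamily hγ hS, fun δ hδ => weightLT_split hG hn hγ.1 hS hδ.1.1 hδ.map_eq⟩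
  · intro n K p q V E iV iE G m γ v d W₁ W₂ c c' _ _ hγ hW hc hc'
    exact ⟨splitEquiv iV, splitEquiv iE, splitCode_correct hγ (hW.isCutSet hγ.1) hc hc'⟩
  · exact fun n K => ⟨exists_splitStep, fun s t h => weightLT_of_splitStep h, wellFounded_splitStep,
      exists_algorithmOutput, fun s b h => h.correct⟩
  · exact (primrec_splitLoop.comp
      ((Primrec.list_length.comp (Primrec.snd.comp (Primrec.fst))).pair
        (Primrec.snd.comp .snd))).to_comp
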